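/- **Setting.** Let $p\in\mathbb Z$ and let $g(u,\bar u,v,\bar v)=F(u\bar u,v\bar v)$, where $F$ is analytic near $0\in\mathbb C^2$, $g$ is real when $\bar u,\bar v$ are the conjugates of $u,v$, and $g$ vanishes at $0\in\mathbb C^4$ to order at least $5$. For sequences $\psi=(a,b)$, $\bar\psi=(\bar a,\bar b)$ (treated as independent variables; real points are those where $\bar\psi$ is the conjugate of $\psi$) put $$P_2=\sum_{j\in\mathbb Z} j^2(a_j\bar a_j+b_j\bar b_j),\quad P_4=\sum_{i+j=k+l}a_kb_l\bar a_i\bar b_j,\quad Z_4=\sum_{i+j=k+l,\ i^2+j^2=k^2+l^2}a_kb_l\bar a_i\bar b_j,$$ $$R_5=\frac1{2\pi}\int_0^{2\pi} g\Big(\sum_j a_je^{ijx},\sum_j\bar a_je^{-ijx},\sum_j b_je^{ijx},\sum_j\bar b_je^{-ijx}\Big)dx,\qquad H=P_2+P_4+R_5.$$ Let $\mathcal P_s$ be the space of $(\psi,\bar\psi)$ with each component in $\ell^2_s$ (weights $(1+j^2)^{s}$), with the form $-i\,d\psi\wedge d\bar\psi$. Let $\mathcal Z=(\mathbb Z\setminus\{p\})\times\{+,-\}$,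 $w_{j\pm}=\max(1,|j|)$, clusters $[j\pm]=\{j\pm,-j\pm\}\cap\mathcal Z$, and let $Z_s$ be the space of $\zeta=(\zeta_\alpha)_{\alpha\in\mathcal Z}$ with $\|\zeta\|_s^2=\sum_\alpha w_\alpha^{2s}|\zeta_\alpha|^2<\infty$. Points are $x=(r,\theta,z)$ with $r\in\mathbb C^2$, $\theta\in\mathbb C^2/2\pi\mathbb Z^2$, $z=(\zeta,\bar\zeta)\in Z_s\times Z_s$; they are real if $r,\theta$ are real and $\bar\zeta$ is the conjugate of $\zeta$. All finite products carry maximum norms. Put $$\mathcal O^s(\sigma,\mu)=\{|r|<\mu^2,\ |\Im\theta|<\sigma,\ \|z\|_s<\mu\},\qquad \mathbf T_\rho(\nu,\sigma,\mu,s)=\{(I,\theta,z):|I-\nu\rho|<\nu\mu^2,\ |\Im\theta|<\sigma,\ \|z\|_s<\nu^{1/2}\mu\},$$ and $\mathcal D=[1,2]^2$. A point $(I,\theta,z)$ is identified with the Fourier data $a_p=\sqrt{I_1}e^{i\theta_1}$, $\bar a_p=\sqrt{I_1}e^{-i\theta_1}$, $b_p=\sqrt{I_2}e^{i\theta_2}$,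 $\bar b_p=\sqrt{I_2}e^{-i\theta_2}$, $a_k=\zeta_{k+}$, $b_k=\zeta_{k-}$, $\bar a_k=\bar\zeta_{k+}$, $\bar b_k=\bar\zeta_{k-}$ ($k\ne p$). Define the maps * $\chi_\rho(r,\theta,z)=(\nu\rho+\nu r,\theta,\nu^{1/2}z)$; * $\Psi_{sym}(I,\theta,(e,f))=(I,\theta,(c,d))$ with $c_k=\frac{e_k+f_k}{\sqrt2}$, $d_k=\frac{e_k-f_k}{\sqrt2}$ (same formulas for the barred variables); * $\Psi_{ang}(J,\theta,(c,d))=(I,\theta,(a,b))$ with $a_k=c_ke^{i\theta_1}$, $b_k=d_ke^{i\theta_2}$, $\bar a_k=\bar c_ke^{-i\theta_1}$, $\bar b_k=\bar d_ke^{-i\theta_2}$, $I_1=J_1-\sum_k c_k\bar c_k$, $I_2=J_2-\sum_k d_k\bar d_k$. For $f=f(x;\rho)$ on $\mathcal O^s(\sigma,\mu)\times\mathcal D$, $2\pi$-periodic in $\theta$, write $f\in\mathcal T^s(\sigma,\mu,\mathcal D)$ if $f$ is $C^1$ in $(\rho,x)$, real at real points, holomorphic in $x$, and the gradient $\nabla_zf$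 (with values in $Z_s\times Z_s$) and the Hessian $\nabla^2_{\zeta\bar\zeta}f$ (with values in the bounded operators on $Z_s$) exist, are holomorphic in $x$ and $C^1$ in $(\rho,x)$. Let $$[f]^s_{\sigma,\mu,\mathcal D}=\sup_{j=0,1;\ \rho\in\mathcal D;\ x\in\mathcal O^s(\sigma,\mu)}\max\big(|\partial^j_\rho f|,\ \mu\|\partial_\rho^j\nabla_zf\|_s,\ \mu^2|\partial_\rho^j\nabla^2_{\zeta\bar\zeta}f|_s\big),$$ $$f^T(x)=f(0,\theta,0)+d_rf(0,\theta,0)[r]+d_zf(0,\theta,0)[z]+\tfrac12d_z^2f(0,\theta,0)[z,z].$$ Finally $f\in\mathcal T^s_{\rm res}(\sigma,\mu,\mathcal D)$ if $f\in\mathcal T^s(\sigma,\mu,\mathcal D)$ and there is $M$ such that for all $\rho\in\mathcal D$, $k\in\mathbb Z^2\setminus\{0\}$ and $\alpha,\beta\in\mathcal Z$ with $[\alpha]=[\beta]$: if the monomial $e^{ik\cdot\theta}\zeta_\alpha\bar\zeta_\beta$ occurs in $f^T$, then $\alpha=\beta$ or $w_\alpha\le M|k|$. **Theorem.** Fix $p$,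 $g$ as above and $s>\frac12$. There exist $\varepsilon,K>0$ and a Birkhoff change of variables $\tau$ on the ball $B_s(\varepsilon)\subset\mathcal P_s$: a real holomorphic symplectic map, biholomorphic onto its image, with $\tau(B_s(\varepsilon))\subset B_s(2\varepsilon)$, $\|\tau(w)-w\|_s\le K\|w\|_s^3$, which preserves $\sum_j a_j\bar a_j$, $\sum_j b_j\bar b_j$, $\sum_j j(a_j\bar a_j+b_j\bar b_j)$ and the set of points of finite energy (those with $\sum_j j^2(|a_j|^2+|\bar a_j|^2+|b_j|^2+|\bar b_j|^2)<\infty$), and which satisfies at points of finite energy $(P_2+P_4)\circ\tau=P_2+Z_4+R_6$, where $R_6$ is holomorphic on $B_s(\varepsilon)$ and its gradient is a holomorphic $\mathcal P_s$-valued map bounded by $K\|w\|_s^5$. Moreover there exist $\nu_0,\sigma_0,\mu_0>0$ (with $\sigma_0\le\frac12$, $\mu_0\le\frac{e^{-1/2}}2$) such that for every $0<\nu\le\nu_0$ there are maps $\Phi_\rho$ and functions $f(\cdot\,;\rho)$, $\rho\in\mathcal D$, on $\mathcal O^s(\frac12,\frac{e^{-1/2}}2)$ with the following properties. 1. For all $\rho\in\mathcal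 D$, $\Phi_\rho:\mathcal O^s(\frac12,\frac{e^{-1/2}}2)\to\mathbf T_\rho(\nu,1,1,s)$ is real holomorphic and biholomorphic onto its image; $(\rho,x)\mapsto\Phi_\rho(x)$ is real analytic; the angle component of $\Phi_\rho(x)$ minus $\theta$ and the other components are $2\pi$-periodic in $\theta$; and $\Phi_\rho$ pulls back $-dI\wedge d\theta-i\,d\zeta'\wedge d\bar\zeta'$ to $-\nu\,dr\wedge d\theta-i\nu\,d\zeta\wedge d\bar\zeta$. With the above identification, $\Phi_\rho=\tau\circ\Psi_{ang}\circ\Psi_{sym}\circ\chi_\rho$, and $\Phi_\rho$ is close to $\Psi_{ang}\circ\Psi_{sym}\circ\chi_\rho$: their $I$-, $\theta$- and $z$-components differ by at most $K\nu^2$, $K\nu$ and $K\nu^{3/2}$. 2. Let $C=\nu^2\rho_1\rho_2+\nu p^2(\rho_1+\rho_2)$. At every $x=(r,\theta,z)\in\mathcal O^s(\frac12,\frac{e^{-1/2}}2)$ of finite energy (i.e. $\sum_\alpha j^2(|\zeta_\alpha|^2+|\bar\zeta_\alpha|^2)<\infty$, $\alpha=(j,\pm)$; automatic when $s\ge1$)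 the image $\Phi_\rho(x)$ has finite energy and $$\frac1\nu\big(H\circ\Phi_\rho-C\big)(x)=h_0(r,z)+f(x;\rho),\qquad h_0=\Omega(\rho)\cdot r+\sum_{\alpha\in\mathcal Z}\Lambda_\alpha(\rho)\,\zeta_\alpha\bar\zeta_\alpha,$$ $$\Omega(\rho)=(p^2+\nu\rho_2,\ p^2+\nu\rho_1),\qquad \Lambda_{j\pm}(\rho)=j^2-p^2\pm\nu\sqrt{\rho_1\rho_2}\in\mathbb R .$$ 3. For all $0<\sigma\le\sigma_0$ and $0<\mu\le\mu_0$: $f\in\mathcal T^s_{\rm res}(\sigma,\mu,\mathcal D)$, $[f]^s_{\sigma,\mu,\mathcal D}\le K\nu$ and $[f^T]^s_{\sigma,\mu,\mathcal D}\le K\nu^{3/2}$. The constants $\varepsilon,K,\nu_0,\sigma_0,\mu_0$ may depend on $p$, $g$ and $s$ only. -/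

import Mathlib

open Filter Asymptotics
open scoped Topology ENNReal ComplexConjugate

namespace CoupledNLS

noncomputable section

/-! ### Weighted `ℓ²` spaces -/

/-- The weighted space of all families `c : ι → ℂ` with `∑ α, (w α) ^ (2 s) * |c α| ^ 2 < ∞`.
The family `c` is stored as the square summable family `α ↦ (w α) ^ s * c α`, which is an isometry
when the weights are positive (see `norm_sq_eq`, `exists_coeff_eq`, `coeff_injective`); the entries
themselves are given by `coeff`. -/
def Wl2 (ι : Type) (_w : ι → ℝ) (_s : ℝ) : Type := lp (fun _ : ι => ℂ) 2

namespace Wl2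

variable {ι : Type} {w : ι → ℝ} {s : ℝ}

instance : NormedAddCommGroup (Wl2 ι w s) :=
  inferInstanceAs (NormedAddCommGroup (lp (fun _ : ι => ℂ) 2))

instance : NormedSpace ℂ (Wl2 ι w s) :=
  inferInstanceAs (NormedSpace ℂ (lp (fun _ : ι => ℂ) 2))

instance : CompleteSpace (Wl2 ι w s) :=
  inferInstanceAs (CompleteSpace (lp (fun _ : ι => ℂ) 2))

/-- The underlying square summable family. -/
def toLp (u : Wl2 ι w s) : lp (fun _ : ι => ℂ) 2 := u

/-- The entries of an element of the weighted space. -/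
def coeff (u : Wl2 ι w s) (α : ι) : ℂ := ((w α ^ (-s) : ℝ) : ℂ) * u.toLp α

open Classical in
/-- The element whose entry is `1` at `α` and `0` elsewhere. -/
def basis (α : ι) : Wl2 ι w s := lp.single (E := fun _ : ι => ℂ) 2 α ((w α ^ s : ℝ) : ℂ)

/-- The bilinear pairing `∑ α, u α * v α`. -/
def pair (u v : Wl2 ι w s) : ℂ := ∑' α, u.coeff α * v.coeff α

theorem weighted_coeff (hw : ∀ α, 0 < w α) (u : Wl2 ι w s) (α : ι) :
    w α ^ (2 * s) * ‖u.coeff α‖ ^ 2 = ‖u.toLp α‖ ^ 2 := by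
  have h : w α ^ (2 * s) * (w α ^ (-s)) ^ 2 = 1 := by
    rw [← Real.rpow_natCast (w α ^ (-s)) 2, ← Real.rpow_mul (hw α).le, ← Real.rpow_add (hw α)]
    have : 2 * s + -s * ((2 : ℕ) : ℝ) = 0 := by push_cast; ring
    rw [this, Real.rpow_zero]
  rw [coeff, norm_mul, Complex.norm_real, Real.norm_eq_abs,
    abs_of_pos (Real.rpow_pos_of_pos (hw α) _), mul_pow, ← mul_assoc, h, one_mul]

/-- The norm is the weighted `ℓ²` norm of the entries. -/
theorem norm_sq_eq (hw : ∀ α, 0 < w α) (u : Wl2 ι w s) :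
    ‖u‖ ^ 2 = ∑' α, w α ^ (2 * s) * ‖u.coeff α‖ ^ 2 := by
  have h := lp.norm_rpow_eq_tsum (E := fun _ : ι => ℂ) (p := 2) (by norm_num) u.toLp
  have h2 : (2 : ℝ≥0∞).toReal = ((2 : ℕ) : ℝ) := by norm_num
  simp only [h2, Real.rpow_natCast] at h
  simp only [weighted_coeff hw]
  exact h

theorem coeff_injective (hw : ∀ α, 0 < w α) :
    Function.Injective (coeff : Wl2 ι w s → ι → ℂ) := by
  intro u v h
  refine lp.ext (funext fun α => ?_)
  have h1 := congrFun h α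
  have h2 : ((w α ^ (-s) : ℝ) : ℂ) ≠ 0 := by
    exact_mod_cast (Real.rpow_pos_of_pos (hw α) _).ne'
  exact mul_left_cancel₀ h2 h1

/-- Every family with finite weighted norm is the family of entries of an element. -/
theorem exists_coeff_eq (hw : ∀ α, 0 < w α) (c : ι → ℂ)
    (hc : Summable fun α => w α ^ (2 * s) * ‖c α‖ ^ 2) :
    ∃ u : Wl2 ι w s, u.coeff = c := by
  have hmem : Memℓp (fun α => ((w α ^ s : ℝ) : ℂ) * c α) 2 := by
    refine memℓp_gen ?_
    have h2 : (2 : ℝ≥0∞).toReal = ((2 : ℕ) : ℝ) := by norm_num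
    simp only [h2, Real.rpow_natCast]
    refine hc.congr fun α => ?_
    rw [norm_mul, Complex.norm_real, Real.norm_eq_abs,
      abs_of_pos (Real.rpow_pos_of_pos (hw α) _), mul_pow,
      ← Real.rpow_natCast (w α ^ s) 2, ← Real.rpow_mul (hw α).le, mul_comm s]
    push_cast
    rfl
  refine ⟨(⟨_, hmem⟩ : lp (fun _ : ι => ℂ) 2), funext fun α => ?_⟩
  change ((w α ^ (-s) : ℝ) : ℂ) * (((w α ^ s : ℝ) : ℂ) * c α) = c α
  rw [← mul_assoc, ← Complex.ofReal_mul, ← Real.rpow_add (hw α)]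
  simp

theorem coeff_basis_same (hw : ∀ α, 0 < w α) (α : ι) :
    (basis α : Wl2 ι w s).coeff α = 1 := by
  have h : (basis α : Wl2 ι w s).toLp α = ((w α ^ s : ℝ) : ℂ) := by
    classical
    simp [basis, toLp]
  rw [coeff, h, ← Complex.ofReal_mul, ← Real.rpow_add (hw α)]
  simp

theorem coeff_basis_ne {α β : ι} (h : β ≠ α) : (basis α : Wl2 ι w s).coeff β = 0 := by
  have h' : (basis α : Wl2 ι w s).toLp β = 0 := by
    classical
    simp [basis, toLp, h]
  rw [coeff, h', mul_zero]

end Wl2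

/-! ### Modes, phase spaces and symplectic forms -/

/-- Fourier modes: `(j, 0)` stands for `a_j` and `(j, 1)` for `b_j`. -/
abbrev Mode : Type := ℤ × Fin 2

/-- External modes: all modes except the two internal ones `a_p`, `b_p`.
The species `0` is written `+` and the species `1` is written `-`. -/
abbrev ExtMode (p : ℤ) : Type := {j : ℤ // j ≠ p} × Fin 2

/-- The weight `(1 + j ^ 2) ^ (1 / 2)`. -/
def fourierWeight (m : Mode) : ℝ := Real.sqrt (1 + (m.1 : ℝ) ^ 2)

/-- The weight `max (1, |j|)`. -/
def extWeight {p : ℤ} (α : ExtMode p) : ℝ := max 1 |((α.1 : ℤ) : ℝ)|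

theorem fourierWeight_pos (m : Mode) : 0 < fourierWeight m :=
  Real.sqrt_pos.mpr (by positivity)

theorem extWeight_pos {p : ℤ} (α : ExtMode p) : 0 < extWeight α :=
  lt_of_lt_of_le one_pos (le_max_left _ _)

/-- Two external modes lie in the same cluster when their Fourier indices agree up to sign. -/
def SameCluster {p : ℤ} (α β : ExtMode p) : Prop := |(α.1 : ℤ)| = |(β.1 : ℤ)|

/-- Pairs `(ψ, ψ̄)` of independent sequences in `ℓ²_s`, with `ψ = (a, b)` and `ψ̄ = (ā, b̄)`. -/
abbrev Ps (s : ℝ) : Type := Wl2 Mode fourierWeight s × Wl2 Mode fourierWeight s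

/-- The space of external variables. -/
abbrev Zs (p : ℤ) (s : ℝ) : Type := Wl2 (ExtMode p) extWeight s

/-- Points `(r, θ, (ζ, ζ̄))` of `ℂ² × ℂ² × (Z_s × Z_s)` with the maximum norm. The angles are
lifted to `ℂ²`: functions on the torus are `2π`-periodic functions of `θ`. -/
abbrev Phase (p : ℤ) (s : ℝ) : Type := (Fin 2 → ℂ) × (Fin 2 → ℂ) × (Zs p s × Zs p s)

variable {p : ℤ} {s : ℝ}

/-- The form `-i ∑ dψ ∧ dψ̄`. -/
def omegaPs (u v : Ps s) : ℂ := -Complex.I * (u.1.pair v.2 - v.1.pair u.2)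

/-- The form `-dr ∧ dθ - i dζ ∧ dζ̄`. -/
def omega (u v : Phase p s) : ℂ :=
  -(∑ i, (u.1 i * v.2.1 i - v.1 i * u.2.1 i))
    - Complex.I * (u.2.2.1.pair v.2.2.2 - v.2.2.1.pair u.2.2.2)

/-- Real points of the Fourier phase space: `ψ̄` is the complex conjugate of `ψ`. -/
def IsRealPs (w : Ps s) : Prop := ∀ m, w.2.coeff m = conj (w.1.coeff m)

/-- Real points: `r`, `θ` are real and `ζ̄` is the complex conjugate of `ζ`. -/
def IsRealPhase (x : Phase p s) : Prop :=
  (∀ i, (x.1 i).im = 0) ∧ (∀ i, (x.2.1 i).im = 0) ∧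
    ∀ α, x.2.2.2.coeff α = conj (x.2.2.1.coeff α)

/-- The translation vector `(0, 2πk, 0)`. -/
def shift (k : Fin 2 → ℤ) : Phase p s := (0, fun i => 2 * (Real.pi : ℂ) * (k i : ℂ), 0)

/-- The domain `|r| < μ²`, `|Im θ| < σ`, `‖z‖_s < μ`. -/
def dom (σ μ : ℝ) : Set (Phase p s) :=
  {x | ‖x.1‖ < μ ^ 2 ∧ (∀ i, |(x.2.1 i).im| < σ) ∧ ‖x.2.2‖ < μ}

/-- The toroidal neighbourhood `|I - νρ| < νμ²`, `|Im θ| < σ`, `‖z‖_s < ν^{1/2} μ`. -/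
def torusNhd (ν : ℝ) (ρ : Fin 2 → ℝ) (σ μ : ℝ) : Set (Phase p s) :=
  {x | ‖(fun i => x.1 i - ((ν * ρ i : ℝ) : ℂ))‖ < ν * μ ^ 2 ∧
    (∀ i, |(x.2.1 i).im| < σ) ∧ ‖x.2.2‖ < Real.sqrt ν * μ}

/-- The parameter set `[1,2]²`. -/
def paramSet : Set (Fin 2 → ℝ) := Set.Icc 1 2

/-! ### The Hamiltonian in Fourier variables -/

/-- The Fourier coefficients `ψ = (a, b)` and `ψ̄ = (ā, b̄)` as plain families. -/
structure FourierPt where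
  psi : Mode → ℂ
  psiBar : Mode → ℂ

/-- The families of entries of a point of the Fourier phase space. -/
def fourierCoords (w : Ps s) : FourierPt := ⟨w.1.coeff, w.2.coeff⟩

/-- Finiteness of `∑ j² |ψ_j|²` and `∑ j² |ψ̄_j|²`, the domain of `P₂`. For `s ≥ 1` it holds at
every point of the phase space; for `s < 1` it selects a dense subset. Finitely many modes, such as
the internal ones, play no role in it. -/
def FiniteEnergy (u : FourierPt) : Prop :=
  Summable (fun m : Mode => (m.1 : ℝ) ^ 2 * ‖u.psi m‖ ^ 2) ∧
    Summable (fun m : Mode => (m.1 : ℝ) ^ 2 * ‖u.psiBar m‖ ^ 2)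

/-- `∑_j j² (a_j ā_j + b_j b̄_j)`. -/
def P2 (u : FourierPt) : ℂ := ∑' m : Mode, (m.1 : ℂ) ^ 2 * (u.psi m * u.psiBar m)

/-- `∑_{i+j=k+l} a_k b_l ā_i b̄_j`, summed over `(i, j, k)` with `l = i + j - k`. -/
def P4 (u : FourierPt) : ℂ :=
  ∑' q : ℤ × ℤ × ℤ, u.psi (q.2.2, 0) * u.psi (q.1 + q.2.1 - q.2.2, 1) *
    u.psiBar (q.1, 0) * u.psiBar (q.2.1, 1)

/-- The resonant part of `P4`: the same sum restricted to `i² + j² = k² + l²`. -/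
def Z4 (u : FourierPt) : ℂ :=
  ∑' q : ℤ × ℤ × ℤ,
    if q.1 ^ 2 + q.2.1 ^ 2 = q.2.2 ^ 2 + (q.1 + q.2.1 - q.2.2) ^ 2 then
      u.psi (q.2.2, 0) * u.psi (q.1 + q.2.1 - q.2.2, 1) *
        u.psiBar (q.1, 0) * u.psiBar (q.2.1, 1)
    else 0

/-- The nonlinearity `g(u, ū, v, v̄) = F(|u|², |v|²)`, the four arguments being independent. -/
def nonlin (F : ℂ × ℂ → ℂ) (u ubar v vbar : ℂ) : ℂ := F (u * ubar, v * vbar)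

/-- `∑_j c_j e^{ijx}`. -/
def fourierSeries (c : ℤ → ℂ) (x : ℝ) : ℂ := ∑' j : ℤ, c j * Complex.exp (Complex.I * j * x)

/-- `∑_j c_j e^{-ijx}`. -/
def fourierSeriesBar (c : ℤ → ℂ) (x : ℝ) : ℂ := ∑' j : ℤ, c j * Complex.exp (-(Complex.I * j * x))

/-- The mean over the circle of `g(u, ū, v, v̄)`. -/
def R5 (F : ℂ × ℂ → ℂ) (u : FourierPt) : ℂ :=
  (1 / (2 * (Real.pi : ℂ))) * ∫ x in (0 : ℝ)..(2 * Real.pi),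
    nonlin F (fourierSeries (fun j => u.psi (j, 0)) x) (fourierSeriesBar (fun j => u.psiBar (j, 0)) x)
      (fourierSeries (fun j => u.psi (j, 1)) x) (fourierSeriesBar (fun j => u.psiBar (j, 1)) x)

/-- The Hamiltonian `P₂ + P₄ + R₅`. -/
def hamiltonian (F : ℂ × ℂ → ℂ) (u : FourierPt) : ℂ := P2 u + P4 u + R5 F u

/-- The partial mass `∑_j |a_j|²` (species `0`) or `∑_j |b_j|²` (species `1`). -/
def partialMass (i : Fin 2) (u : FourierPt) : ℂ := ∑' j : ℤ, u.psi (j, i) * u.psiBar (j, i)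

/-- The momentum `∑_j j (|a_j|² + |b_j|²)`. -/
def momentum (u : FourierPt) : ℂ := ∑' m : Mode, (m.1 : ℂ) * (u.psi m * u.psiBar m)

/-! ### Changes of variables -/

/-- `T` is an injective holomorphic map on `U` whose derivative is invertible at every point. -/
def IsBiholoOn {E : Type} [NormedAddCommGroup E] [NormedSpace ℂ E] (T : E → E) (U : Set E) :
    Prop :=
  DifferentiableOn ℂ T U ∧ Set.InjOn T U ∧ ∀ x ∈ U, (fderiv ℂ T x).IsInvertible

/-- `τ` is a symplectic Birkhoff change of variables on the ball of radius `ε`: it is real and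
biholomorphic onto its image in the ball of radius `2ε`, symplectic, `K`-cubically close to the
identity, preserves the partial masses, the momentum and finiteness of the energy, and transforms
`P₂ + P₄` into `P₂ + Z₄ + R₆` with a remainder of order six (in terms of its vector field). -/
structure IsBirkhoffMap (ε K : ℝ) (τ : Ps s → Ps s) : Prop where
  biholo : IsBiholoOn τ (Metric.ball 0 ε)
  mapsTo : Set.MapsTo τ (Metric.ball 0 ε) (Metric.ball 0 (2 * ε))
  real : ∀ w ∈ Metric.ball (0 : Ps s) ε, IsRealPs w → IsRealPs (τ w)
  symplectic : ∀ w ∈ Metric.ball (0 : Ps s) ε, ∀ h k,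
    omegaPs (fderiv ℂ τ w h) (fderiv ℂ τ w k) = omegaPs h k
  close : ∀ w ∈ Metric.ball (0 : Ps s) ε, ‖τ w - w‖ ≤ K * ‖w‖ ^ 3
  mass_eq : ∀ w ∈ Metric.ball (0 : Ps s) ε, ∀ i,
    partialMass i (fourierCoords (τ w)) = partialMass i (fourierCoords w)
  momentum_eq : ∀ w ∈ Metric.ball (0 : Ps s) ε,
    momentum (fourierCoords (τ w)) = momentum (fourierCoords w)
  energy : ∀ w ∈ Metric.ball (0 : Ps s) ε,
    FiniteEnergy (fourierCoords w) → FiniteEnergy (fourierCoords (τ w))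
  normalForm : ∃ (R6 : Ps s → ℂ) (G : Ps s → Ps s),
    DifferentiableOn ℂ R6 (Metric.ball 0 ε) ∧ DifferentiableOn ℂ G (Metric.ball 0 ε) ∧
    (∀ w ∈ Metric.ball (0 : Ps s) ε,
      (∀ h, fderiv ℂ R6 w h = (G w).1.pair h.1 + (G w).2.pair h.2) ∧ ‖G w‖ ≤ K * ‖w‖ ^ 5) ∧
    ∀ w ∈ Metric.ball (0 : Ps s) ε, FiniteEnergy (fourierCoords w) →
      P2 (fourierCoords (τ w)) + P4 (fourierCoords (τ w)) =
        P2 (fourierCoords w) + Z4 (fourierCoords w) + R6 w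

/-- Actions, angles and external variables as plain families. -/
structure Pt (p : ℤ) where
  act : Fin 2 → ℂ
  ang : Fin 2 → ℂ
  zeta : ExtMode p → ℂ
  zetaBar : ExtMode p → ℂ

/-- The plain coordinates of a point of the phase space. -/
def coords (x : Phase p s) : Pt p := ⟨x.1, x.2.1, x.2.2.1.coeff, x.2.2.2.coeff⟩

/-- Passage from `(I, θ, z)` to Fourier variables: `a_p = √I₁ e^{iθ₁}`, `b_p = √I₂ e^{iθ₂}`, and
the external modes are the remaining Fourier coefficients. -/
def toFourier (y : Pt p) : FourierPt where
  psi m := if h : m.1 = p then y.act m.2 ^ (1 / 2 : ℂ) * Complex.exp (Complex.I * y.ang m.2)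
    else y.zeta (⟨m.1, h⟩, m.2)
  psiBar m := if h : m.1 = p then y.act m.2 ^ (1 / 2 : ℂ) * Complex.exp (-(Complex.I * y.ang m.2))
    else y.zetaBar (⟨m.1, h⟩, m.2)

/-- The rescaling `(r, θ, z) ↦ (νρ + νr, θ, ν^{1/2} z)`. -/
def chi (ν : ℝ) (ρ : Fin 2 → ℝ) (y : Pt p) : Pt p where
  act i := (ν : ℂ) * ρ i + ν * y.act i
  ang := y.ang
  zeta α := (Real.sqrt ν : ℂ) * y.zeta α
  zetaBar α := (Real.sqrt ν : ℂ) * y.zetaBar α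

/-- From `(e, f)` to `(c, d) = ((e + f) / √2, (e - f) / √2)`. -/
def psiSym (y : Pt p) : Pt p where
  act := y.act
  ang := y.ang
  zeta α := ![(y.zeta (α.1, 0) + y.zeta (α.1, 1)) / (Real.sqrt 2 : ℂ),
    (y.zeta (α.1, 0) - y.zeta (α.1, 1)) / (Real.sqrt 2 : ℂ)] α.2
  zetaBar α := ![(y.zetaBar (α.1, 0) + y.zetaBar (α.1, 1)) / (Real.sqrt 2 : ℂ),
    (y.zetaBar (α.1, 0) - y.zetaBar (α.1, 1)) / (Real.sqrt 2 : ℂ)] α.2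

/-- From `(c, d)` to `(a, b)`: `a_k = c_k e^{iθ₁}`, `b_k = d_k e^{iθ₂}`, and the actions are
diminished by `∑ |c_k|²` and `∑ |d_k|²` respectively. -/
def psiAng (y : Pt p) : Pt p where
  act i := y.act i - ∑' k : {j : ℤ // j ≠ p}, y.zeta (k, i) * y.zetaBar (k, i)
  ang := y.ang
  zeta α := y.zeta α * Complex.exp (Complex.I * y.ang α.2)
  zetaBar α := y.zetaBar α * Complex.exp (-(Complex.I * y.ang α.2))

/-! ### The integrable Hamiltonian -/

/-- The internal frequencies `(p² + νρ₂, p² + νρ₁)`. -/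
def freqInt (p : ℤ) (ν : ℝ) (ρ : Fin 2 → ℝ) : Fin 2 → ℝ :=
  ![(p : ℝ) ^ 2 + ν * ρ 1, (p : ℝ) ^ 2 + ν * ρ 0]

/-- The normal eigenvalues `j² - p² ± ν √(ρ₁ρ₂)`. -/
def freqExt (ν : ℝ) (ρ : Fin 2 → ℝ) (α : ExtMode p) : ℝ :=
  ((α.1 : ℤ) : ℝ) ^ 2 - (p : ℝ) ^ 2 + ![1, -1] α.2 * (ν * Real.sqrt (ρ 0 * ρ 1))

/-- `Ω · r + ∑_α Λ_α |ζ_α|²`. -/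
def h0 (ν : ℝ) (ρ : Fin 2 → ℝ) (y : Pt p) : ℂ :=
  ∑ i, (freqInt p ν ρ i : ℂ) * y.act i + ∑' α, (freqExt ν ρ α : ℂ) * (y.zeta α * y.zetaBar α)

/-! ### Classes of perturbations -/

/-- `G` is the gradient of `f` at `x` in the variables `z = (ζ, ζ̄)`. -/
def IsZGrad (f : Phase p s → ℂ) (x : Phase p s) (G : Zs p s × Zs p s) : Prop :=
  ∀ h : Zs p s × Zs p s, fderiv ℂ f x (0, 0, h) = G.1.pair h.1 + G.2.pair h.2

/-- The second derivative of `f` at `x`. -/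
def hess (f : Phase p s → ℂ) (x u v : Phase p s) : ℂ := fderiv ℂ (fderiv ℂ f) x u v

/-- `A` is the bounded operator on `Z_s` with matrix `∂²f / ∂ζ_α ∂ζ̄_β` at `x`. -/
def IsZHess (f : Phase p s → ℂ) (x : Phase p s) (A : Zs p s →L[ℂ] Zs p s) : Prop :=
  ∀ h k : Zs p s, hess f x (0, 0, (h, 0)) (0, 0, (0, k)) = h.pair (A k)

open Classical in
/-- The gradient in `z` (zero if it does not belong to `Z_s × Z_s`). -/
def zGrad (f : Phase p s → ℂ) (x : Phase p s) : Zs p s × Zs p s :=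
  if h : ∃ G, IsZGrad f x G then h.choose else 0

open Classical in
/-- The mixed Hessian in `(ζ, ζ̄)` (zero if it is not a bounded operator on `Z_s`). -/
def zHess (f : Phase p s → ℂ) (x : Phase p s) : Zs p s →L[ℂ] Zs p s :=
  if h : ∃ A, IsZHess f x A then h.choose else 0

/-- The class `T^s(σ, μ, D)`, for parameter sets `D` that are closures of convex open sets. -/
structure InT (σ μ : ℝ) (D : Set (Fin 2 → ℝ)) (f : (Fin 2 → ℝ) → Phase p s → ℂ) : Prop where
  periodic : ∀ ρ ∈ D, ∀ x ∈ dom σ μ, ∀ k : Fin 2 → ℤ, f ρ (x + shift k) = f ρ x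
  real : ∀ ρ ∈ D, ∀ x ∈ dom σ μ, IsRealPhase x → (f ρ x).im = 0
  holo : ∀ ρ ∈ D, DifferentiableOn ℂ (f ρ) (dom σ μ)
  smooth : ContDiffOn ℝ 1 (fun q : (Fin 2 → ℝ) × Phase p s => f q.1 q.2) (D ×ˢ dom σ μ)
  grad_exists : ∀ ρ ∈ D, ∀ x ∈ dom σ μ, ∃ G, IsZGrad (f ρ) x G
  grad_holo : ∀ ρ ∈ D, DifferentiableOn ℂ (zGrad (f ρ)) (dom σ μ)
  grad_smooth : ContDiffOn ℝ 1 (fun q : (Fin 2 → ℝ) × Phase p s => zGrad (f q.1) q.2)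
    (D ×ˢ dom σ μ)
  hess_exists : ∀ ρ ∈ D, ∀ x ∈ dom σ μ, ∃ A, IsZHess (f ρ) x A
  hess_holo : ∀ ρ ∈ D, DifferentiableOn ℂ (zHess (f ρ)) (dom σ μ)
  hess_smooth : ContDiffOn ℝ 1 (fun q : (Fin 2 → ℝ) × Phase p s => zHess (f q.1) q.2)
    (D ×ˢ dom σ μ)

/-- The norm `[f]^s_{σ, μ, D}`: the supremum over `ρ ∈ D` and `x` in the domain of `|∂_ρ^j f|`,
`μ ‖∂_ρ^j ∇_z f‖_s` and `μ² |∂_ρ^j ∇²_{ζζ̄} f|_s` for `j = 0, 1`. -/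
def tNorm (σ μ : ℝ) (D : Set (Fin 2 → ℝ)) (f : (Fin 2 → ℝ) → Phase p s → ℂ) : ℝ≥0∞ :=
  ⨆ ρ ∈ D, ⨆ x ∈ dom (p := p) (s := s) σ μ,
    max
      (max ‖f ρ x‖ₑ (max (ENNReal.ofReal μ * ‖zGrad (f ρ) x‖ₑ)
        (ENNReal.ofReal (μ ^ 2) * ‖zHess (f ρ) x‖ₑ)))
      (max ‖fderivWithin ℝ (fun ρ' => f ρ' x) D ρ‖ₑ
        (max (ENNReal.ofReal μ * ‖fderivWithin ℝ (fun ρ' => zGrad (f ρ') x) D ρ‖ₑ)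
          (ENNReal.ofReal (μ ^ 2) * ‖fderivWithin ℝ (fun ρ' => zHess (f ρ') x) D ρ‖ₑ)))

/-- The jet `f(0,θ,0) + d_r f(0,θ,0)[r] + d_z f(0,θ,0)[z] + ½ d_z² f(0,θ,0)[z,z]`. -/
def jet (f : Phase p s → ℂ) (x : Phase p s) : ℂ :=
  f (0, x.2.1, 0) + fderiv ℂ f (0, x.2.1, 0) (x.1, 0, 0) + fderiv ℂ f (0, x.2.1, 0) (0, 0, x.2.2)
    + (1 / 2) * hess f (0, x.2.1, 0) (0, 0, x.2.2) (0, 0, x.2.2)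

/-- The coefficient of the monomial `e^{ik·θ} ζ_α ζ̄_β` in the jet of `f`. -/
def jetCoeff (f : Phase p s → ℂ) (k : Fin 2 → ℤ) (α β : ExtMode p) : ℂ :=
  (1 / (2 * (Real.pi : ℂ)) ^ 2) * ∫ t₀ in (0 : ℝ)..(2 * Real.pi), ∫ t₁ in (0 : ℝ)..(2 * Real.pi),
    Complex.exp (-(Complex.I * (k 0 * t₀ + k 1 * t₁))) *
      hess f (0, ![(t₀ : ℂ), (t₁ : ℂ)], 0) (0, 0, (Wl2.basis α, 0)) (0, 0, (0, Wl2.basis β))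

/-- The restricted class `T_res^s(σ, μ, D)`. -/
def InTres (σ μ : ℝ) (D : Set (Fin 2 → ℝ)) (f : (Fin 2 → ℝ) → Phase p s → ℂ) : Prop :=
  InT σ μ D f ∧ ∃ M : ℝ, ∀ ρ ∈ D, ∀ k : Fin 2 → ℤ, k ≠ 0 → ∀ α β : ExtMode p, SameCluster α β →
    jetCoeff (f ρ) k α β ≠ 0 → α = β ∨ extWeight α ≤ M * ‖k‖

end

end CoupledNLS

/-!
The statement has two parts: a Birkhoff map for the quartic part of the Hamiltonian, and action-angle
variables around the tori of the two modes `p`, in which the normal form is read off.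

**The Birkhoff map.** The nonresonant part of `P₄` is removed by the generator `χ` with kernel
`kerChi`, which solves the homological equation (`legs_energy`) without small divisors. Its flow is
replaced by the implicit midpoint rule `τ = (id + ½ X) ∘ (id - ½ X)⁻¹`, `X = J ∇χ`, with midpoint
`m(w)`, the value of the inverse at `w` (`exists_midpoint`, `midStep`). It is symplectic, since `DX`
is skew for the form (`halfStep_symplectic`), and it has an advantage over the flow: for a quadratic
`Q` the difference `Q(τ w) - Q(w)` is exactly twice the bilinear form of `Q` at `(m, X m)`
(`diag_halfStep_sub`). So masses and momentum are preserved and `P₂` changes by `(Z₄ - P₄)(m)`, with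
no series to control. The remainder `R₆` is a combination of values of quartics at `m` and at the two
half steps, all of them within `O(|w|³)` of each other, which gives a gradient of order five
(`IsMidpoint.exists_remainder`). Cubic fields with kernels bounded by one are bounded on `ℓ²_s` for
`s > 1/2` by Cauchy–Schwarz on the fibres of momentum conservation, for sums in `[0, ∞]`
(`sqNorm_fibSum_le`). The same estimate for the weights `min(|j|, N)`, uniformly in `N`, shows that
the midpoint inherits finite energy (`energyV_midpoint_ne_top`). Everything is collected in
`exists_birkhoffSystem`.

**The higher nonlinearity.** For `s > 1/2` the functions on the circle form an algebra under
convolution of coefficients, in which the power series of `F` and of its derivatives can be evaluated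
(`exists_funCalc`, `exists_circ_funCalc`). Vanishing of `F(u ū, v v̄)` to order five makes `F` smaller
than quadratic in the densities, so its power series starts in degree three, and the gradient of `R₅`
is again of order five (`isLittleO_of_nonlin`, `exists_R5_grad`).

**The change of variables.** Let `polar (R, z)` be the Fourier point with angles zero, actions `R`
including the external masses, and symmetrized external modes. The explicit part of the change of
variables, written in Fourier coordinates by `scaledChart`, is the rotation by `θ` of `√ν polar (ρ + r,
z)`. Since `τ` commutes with rotations, it can be lifted to actions and angles by applying it before
the rotation, at a point where the internal entries lie in the right half-plane: this is `liftMap`,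
characterized by `chart (liftMap x) = τ (scaledChart x)` (`IsScale.chart_liftMap`). Symplecticity,
invertibility of the derivative and injectivity follow from this relation. The map `Φ_ρ` is `liftMap`
after the translation `r ↦ ρ + r`, so its analyticity in `ρ` is analyticity in the actions.

**The normal form.** On momentum-conserving quadruples resonance means `i = k` or `j = k`
(`resonant_iff`), whence `Z₄` is a combination of products of quadratic sums and in polar coordinates
equals `R₁ R₂ + √.. √.. (|e|² - |f|²)` plus terms of order four in `z` (`quartic_polar`); the square
roots are those of the internal actions. Together with `P2_scaledChart` this gives `C`, `Ω` and `Λ`.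
By invariance under rotations the perturbation is
`ν quarticRem + ν⁻¹ (R₆ + R₅ ∘ τ)(√ν polar (ρ + r, z))`, independent of `θ`. The resonance condition is
therefore void (`jetCoeff_eq_zero`). The first term is `O(ν)` with vanishing jet
(`jetFn_quarticRem`): along `t ↦ (t² r, θ, t z)` it is of order three in `t`, and this is what the jet
detects (`IsZClass.jetFn_eq_zero`). The second is of order six in `√ν`, divided by `ν`, hence `O(ν²)`
(`IsScale.isZClass_highOrder`). Both extend holomorphically to complex `ρ` on the `cylinder`, so the
bounds on the gradient, the Hessian, the jet and the derivatives in `ρ` are Cauchy estimates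
(`IsZClass.tNorm_le`, `IsZClass.jet`).
-/


set_option maxSynthPendingDepth 3
set_option linter.unusedSectionVars false

namespace CoupledNLS

noncomputable section

/-! ### Weighted sequence spaces -/

/-- The square of the weighted `ℓ²` norm of a family, with values in `[0, ∞]`. -/
def sqNorm {ι : Type} (c : ι → ℝ≥0∞) (x : ι → ℝ≥0∞) : ℝ≥0∞ := ∑' α, (c α * x α) ^ 2

/-- The weight `w ^ s` with values in `[0, ∞]`. -/
def wt {ι : Type} (w : ι → ℝ) (s : ℝ) (α : ι) : ℝ≥0∞ := ENNReal.ofReal (w α ^ s)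

namespace Wl2

variable {ι κ : Type} {w : ι → ℝ} {w' : κ → ℝ} {s t : ℝ}

@[simp] theorem coeff_add (u v : Wl2 ι w s) (α : ι) : (u + v).coeff α = u.coeff α + v.coeff α := by
  change ((w α ^ (-s) : ℝ) : ℂ) * (u.toLp α + v.toLp α) = _
  rw [mul_add]; rfl

@[simp] theorem coeff_smul (c : ℂ) (u : Wl2 ι w s) (α : ι) : (c • u).coeff α = c * u.coeff α := by
  change ((w α ^ (-s) : ℝ) : ℂ) * (c * u.toLp α) = c * (((w α ^ (-s) : ℝ) : ℂ) * u.toLp α)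
  ring

@[simp] theorem coeff_zero (α : ι) : (0 : Wl2 ι w s).coeff α = 0 := by
  change ((w α ^ (-s) : ℝ) : ℂ) * 0 = 0
  simp

@[simp] theorem coeff_neg (u : Wl2 ι w s) (α : ι) : (-u).coeff α = -u.coeff α := by
  have := coeff_smul (-1) u α
  simpa using this

@[simp] theorem coeff_sub (u v : Wl2 ι w s) (α : ι) : (u - v).coeff α = u.coeff α - v.coeff α := by
  rw [sub_eq_add_neg, coeff_add, coeff_neg, sub_eq_add_neg]

theorem ext_coeff (hw : ∀ α, 0 < w α) {u v : Wl2 ι w s} (h : ∀ α, u.coeff α = v.coeff α) : u = v :=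
  coeff_injective hw (funext h)

theorem enorm_sq_eq (hw : ∀ α, 0 < w α) (u : Wl2 ι w s) :
    ‖u‖ₑ ^ 2 = sqNorm (wt w s) (fun α => ‖u.coeff α‖ₑ) := by
  have h1 := lp.memℓp u.toLp
  have hs := h1.summable (by norm_num)
  have h2 : (2 : ℝ≥0∞).toReal = ((2 : ℕ) : ℝ) := by norm_num
  simp only [h2, Real.rpow_natCast] at hs
  rw [← ofReal_norm, ← ENNReal.ofReal_pow (norm_nonneg _), norm_sq_eq hw]
  simp only [weighted_coeff hw]
  rw [ENNReal.ofReal_tsum_of_nonneg (fun _ => by positivity) hs]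
  unfold sqNorm
  congr 1; ext α
  rw [← weighted_coeff hw, wt, mul_pow, ENNReal.ofReal_mul (Real.rpow_nonneg (hw α).le _),
    ENNReal.ofReal_pow (norm_nonneg _), ofReal_norm, ← ENNReal.ofReal_pow
    (Real.rpow_nonneg (hw α).le _), ← Real.rpow_natCast, ← Real.rpow_mul (hw α).le]
  congr 3; push_cast; ring_nf

theorem sqNorm_ne_top (hw : ∀ α, 0 < w α) (u : Wl2 ι w s) :
    sqNorm (wt w s) (fun α => ‖u.coeff α‖ₑ) ≠ ∞ := by
  rw [← enorm_sq_eq hw]; simp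

theorem exists_of_sqNorm (hw : ∀ α, 0 < w α) (c : ι → ℂ)
    (hc : sqNorm (wt w s) (fun α => ‖c α‖ₑ) ≠ ∞) : ∃ u : Wl2 ι w s, u.coeff = c := by
  apply exists_coeff_eq hw
  have := ENNReal.summable_toReal hc
  refine this.congr fun α => ?_
  rw [wt, mul_pow, ENNReal.toReal_mul, ENNReal.toReal_pow, ENNReal.toReal_pow,
    ENNReal.toReal_ofReal (Real.rpow_nonneg (hw α).le _), toReal_enorm,
    ← Real.rpow_natCast (w α ^ s), ← Real.rpow_mul (hw α).le]
  congr 2; push_cast; ring_nf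

open Classical in
/-- The element with prescribed entries (zero if the weighted norm is infinite). -/
def ofCoeff (w : ι → ℝ) (s : ℝ) (c : ι → ℂ) : Wl2 ι w s :=
  if h : ∃ u : Wl2 ι w s, u.coeff = c then h.choose else 0

theorem coeff_ofCoeff (hw : ∀ α, 0 < w α) (c : ι → ℂ)
    (hc : sqNorm (wt w s) (fun α => ‖c α‖ₑ) ≠ ∞) : (ofCoeff w s c).coeff = c := by
  have h := exists_of_sqNorm hw c hc
  rw [ofCoeff, dif_pos h]
  exact h.choose_spec

theorem norm_le_of_sqNorm_le (hw : ∀ α, 0 < w α) (u : Wl2 ι w s) {C : ℝ} (hC : 0 ≤ C)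
    (h : sqNorm (wt w s) (fun α => ‖u.coeff α‖ₑ) ≤ ENNReal.ofReal C ^ 2) : ‖u‖ ≤ C := by
  rw [← enorm_sq_eq hw] at h
  have h' := (ENNReal.pow_le_pow_left_iff two_ne_zero).1 h
  rw [← ofReal_norm] at h'
  exact (ENNReal.ofReal_le_ofReal_iff hC).1 h'

theorem norm_le_of_sqNorm_le' (hw : ∀ α, 0 < w α) (hw' : ∀ α, 0 < w' α) (u : Wl2 ι w s)
    (v : Wl2 κ w' t) {C : ℝ} (hC : 0 ≤ C)
    (h : sqNorm (wt w s) (fun α => ‖u.coeff α‖ₑ) ≤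
      ENNReal.ofReal C ^ 2 * sqNorm (wt w' t) (fun α => ‖v.coeff α‖ₑ)) : ‖u‖ ≤ C * ‖v‖ := by
  apply norm_le_of_sqNorm_le hw _ (by positivity)
  rwa [ENNReal.ofReal_mul hC, mul_pow, ofReal_norm, enorm_sq_eq hw']

/-- A linear map on families that is bounded between weighted spaces, as an operator. -/
theorem exists_clm (hw : ∀ α, 0 < w α) (hw' : ∀ α, 0 < w' α) (T : (ι → ℂ) →ₗ[ℂ] (κ → ℂ)) {C : ℝ}
    (hC : 0 ≤ C) (hT : ∀ c : ι → ℂ, sqNorm (wt w' t) (fun α => ‖T c α‖ₑ) ≤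
      ENNReal.ofReal C ^ 2 * sqNorm (wt w s) (fun α => ‖c α‖ₑ)) :
    ∃ L : Wl2 ι w s →L[ℂ] Wl2 κ w' t, (∀ u α, (L u).coeff α = T u.coeff α) ∧
      ∀ u, ‖L u‖ ≤ C * ‖u‖ := by
  have hco : ∀ u : Wl2 ι w s, (ofCoeff w' t (T u.coeff)).coeff = T u.coeff := fun u =>
    coeff_ofCoeff hw' _ (ne_top_of_le_ne_top
      (ENNReal.mul_ne_top (by simp) (sqNorm_ne_top hw u)) (hT u.coeff))
  let L : Wl2 ι w s →ₗ[ℂ] Wl2 κ w' t :=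
    { toFun := fun u => ofCoeff w' t (T u.coeff)
      map_add' := fun u v => ext_coeff hw' fun α => by
        have : (u + v).coeff = u.coeff + v.coeff := funext fun α => by simp
        rw [coeff_add, hco, hco, hco, this, map_add]; rfl
      map_smul' := fun c u => ext_coeff hw' fun α => by
        have : (c • u).coeff = c • u.coeff := funext fun α => by simp
        rw [RingHom.id_apply, coeff_smul, hco, hco, this, map_smul]; rfl }
  have hb : ∀ u, ‖L u‖ ≤ C * ‖u‖ := fun u => by
    refine norm_le_of_sqNorm_le' hw' hw _ _ hC ?_
    have : (L u).coeff = T u.coeff := hco u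
    rw [this]; exact hT _
  exact ⟨L.mkContinuous C hb, fun u α => congrFun (hco u) α, hb⟩

theorem norm_coeff_le (hw : ∀ α, 0 < w α) (u : Wl2 ι w s) (α : ι) :
    ‖u.coeff α‖ ≤ w α ^ (-s) * ‖u‖ := by
  rw [coeff, norm_mul, Complex.norm_real, Real.norm_eq_abs,
    abs_of_pos (Real.rpow_pos_of_pos (hw α) _)]
  exact mul_le_mul_of_nonneg_left (lp.norm_apply_le_norm (by norm_num) u.toLp α)
    (Real.rpow_nonneg (hw α).le _)

/-- The entry at `α` as a continuous linear functional. -/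
def coeffL (hw : ∀ α, 0 < w α) (α : ι) : Wl2 ι w s →L[ℂ] ℂ :=
  LinearMap.mkContinuous
    { toFun := fun u => u.coeff α, map_add' := fun u v => coeff_add u v α,
      map_smul' := fun c u => coeff_smul c u α } (w α ^ (-s)) fun u => norm_coeff_le hw u α

@[simp] theorem coeffL_apply (hw : ∀ α, 0 < w α) (α : ι) (u : Wl2 ι w s) :
    coeffL hw α u = u.coeff α := rfl

end Wl2

/-- The Cauchy-Schwarz inequality for sums in `[0, ∞]`. -/
theorem tsum_mul_sq_le {ι : Type} (a b : ι → ℝ≥0∞) :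
    (∑' i, a i * b i) ^ 2 ≤ (∑' i, a i ^ 2) * ∑' i, b i ^ 2 := by
  have h : ∀ t : Finset ι, ∑ i ∈ t, a i * b i ≤
      ((∑' i, a i ^ 2) * ∑' i, b i ^ 2) ^ (1 / 2 : ℝ) := fun t => by
    have := ENNReal.inner_le_Lp_mul_Lq t a b Real.HolderConjugate.two_two
    refine this.trans ?_
    rw [← ENNReal.mul_rpow_of_nonneg _ _ (by norm_num)]
    refine ENNReal.rpow_le_rpow ?_ (by norm_num)
    have e : ∀ x : ℝ≥0∞, x ^ (2 : ℝ) = x ^ 2 := fun x => by exact_mod_cast ENNReal.rpow_natCast x 2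
    simp only [e]
    exact mul_le_mul' (ENNReal.sum_le_tsum _) (ENNReal.sum_le_tsum _)
  have h2 : ∑' i, a i * b i ≤ ((∑' i, a i ^ 2) * ∑' i, b i ^ 2) ^ (1 / 2 : ℝ) := by
    rw [ENNReal.tsum_eq_iSup_sum]; exact iSup_le h
  calc (∑' i, a i * b i) ^ 2 ≤ (((∑' i, a i ^ 2) * ∑' i, b i ^ 2) ^ (1 / 2 : ℝ)) ^ 2 :=
        pow_le_pow_left' h2 2
    _ = _ := by
        rw [← ENNReal.rpow_natCast, ← ENNReal.rpow_mul]; norm_num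

theorem tsum_comp_le_of_injective {ι κ : Type} {f : ι → κ} (hf : Function.Injective f)
    (g : κ → ℝ≥0∞) : ∑' i, g (f i) ≤ ∑' k, g k :=
  ENNReal.tsum_comp_le_tsum_of_injective hf g

/-- A sum over all indices is the iterated sum over the fibres of a map. -/
theorem tsum_fiber {Q ι : Type} (e : Q → ι) (g : Q → ℝ≥0∞) :
    ∑' n, ∑' q : {q // e q = n}, g q = ∑' q, g q := by
  rw [← (Equiv.sigmaFiberEquiv e).tsum_eq g, ENNReal.tsum_sigma']
  rfl

theorem tsum_fiber_complex {Q ι : Type} (e : Q → ι) (g : Q → ℂ) (hg : Summable g) :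
    ∑' n, ∑' q : {q // e q = n}, g q = ∑' q, g q := by
  rw [← (Equiv.sigmaFiberEquiv e).tsum_eq g]
  exact (Summable.tsum_sigma (f := fun c => g (Equiv.sigmaFiberEquiv e c))
    ((Equiv.sigmaFiberEquiv e).summable_iff.2 hg)).symm

theorem summable_of_tsum_enorm {ι : Type} {f : ι → ℂ} (h : ∑' i, ‖f i‖ₑ ≠ ∞) : Summable f := by
  apply Summable.of_norm
  refine (ENNReal.summable_toReal h).congr fun i => by simp

theorem enorm_tsum_le' {ι : Type} (f : ι → ℂ) : ‖∑' i, f i‖ₑ ≤ ∑' i, ‖f i‖ₑ := by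
  by_cases h : ∑' i, ‖f i‖ₑ = ∞
  · rw [h]; exact le_top
  · have hs : Summable fun i => ‖f i‖ := by
      simpa using ENNReal.summable_toReal h
    have := norm_tsum_le_tsum_norm hs
    rw [← ofReal_norm]
    refine (ENNReal.ofReal_le_ofReal this).trans ?_
    rw [ENNReal.ofReal_tsum_of_nonneg (fun _ => norm_nonneg _) hs]
    simp

namespace Wl2

variable {ι κ : Type} {w : ι → ℝ} {w' : κ → ℝ} {s t : ℝ}

theorem tsum_enorm_mul_sq_le (hw : ∀ α, 1 ≤ w α) (hs : 0 ≤ s) (x y : ι → ℝ≥0∞) :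
    (∑' α, x α * y α) ^ 2 ≤ sqNorm (wt w s) x * sqNorm (wt w s) y := by
  have h1 : ∀ α, 1 ≤ wt w s α := fun α => by
    rw [wt, ← ENNReal.ofReal_one]; exact ENNReal.ofReal_le_ofReal (Real.one_le_rpow (hw α) hs)
  refine (pow_le_pow_left' (ENNReal.tsum_le_tsum fun α => ?_) 2).trans
    (tsum_mul_sq_le (fun α => wt w s α * x α) (fun α => wt w s α * y α))
  calc x α * y α = (1 * x α) * (1 * y α) := by simp
    _ ≤ _ := by gcongr <;> exact h1 α

theorem tsum_enorm_mul_le (hw : ∀ α, 1 ≤ w α) (hs : 0 ≤ s) (u v : Wl2 ι w s) :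
    ∑' α, ‖u.coeff α * v.coeff α‖ₑ ≤ ‖u‖ₑ * ‖v‖ₑ := by
  have hw0 : ∀ α, 0 < w α := fun α => one_pos.trans_le (hw α)
  have := tsum_enorm_mul_sq_le hw hs (fun α => ‖u.coeff α‖ₑ) (fun α => ‖v.coeff α‖ₑ)
  rw [← enorm_sq_eq hw0, ← enorm_sq_eq hw0, ← mul_pow] at this
  simp only [enorm_mul]
  exact (ENNReal.pow_le_pow_left_iff two_ne_zero).1 this

theorem summable_pair (hw : ∀ α, 1 ≤ w α) (hs : 0 ≤ s) (u v : Wl2 ι w s) :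
    Summable fun α => u.coeff α * v.coeff α :=
  summable_of_tsum_enorm (ne_top_of_le_ne_top (ENNReal.mul_ne_top (by simp) (by simp))
    (tsum_enorm_mul_le hw hs u v))

theorem norm_pair_le (hw : ∀ α, 1 ≤ w α) (hs : 0 ≤ s) (u v : Wl2 ι w s) :
    ‖u.pair v‖ ≤ ‖u‖ * ‖v‖ := by
  have h := (enorm_tsum_le' _).trans (tsum_enorm_mul_le hw hs u v)
  have h2 := ENNReal.toReal_mono (ENNReal.mul_ne_top (by simp) (by simp)) h
  simpa [pair] using h2

theorem pair_comm (u v : Wl2 ι w s) : u.pair v = v.pair u := by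
  unfold pair; congr 1; ext; ring

/-- The bilinear pairing as a bounded bilinear map. -/
def pairL (hw : ∀ α, 1 ≤ w α) (hs : 0 ≤ s) : Wl2 ι w s →L[ℂ] Wl2 ι w s →L[ℂ] ℂ :=
  LinearMap.mkContinuous₂
    (LinearMap.mk₂ ℂ pair
      (fun u v x => by
        simp only [pair, coeff_add, add_mul]
        exact (summable_pair hw hs u x).tsum_add (summable_pair hw hs v x))
      (fun c u x => by simp only [pair, coeff_smul, mul_assoc, tsum_mul_left, smul_eq_mul])
      (fun x u v => by
        simp only [pair, coeff_add, mul_add]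
        exact (summable_pair hw hs x u).tsum_add (summable_pair hw hs x v))
      (fun c u x => by
        simp only [pair, coeff_smul, smul_eq_mul, mul_left_comm _ c, tsum_mul_left]))
    1 fun u v => by rw [one_mul]; exact norm_pair_le hw hs u v

@[simp] theorem pairL_apply (hw : ∀ α, 1 ≤ w α) (hs : 0 ≤ s) (u v : Wl2 ι w s) :
    pairL hw hs u v = u.pair v := rfl

theorem pair_basis (hw : ∀ α, 0 < w α) (u : Wl2 ι w s) (α : ι) : u.pair (basis α) = u.coeff α := by
  rw [pair, tsum_eq_single α fun β hβ => by rw [coeff_basis_ne hβ, mul_zero],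
    coeff_basis_same hw, mul_one]

theorem ext_pair (hw : ∀ α, 0 < w α) {u v : Wl2 ι w s} (h : ∀ x, u.pair x = v.pair x) : u = v :=
  ext_coeff hw fun α => by rw [← pair_basis hw, ← pair_basis hw, h]

/-- Square summability of the inverse weights makes every family in the space summable. -/
theorem tsum_enorm_sq_le (hw : ∀ α, 0 < w α) (u : Wl2 ι w s) :
    (∑' α, ‖u.coeff α‖ₑ) ^ 2 ≤ (∑' α, (wt w s α)⁻¹ ^ 2) * ‖u‖ₑ ^ 2 := by
  rw [enorm_sq_eq hw]
  refine le_trans (le_of_eq ?_) (tsum_mul_sq_le (fun α => (wt w s α)⁻¹)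
    (fun α => wt w s α * ‖u.coeff α‖ₑ))
  congr 2; ext α
  rw [← mul_assoc, ENNReal.inv_mul_cancel, one_mul]
  · simpa [wt] using Real.rpow_pos_of_pos (hw α) s
  · simp [wt]

end Wl2

end

noncomputable section

/-! ### Bounded trilinear operators -/

section Trilinear

variable {Q ι : Type} {e f g h : Q → ι} {c : ι → ℝ≥0∞}

/-- Cauchy–Schwarz on the fibres of `e`: the factors `(c y) (c z)` are weighted by `c⁻¹ c⁻¹`, and a
summand is determined by its legs `g`, `h` together with either `e` or `f`. -/
theorem fiber_sq_le (hfgh : Function.Injective fun q => (f q, g q, h q))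
    (hegh : Function.Injective fun q => (e q, g q, h q))
    (hc0 : ∀ α, c α ≠ 0) (hct : ∀ α, c α ≠ ∞) (x y z : ι → ℝ≥0∞) :
    ∑' n, (∑' q : {q // e q = n}, x (f q) * y (g q) * z (h q)) ^ 2 ≤
      (∑' α, (c α)⁻¹ ^ 2) ^ 2 * ((∑' α, x α ^ 2) * sqNorm c y * sqNorm c z) := by
  set S := ∑' α, (c α)⁻¹ ^ 2 with hS
  have prod2 : ∀ a b : ι → ℝ≥0∞, ∑' p : ι × ι, a p.1 * b p.2 = (∑' i, a i) * ∑' j, b j :=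
    fun a b => by
      rw [ENNReal.tsum_prod' (f := fun p : ι × ι => a p.1 * b p.2)]
      simp only [ENNReal.tsum_mul_left, ENNReal.tsum_mul_right]
  have h1 : ∀ n, (∑' q : {q // e q = n}, x (f q) * y (g q) * z (h q)) ^ 2 ≤
      S ^ 2 * ∑' q : {q // e q = n}, (x (f q) * (c (g q) * y (g q)) * (c (h q) * z (h q))) ^ 2 := by
    intro n
    have hi : Function.Injective fun q : {q // e q = n} => (g q, h q) := fun q q' hq => by
      simp only [Prod.mk.injEq] at hq
      exact Subtype.ext (hegh (by simp only [q.2, q'.2, hq.1, hq.2]))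
    calc (∑' q : {q // e q = n}, x (f q) * y (g q) * z (h q)) ^ 2
        = (∑' q : {q // e q = n}, ((c (g q))⁻¹ * (c (h q))⁻¹) *
            (x (f q) * (c (g q) * y (g q)) * (c (h q) * z (h q)))) ^ 2 := by
          congr 2; ext q
          have e1 := ENNReal.inv_mul_cancel (hc0 (g q)) (hct (g q))
          have e2 := ENNReal.inv_mul_cancel (hc0 (h q)) (hct (h q))
          calc x (f q) * y (g q) * z (h q) = ((c (g q))⁻¹ * c (g q)) * ((c (h q))⁻¹ * c (h q)) *
                (x (f q) * y (g q) * z (h q)) := by rw [e1, e2]; simp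
            _ = _ := by ring
      _ ≤ _ := tsum_mul_sq_le _ _
      _ ≤ _ := by
          gcongr
          calc ∑' q : {q // e q = n}, ((c (g q))⁻¹ * (c (h q))⁻¹) ^ 2
              ≤ ∑' p : ι × ι, ((c p.1)⁻¹ * (c p.2)⁻¹) ^ 2 :=
                tsum_comp_le_of_injective hi fun p => ((c p.1)⁻¹ * (c p.2)⁻¹) ^ 2
            _ = S ^ 2 := by simp only [mul_pow]; rw [prod2 (fun a => (c a)⁻¹ ^ 2) fun a => (c a)⁻¹ ^ 2, sq S]
  calc _ ≤ ∑' n, S ^ 2 * ∑' q : {q // e q = n},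
        (x (f q) * (c (g q) * y (g q)) * (c (h q) * z (h q))) ^ 2 := ENNReal.tsum_le_tsum h1
    _ = S ^ 2 * ∑' q, (x (f q) * (c (g q) * y (g q)) * (c (h q) * z (h q))) ^ 2 := by
        rw [ENNReal.tsum_mul_left]
        congr 1
        exact tsum_fiber e fun q => (x (f q) * (c (g q) * y (g q)) * (c (h q) * z (h q))) ^ 2
    _ ≤ S ^ 2 * ∑' p : ι × ι × ι, x p.1 ^ 2 * ((c p.2.1 * y p.2.1) ^ 2 *
          (c p.2.2 * z p.2.2) ^ 2) := by
        gcongr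
        refine le_trans (le_of_eq ?_) (tsum_comp_le_of_injective hfgh fun p : ι × ι × ι =>
          x p.1 ^ 2 * ((c p.2.1 * y p.2.1) ^ 2 * (c p.2.2 * z p.2.2) ^ 2))
        congr 1; ext q; ring
    _ = _ := by
        rw [ENNReal.tsum_prod' (f := fun p : ι × ι × ι => x p.1 ^ 2 *
          ((c p.2.1 * y p.2.1) ^ 2 * (c p.2.2 * z p.2.2) ^ 2))]
        simp only [ENNReal.tsum_mul_left, ENNReal.tsum_mul_right]
        rw [prod2 (fun i => (c i * y i) ^ 2) fun i => (c i * z i) ^ 2]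
        simp only [sqNorm]; ring

/-- Four maps `e, f, g, h` from an index set of monomials such that any three of them determine
the monomial, with square summable inverse weights. -/
structure IsLegs (c : ι → ℝ≥0∞) (e f g h : Q → ι) : Prop where
  fgh : Function.Injective fun q => (f q, g q, h q)
  egh : Function.Injective fun q => (e q, g q, h q)
  efh : Function.Injective fun q => (e q, f q, h q)
  efg : Function.Injective fun q => (e q, f q, g q)
  ne_zero : ∀ α, c α ≠ 0
  ne_top : ∀ α, c α ≠ ∞
  summable : ∑' α, (c α)⁻¹ ^ 2 ≠ ∞

/-- A weight is tame along the legs if at the first one it is dominated by the sum over the other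
three. -/
def IsTame (V : ι → ℝ≥0∞) (A : ℝ≥0∞) (e f g h : Q → ι) : Prop :=
  ∀ q, V (e q) ≤ A * (V (f q) + V (g q) + V (h q))

/-- The sums of absolute values over the fibres of the first leg. -/
def fibSum (e f g h : Q → ι) (x y z : ι → ℝ≥0∞) (n : ι) : ℝ≥0∞ :=
  ∑' q : {q // e q = n}, x (f q) * y (g q) * z (h q)

theorem add_three_sq_le (a b d : ℝ≥0∞) : (a + b + d) ^ 2 ≤ 3 * (a ^ 2 + b ^ 2 + d ^ 2) := by
  by_cases h : a = ∞ ∨ b = ∞ ∨ d = ∞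
  · have : a ^ 2 + b ^ 2 + d ^ 2 = ∞ := by rcases h with h | h | h <;> simp [h]
    rw [this, ENNReal.mul_top (by simp)]; exact le_top
  · push Not at h
    lift a to NNReal using h.1
    lift b to NNReal using h.2.1
    lift d to NNReal using h.2.2
    have : (a + b + d) ^ 2 ≤ 3 * (a ^ 2 + b ^ 2 + d ^ 2) := by
      rw [← NNReal.coe_le_coe]; push_cast
      nlinarith [sq_nonneg ((a : ℝ) - b), sq_nonneg ((b : ℝ) - d), sq_nonneg ((a : ℝ) - d)]
    exact_mod_cast this

/-- The tame estimate: a weight that is dominated along the legs falls on one factor at a time. -/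
theorem sqNorm_fibSum_le (H : IsLegs c e f g h) {V : ι → ℝ≥0∞} {A : ℝ≥0∞}
    (hV : IsTame V A e f g h) (x y z : ι → ℝ≥0∞) :
    sqNorm V (fibSum e f g h x y z) ≤ 3 * A ^ 2 * (∑' α, (c α)⁻¹ ^ 2) ^ 2 *
      (sqNorm V x * sqNorm c y * sqNorm c z + sqNorm c x * sqNorm V y * sqNorm c z +
        sqNorm c x * sqNorm c y * sqNorm V z) := by
  set S := ∑' α, (c α)⁻¹ ^ 2
  set F1 : ι → ℝ≥0∞ := fun n => ∑' q : {q // e q = n}, (V (f q) * x (f q)) * y (g q) * z (h q)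
  set F2 : ι → ℝ≥0∞ := fun n => ∑' q : {q // e q = n}, (V (g q) * y (g q)) * x (f q) * z (h q)
  set F3 : ι → ℝ≥0∞ := fun n => ∑' q : {q // e q = n}, (V (h q) * z (h q)) * x (f q) * y (g q)
  have h1 : ∀ n, V n * fibSum e f g h x y z n ≤ A * (F1 n + F2 n + F3 n) := fun n => by
    simp only [fibSum, F1, F2, F3]
    rw [← ENNReal.tsum_add, ← ENNReal.tsum_add, ← ENNReal.tsum_mul_left, ← ENNReal.tsum_mul_left]
    refine ENNReal.tsum_le_tsum fun q => ?_
    have := hV q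
    rw [q.2] at this
    calc V n * (x (f q) * y (g q) * z (h q)) ≤
        (A * (V (f q) + V (g q) + V (h q))) * (x (f q) * y (g q) * z (h q)) := by gcongr
      _ = _ := by ring
  have b1 := fiber_sq_le (e := e) H.fgh H.egh H.ne_zero H.ne_top (fun α => V α * x α) y z
  have b2 := fiber_sq_le (e := e) (f := g) (g := f) (h := h)
    (fun q q' hq => H.fgh (by simp only [Prod.mk.injEq] at hq ⊢; tauto)) H.efh H.ne_zero H.ne_top
    (fun α => V α * y α) x z
  have b3 := fiber_sq_le (e := e) (f := h) (g := f) (h := g)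
    (fun q q' hq => H.fgh (by simp only [Prod.mk.injEq] at hq ⊢; tauto)) H.efg H.ne_zero H.ne_top
    (fun α => V α * z α) x y
  calc sqNorm V (fibSum e f g h x y z) ≤ ∑' n, A ^ 2 * (3 * (F1 n ^ 2 + F2 n ^ 2 + F3 n ^ 2)) := by
        refine ENNReal.tsum_le_tsum fun n => (pow_le_pow_left' (h1 n) 2).trans ?_
        rw [mul_pow]; gcongr; exact add_three_sq_le _ _ _
    _ = A ^ 2 * (3 * (∑' n, F1 n ^ 2 + ∑' n, F2 n ^ 2 + ∑' n, F3 n ^ 2)) := by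
        rw [ENNReal.tsum_mul_left, ENNReal.tsum_mul_left, ENNReal.tsum_add, ENNReal.tsum_add]
    _ ≤ A ^ 2 * (3 * (S ^ 2 * (sqNorm V x * sqNorm c y * sqNorm c z) +
          S ^ 2 * (sqNorm V y * sqNorm c x * sqNorm c z) +
          S ^ 2 * (sqNorm V z * sqNorm c x * sqNorm c y))) := by gcongr <;> assumption
    _ = _ := by ring

theorem sqNorm_fibSum_self_le (H : IsLegs c e f g h) {A : ℝ≥0∞} (hV : IsTame c A e f g h)
    (x y z : ι → ℝ≥0∞) : sqNorm c (fibSum e f g h x y z) ≤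
      (3 * A * ∑' α, (c α)⁻¹ ^ 2) ^ 2 * (sqNorm c x * sqNorm c y * sqNorm c z) :=
  (sqNorm_fibSum_le H hV x y z).trans (le_of_eq (by ring))

variable {w : ι → ℝ} {s : ℝ}

theorem fibSum_ne_top (hw : ∀ α, 0 < w α) (H : IsLegs (wt w s) e f g h) {A : ℝ≥0∞} (hA : A ≠ ∞)
    (hV : IsTame (wt w s) A e f g h) (x y z : Wl2 ι w s) (n : ι) :
    fibSum e f g h (fun α => ‖x.coeff α‖ₑ) (fun α => ‖y.coeff α‖ₑ) (fun α => ‖z.coeff α‖ₑ) n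
      ≠ ∞ := by
  intro htop
  have h1 := sqNorm_fibSum_self_le H hV (fun α => ‖x.coeff α‖ₑ) (fun α => ‖y.coeff α‖ₑ)
    (fun α => ‖z.coeff α‖ₑ)
  have h2 := (ENNReal.le_tsum (f := fun α => (wt w s α * fibSum e f g h (fun α => ‖x.coeff α‖ₑ)
    (fun α => ‖y.coeff α‖ₑ) (fun α => ‖z.coeff α‖ₑ) α) ^ 2) n).trans h1
  rw [htop, ENNReal.mul_top (H.ne_zero n), ENNReal.top_pow two_ne_zero] at h2
  refine absurd (top_le_iff.1 h2) (ENNReal.mul_ne_top (ENNReal.pow_ne_top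
    (ENNReal.mul_ne_top (ENNReal.mul_ne_top (by simp) hA) H.summable)) ?_)
  simp only [← Wl2.enorm_sq_eq hw]
  exact ENNReal.mul_ne_top (ENNReal.mul_ne_top (by simp) (by simp)) (by simp)

theorem enorm_fiber_tsum_le {κ : Q → ℂ} (hκ : ∀ q, ‖κ q‖ ≤ 1) (x y z : ι → ℂ) (n : ι) :
    ∑' q : {q // e q = n}, ‖κ q * (x (f q) * y (g q) * z (h q))‖ₑ ≤
      fibSum e f g h (fun α => ‖x α‖ₑ) (fun α => ‖y α‖ₑ) (fun α => ‖z α‖ₑ) n := by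
  refine ENNReal.tsum_le_tsum fun q => ?_
  have : ‖κ q‖ₑ ≤ 1 := by
    rw [← ofReal_norm, ← ENNReal.ofReal_one]; exact ENNReal.ofReal_le_ofReal (hκ q)
  rw [enorm_mul, enorm_mul, enorm_mul]
  exact mul_le_of_le_one_left' this

set_option maxHeartbeats 1000000 in
/-- The bounded trilinear operator whose entry at `n` is the sum of `κ q * x (f q) * y (g q) *
z (h q)` over the monomials `q` with `e q = n`. -/
theorem exists_triOp (hw : ∀ α, 0 < w α) (H : IsLegs (wt w s) e f g h) {A : ℝ≥0∞} (hA : A ≠ ∞)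
    (hV : IsTame (wt w s) A e f g h) {κ : Q → ℂ} (hκ : ∀ q, ‖κ q‖ ≤ 1) :
    ∃ T : Wl2 ι w s →L[ℂ] Wl2 ι w s →L[ℂ] Wl2 ι w s →L[ℂ] Wl2 ι w s, ∀ x y z n,
      (T x y z).coeff n =
        ∑' q : {q // e q = n}, κ q * (x.coeff (f q) * y.coeff (g q) * z.coeff (h q)) := by
  set t : Wl2 ι w s → Wl2 ι w s → Wl2 ι w s → ι → ℂ := fun x y z n =>
    ∑' q : {q // e q = n}, κ q * (x.coeff (f q) * y.coeff (g q) * z.coeff (h q)) with ht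
  set K : ℝ≥0∞ := 3 * A * ∑' α, (wt w s α)⁻¹ ^ 2 with hK
  have hKt : K ≠ ∞ := ENNReal.mul_ne_top (ENNReal.mul_ne_top (by simp) hA) H.summable
  have hsum : ∀ (x y z : Wl2 ι w s) n, Summable fun q : {q // e q = n} =>
      κ q * (x.coeff (f q) * y.coeff (g q) * z.coeff (h q)) := fun x y z n =>
    summable_of_tsum_enorm (ne_top_of_le_ne_top (fibSum_ne_top hw H hA hV x y z n)
      (enorm_fiber_tsum_le hκ _ _ _ n))
  have hb : ∀ x y z, sqNorm (wt w s) (fun n => ‖t x y z n‖ₑ) ≤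
      K ^ 2 * (‖x‖ₑ ^ 2 * ‖y‖ₑ ^ 2 * ‖z‖ₑ ^ 2) := fun x y z => by
    simp only [Wl2.enorm_sq_eq hw]
    refine le_trans (ENNReal.tsum_le_tsum fun n => ?_) (sqNorm_fibSum_self_le H hV _ _ _)
    gcongr
    exact (enorm_tsum_le' _).trans (enorm_fiber_tsum_le hκ _ _ _ n)
  have hco : ∀ x y z, (Wl2.ofCoeff w s (t x y z)).coeff = t x y z := fun x y z =>
    Wl2.coeff_ofCoeff hw _ (ne_top_of_le_ne_top (ENNReal.mul_ne_top (by simp [hKt])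
      (by finiteness)) (hb x y z))
  have hn : ∀ x y z, ‖Wl2.ofCoeff w s (t x y z)‖ ≤ K.toReal * ‖x‖ * ‖y‖ * ‖z‖ := fun x y z => by
    apply Wl2.norm_le_of_sqNorm_le hw _ (by positivity)
    rw [hco]
    refine (hb x y z).trans (le_of_eq ?_)
    rw [ENNReal.ofReal_mul (by positivity), ENNReal.ofReal_mul (by positivity),
      ENNReal.ofReal_mul (by positivity), ENNReal.ofReal_toReal hKt]
    simp only [ofReal_norm]; ring
  let T1 : Wl2 ι w s → Wl2 ι w s → (Wl2 ι w s →L[ℂ] Wl2 ι w s) := fun x y =>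
    LinearMap.mkContinuous
      { toFun := fun z => Wl2.ofCoeff w s (t x y z)
        map_add' := fun z z' => Wl2.ext_coeff hw fun n => by
          rw [Wl2.coeff_add, hco, hco, hco]
          simp only [ht, Wl2.coeff_add, mul_add]
          exact (hsum x y z n).tsum_add (hsum x y z' n)
        map_smul' := fun a z => Wl2.ext_coeff hw fun n => by
          rw [RingHom.id_apply, Wl2.coeff_smul, hco, hco]
          simp only [ht, Wl2.coeff_smul]
          rw [← tsum_mul_left]; congr 1; ext q; ring } (K.toReal * ‖x‖ * ‖y‖) (hn x y)
  have hT1 : ∀ x y z, (T1 x y z).coeff = t x y z := hco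
  refine ⟨LinearMap.mkContinuous₂ (LinearMap.mk₂ ℂ T1 ?_ ?_ ?_ ?_) K.toReal fun x y =>
    ContinuousLinearMap.opNorm_le_bound _ (by positivity) (hn x y), fun x y z n => congrFun (hco x y z) n⟩
  · intro x x' y; ext1 z
    refine Wl2.ext_coeff hw fun n => ?_
    rw [add_apply, Wl2.coeff_add, hT1, hT1, hT1]
    simp only [ht, Wl2.coeff_add, mul_add, add_mul]
    exact (hsum x y z n).tsum_add (hsum x' y z n)
  · intro a x y; ext1 z
    refine Wl2.ext_coeff hw fun n => ?_
    rw [smul_apply, Wl2.coeff_smul, hT1, hT1]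
    simp only [ht, Wl2.coeff_smul]
    rw [← tsum_mul_left]; congr 1; ext q; ring
  · intro x y y'; ext1 z
    refine Wl2.ext_coeff hw fun n => ?_
    rw [add_apply, Wl2.coeff_add, hT1, hT1, hT1]
    simp only [ht, Wl2.coeff_add, mul_add, add_mul]
    exact (hsum x y z n).tsum_add (hsum x y' z n)
  · intro a x y; ext1 z
    refine Wl2.ext_coeff hw fun n => ?_
    rw [smul_apply, Wl2.coeff_smul, hT1, hT1]
    simp only [ht, Wl2.coeff_smul]
    rw [← tsum_mul_left]; congr 1; ext q; ring

/-- Absolute summability of a weighted quartic sum: half of the weight is put on the first factor,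
half on the trilinear expression in the other three. -/
theorem summable_quartic (H : IsLegs c e f g h) {V : ι → ℝ≥0∞} {A : ℝ≥0∞} (hA : A ≠ ∞)
    (hV : IsTame V A e f g h) {κ : Q → ℂ} (hκ : ∀ q, ‖κ q‖ ≤ 1) {d : ι → ℂ}
    (hd : ∀ n, ‖d n‖ₑ ≤ V n ^ 2) {u x y z : ι → ℂ} (hu : sqNorm V (fun α => ‖u α‖ₑ) ≠ ∞)
    (hx : sqNorm V (fun α => ‖x α‖ₑ) ≠ ∞) (hy : sqNorm V (fun α => ‖y α‖ₑ) ≠ ∞)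
    (hz : sqNorm V (fun α => ‖z α‖ₑ) ≠ ∞) (hx' : sqNorm c (fun α => ‖x α‖ₑ) ≠ ∞)
    (hy' : sqNorm c (fun α => ‖y α‖ₑ) ≠ ∞) (hz' : sqNorm c (fun α => ‖z α‖ₑ) ≠ ∞) :
    Summable fun q => d (e q) * (κ q * (u (e q) * (x (f q) * y (g q) * z (h q)))) := by
  apply summable_of_tsum_enorm
  set F := fibSum e f g h (fun α => ‖x α‖ₑ) (fun α => ‖y α‖ₑ) (fun α => ‖z α‖ₑ)
  have hF : sqNorm V F ≠ ∞ := by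
    refine ne_top_of_le_ne_top ?_ (sqNorm_fibSum_le H hV _ _ _)
    have := H.summable
    finiteness
  have hle : ∑' q, ‖d (e q) * (κ q * (u (e q) * (x (f q) * y (g q) * z (h q))))‖ₑ ≤
      ∑' n, (V n * ‖u n‖ₑ) * (V n * F n) := by
    rw [← tsum_fiber e]
    refine ENNReal.tsum_le_tsum fun n => ?_
    simp only [F, fibSum]
    rw [← ENNReal.tsum_mul_left, ← ENNReal.tsum_mul_left]
    refine ENNReal.tsum_le_tsum fun q => ?_
    have h1 : ‖κ q‖ₑ ≤ 1 := by
      rw [← ofReal_norm, ← ENNReal.ofReal_one]; exact ENNReal.ofReal_le_ofReal (hκ q)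
    rw [q.2]
    simp only [enorm_mul]
    calc _ ≤ V n ^ 2 * (1 * (‖u n‖ₑ * (‖x (f q)‖ₑ * ‖y (g q)‖ₑ * ‖z (h q)‖ₑ))) := by
          gcongr; exact hd n
      _ = _ := by ring
  refine ne_top_of_le_ne_top ?_ hle
  intro htop
  have := tsum_mul_sq_le (fun n => V n * ‖u n‖ₑ) fun n => V n * F n
  rw [htop, ENNReal.top_pow two_ne_zero] at this
  exact ENNReal.mul_ne_top hu hF (top_le_iff.1 this)

/-- Summation over the fibres of the first leg. -/
theorem tsum_quartic_fiber {κ : Q → ℂ} {d u x y z : ι → ℂ}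
    (hs : Summable fun q => d (e q) * (κ q * (u (e q) * (x (f q) * y (g q) * z (h q))))) :
    ∑' n, d n * (u n * ∑' q : {q // e q = n}, κ q * (x (f q) * y (g q) * z (h q))) =
      ∑' q, d (e q) * (κ q * (u (e q) * (x (f q) * y (g q) * z (h q)))) := by
  rw [← tsum_fiber_complex e _ hs]
  congr 1; ext n
  rw [← mul_assoc, ← tsum_mul_left]
  congr 1; ext q
  rw [q.2]; ring

theorem summable_quartic_fiber {κ : Q → ℂ} {d u x y z : ι → ℂ}
    (hs : Summable fun q => d (e q) * (κ q * (u (e q) * (x (f q) * y (g q) * z (h q))))) :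
    Summable fun n => d n * (u n * ∑' q : {q // e q = n}, κ q * (x (f q) * y (g q) * z (h q))) := by
  refine (((Equiv.sigmaFiberEquiv e).summable_iff.2 hs).sigma).congr fun n => ?_
  rw [← mul_assoc, ← tsum_mul_left]
  congr 1; ext q
  have : e q = n := q.2
  simp only [Equiv.sigmaFiberEquiv, Equiv.coe_fn_mk, Function.comp]
  rw [this]; ring

end Trilinear

end

noncomputable section

/-! ### Weights on Fourier modes -/

/-- The weight `(1 + j ^ 2) ^ (1 / 2)` on the integers. -/
def intWeight (j : ℤ) : ℝ := Real.sqrt (1 + (j : ℝ) ^ 2)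

theorem one_le_intWeight (j : ℤ) : 1 ≤ intWeight j :=
  Real.one_le_sqrt.2 (by nlinarith [sq_nonneg (j : ℝ)])

theorem intWeight_pos (j : ℤ) : 0 < intWeight j := one_pos.trans_le (one_le_intWeight j)

theorem one_le_fourierWeight (m : Mode) : 1 ≤ fourierWeight m := one_le_intWeight m.1

theorem one_le_extWeight {p : ℤ} (α : ExtMode p) : 1 ≤ extWeight α := le_max_left _ _

theorem wt_ne_zero {ι : Type} {w : ι → ℝ} (hw : ∀ α, 0 < w α) (s : ℝ) (α : ι) : wt w s α ≠ 0 := by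
  simpa [wt] using Real.rpow_pos_of_pos (hw α) s

theorem wt_ne_top {ι : Type} (w : ι → ℝ) (s : ℝ) (α : ι) : wt w s α ≠ ∞ := by simp [wt]

theorem abs_le_intWeight (j : ℤ) : |(j : ℝ)| ≤ intWeight j := by
  rw [intWeight, ← Real.sqrt_sq_eq_abs]; exact Real.sqrt_le_sqrt (by linarith)

theorem intWeight_le_one_add (j : ℤ) : intWeight j ≤ 1 + |(j : ℝ)| := by
  rw [intWeight, Real.sqrt_le_left (by positivity)]
  nlinarith [abs_nonneg (j : ℝ), sq_abs (j : ℝ)]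

theorem intWeight_le_add {n x y z : ℤ} (h : |n| ≤ |x| + |y| + |z|) :
    intWeight n ≤ intWeight x + intWeight y + intWeight z := by
  have h' : |(n : ℝ)| ≤ |(x : ℝ)| + |(y : ℝ)| + |(z : ℝ)| := by exact_mod_cast h
  have e : ∀ j : ℤ, intWeight j ^ 2 = 1 + |(j : ℝ)| ^ 2 := fun j => by
    rw [intWeight, Real.sq_sqrt (by positivity), sq_abs]
  have hp := fun j => (intWeight_pos j).le
  rw [← abs_of_nonneg (hp n), ← abs_of_nonneg (add_nonneg (add_nonneg (hp x) (hp y)) (hp z)),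
    ← sq_le_sq]
  have h2 : |(n : ℝ)| ^ 2 ≤ (|(x : ℝ)| + |(y : ℝ)| + |(z : ℝ)|) ^ 2 :=
    pow_le_pow_left₀ (abs_nonneg _) h' 2
  have h3 := mul_le_mul (abs_le_intWeight x) (abs_le_intWeight y) (abs_nonneg _) (hp x)
  have h4 := mul_le_mul (abs_le_intWeight x) (abs_le_intWeight z) (abs_nonneg _) (hp x)
  have h5 := mul_le_mul (abs_le_intWeight y) (abs_le_intWeight z) (abs_nonneg _) (hp y)
  nlinarith [e n, e x, e y, e z]

theorem rpow_le_of_le_add_three {a x y z s : ℝ} (hs : 0 ≤ s) (ha : 0 ≤ a) (hx : 0 ≤ x)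
    (hy : 0 ≤ y) (hz : 0 ≤ z) (h : a ≤ x + y + z) : a ^ s ≤ 3 ^ s * (x ^ s + y ^ s + z ^ s) := by
  have hM : ∀ M, 0 ≤ M → a ≤ 3 * M → a ^ s ≤ 3 ^ s * M ^ s := fun M hM h =>
    (Real.rpow_le_rpow ha h hs).trans_eq (Real.mul_rpow (by norm_num) hM)
  have px := Real.rpow_nonneg hx s
  have py := Real.rpow_nonneg hy s
  have pz := Real.rpow_nonneg hz s
  have p3 : (0 : ℝ) ≤ 3 ^ s := by positivity
  rcases le_total x y with h1 | h1 <;> rcases le_total y z with h2 | h2 <;>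
    rcases le_total x z with h3 | h3
  all_goals first
    | exact (hM x hx (by linarith)).trans (mul_le_mul_of_nonneg_left (by linarith) p3)
    | exact (hM y hy (by linarith)).trans (mul_le_mul_of_nonneg_left (by linarith) p3)
    | exact (hM z hz (by linarith)).trans (mul_le_mul_of_nonneg_left (by linarith) p3)

theorem wt_intWeight_le {n x y z : ℤ} {s : ℝ} (hs : 0 ≤ s) (h : |n| ≤ |x| + |y| + |z|) :
    wt intWeight s n ≤ ENNReal.ofReal (3 ^ s) *
      (wt intWeight s x + wt intWeight s y + wt intWeight s z) := by
  have p := fun j => Real.rpow_nonneg (intWeight_pos j).le s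
  have hp := fun j => (intWeight_pos j).le
  simp only [wt]
  rw [← ENNReal.ofReal_add (p _) (p _), ← ENNReal.ofReal_add (add_nonneg (p _) (p _)) (p _),
    ← ENNReal.ofReal_mul (by positivity)]
  exact ENNReal.ofReal_le_ofReal
    (rpow_le_of_le_add_three hs (hp _) (hp _) (hp _) (hp _) (intWeight_le_add h))

theorem tsum_wt_intWeight_ne_top {s : ℝ} (hs : 1 / 2 < s) :
    ∑' j : ℤ, (wt intWeight s j)⁻¹ ^ 2 ≠ ∞ := by
  have h1 : Summable fun j : ℤ => |(j : ℝ)| ^ (-(2 * s)) + if j = 0 then 1 else 0 :=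
    (Real.summable_abs_int_rpow (by linarith)).add
      (summable_of_ne_finset_zero (s := {0}) fun j hj => if_neg (by simpa using hj))
  have h2 : ∀ j : ℤ, (intWeight j ^ s)⁻¹ ^ 2 ≤ |(j : ℝ)| ^ (-(2 * s)) + if j = 0 then 1 else 0 := by
    intro j
    by_cases hj : j = 0
    · subst hj
      have : ((0 : ℝ)) ^ (-(2 * s)) = 0 := Real.zero_rpow (by linarith)
      simp [intWeight, this]
    · have hj' : 0 < |(j : ℝ)| := abs_pos.2 (by exact_mod_cast hj)
      rw [if_neg hj, add_zero, ← Real.rpow_neg (intWeight_pos j).le, ← Real.rpow_natCast,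
        ← Real.rpow_mul (intWeight_pos j).le]
      have : -s * ((2 : ℕ) : ℝ) = -(2 * s) := by push_cast; ring
      rw [this]
      exact Real.rpow_le_rpow_of_nonpos hj' (abs_le_intWeight j) (by linarith)
  have h3 := Summable.of_nonneg_of_le (fun j => by positivity) h2 h1
  have h4 : ∀ j : ℤ, (wt intWeight s j)⁻¹ ^ 2 = ENNReal.ofReal ((intWeight j ^ s)⁻¹ ^ 2) := fun j => by
    have := Real.rpow_pos_of_pos (intWeight_pos j) s
    rw [wt, ← ENNReal.ofReal_inv_of_pos this, ENNReal.ofReal_pow (inv_nonneg.2 this.le)]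
  simp only [h4]
  rw [← ENNReal.ofReal_tsum_of_nonneg (fun j => by positivity) h3]
  simp

theorem tsum_wt_fourierWeight_ne_top {s : ℝ} (hs : 1 / 2 < s) :
    ∑' m : Mode, (wt fourierWeight s m)⁻¹ ^ 2 ≠ ∞ := by
  have : ∀ m : Mode, (wt fourierWeight s m)⁻¹ ^ 2 = (wt intWeight s m.1)⁻¹ ^ 2 := fun _ => rfl
  simp only [this]
  rw [ENNReal.tsum_prod' (f := fun m : Mode => (wt intWeight s m.1)⁻¹ ^ 2)]
  simp only [tsum_fintype, Fin.sum_univ_two]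
  rw [ENNReal.tsum_add]
  exact ENNReal.add_ne_top.2 ⟨tsum_wt_intWeight_ne_top hs, tsum_wt_intWeight_ne_top hs⟩

/-! ### Quartic Hamiltonians -/

/-- The mode of the factor `a_k` of the monomial `a_k b_l ā_i b̄_j` with index `q = (i, j, k)`. -/
def legA (q : ℤ × ℤ × ℤ) : Mode := (q.2.2, 0)

/-- The mode of the factor `b_l`, `l = i + j - k`. -/
def legB (q : ℤ × ℤ × ℤ) : Mode := (q.1 + q.2.1 - q.2.2, 1)

/-- The mode of the factor `ā_i`. -/
def legA' (q : ℤ × ℤ × ℤ) : Mode := (q.1, 0)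

/-- The mode of the factor `b̄_j`. -/
def legB' (q : ℤ × ℤ × ℤ) : Mode := (q.2.1, 1)

/-- Four legs of a quartic monomial, in some order, subject to momentum conservation. -/
structure IsQuarticLegs (e f g h : ℤ × ℤ × ℤ → Mode) : Prop where
  efg : Function.Injective fun q => (e q, f q, g q)
  efh : Function.Injective fun q => (e q, f q, h q)
  egh : Function.Injective fun q => (e q, g q, h q)
  fgh : Function.Injective fun q => (f q, g q, h q)
  abs_le : ∀ q, |(e q).1| ≤ |(f q).1| + |(g q).1| + |(h q).1|

theorem abs_le_three {n x y z : ℤ} (h : n = x + y - z ∨ n = y + z - x ∨ n = x + z - y) :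
    |n| ≤ |x| + |y| + |z| := by
  rcases abs_cases n with h1 | h1 <;> rcases abs_cases x with h2 | h2 <;>
    rcases abs_cases y with h3 | h3 <;> rcases abs_cases z with h4 | h4 <;> omega

theorem quarticLegsA : IsQuarticLegs legA legB legA' legB' := by
  constructor
  on_goal 5 => intro q; exact abs_le_three (.inr (.inl (by simp only [legA, legB, legA', legB']; ring)))
  all_goals
    rintro ⟨i, j, k⟩ ⟨i', j', k'⟩ h
    simp only [legA, legB, legA', legB', Prod.mk.injEq, and_true] at h ⊢
    omega

theorem quarticLegsB : IsQuarticLegs legB legA legA' legB' := by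
  constructor
  on_goal 5 => intro q; exact abs_le_three (.inr (.inl rfl))
  all_goals
    rintro ⟨i, j, k⟩ ⟨i', j', k'⟩ h
    simp only [legA, legB, legA', legB', Prod.mk.injEq, and_true] at h ⊢
    omega

theorem quarticLegsA' : IsQuarticLegs legA' legB' legA legB := by
  constructor
  on_goal 5 => intro q; exact abs_le_three (.inr (.inl (by simp only [legA, legB, legA', legB']; ring)))
  all_goals
    rintro ⟨i, j, k⟩ ⟨i', j', k'⟩ h
    simp only [legA, legB, legA', legB', Prod.mk.injEq, and_true] at h ⊢
    omega

theorem quarticLegsB' : IsQuarticLegs legB' legA' legA legB := by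
  constructor
  on_goal 5 => intro q; exact abs_le_three (.inr (.inl (by simp only [legA, legB, legA', legB']; ring)))
  all_goals
    rintro ⟨i, j, k⟩ ⟨i', j', k'⟩ h
    simp only [legA, legB, legA', legB', Prod.mk.injEq, and_true] at h ⊢
    omega

variable {e f g h : ℤ × ℤ × ℤ → Mode} {s : ℝ}

theorem IsQuarticLegs.isLegs (H : IsQuarticLegs e f g h) (hs : 1 / 2 < s) :
    IsLegs (wt fourierWeight s) e f g h :=
  ⟨H.fgh, H.egh, H.efh, H.efg, wt_ne_zero fourierWeight_pos s, wt_ne_top _ _,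
    tsum_wt_fourierWeight_ne_top hs⟩

theorem IsQuarticLegs.isTame (H : IsQuarticLegs e f g h) (hs : 0 ≤ s) :
    IsTame (wt fourierWeight s) (ENNReal.ofReal (3 ^ s)) e f g h := fun q =>
  wt_intWeight_le hs (H.abs_le q)

/-- A bounded kernel: the coefficients of a quartic Hamiltonian. -/
structure Kernel where
  toFun : ℤ × ℤ × ℤ → ℂ
  bound : ∀ q, ‖toFun q‖ ≤ 1

variable [Fact (1 / 2 < s)]

theorem half_lt (s : ℝ) [h : Fact (1 / 2 < s)] : 1 / 2 < s := h.out

theorem s_nonneg (s : ℝ) [h : Fact (1 / 2 < s)] : 0 ≤ s := by linarith [h.out]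

/-- The space of one family of Fourier coefficients. -/
abbrev Hs (s : ℝ) : Type := Wl2 Mode fourierWeight s

/-- The trilinear operator attached to a kernel and an ordering of the legs. -/
def triOp (H : IsQuarticLegs e f g h) (κ : Kernel) : Hs s →L[ℂ] Hs s →L[ℂ] Hs s →L[ℂ] Hs s :=
  (exists_triOp fourierWeight_pos (H.isLegs (half_lt s)) ENNReal.ofReal_ne_top
    (H.isTame (s_nonneg s)) κ.bound).choose

theorem coeff_triOp (H : IsQuarticLegs e f g h) (κ : Kernel) (x y z : Hs s) (n : Mode) :
    (triOp H κ x y z).coeff n =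
      ∑' q : {q // e q = n}, κ.toFun q * (x.coeff (f q) * y.coeff (g q) * z.coeff (h q)) :=
  (exists_triOp fourierWeight_pos (H.isLegs (half_lt s)) ENNReal.ofReal_ne_top
    (H.isTame (s_nonneg s)) κ.bound).choose_spec x y z n

theorem one_le_wt_sq (n : Mode) : ‖(1 : ℂ)‖ₑ ≤ wt fourierWeight s n ^ 2 := by
  simp only [enorm_one]
  exact one_le_pow₀ (by
    rw [wt, ← ENNReal.ofReal_one]
    exact ENNReal.ofReal_le_ofReal (Real.one_le_rpow (one_le_fourierWeight n) (s_nonneg s)))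

theorem summable_quartic_of_weight (H : IsQuarticLegs e f g h) (κ : Kernel) {d : Mode → ℂ}
    (hd : ∀ n, ‖d n‖ₑ ≤ wt fourierWeight s n ^ 2) (u x y z : Hs s) :
    Summable fun q => d (e q) *
      (κ.toFun q * (u.coeff (e q) * (x.coeff (f q) * y.coeff (g q) * z.coeff (h q)))) :=
  summable_quartic (H.isLegs (half_lt s)) ENNReal.ofReal_ne_top
    (H.isTame (s_nonneg s)) κ.bound hd (Wl2.sqNorm_ne_top fourierWeight_pos u)
    (Wl2.sqNorm_ne_top fourierWeight_pos x) (Wl2.sqNorm_ne_top fourierWeight_pos y)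
    (Wl2.sqNorm_ne_top fourierWeight_pos z) (Wl2.sqNorm_ne_top fourierWeight_pos x)
    (Wl2.sqNorm_ne_top fourierWeight_pos y) (Wl2.sqNorm_ne_top fourierWeight_pos z)

theorem pair_triOp (H : IsQuarticLegs e f g h) (κ : Kernel) (u x y z : Hs s) :
    u.pair (triOp H κ x y z) =
      ∑' q, κ.toFun q * (u.coeff (e q) * (x.coeff (f q) * y.coeff (g q) * z.coeff (h q))) := by
  have hs := summable_quartic_of_weight H κ (d := fun _ => 1) one_le_wt_sq u x y z
  have := tsum_quartic_fiber (d := fun _ => 1) (u := u.coeff) (x := x.coeff) (y := y.coeff)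
    (z := z.coeff) hs
  simp only [one_mul] at this
  rw [← this, Wl2.pair]
  exact tsum_congr fun n => by rw [coeff_triOp]

theorem summable_pair_triOp (H : IsQuarticLegs e f g h) (κ : Kernel) (u x y z : Hs s) : Summable
    fun q => κ.toFun q * (u.coeff (e q) * (x.coeff (f q) * y.coeff (g q) * z.coeff (h q))) := by
  simpa only [one_mul] using summable_quartic_of_weight H κ (d := fun _ => 1) one_le_wt_sq u x y z

theorem pair_triOp_B (κ : Kernel) (u v x y : Hs s) :
    v.pair (triOp quarticLegsB κ u x y) = u.pair (triOp quarticLegsA κ v x y) := by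
  rw [pair_triOp, pair_triOp]; congr 1; ext q; ring

theorem pair_triOp_A' (κ : Kernel) (u v x y : Hs s) :
    x.pair (triOp quarticLegsA' κ y u v) = u.pair (triOp quarticLegsA κ v x y) := by
  rw [pair_triOp, pair_triOp]; congr 1; ext q; ring

theorem pair_triOp_B' (κ : Kernel) (u v x y : Hs s) :
    y.pair (triOp quarticLegsB' κ x u v) = u.pair (triOp quarticLegsA κ v x y) := by
  rw [pair_triOp, pair_triOp]; congr 1; ext q; ring

/-- Composition of a trilinear operator with linear maps on both sides. -/
def triComp {P E G : Type} [NormedAddCommGroup P] [NormedSpace ℂ P] [NormedAddCommGroup E]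
    [NormedSpace ℂ E] [NormedAddCommGroup G] [NormedSpace ℂ G] (T : E →L[ℂ] E →L[ℂ] E →L[ℂ] E)
    (a b c : P →L[ℂ] E) (o : E →L[ℂ] G) : P →L[ℂ] P →L[ℂ] P →L[ℂ] G :=
  (ContinuousLinearMap.compL ℂ P (E →L[ℂ] E) (P →L[ℂ] G)
    ((ContinuousLinearMap.compL ℂ P E G o).comp ((ContinuousLinearMap.compL ℂ P E E).flip c))).comp
    (T.bilinearComp a b)

open ContinuousLinearMap in
/-- The symmetric trilinear operator whose diagonal is the gradient of the quartic Hamiltonian. -/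
def gradOp (κ : Kernel) : Ps s →L[ℂ] Ps s →L[ℂ] Ps s →L[ℂ] Ps s :=
  triComp (triOp quarticLegsA κ) (fst ℂ _ _) (snd ℂ _ _) (snd ℂ _ _) (inl ℂ _ _) +
  triComp (triOp quarticLegsB κ) (fst ℂ _ _) (snd ℂ _ _) (snd ℂ _ _) (inl ℂ _ _) +
  triComp (triOp quarticLegsA' κ) (snd ℂ _ _) (fst ℂ _ _) (fst ℂ _ _) (inr ℂ _ _) +
  triComp (triOp quarticLegsB' κ) (snd ℂ _ _) (fst ℂ _ _) (fst ℂ _ _) (inr ℂ _ _)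

theorem gradOp_fst (κ : Kernel) (u v x : Ps s) : (gradOp κ u v x).1 =
    triOp quarticLegsA κ u.1 v.2 x.2 + triOp quarticLegsB κ u.1 v.2 x.2 := by
  change triOp quarticLegsA κ u.1 v.2 x.2 + triOp quarticLegsB κ u.1 v.2 x.2 + 0 + 0 = _
  simp

theorem gradOp_snd (κ : Kernel) (u v x : Ps s) : (gradOp κ u v x).2 =
    triOp quarticLegsA' κ u.2 v.1 x.1 + triOp quarticLegsB' κ u.2 v.1 x.1 := by
  change 0 + 0 + triOp quarticLegsA' κ u.2 v.1 x.1 + triOp quarticLegsB' κ u.2 v.1 x.1 = _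
  simp

/-- The bilinear pairing of `P_s` with itself in which gradients are taken. -/
def bil : Ps s →L[ℂ] Ps s →L[ℂ] ℂ :=
  (Wl2.pairL one_le_fourierWeight (s_nonneg s)).bilinearComp
      (ContinuousLinearMap.fst ℂ _ _) (ContinuousLinearMap.fst ℂ _ _) +
    (Wl2.pairL one_le_fourierWeight (s_nonneg s)).bilinearComp
      (ContinuousLinearMap.snd ℂ _ _) (ContinuousLinearMap.snd ℂ _ _)

theorem bil_apply (u v : Ps s) : bil u v = u.1.pair v.1 + u.2.pair v.2 := rfl

theorem bil_comm (u v : Ps s) : bil u v = bil v u := by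
  rw [bil_apply, bil_apply, Wl2.pair_comm, Wl2.pair_comm u.2]

/-- The quartic Hamiltonian with a given kernel. -/
def quartic (κ : Kernel) (u : FourierPt) : ℂ :=
  ∑' q, κ.toFun q * (u.psi (legA q) * (u.psi (legB q) * u.psiBar (legA' q) * u.psiBar (legB' q)))

theorem quartic_eq (κ : Kernel) (w : Ps s) :
    quartic κ (fourierCoords w) = w.1.pair (triOp quarticLegsA κ w.1 w.2 w.2) :=
  (pair_triOp quarticLegsA κ w.1 w.1 w.2 w.2).symm

theorem hasFDerivAt_trilinear {E G : Type} [NormedAddCommGroup E] [NormedSpace ℂ E]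
    [NormedAddCommGroup G] [NormedSpace ℂ G] (T : E →L[ℂ] E →L[ℂ] E →L[ℂ] G) (w : E) :
    ∃ D : E →L[ℂ] G, HasFDerivAt (fun w => T w w w) D w ∧
      ∀ h, D h = T h w w + T w h w + T w w h := by
  have h1 : HasFDerivAt (fun w : E => w) (ContinuousLinearMap.id ℂ E) w := hasFDerivAt_id w
  refine ⟨_, ((T.hasFDerivAt.comp w h1).clm_apply h1).clm_apply h1, fun h => ?_⟩
  simp
  abel

theorem contDiff_trilinear {E G : Type} [NormedAddCommGroup E] [NormedSpace ℂ E]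
    [NormedAddCommGroup G] [NormedSpace ℂ G] (T : E →L[ℂ] E →L[ℂ] E →L[ℂ] G) {n : WithTop ℕ∞} :
    ContDiff ℂ n (fun w => T w w w) :=
  ((T.contDiff.clm_apply contDiff_id).clm_apply contDiff_id)

theorem hasFDerivAt_bilinear_trilinear {P E : Type} [NormedAddCommGroup P] [NormedSpace ℂ P]
    [NormedAddCommGroup E] [NormedSpace ℂ E] (B : E →L[ℂ] E →L[ℂ] ℂ)
    (T : E →L[ℂ] E →L[ℂ] E →L[ℂ] E) (a b : P →L[ℂ] E) (w : P) :
    ∃ D : P →L[ℂ] ℂ, HasFDerivAt (fun w => B (a w) (T (a w) (b w) (b w))) D w ∧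
      ∀ h, D h = B (a h) (T (a w) (b w) (b w)) + B (a w) (T (a h) (b w) (b w)) +
        B (a w) (T (a w) (b h) (b w)) + B (a w) (T (a w) (b w) (b h)) := by
  have h3 := (((T.comp a).hasFDerivAt (x := w)).clm_apply b.hasFDerivAt).clm_apply b.hasFDerivAt
  refine ⟨_, ((B.comp a).hasFDerivAt (x := w)).clm_apply h3, fun h => ?_⟩
  simp
  ring

theorem hasFDerivAt_quartic (κ : Kernel) (w : Ps s) :
    HasFDerivAt (fun w : Ps s => quartic κ (fourierCoords w)) (bil (gradOp κ w w w)) w := by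
  simp only [quartic_eq]
  obtain ⟨D, hD, hD'⟩ := hasFDerivAt_bilinear_trilinear
    (Wl2.pairL one_le_fourierWeight (s_nonneg s)) (triOp quarticLegsA κ)
    (ContinuousLinearMap.fst ℂ (Hs s) (Hs s)) (ContinuousLinearMap.snd ℂ (Hs s) (Hs s)) w
  suffices h : bil (gradOp κ w w w) = D by rw [h]; exact hD
  refine ContinuousLinearMap.ext fun h => ?_
  rw [bil_comm, bil_apply, gradOp_fst, gradOp_snd, hD']
  simp only [← Wl2.pairL_apply one_le_fourierWeight (s_nonneg s), map_add]
  simp only [Wl2.pairL_apply, ContinuousLinearMap.coe_fst', ContinuousLinearMap.coe_snd']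
  rw [pair_triOp_B κ w.1 h.1 w.2 w.2, pair_triOp_A' κ w.1 w.1 h.2 w.2,
    pair_triOp_B' κ w.1 w.1 w.2 h.2]
  ring

theorem contDiff_quartic (κ : Kernel) {n : WithTop ℕ∞} :
    ContDiff ℂ n (fun w : Ps s => quartic κ (fourierCoords w)) := by
  simp only [quartic_eq]
  exact ((Wl2.pairL one_le_fourierWeight (s_nonneg s)).contDiff.comp contDiff_fst).clm_apply
    ((((triOp quarticLegsA κ).contDiff.comp contDiff_fst).clm_apply contDiff_snd).clm_apply
      contDiff_snd)

end

noncomputable section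

/-! ### Functions with a gradient with respect to a bilinear pairing -/

open scoped ContDiff

section Gradient

variable {E : Type} [NormedAddCommGroup E] [NormedSpace ℂ E]

/-- `Q` is analytic on `U` with analytic gradient `G` with respect to the pairing `B`. -/
structure HasGradOn (B : E →L[ℂ] E →L[ℂ] ℂ) (Q : E → ℂ) (G : E → E) (U : Set E) : Prop where
  fn : ContDiffOn ℂ ω Q U
  grad : ContDiffOn ℂ ω G U
  deriv : ∀ w ∈ U, HasFDerivAt Q (B (G w)) w

variable {B : E →L[ℂ] E →L[ℂ] ℂ} {Q Q' : E → ℂ} {G G' : E → E} {U V : Set E}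

theorem HasGradOn.add (h : HasGradOn B Q G U) (h' : HasGradOn B Q' G' U) :
    HasGradOn B (fun w => Q w + Q' w) (fun w => G w + G' w) U :=
  ⟨h.fn.add h'.fn, h.grad.add h'.grad, fun w hw => by
    rw [map_add]; exact (h.deriv w hw).add (h'.deriv w hw)⟩

theorem HasGradOn.sub (h : HasGradOn B Q G U) (h' : HasGradOn B Q' G' U) :
    HasGradOn B (fun w => Q w - Q' w) (fun w => G w - G' w) U :=
  ⟨h.fn.sub h'.fn, h.grad.sub h'.grad, fun w hw => by
    rw [map_sub]; exact (h.deriv w hw).sub (h'.deriv w hw)⟩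

theorem HasGradOn.mono (h : HasGradOn B Q G U) (hV : V ⊆ U) : HasGradOn B Q G V :=
  ⟨h.fn.mono hV, h.grad.mono hV, fun w hw => h.deriv w (hV hw)⟩

/-- The chain rule for gradients: the derivative of the inner map has to have a transpose. -/
theorem HasGradOn.comp (h : HasGradOn B Q G V) {Θ : E → E} {Θt : E → E →L[ℂ] E}
    (hΘ : ContDiffOn ℂ ω Θ U) (hmaps : Set.MapsTo Θ U V) (ht : ContDiffOn ℂ ω Θt U)
    (hD : ∀ w ∈ U, ∃ D : E →L[ℂ] E, HasFDerivAt Θ D w ∧ ∀ u k, B u (D k) = B (Θt w u) k) :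
    HasGradOn B (fun w => Q (Θ w)) (fun w => Θt w (G (Θ w))) U := by
  refine ⟨h.fn.comp hΘ hmaps, ht.clm_apply (h.grad.comp hΘ hmaps), fun w hw => ?_⟩
  obtain ⟨D, hD1, hD2⟩ := hD w hw
  have e : B (Θt w (G (Θ w))) = (B (G (Θ w))).comp D :=
    ContinuousLinearMap.ext fun k => (hD2 (G (Θ w)) k).symm
  rw [e]
  exact (h.deriv _ (hmaps hw)).comp w hD1

/-- A function with a gradient that vanishes at the centre of a ball is bounded by the gradient. -/
theorem HasGradOn.norm_le {ε : ℝ} (h : HasGradOn B Q G (Metric.ball 0 ε)) (h0 : Q 0 = 0) {K : ℝ}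
    {n : ℕ} (hK : 0 ≤ K) (hG : ∀ w ∈ Metric.ball (0 : E) ε, ‖G w‖ ≤ K * ‖w‖ ^ n) {w : E}
    (hw : w ∈ Metric.ball (0 : E) ε) : ‖Q w‖ ≤ ‖B‖ * K * ‖w‖ ^ (n + 1) := by
  have hsub : Metric.closedBall (0 : E) ‖w‖ ⊆ Metric.ball 0 ε := fun x hx => by
    simp only [Metric.mem_closedBall, Metric.mem_ball, dist_zero_right] at *
    exact hx.trans_lt hw
  have := (convex_closedBall (0 : E) ‖w‖).norm_image_sub_le_of_norm_hasFDerivWithin_le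
    (f := Q) (f' := fun w => B (G w)) (C := ‖B‖ * (K * ‖w‖ ^ n)) (𝕜 := ℂ) (x := 0) (y := w)
    (fun x hx => (h.deriv x (hsub hx)).hasFDerivWithinAt)
    (fun x hx => ?_) (by simp) (by simp)
  · rw [h0, sub_zero, sub_zero] at this
    refine this.trans (le_of_eq (by ring))
  · refine (B.le_opNorm _).trans ?_
    refine mul_le_mul_of_nonneg_left ((hG x (hsub hx)).trans ?_) (norm_nonneg _)
    have hx' : ‖x‖ ≤ ‖w‖ := by simpa using hx
    gcongr

/-- The derivative of a gradient is symmetric. -/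
theorem HasGradOn.symm (h : HasGradOn B Q G U) (hU : IsOpen U) {w : E} (hw : w ∈ U) (k l : E) :
    B (fderiv ℂ G w k) l = B (fderiv ℂ G w l) k := by
  have hs := ((h.fn.contDiffAt (hU.mem_nhds hw)).of_le
    (show (minSmoothness ℂ 2) ≤ ω from le_top)).isSymmSndFDerivAt le_rfl
  have h1 : fderiv ℂ Q =ᶠ[𝓝 w] fun x => B (G x) := by
    filter_upwards [hU.mem_nhds hw] with x hx using (h.deriv x hx).fderiv
  have h2 : DifferentiableAt ℂ G w :=
    (h.grad.contDiffAt (hU.mem_nhds hw)).differentiableAt (by simp)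
  have h3 : fderiv ℂ (fderiv ℂ Q) w = B.comp (fderiv ℂ G w) := by
    rw [h1.fderiv_eq]; exact (B.hasFDerivAt.comp w h2.hasFDerivAt).fderiv
  have := hs.eq k l
  rw [h3] at this
  exact this

end Gradient

/-! ### The midpoint transformation of a cubic Hamiltonian vector field -/

section Midpoint

variable {E : Type} [NormedAddCommGroup E] [NormedSpace ℂ E]

theorem norm_trilinear_sub_le (T : E →L[ℂ] E →L[ℂ] E →L[ℂ] E) {r : ℝ} {x y : E} (hx : ‖x‖ ≤ r)
    (hy : ‖y‖ ≤ r) : ‖T x x x - T y y y‖ ≤ 3 * ‖T‖ * r ^ 2 * ‖x - y‖ := by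
  have hr := (norm_nonneg x).trans hx
  have e : T x x x - T y y y = T (x - y) x x + T y (x - y) x + T y y (x - y) := by
    simp only [map_sub, sub_apply]; abel
  have b : ∀ a b c : E, ‖T a b c‖ ≤ ‖T‖ * ‖a‖ * ‖b‖ * ‖c‖ := fun a b c =>
    ((T a).le_opNorm₂ b c).trans (by gcongr; exact T.le_opNorm a)
  rw [e]
  refine (norm_add₃_le).trans ?_
  have h1 : ‖T (x - y) x x‖ ≤ ‖T‖ * ‖x - y‖ * r * r := (b _ _ _).trans (by gcongr)
  have h2 : ‖T y (x - y) x‖ ≤ ‖T‖ * r * ‖x - y‖ * r := (b _ _ _).trans (by gcongr)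
  have h3 : ‖T y y (x - y)‖ ≤ ‖T‖ * r * r * ‖x - y‖ := (b _ _ _).trans (by gcongr)
  nlinarith

theorem norm_fderiv_trilinear_le (T : E →L[ℂ] E →L[ℂ] E →L[ℂ] E) (x : E) :
    ‖fderiv ℂ (fun w => T w w w) x‖ ≤ 3 * ‖T‖ * ‖x‖ ^ 2 := by
  obtain ⟨D, hD, hD'⟩ := hasFDerivAt_trilinear T x
  rw [hD.fderiv]
  refine D.opNorm_le_bound (by positivity) fun h => ?_
  have b : ∀ a b c : E, ‖T a b c‖ ≤ ‖T‖ * ‖a‖ * ‖b‖ * ‖c‖ := fun a b c =>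
    ((T a).le_opNorm₂ b c).trans (by gcongr; exact T.le_opNorm a)
  rw [hD']
  refine (norm_add₃_le).trans ?_
  have h1 := b h x x
  have h2 := b x h x
  have h3 := b x x h
  nlinarith

/-- The vector field `J ∇χ` of a quartic Hamiltonian with gradient `w ↦ T w w w`. -/
def field (J : E →L[ℂ] E) (T : E →L[ℂ] E →L[ℂ] E →L[ℂ] E) (x : E) : E := J (T x x x)

/-- The map `x ↦ x + c J ∇χ(x)`; the midpoint transformation takes `x - ½ J ∇χ(x)` to
`x + ½ J ∇χ(x)`. -/
def halfStep (J : E →L[ℂ] E) (T : E →L[ℂ] E →L[ℂ] E →L[ℂ] E) (c : ℂ) (x : E) : E :=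
  x + c • field J T x

/-- The derivative of the gradient of the quartic Hamiltonian. -/
def hessOp (T : E →L[ℂ] E →L[ℂ] E →L[ℂ] E) (x : E) : E →L[ℂ] E := fderiv ℂ (fun w => T w w w) x

/-- The transpose of the derivative of `halfStep`, for `J` skew and `hessOp` symmetric. -/
def halfStepT (J : E →L[ℂ] E) (T : E →L[ℂ] E →L[ℂ] E →L[ℂ] E) (c : ℂ) (x : E) : E →L[ℂ] E :=
  1 - c • (hessOp T x).comp J

variable (J : E →L[ℂ] E) (T : E →L[ℂ] E →L[ℂ] E →L[ℂ] E)

theorem contDiff_field : ContDiff ℂ ω (field J T) := J.contDiff.comp (contDiff_trilinear T)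

theorem contDiff_halfStep (c : ℂ) : ContDiff ℂ ω (halfStep J T c) :=
  contDiff_id.add ((contDiff_field J T).const_smul c)

theorem contDiff_hessOp : ContDiff ℂ ω (hessOp T) :=
  (contDiff_trilinear T (n := ω)).fderiv_right (by simp)

theorem contDiff_halfStepT (c : ℂ) : ContDiff ℂ ω (halfStepT J T c) :=
  contDiff_const.sub (((contDiff_hessOp T).clm_comp contDiff_const).const_smul c)

theorem hasFDerivAt_halfStep (c : ℂ) (x : E) :
    HasFDerivAt (halfStep J T c) (1 + c • J.comp (hessOp T x)) x := by
  obtain ⟨D, hD, -⟩ := hasFDerivAt_trilinear T x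
  have : hessOp T x = D := hD.fderiv
  rw [this]
  exact (hasFDerivAt_id x).add ((J.hasFDerivAt.comp x hD).const_smul c)

theorem field_sub_le {r : ℝ} {x y : E} (hx : ‖x‖ ≤ r) (hy : ‖y‖ ≤ r) :
    ‖field J T x - field J T y‖ ≤ 3 * (‖J‖ * ‖T‖) * r ^ 2 * ‖x - y‖ := by
  rw [field, field, ← map_sub]
  refine (J.le_opNorm _).trans ?_
  have := mul_le_mul_of_nonneg_left (norm_trilinear_sub_le T hx hy) (norm_nonneg J)
  linarith

theorem norm_field_le (x : E) : ‖field J T x‖ ≤ 3 * (‖J‖ * ‖T‖) * ‖x‖ ^ 3 := by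
  have := field_sub_le J T (le_refl ‖x‖) (show ‖(0 : E)‖ ≤ ‖x‖ by simp)
  have h0 : field J T 0 = 0 := by simp [field]
  rw [h0, sub_zero, sub_zero] at this
  linarith

theorem norm_hessOp_comp_le (x : E) : ‖(hessOp T x).comp J‖ ≤ 3 * (‖J‖ * ‖T‖) * ‖x‖ ^ 2 := by
  refine ((hessOp T x).opNorm_comp_le J).trans ?_
  have := mul_le_mul_of_nonneg_right (norm_fderiv_trilinear_le T x) (norm_nonneg J)
  rw [hessOp]; linarith

theorem norm_comp_hessOp_le (x : E) : ‖J.comp (hessOp T x)‖ ≤ 3 * (‖J‖ * ‖T‖) * ‖x‖ ^ 2 := by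
  refine (J.opNorm_comp_le (hessOp T x)).trans ?_
  have := mul_le_mul_of_nonneg_left (norm_fderiv_trilinear_le T x) (norm_nonneg J)
  rw [hessOp]; linarith

/-- The half steps are injective where the vector field is a contraction. -/
theorem halfStep_injOn {δ : ℝ} (hδ : 3 * (‖J‖ * ‖T‖) * δ ^ 2 ≤ 1) {c : ℂ}
    (hc : ‖c‖ = 1 / 2) : Set.InjOn (halfStep J T c) (Metric.ball 0 δ) := by
  intro x hx y hy h
  have hx' : ‖x‖ ≤ δ := by simpa using (Metric.mem_ball.1 hx).le
  have hy' : ‖y‖ ≤ δ := by simpa using (Metric.mem_ball.1 hy).le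
  have h1 := field_sub_le J T hx' hy'
  have h2 : x - y = c • (field J T y - field J T x) := by
    simp only [halfStep] at h
    rw [smul_sub, sub_eq_sub_iff_add_eq_add, h]; abel
  have h3 : ‖x - y‖ = 1 / 2 * ‖field J T x - field J T y‖ := by
    rw [h2, norm_smul, hc, norm_sub_rev]
  have h4 := mul_le_mul_of_nonneg_right hδ (norm_nonneg (x - y))
  have : ‖x - y‖ ≤ 0 := by nlinarith [norm_nonneg (x - y)]
  exact sub_eq_zero.1 (norm_le_zero_iff.1 this)

theorem isUnit_one_add_of_norm [CompleteSpace E] {A : E →L[ℂ] E} (hA : ‖A‖ < 1) : IsUnit (1 + A) := by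
  have := isUnit_one_sub_of_norm_lt_one (x := -A) (by rwa [norm_neg])
  rwa [sub_neg_eq_add] at this

/-- The inverse `m` of `x ↦ x - ½ J ∇χ(x)` near the origin. -/
theorem exists_midpoint [CompleteSpace E] : ∃ (δ ε : ℝ) (m : E → E), 0 < δ ∧ 0 < ε ∧ 4 * ε ≤ δ ∧
    3 * (‖J‖ * ‖T‖) * δ ^ 2 ≤ 1 ∧ ContDiffOn ℂ ω m (Metric.ball 0 ε) ∧
    ∀ w ∈ Metric.ball (0 : E) ε, ‖m w‖ ≤ 2 * ‖w‖ ∧ halfStep J T (-(1 / 2)) (m w) = w := by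
  obtain ⟨δ, hδ0, hδ⟩ : ∃ δ : ℝ, 0 < δ ∧ 3 * (‖J‖ * ‖T‖) * δ ^ 2 ≤ 1 := by
    have : Tendsto (fun δ : ℝ => 3 * (‖J‖ * ‖T‖) * δ ^ 2) (𝓝[>] 0) (𝓝 0) := by
      have : Continuous fun δ : ℝ => 3 * (‖J‖ * ‖T‖) * δ ^ 2 := by fun_prop
      have h := this.continuousWithinAt (s := Set.Ioi 0) (x := 0)
      rw [ContinuousWithinAt] at h
      simpa using h
    obtain ⟨δ, h1, h2⟩ := ((this.eventually (ge_mem_nhds one_pos)).and self_mem_nhdsWithin).exists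
    exact ⟨δ, h2, h1⟩
  set b := halfStep J T (-(1 / 2)) with hb
  have hb0 : b 0 = 0 := by simp [hb, halfStep, field]
  have hd : HasFDerivAt b ((ContinuousLinearEquiv.refl ℂ E : E ≃L[ℂ] E) : E →L[ℂ] E) 0 := by
    have := hasFDerivAt_halfStep J T (-(1 / 2)) 0
    have h0 : hessOp T (0 : E) = 0 := by
      rw [← norm_le_zero_iff]
      exact (norm_fderiv_trilinear_le T 0).trans (by simp)
    rw [h0] at this
    convert this using 1
    ext; simp
  have hc : ContDiffAt ℂ ω b 0 := (contDiff_halfStep J T _).contDiffAt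
  set e := hc.toOpenPartialHomeomorph b hd (by simp)
  set m : E → E := fun x => e.symm x
  have he : ∀ x, e x = b x := fun x => rfl
  have h0s : (0 : E) ∈ e.source := hc.mem_toOpenPartialHomeomorph_source hd (by simp)
  have h0t : (0 : E) ∈ e.target := by
    have := hc.image_mem_toOpenPartialHomeomorph_target hd (by simp); rwa [hb0] at this
  have hm0 : m 0 = 0 := by
    have := e.left_inv h0s
    rwa [he, hb0] at this
  have hmc : ContDiffAt ℂ ω m 0 := by
    have := hc.to_localInverse hd (by simp)
    rw [hb0] at this; exact this
  have hev : ∀ᶠ w in 𝓝 (0 : E), ContDiffAt ℂ ω m w := hmc.eventually (by simp)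
  have hev2 : ∀ᶠ w in 𝓝 (0 : E), b (m w) = w := by
    filter_upwards [e.open_target.mem_nhds h0t] with w hw
    rw [← he]; exact e.right_inv hw
  have hev3 : ∀ᶠ w in 𝓝 (0 : E), ‖m w‖ < δ := by
    have : ContinuousAt m 0 := hmc.continuousAt
    have := this.norm
    rw [ContinuousAt, hm0, norm_zero] at this
    exact this.eventually (gt_mem_nhds hδ0)
  obtain ⟨ε, hε0, hε⟩ := Metric.eventually_nhds_iff_ball.1 (hev.and (hev2.and hev3))
  refine ⟨δ, min ε (δ / 4), m, hδ0, by positivity, ?_, hδ, fun w hw => ?_, fun w hw => ?_⟩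
  · have := min_le_right ε (δ / 4); linarith
  · exact (hε w (Metric.ball_subset_ball (min_le_left _ _) hw)).1.contDiffWithinAt
  · obtain ⟨-, h2, h3⟩ := hε w (Metric.ball_subset_ball (min_le_left _ _) hw)
    refine ⟨?_, h2⟩
    have h4 : w = m w + (-(1 / 2) : ℂ) • field J T (m w) := h2.symm
    have h5 := norm_field_le J T (m w)
    have h6 : ‖m w‖ ≤ ‖w‖ + 1 / 2 * ‖field J T (m w)‖ := by
      have : m w = w + (1 / 2 : ℂ) • field J T (m w) := by
        calc m w = (m w + (-(1 / 2) : ℂ) • field J T (m w)) + (1 / 2 : ℂ) • field J T (m w) := by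
              rw [neg_smul]; abel
          _ = _ := by rw [← h4]
      calc ‖m w‖ = ‖w + (1 / 2 : ℂ) • field J T (m w)‖ := by rw [← this]
        _ ≤ _ := (norm_add_le _ _).trans (by rw [norm_smul]; norm_num)
    have h7 : 3 * (‖J‖ * ‖T‖) * ‖m w‖ ^ 2 ≤ 1 := by
      refine le_trans ?_ hδ
      gcongr
    have h8 := mul_le_mul_of_nonneg_right h7 (norm_nonneg (m w))
    nlinarith

variable {J T} {B : E →L[ℂ] E →L[ℂ] ℂ}

/-- `J` is a skew involution, and `T` the gradient of a quartic function. -/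
structure IsCayleyData (B : E →L[ℂ] E →L[ℂ] ℂ) (J : E →L[ℂ] E) (T : E →L[ℂ] E →L[ℂ] E →L[ℂ] E) :
    Prop where
  comm : ∀ u v, B u v = B v u
  skew : ∀ u v, B u (J v) = -B (J u) v
  invol : ∀ u, J (J u) = u
  symm : ∀ x u v, B (hessOp T x u) v = B (hessOp T x v) u

theorem halfStepT_spec (h : IsCayleyData B J T) (c : ℂ) (x u k : E) :
    B u ((1 + c • J.comp (hessOp T x)) k) = B (halfStepT J T c x u) k := by
  have e1 : (1 + c • J.comp (hessOp T x)) k = k + c • J (hessOp T x k) := rfl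
  have e2 : halfStepT J T c x u = u - c • hessOp T x (J u) := rfl
  rw [e1, e2, map_add, map_smul, map_sub, map_smul, sub_apply, smul_apply, h.skew,
    h.comm (J u), h.symm x (J u)]
  simp only [smul_eq_mul]; ring

/-- The two half steps pull back the symplectic form to the same form. -/
theorem halfStep_symplectic (h : IsCayleyData B J T) (c : ℂ) (x u v : E) :
    B ((1 + c • J.comp (hessOp T x)) u) (J ((1 + c • J.comp (hessOp T x)) v)) =
      B ((1 + (-c) • J.comp (hessOp T x)) u) (J ((1 + (-c) • J.comp (hessOp T x)) v)) := by
  have e1 : ∀ (c : ℂ) k, (1 + c • J.comp (hessOp T x)) k = k + c • J (hessOp T x k) := fun _ _ => rfl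
  simp only [e1, map_add, map_smul, add_apply, smul_apply, h.invol, smul_eq_mul]
  have h1 := h.skew (J (hessOp T x u)) v
  rw [h.invol] at h1
  have h2 := h.symm x u v
  have h3 := h.comm (hessOp T x v) u
  rw [h1, h2, h3]
  ring

end Midpoint

end

noncomputable section

open scoped ContDiff

section Midpoint

variable {E : Type} [NormedAddCommGroup E] [NormedSpace ℂ E] [CompleteSpace E]

/-- `m` is the inverse of `x ↦ x - ½ J ∇χ(x)` on the ball of radius `ε`, with values in a ball on
which the vector field is a contraction. -/
structure IsMidpoint (J : E →L[ℂ] E) (T : E →L[ℂ] E →L[ℂ] E →L[ℂ] E) (δ ε : ℝ) (m : E → E) :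
    Prop where
  four_le : 4 * ε ≤ δ
  small : 3 * (‖J‖ * ‖T‖) * δ ^ 2 ≤ 1
  smooth : ContDiffOn ℂ ω m (Metric.ball 0 ε)
  norm_le : ∀ w ∈ Metric.ball (0 : E) ε, ‖m w‖ ≤ 2 * ‖w‖
  eq : ∀ w ∈ Metric.ball (0 : E) ε, halfStep J T (-(1 / 2)) (m w) = w

variable {J : E →L[ℂ] E} {T : E →L[ℂ] E →L[ℂ] E →L[ℂ] E} {δ ε : ℝ} {m : E → E}

/-- The midpoint transformation. -/
def midStep (J : E →L[ℂ] E) (T : E →L[ℂ] E →L[ℂ] E →L[ℂ] E) (m : E → E) (w : E) : E :=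
  halfStep J T (1 / 2) (m w)

/-- The transpose of the derivative of the inverse half step. -/
def midT (J : E →L[ℂ] E) (T : E →L[ℂ] E →L[ℂ] E →L[ℂ] E) (m : E → E) (w : E) : E →L[ℂ] E :=
  Ring.inverse (halfStepT J T (-(1 / 2)) (m w))

namespace IsMidpoint

theorem mono (h : IsMidpoint J T δ ε m) {ε' : ℝ} (hε : ε' ≤ ε) : IsMidpoint J T δ ε' m :=
  have hs := Metric.ball_subset_ball (x := (0 : E)) hε
  ⟨by linarith [h.four_le], h.small, h.smooth.mono hs, fun w hw => h.norm_le w (hs hw),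
    fun w hw => h.eq w (hs hw)⟩

theorem norm_lt (h : IsMidpoint J T δ ε m) {w : E} (hw : w ∈ Metric.ball (0 : E) ε) :
    ‖m w‖ < δ := by
  have h1 := h.norm_le w hw
  have h2 : ‖w‖ < ε := by simpa using hw
  linarith [h.four_le, norm_nonneg w]

theorem half_small (h : IsMidpoint J T δ ε m) {w : E} (hw : w ∈ Metric.ball (0 : E) ε) :
    3 * (‖J‖ * ‖T‖) * ‖m w‖ ^ 2 ≤ 1 := by
  refine le_trans ?_ h.small
  have := (h.norm_lt hw).le
  gcongr

theorem isUnit_deriv (h : IsMidpoint J T δ ε m) {w : E} (hw : w ∈ Metric.ball (0 : E) ε) {c : ℂ}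
    (hc : ‖c‖ = 1 / 2) : IsUnit (1 + c • J.comp (hessOp T (m w))) := by
  apply isUnit_one_add_of_norm
  rw [norm_smul, hc]
  linarith [norm_comp_hessOp_le J T (m w), h.half_small hw]

theorem isUnit_halfStepT (h : IsMidpoint J T δ ε m) {w : E} (hw : w ∈ Metric.ball (0 : E) ε) {c : ℂ}
    (hc : ‖c‖ = 1 / 2) : IsUnit (halfStepT J T c (m w)) := by
  rw [halfStepT, sub_eq_add_neg]
  apply isUnit_one_add_of_norm
  rw [norm_neg, norm_smul, hc]
  linarith [norm_hessOp_comp_le J T (m w), h.half_small hw]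

theorem norm_neg_half : ‖(-(1 / 2) : ℂ)‖ = 1 / 2 := by norm_num

theorem differentiableAt (h : IsMidpoint J T δ ε m) {w : E} (hw : w ∈ Metric.ball (0 : E) ε) :
    DifferentiableAt ℂ m w :=
  (h.smooth.contDiffAt (Metric.isOpen_ball.mem_nhds hw)).differentiableAt (by simp)

theorem deriv_comp (h : IsMidpoint J T δ ε m) {w : E} (hw : w ∈ Metric.ball (0 : E) ε) :
    (1 + (-(1 / 2) : ℂ) • J.comp (hessOp T (m w))).comp (fderiv ℂ m w) = 1 := by
  have h1 := (hasFDerivAt_halfStep J T (-(1 / 2)) (m w)).comp w (h.differentiableAt hw).hasFDerivAt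
  have h2 : (halfStep J T (-(1 / 2)) ∘ m) =ᶠ[𝓝 w] id := by
    filter_upwards [Metric.isOpen_ball.mem_nhds hw] with x hx using h.eq x hx
  rw [← h1.fderiv, h2.fderiv_eq, fderiv_id]; rfl

theorem isUnit_fderiv (h : IsMidpoint J T δ ε m) {w : E} (hw : w ∈ Metric.ball (0 : E) ε) :
    IsUnit (fderiv ℂ m w) := by
  obtain ⟨u, hu⟩ := h.isUnit_deriv hw norm_neg_half
  have := h.deriv_comp hw
  rw [← hu] at this
  have h2 : fderiv ℂ m w = (u⁻¹ : (E →L[ℂ] E)ˣ) := (Units.inv_eq_of_mul_eq_one_right this).symm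
  rw [h2]; exact Units.isUnit _

theorem injOn (h : IsMidpoint J T δ ε m) : Set.InjOn m (Metric.ball 0 ε) := fun x hx y hy hxy => by
  rw [← h.eq x hx, ← h.eq y hy, hxy]

theorem midStep_injOn (h : IsMidpoint J T δ ε m) : Set.InjOn (midStep J T m) (Metric.ball 0 ε) :=
  fun x hx y hy hxy => h.injOn hx hy (halfStep_injOn J T h.small (by norm_num)
    (by simpa using h.norm_lt hx) (by simpa using h.norm_lt hy) hxy)

theorem hasFDerivAt_midStep (h : IsMidpoint J T δ ε m) {w : E} (hw : w ∈ Metric.ball (0 : E) ε) :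
    HasFDerivAt (midStep J T m)
      ((1 + (1 / 2 : ℂ) • J.comp (hessOp T (m w))).comp (fderiv ℂ m w)) w :=
  (hasFDerivAt_halfStep J T (1 / 2) (m w)).comp w (h.differentiableAt hw).hasFDerivAt

theorem isUnit_fderiv_midStep (h : IsMidpoint J T δ ε m) {w : E}
    (hw : w ∈ Metric.ball (0 : E) ε) : IsUnit (fderiv ℂ (midStep J T m) w) := by
  rw [(h.hasFDerivAt_midStep hw).fderiv]
  exact (h.isUnit_deriv hw (by norm_num)).mul (h.isUnit_fderiv hw)

theorem isInvertible_of_isUnit {A : E →L[ℂ] E} (hA : IsUnit A) : A.IsInvertible := by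
  obtain ⟨u, rfl⟩ := hA
  exact ⟨ContinuousLinearEquiv.unitsEquiv ℂ E u, rfl⟩

theorem contDiffOn_midStep (h : IsMidpoint J T δ ε m) :
    ContDiffOn ℂ ω (midStep J T m) (Metric.ball 0 ε) :=
  (contDiff_halfStep J T (1 / 2)).comp_contDiffOn h.smooth

/-- The midpoint transformation is symplectic. -/
theorem symplectic (h : IsMidpoint J T δ ε m) {B : E →L[ℂ] E →L[ℂ] ℂ} (hB : IsCayleyData B J T)
    {w : E} (hw : w ∈ Metric.ball (0 : E) ε) (k l : E) :
    B (fderiv ℂ (midStep J T m) w k) (J (fderiv ℂ (midStep J T m) w l)) = B k (J l) := by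
  rw [(h.hasFDerivAt_midStep hw).fderiv, ContinuousLinearMap.comp_apply,
    ContinuousLinearMap.comp_apply, halfStep_symplectic hB]
  have := fun k => congrArg (fun A : E →L[ℂ] E => A k) (h.deriv_comp hw)
  simp only [ContinuousLinearMap.comp_apply, one_apply_eq_self] at this
  rw [this, this]

theorem midT_spec (h : IsMidpoint J T δ ε m) {B : E →L[ℂ] E →L[ℂ] ℂ} (hB : IsCayleyData B J T)
    {w : E} (hw : w ∈ Metric.ball (0 : E) ε) (u k : E) :
    B u (fderiv ℂ m w k) = B (midT J T m w u) k := by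
  set A := halfStepT J T (-(1 / 2)) (m w) with hA
  have h1 : A (Ring.inverse A u) = u := by
    have := Ring.mul_inverse_cancel A (h.isUnit_halfStepT hw norm_neg_half)
    exact congrArg (fun A : E →L[ℂ] E => A u) this
  have h2 : (1 + (-(1 / 2) : ℂ) • J.comp (hessOp T (m w))) (fderiv ℂ m w k) = k :=
    congrArg (fun A : E →L[ℂ] E => A k) (h.deriv_comp hw)
  have h3 := halfStepT_spec hB (-(1 / 2)) (m w) (Ring.inverse A u) (fderiv ℂ m w k)
  rw [h2, ← hA, h1] at h3
  exact h3.symm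

theorem contDiffOn_midT (h : IsMidpoint J T δ ε m) :
    ContDiffOn ℂ ω (midT J T m) (Metric.ball 0 ε) := by
  intro w hw
  have h1 : ContDiffAt ℂ ω (fun w => halfStepT J T (-(1 / 2)) (m w)) w :=
    (contDiff_halfStepT J T _).contDiffAt.comp w
      (h.smooth.contDiffAt (Metric.isOpen_ball.mem_nhds hw))
  obtain ⟨u, hu⟩ := h.isUnit_halfStepT hw norm_neg_half
  have h2 := contDiffAt_ringInverse ℂ (n := ω) u
  rw [hu] at h2
  exact (h2.comp w h1).contDiffWithinAt

theorem norm_midT_le (h : IsMidpoint J T δ ε m) {w : E} (hw : w ∈ Metric.ball (0 : E) ε) (u : E) :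
    ‖midT J T m w u‖ ≤ 2 * ‖u‖ := by
  set A := halfStepT J T (-(1 / 2)) (m w) with hA
  have h1 : A (Ring.inverse A u) = u := by
    have := Ring.mul_inverse_cancel A (h.isUnit_halfStepT hw norm_neg_half)
    exact congrArg (fun A : E →L[ℂ] E => A u) this
  set v := Ring.inverse A u with hv
  have h2 : A v = v + (1 / 2 : ℂ) • (hessOp T (m w)).comp J v := by
    rw [hA, halfStepT, neg_smul, sub_neg_eq_add]; rfl
  have h3 : v = u - (1 / 2 : ℂ) • (hessOp T (m w)).comp J v := by rw [← h1, h2]; abel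
  have h4 : ‖(hessOp T (m w)).comp J v‖ ≤ 1 * ‖v‖ :=
    (ContinuousLinearMap.le_opNorm _ v).trans (by
      gcongr; exact (norm_hessOp_comp_le J T (m w)).trans (h.half_small hw))
  have h5 : ‖v‖ ≤ ‖u‖ + 1 / 2 * ‖(hessOp T (m w)).comp J v‖ := by
    have : ‖v‖ = ‖u - (1 / 2 : ℂ) • (hessOp T (m w)).comp J v‖ := by rw [← h3]
    rw [this]
    exact (norm_sub_le _ _).trans (by rw [norm_smul]; norm_num)
  have : midT J T m w u = v := rfl
  rw [this]
  linarith

theorem midStep_sub (h : IsMidpoint J T δ ε m) {w : E} (hw : w ∈ Metric.ball (0 : E) ε) :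
    midStep J T m w - w = field J T (m w) := by
  have e : midStep J T m w - w = midStep J T m w - halfStep J T (-(1 / 2)) (m w) := by
    rw [h.eq w hw]
  rw [e, midStep, halfStep, halfStep, neg_smul]
  have : field J T (m w) = (1 / 2 : ℂ) • field J T (m w) + (1 / 2 : ℂ) • field J T (m w) := by
    rw [← add_smul]; norm_num
  conv_rhs => rw [this]
  abel

theorem norm_midStep_sub_le (h : IsMidpoint J T δ ε m) {w : E} (hw : w ∈ Metric.ball (0 : E) ε) :
    ‖midStep J T m w - w‖ ≤ 24 * (‖J‖ * ‖T‖) * ‖w‖ ^ 3 := by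
  rw [h.midStep_sub hw]
  refine (norm_field_le J T _).trans ?_
  have : ‖m w‖ ^ 3 ≤ (2 * ‖w‖) ^ 3 := pow_le_pow_left₀ (norm_nonneg _) (h.norm_le w hw) 3
  have h2 := mul_le_mul_of_nonneg_left this (show 0 ≤ 3 * (‖J‖ * ‖T‖) by positivity)
  linarith

/-- Equivariance of the inverse half step under a transformation that commutes with the vector
field. -/
theorem equivariant (h : IsMidpoint J T δ ε m) {g : E → E} (hg : ∀ x, ‖g x‖ ≤ 2 * ‖x‖)
    (hcomm : ∀ x, halfStep J T (-(1 / 2)) (g x) = g (halfStep J T (-(1 / 2)) x)) {w : E}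
    (hw : w ∈ Metric.ball (0 : E) ε) (hgw : g w ∈ Metric.ball (0 : E) ε) : m (g w) = g (m w) := by
  apply halfStep_injOn J T h.small norm_neg_half
  · simpa using h.norm_lt hgw
  · have h1 := hg (m w)
    have h2 := h.norm_le w hw
    have h3 : ‖w‖ < ε := by simpa using hw
    have := h.four_le
    simp only [Metric.mem_ball, dist_zero_right]
    linarith
  · rw [h.eq _ hgw, hcomm, h.eq w hw]

end IsMidpoint

/-- If the difference of the quadratic parts is compensated by `Z - P`, the midpoint transformation
leaves the remainder `(Z - P)(m) + P(m + ½ X) - Z(m - ½ X)`, which has a gradient of order five. -/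
theorem IsMidpoint.exists_remainder (h : IsMidpoint J T δ ε m) {B : E →L[ℂ] E →L[ℂ] ℂ}
    (hB : IsCayleyData B J T) {P Z : E → ℂ} {TP TZ : E →L[ℂ] E →L[ℂ] E →L[ℂ] E}
    (hP : HasGradOn B P (fun w => TP w w w) Set.univ)
    (hZ : HasGradOn B Z (fun w => TZ w w w) Set.univ) :
    ∃ (G : E → E) (K : ℝ), 0 ≤ K ∧ HasGradOn B
      (fun w => Z (m w) - P (m w) + P (midStep J T m w) - Z w) G (Metric.ball 0 ε) ∧
      ∀ w ∈ Metric.ball (0 : E) ε, ‖G w‖ ≤ K * ‖w‖ ^ 5 := by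
  have comp : ∀ {Q : E → ℂ} {TQ : E →L[ℂ] E →L[ℂ] E →L[ℂ] E} (c : ℂ),
      HasGradOn B Q (fun w => TQ w w w) Set.univ →
      HasGradOn B (fun x => Q (halfStep J T c x)) (fun x => halfStepT J T c x
        (TQ (halfStep J T c x) (halfStep J T c x) (halfStep J T c x))) Set.univ := fun c hQ =>
    hQ.comp (contDiff_halfStep J T c).contDiffOn (Set.mapsTo_univ _ _)
      (contDiff_halfStepT J T c).contDiffOn
      fun x _ => ⟨_, hasFDerivAt_halfStep J T c x, halfStepT_spec hB c x⟩
  set S : E → ℂ := fun x => Z x - P x + P (halfStep J T (1 / 2) x) - Z (halfStep J T (-(1 / 2)) x)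
  set GS : E → E := fun x => TZ x x x - TP x x x + halfStepT J T (1 / 2) x
      (TP (halfStep J T (1 / 2) x) (halfStep J T (1 / 2) x) (halfStep J T (1 / 2) x)) -
    halfStepT J T (-(1 / 2)) x (TZ (halfStep J T (-(1 / 2)) x) (halfStep J T (-(1 / 2)) x)
      (halfStep J T (-(1 / 2)) x)) with hGS
  have hS : HasGradOn B S GS Set.univ := ((hZ.sub hP).add (comp _ hP)).sub (comp _ hZ)
  have hR := hS.comp h.smooth (Set.mapsTo_univ _ _) h.contDiffOn_midT
    fun w hw => ⟨_, (h.differentiableAt hw).hasFDerivAt, h.midT_spec hB hw⟩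
  have hfun : ∀ w ∈ Metric.ball (0 : E) ε,
      Z (m w) - P (m w) + P (midStep J T m w) - Z w = S (m w) := fun w hw => by
    simp only [S, midStep]; rw [h.eq w hw]
  set C := ‖J‖ * ‖T‖ with hC
  have hC0 : 0 ≤ C := by positivity
  -- comparison of the pulled back gradient of a quartic with the gradient itself
  have bound : ∀ (TQ : E →L[ℂ] E →L[ℂ] E →L[ℂ] E) (c : ℂ) (x : E), ‖c‖ = 1 / 2 →
      3 * C * ‖x‖ ^ 2 ≤ 1 → ‖halfStepT J T c x (TQ (halfStep J T c x) (halfStep J T c x)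
        (halfStep J T c x)) - TQ x x x‖ ≤ 63 * C * ‖TQ‖ * ‖x‖ ^ 5 := by
    intro TQ c x hc hx
    set y := halfStep J T c x with hy
    have e1 : y - x = c • field J T x := by simp [hy, halfStep]
    have n1 : ‖y - x‖ ≤ 3 / 2 * C * ‖x‖ ^ 3 := by
      rw [e1, norm_smul, hc]; linarith [norm_field_le J T x]
    have n2 : ‖y‖ ≤ 2 * ‖x‖ := by
      have : ‖y‖ ≤ ‖x‖ + ‖y - x‖ := by simpa using norm_add_le x (y - x)
      have h6 := mul_le_mul_of_nonneg_right hx (norm_nonneg x)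
      nlinarith [norm_nonneg x]
    have n3 := norm_trilinear_sub_le TQ n2 (show ‖x‖ ≤ 2 * ‖x‖ by linarith [norm_nonneg x])
    have e2 : halfStepT J T c x (TQ y y y) - TQ x x x =
        (TQ y y y - TQ x x x) - c • ((hessOp T x).comp J) (TQ y y y) := by
      have : halfStepT J T c x (TQ y y y) =
        TQ y y y - c • ((hessOp T x).comp J) (TQ y y y) := rfl
      rw [this]; abel
    have n4 : ‖TQ y y y‖ ≤ 3 * ‖TQ‖ * (2 * ‖x‖) ^ 2 * (2 * ‖x‖) := by
      have := norm_trilinear_sub_le TQ n2 (show ‖(0 : E)‖ ≤ 2 * ‖x‖ by simp)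
      simp only [map_zero, sub_zero] at this
      exact this.trans (by gcongr)
    have n5 : ‖((hessOp T x).comp J) (TQ y y y)‖ ≤
        3 * C * ‖x‖ ^ 2 * (3 * ‖TQ‖ * (2 * ‖x‖) ^ 2 * (2 * ‖x‖)) :=
      (ContinuousLinearMap.le_opNorm _ _).trans (by
        gcongr; exact norm_hessOp_comp_le J T x)
    have n6 : 3 * ‖TQ‖ * (2 * ‖x‖) ^ 2 * ‖y - x‖ ≤
        3 * ‖TQ‖ * (2 * ‖x‖) ^ 2 * (3 / 2 * C * ‖x‖ ^ 3) := by gcongr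
    rw [e2]
    refine (norm_sub_le _ _).trans ?_
    rw [norm_smul, hc]
    have hp : 0 ≤ C * ‖TQ‖ * ‖x‖ ^ 5 := by positivity
    have q1 := n3.trans n6
    ring_nf at q1 n5 hp ⊢
    linarith
  refine ⟨_, 4032 * C * (‖TP‖ + ‖TZ‖), by positivity,
    ⟨hR.fn.congr hfun, hR.grad, fun w hw => (hR.deriv w hw).congr_of_eventuallyEq ?_⟩,
    fun w hw => ?_⟩
  · filter_upwards [Metric.isOpen_ball.mem_nhds hw] with x hx using hfun x hx
  · refine (h.norm_midT_le hw _).trans ?_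
    have hx := h.half_small hw
    have hm := h.norm_le w hw
    have b1 := bound TP (1 / 2) (m w) (by norm_num) hx
    have b2 := bound TZ (-(1 / 2)) (m w) IsMidpoint.norm_neg_half hx
    have e : GS (m w) = (halfStepT J T (1 / 2) (m w) (TP (halfStep J T (1 / 2) (m w))
        (halfStep J T (1 / 2) (m w)) (halfStep J T (1 / 2) (m w))) - TP (m w) (m w) (m w)) -
      (halfStepT J T (-(1 / 2)) (m w) (TZ (halfStep J T (-(1 / 2)) (m w))
        (halfStep J T (-(1 / 2)) (m w)) (halfStep J T (-(1 / 2)) (m w))) -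
          TZ (m w) (m w) (m w)) := by
      simp only [hGS]; abel
    have h1 : ‖GS (m w)‖ ≤ 63 * C * (‖TP‖ + ‖TZ‖) * ‖m w‖ ^ 5 := by
      rw [e]
      refine (norm_sub_le _ _).trans ((add_le_add b1 b2).trans (le_of_eq (by ring)))
    have h2 : ‖m w‖ ^ 5 ≤ (2 * ‖w‖) ^ 5 := pow_le_pow_left₀ (norm_nonneg _) hm 5
    have h3 := mul_le_mul_of_nonneg_left h2 (show 0 ≤ 63 * C * (‖TP‖ + ‖TZ‖) by positivity)
    calc 2 * ‖GS (m w)‖ ≤ 2 * (63 * C * (‖TP‖ + ‖TZ‖) * (2 * ‖w‖) ^ 5) := by linarith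
      _ = _ := by ring

end Midpoint

end

noncomputable section

open scoped ContDiff

/-! ### The kernels and the symplectic operator -/

/-- The difference `k² + l² - i² - j²` of a monomial. -/
def divisor (q : ℤ × ℤ × ℤ) : ℤ := q.2.2 ^ 2 + (q.1 + q.2.1 - q.2.2) ^ 2 - q.1 ^ 2 - q.2.1 ^ 2

/-- The resonance relation. -/
def Resonant (q : ℤ × ℤ × ℤ) : Prop :=
  q.1 ^ 2 + q.2.1 ^ 2 = q.2.2 ^ 2 + (q.1 + q.2.1 - q.2.2) ^ 2

instance : DecidablePred Resonant := fun _ => inferInstanceAs (Decidable (_ = _))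

theorem divisor_eq_zero_iff (q : ℤ × ℤ × ℤ) : divisor q = 0 ↔ Resonant q := by
  unfold divisor Resonant; constructor <;> intro h <;> linarith

/-- The kernel of `P₄`. -/
def kerOne : Kernel := ⟨fun _ => 1, fun _ => by simp⟩

/-- The kernel of `Z₄`. -/
def kerRes : Kernel := ⟨fun q => if Resonant q then 1 else 0, fun q => by split_ifs <;> simp⟩

/-- The kernel of the generator of the Birkhoff transformation, which solves the homological
equation: the divisors are nonzero integers. -/
def kerChi : Kernel := ⟨fun q => if Resonant q then 0 else Complex.I / (divisor q : ℂ), fun q => by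
  split_ifs with h
  · simp
  · rw [norm_div, Complex.norm_I, Complex.norm_intCast]
    have h0 : divisor q ≠ 0 := fun h' => h ((divisor_eq_zero_iff q).1 h')
    have : (1 : ℝ) ≤ |(divisor q : ℝ)| := by exact_mod_cast Int.one_le_abs h0
    exact div_le_one_of_le₀ this (by positivity)⟩

theorem P4_eq (u : FourierPt) : P4 u = quartic kerOne u := by
  simp only [P4, quartic, kerOne, legA, legB, legA', legB']
  congr 1; ext q; ring

theorem Z4_eq (u : FourierPt) : Z4 u = quartic kerRes u := by
  refine tsum_congr fun q => ?_
  by_cases hR : Resonant q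
  · have hR' := hR
    unfold Resonant at hR'
    simp only [kerRes, if_pos hR, if_pos hR', legA, legB, legA', legB']; ring
  · have hR' := hR
    unfold Resonant at hR'
    simp only [kerRes, if_neg hR, if_neg hR', zero_mul]

variable {s : ℝ} [Fact (1 / 2 < s)]

/-- The operator `(ψ, ψ̄) ↦ (-i ψ̄, i ψ)`: the form is `ω(u, v) = ⟨u, J v⟩`, and `J ∇χ` is the
Hamiltonian vector field of `χ`. -/
def symJ : Ps s →L[ℂ] Ps s :=
  ((-Complex.I) • ContinuousLinearMap.snd ℂ (Hs s) (Hs s)).prod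
    (Complex.I • ContinuousLinearMap.fst ℂ (Hs s) (Hs s))

theorem symJ_apply (u : Ps s) : symJ u = ((-Complex.I) • u.2, Complex.I • u.1) := rfl

theorem pair_smul_right {ι : Type} {w : ι → ℝ} (c : ℂ) (u v : Wl2 ι w s) :
    u.pair (c • v) = c * u.pair v := by
  simp only [Wl2.pair, Wl2.coeff_smul, mul_left_comm _ c, tsum_mul_left]

theorem pair_smul_left {ι : Type} {w : ι → ℝ} (c : ℂ) (u v : Wl2 ι w s) :
    (c • u).pair v = c * u.pair v := by
  rw [Wl2.pair_comm, pair_smul_right, Wl2.pair_comm]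

theorem omegaPs_eq (u v : Ps s) : omegaPs u v = bil u (symJ v) := by
  rw [omegaPs, bil_apply, symJ_apply, pair_smul_right, pair_smul_right, Wl2.pair_comm v.1]
  ring

theorem hasGradOn_quartic (κ : Kernel) : HasGradOn bil
    (fun w : Ps s => quartic κ (fourierCoords w)) (fun w => gradOp κ w w w) Set.univ :=
  ⟨(contDiff_quartic κ).contDiffOn, (contDiff_trilinear _).contDiffOn,
    fun w _ => hasFDerivAt_quartic κ w⟩

theorem isCayleyData (κ : Kernel) : IsCayleyData (bil (s := s)) symJ (gradOp κ) where
  comm := bil_comm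
  skew u v := by
    rw [bil_apply, bil_apply, symJ_apply, symJ_apply, pair_smul_right, pair_smul_right,
      pair_smul_left, pair_smul_left]
    ring
  invol u := by
    rw [symJ_apply, symJ_apply, smul_smul, smul_smul]
    simp
  symm x u v := (hasGradOn_quartic κ).symm isOpen_univ (Set.mem_univ x) u v

/-! ### Gauge transformations -/

section Phase

variable {ι : Type} {w : ι × Fin 2 → ℝ}

theorem exists_species (hw : ∀ α, 0 < w α) (i : Fin 2) :
    ∃ L : Wl2 (ι × Fin 2) w s →L[ℂ] Wl2 (ι × Fin 2) w s,
      ∀ u α, (L u).coeff α = if α.2 = i then u.coeff α else 0 := by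
  obtain ⟨L, hL, -⟩ := Wl2.exists_clm (s := s) (t := s) hw hw
    (LinearMap.pi fun α : ι × Fin 2 => if α.2 = i then LinearMap.proj α else 0) (C := 1)
    zero_le_one fun c => by
      rw [ENNReal.ofReal_one, one_pow, one_mul]
      refine ENNReal.tsum_le_tsum fun α => ?_
      gcongr
      simp only [LinearMap.pi_apply]
      split_ifs <;> simp
  refine ⟨L, fun u α => ?_⟩
  rw [hL]
  simp only [LinearMap.pi_apply]
  split_ifs <;> simp

/-- The projection to one species. -/
def species (hw : ∀ α, 0 < w α) (i : Fin 2) : Wl2 (ι × Fin 2) w s →L[ℂ] Wl2 (ι × Fin 2) w s :=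
  (exists_species hw i).choose

theorem coeff_species (hw : ∀ α, 0 < w α) (i : Fin 2) (u : Wl2 (ι × Fin 2) w s) (α : ι × Fin 2) :
    (species hw i u).coeff α = if α.2 = i then u.coeff α else 0 :=
  (exists_species hw i).choose_spec u α

/-- Multiplication of the two species by two complex numbers. -/
def phase (hw : ∀ α, 0 < w α) (c : Fin 2 → ℂ) : Wl2 (ι × Fin 2) w s →L[ℂ] Wl2 (ι × Fin 2) w s :=
  ∑ i, c i • species hw i

theorem phase_apply (hw : ∀ α, 0 < w α) (c : Fin 2 → ℂ) (u : Wl2 (ι × Fin 2) w s) :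
    phase hw c u = c 0 • species hw 0 u + c 1 • species hw 1 u := by
  simp [phase, Fin.sum_univ_two]

@[simp] theorem coeff_phase (hw : ∀ α, 0 < w α) (c : Fin 2 → ℂ) (u : Wl2 (ι × Fin 2) w s)
    (α : ι × Fin 2) : (phase hw c u).coeff α = c α.2 * u.coeff α := by
  rw [phase_apply, Wl2.coeff_add, Wl2.coeff_smul, Wl2.coeff_smul, coeff_species, coeff_species]
  obtain ⟨a, i⟩ := α
  fin_cases i <;> simp

theorem norm_phase_le (hw : ∀ α, 0 < w α) {c : Fin 2 → ℂ} {C : ℝ} (hc : ∀ i, ‖c i‖ ≤ C)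
    (u : Wl2 (ι × Fin 2) w s) : ‖phase hw c u‖ ≤ C * ‖u‖ := by
  have hC : 0 ≤ C := (norm_nonneg _).trans (hc 0)
  refine Wl2.norm_le_of_sqNorm_le' hw hw _ _ hC ?_
  rw [sqNorm, sqNorm, ← ENNReal.tsum_mul_left]
  refine ENNReal.tsum_le_tsum fun α => ?_
  rw [coeff_phase, enorm_mul, ← mul_pow]
  have : ‖c α.2‖ₑ ≤ ENNReal.ofReal C := by
    rw [← ofReal_norm]; exact ENNReal.ofReal_le_ofReal (hc _)
  calc _ ≤ (wt w s α * (ENNReal.ofReal C * ‖u.coeff α‖ₑ)) ^ 2 := by gcongr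
    _ = _ := by ring

theorem contDiff_phase (hw : ∀ α, 0 < w α) {n : WithTop ℕ∞} :
    ContDiff ℂ n (phase (s := s) hw) := by
  unfold phase
  exact ContDiff.sum fun i _ => (contDiff_apply ℂ ℂ i).smul contDiff_const

theorem phase_phase (hw : ∀ α, 0 < w α) (c d : Fin 2 → ℂ) (u : Wl2 (ι × Fin 2) w s) :
    phase hw c (phase hw d u) = phase hw (c * d) u :=
  Wl2.ext_coeff hw fun α => by simp [mul_assoc]

theorem phase_one (hw : ∀ α, 0 < w α) (u : Wl2 (ι × Fin 2) w s) : phase hw 1 u = u :=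
  Wl2.ext_coeff hw fun α => by simp

theorem pair_phase (hw : ∀ α, 0 < w α) (c : Fin 2 → ℂ) (u v : Wl2 (ι × Fin 2) w s) :
    (phase hw c u).pair v = u.pair (phase hw c v) := by
  simp only [Wl2.pair, coeff_phase]; congr 1; ext; ring

/-- The phases `e^{iθ}`. -/
def cis (θ : Fin 2 → ℂ) (i : Fin 2) : ℂ := Complex.exp (Complex.I * θ i)

theorem cis_mul_neg (θ : Fin 2 → ℂ) (i : Fin 2) : cis θ i * cis (-θ) i = 1 := by
  rw [cis, cis, ← Complex.exp_add]; simp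

theorem cis_neg (θ : Fin 2 → ℂ) (i : Fin 2) : cis (-θ) i = Complex.exp (-(Complex.I * θ i)) := by
  simp [cis]

theorem norm_cis_le {θ : Fin 2 → ℂ} {σ : ℝ} (h : ∀ i, |(θ i).im| ≤ σ) (i : Fin 2) :
    ‖cis θ i‖ ≤ Real.exp σ := by
  rw [cis, Complex.norm_exp]
  apply Real.exp_le_exp.2
  have := (abs_le.1 (h i)).1
  simp; linarith

theorem contDiff_cis {n : WithTop ℕ∞} : ContDiff ℂ n cis := by
  unfold cis
  fun_prop

end Phase

/-- The gauge transformation `ψ ↦ e^{iθ} ψ`, `ψ̄ ↦ e^{-iθ} ψ̄`. -/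
def gauge (θ : Fin 2 → ℂ) (w : Ps s) : Ps s :=
  (phase fourierWeight_pos (cis θ) w.1, phase fourierWeight_pos (cis (-θ)) w.2)

theorem norm_gauge_le {θ : Fin 2 → ℂ} (hθ : ∀ i, |(θ i).im| ≤ 1 / 2) (w : Ps s) :
    ‖gauge θ w‖ ≤ 2 * ‖w‖ := by
  have he : Real.exp (1 / 2) ≤ 2 := by
    have h := Real.exp_one_lt_d9
    have h1 : Real.exp (1 / 2) ^ 2 = Real.exp 1 := by rw [← Real.exp_nat_mul]; norm_num
    nlinarith [Real.exp_pos (1 / 2)]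
  have h1 := norm_phase_le (s := s) fourierWeight_pos (c := cis θ)
    (fun i => (norm_cis_le hθ i).trans he) w.1
  have h2 := norm_phase_le (s := s) fourierWeight_pos (c := cis (-θ))
    (fun i => (norm_cis_le (θ := -θ) (by simpa using hθ) i).trans he) w.2
  refine max_le (h1.trans ?_) (h2.trans ?_)
  · gcongr; exact norm_fst_le w
  · gcongr; exact norm_snd_le w

variable {e f g h e' f' g' h' : ℤ × ℤ × ℤ → Mode}

theorem triOp_phase (H : IsQuarticLegs e f g h) (κ : Kernel) {a b c d : Fin 2 → ℂ}
    (hd : ∀ q, a (f q).2 * b (g q).2 * c (h q).2 = d (e q).2) (x y z : Hs s) :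
    triOp H κ (phase fourierWeight_pos a x) (phase fourierWeight_pos b y)
      (phase fourierWeight_pos c z) = phase fourierWeight_pos d (triOp H κ x y z) := by
  refine Wl2.ext_coeff fourierWeight_pos fun n => ?_
  rw [coeff_phase, coeff_triOp, coeff_triOp, ← tsum_mul_left]
  congr 1; ext q
  have := hd q
  rw [q.2] at this
  simp only [coeff_phase]
  linear_combination (κ.toFun q * x.coeff (f q) * y.coeff (g q) * z.coeff (h q)) * this

theorem field_gauge (κ : Kernel) (θ : Fin 2 → ℂ) (w : Ps s) :
    field symJ (gradOp κ) (gauge θ w) = gauge θ (field symJ (gradOp κ) w) := by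
  have h0 := cis_mul_neg θ 0
  have h1 := cis_mul_neg θ 1
  have e1 : (gradOp κ (gauge θ w) (gauge θ w) (gauge θ w)).1 =
      phase fourierWeight_pos (cis (-θ)) (gradOp κ w w w).1 := by
    rw [gradOp_fst, gradOp_fst, map_add]
    congr 1
    · exact triOp_phase _ _ (fun q => by
        simp only [legA, legB, legA', legB']; linear_combination cis (-θ) 0 * h1) _ _ _
    · exact triOp_phase _ _ (fun q => by
        simp only [legA, legB, legA', legB']; linear_combination cis (-θ) 1 * h0) _ _ _
  have e2 : (gradOp κ (gauge θ w) (gauge θ w) (gauge θ w)).2 =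
      phase fourierWeight_pos (cis θ) (gradOp κ w w w).2 := by
    rw [gradOp_snd, gradOp_snd, map_add]
    congr 1
    · exact triOp_phase _ _ (fun q => by
        simp only [legA, legB, legA', legB']; linear_combination cis θ 0 * h1) _ _ _
    · exact triOp_phase _ _ (fun q => by
        simp only [legA, legB, legA', legB']; linear_combination cis θ 1 * h0) _ _ _
  simp only [field, symJ_apply, e1, e2]
  simp only [gauge, map_smul]

theorem gauge_add_smul (θ : Fin 2 → ℂ) (c : ℂ) (x y : Ps s) :
    gauge θ (x + c • y) = gauge θ x + c • gauge θ y := by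
  simp [gauge]

theorem halfStep_gauge (κ : Kernel) (c : ℂ) (θ : Fin 2 → ℂ) (w : Ps s) :
    halfStep symJ (gradOp κ) c (gauge θ w) = gauge θ (halfStep symJ (gradOp κ) c w) := by
  rw [halfStep, halfStep, field_gauge, gauge_add_smul]

/-- A quartic Hamiltonian depends on products in which the phases cancel. -/
theorem quartic_gauge (κ : Kernel) (θ : Fin 2 → ℂ) (w : Ps s) :
    quartic κ (fourierCoords (gauge θ w)) = quartic κ (fourierCoords w) := by
  have h0 := cis_mul_neg θ 0
  have h1 := cis_mul_neg θ 1
  unfold quartic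
  congr 1; ext q
  simp only [fourierCoords, gauge, coeff_phase, legA, legB, legA', legB']
  linear_combination (κ.toFun q * w.1.coeff (q.2.2, 0) * w.1.coeff (q.1 + q.2.1 - q.2.2, 1) *
    w.2.coeff (q.1, 0) * w.2.coeff (q.2.1, 1)) * (cis θ 1 * cis (-θ) 1) * h0 +
    (κ.toFun q * w.1.coeff (q.2.2, 0) * w.1.coeff (q.1 + q.2.1 - q.2.2, 1) *
    w.2.coeff (q.1, 0) * w.2.coeff (q.2.1, 1)) * h1

/-! ### Reality -/

section Conj

variable {ι : Type} {w : ι → ℝ}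

/-- Complex conjugation of the entries. -/
def conjW (u : Wl2 ι w s) : Wl2 ι w s := Wl2.ofCoeff w s fun α => conj (u.coeff α)

theorem coeff_conjW (hw : ∀ α, 0 < w α) (u : Wl2 ι w s) (α : ι) :
    (conjW u).coeff α = conj (u.coeff α) := by
  refine congrFun (Wl2.coeff_ofCoeff hw _ ?_) α
  have h : ∀ z : ℂ, ‖conj z‖ₑ = ‖z‖ₑ := fun z => by
    rw [← ofReal_norm, ← ofReal_norm, Complex.norm_conj]
  simp only [h]; exact Wl2.sqNorm_ne_top hw u

theorem norm_conjW_le (hw : ∀ α, 0 < w α) (u : Wl2 ι w s) : ‖conjW u‖ ≤ ‖u‖ := by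
  rw [← one_mul ‖u‖]
  refine Wl2.norm_le_of_sqNorm_le' hw hw _ _ zero_le_one ?_
  have h : ∀ z : ℂ, ‖conj z‖ₑ = ‖z‖ₑ := fun z => by
    rw [← ofReal_norm, ← ofReal_norm, Complex.norm_conj]
  simp only [coeff_conjW hw, h]; simp

end Conj

/-- The conjugation of `P_s` whose fixed points are the real points. -/
def conjPs (w : Ps s) : Ps s := (conjW w.2, conjW w.1)

theorem isRealPs_iff (w : Ps s) : IsRealPs w ↔ conjPs w = w := by
  constructor
  · intro hw
    refine Prod.ext ?_ ?_
    · exact Wl2.ext_coeff fourierWeight_pos fun m => by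
        simp only [conjPs]; rw [coeff_conjW fourierWeight_pos, hw m, Complex.conj_conj]
    · exact Wl2.ext_coeff fourierWeight_pos fun m => by
        simp only [conjPs]; rw [coeff_conjW fourierWeight_pos, hw m]
  · intro h m
    rw [← coeff_conjW fourierWeight_pos]
    exact congrArg (fun v : Ps s => v.2.coeff m) h.symm

theorem norm_conjPs_le (w : Ps s) : ‖conjPs w‖ ≤ 2 * ‖w‖ := by
  have h1 := norm_conjW_le fourierWeight_pos w.1
  have h2 := norm_conjW_le fourierWeight_pos w.2
  have h3 := norm_fst_le w
  have h4 := norm_snd_le w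
  have h5 := norm_nonneg w
  exact max_le (by simp only [conjPs]; linarith) (by simp only [conjPs]; linarith)

/-- The exchange `(i, j, k, l) ↦ (k, l, i, j)`. -/
def swapEquiv : (ℤ × ℤ × ℤ) ≃ (ℤ × ℤ × ℤ) where
  toFun q := (q.2.2, q.1 + q.2.1 - q.2.2, q.1)
  invFun q := (q.2.2, q.1 + q.2.1 - q.2.2, q.1)
  left_inv q := by obtain ⟨i, j, k⟩ := q; simp
  right_inv q := by obtain ⟨i, j, k⟩ := q; simp

theorem legA_swap (q) : legA (swapEquiv q) = legA' q := rfl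
theorem legA'_swap (q) : legA' (swapEquiv q) = legA q := rfl
theorem legB'_swap (q) : legB' (swapEquiv q) = legB q := rfl
theorem legB_swap (q) : legB (swapEquiv q) = legB' q := by
  obtain ⟨i, j, k⟩ := q; simp [legB, legB', swapEquiv]

/-- A Hermitian kernel: the quartic Hamiltonian is real at real points. -/
def Kernel.IsHerm (κ : Kernel) : Prop := ∀ q, κ.toFun (swapEquiv q) = conj (κ.toFun q)

theorem divisor_swap (q) : divisor (swapEquiv q) = -divisor q := by
  obtain ⟨i, j, k⟩ := q; simp only [divisor, swapEquiv, Equiv.coe_fn_mk]; ring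

theorem resonant_swap (q) : Resonant (swapEquiv q) ↔ Resonant q := by
  rw [← divisor_eq_zero_iff, ← divisor_eq_zero_iff, divisor_swap, neg_eq_zero]

theorem kerOne_isHerm : kerOne.IsHerm := fun q => by simp [kerOne]

theorem kerRes_isHerm : kerRes.IsHerm := fun q => by
  simp only [kerRes, resonant_swap]; split_ifs <;> simp

theorem kerChi_isHerm : kerChi.IsHerm := fun q => by
  simp only [kerChi, resonant_swap, divisor_swap]
  split_ifs
  · simp
  · simp [map_div₀, neg_div, div_neg]

theorem triOp_conj (H : IsQuarticLegs e f g h) (H' : IsQuarticLegs e' f' g' h') {κ : Kernel}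
    (hκ : κ.IsHerm) (he : ∀ q, e' (swapEquiv q) = e q) (hf : ∀ q, f' (swapEquiv q) = f q)
    (hg : ∀ q, g' (swapEquiv q) = g q) (hh : ∀ q, h' (swapEquiv q) = h q) (x y z : Hs s) :
    triOp H' κ (conjW x) (conjW y) (conjW z) = conjW (triOp H κ x y z) := by
  refine Wl2.ext_coeff fourierWeight_pos fun n => ?_
  rw [coeff_conjW fourierWeight_pos, coeff_triOp, coeff_triOp, Complex.conj_tsum]
  rw [← (swapEquiv.subtypeEquiv (p := fun q => e q = n) (q := fun q => e' q = n)
    fun q => by rw [he]).tsum_eq]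
  congr 1; ext q
  simp only [Equiv.subtypeEquiv_apply, hκ q.1, hf, hg, hh, coeff_conjW fourierWeight_pos, map_mul]

theorem conjW_smul {ι : Type} {w : ι → ℝ} (hw : ∀ α, 0 < w α) (c : ℂ) (u : Wl2 ι w s) :
    conjW (c • u) = conj c • conjW u :=
  Wl2.ext_coeff hw fun α => by
    rw [coeff_conjW hw, Wl2.coeff_smul, Wl2.coeff_smul, coeff_conjW hw, map_mul]

theorem conjW_add {ι : Type} {w : ι → ℝ} (hw : ∀ α, 0 < w α) (u v : Wl2 ι w s) :
    conjW (u + v) = conjW u + conjW v :=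
  Wl2.ext_coeff hw fun α => by
    rw [coeff_conjW hw, Wl2.coeff_add, Wl2.coeff_add, coeff_conjW hw, coeff_conjW hw, map_add]

theorem halfStep_conj {κ : Kernel} (hκ : κ.IsHerm) {c : ℂ} (hc : conj c = c) (w : Ps s) :
    halfStep symJ (gradOp κ) c (conjPs w) = conjPs (halfStep symJ (gradOp κ) c w) := by
  have e1 : (gradOp κ (conjPs w) (conjPs w) (conjPs w)).1 = conjW (gradOp κ w w w).2 := by
    rw [gradOp_fst, gradOp_snd, conjW_add fourierWeight_pos]
    congr 1
    · exact triOp_conj quarticLegsA' quarticLegsA hκ legA_swap legB_swap legA'_swap legB'_swap _ _ _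
    · exact triOp_conj quarticLegsB' quarticLegsB hκ legB_swap legA_swap legA'_swap legB'_swap _ _ _
  have e2 : (gradOp κ (conjPs w) (conjPs w) (conjPs w)).2 = conjW (gradOp κ w w w).1 := by
    rw [gradOp_fst, gradOp_snd, conjW_add fourierWeight_pos]
    congr 1
    · exact triOp_conj quarticLegsA quarticLegsA' hκ legA'_swap legB'_swap legA_swap legB_swap _ _ _
    · exact triOp_conj quarticLegsB quarticLegsB' hκ legB'_swap legA'_swap legA_swap legB_swap _ _ _
  have e3 : field symJ (gradOp κ) (conjPs w) = conjPs (field symJ (gradOp κ) w) := by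
    simp only [field, symJ_apply, e1, e2]
    simp only [conjPs, conjW_smul fourierWeight_pos]
    simp
  rw [halfStep, halfStep, e3]
  simp only [conjPs]
  refine Prod.ext ?_ ?_
  · simp only [Prod.fst_add, Prod.smul_fst, Prod.snd_add, Prod.smul_snd]
    rw [conjW_add fourierWeight_pos, conjW_smul fourierWeight_pos, hc]
  · simp only [Prod.fst_add, Prod.smul_fst, Prod.snd_add, Prod.smul_snd]
    rw [conjW_add fourierWeight_pos, conjW_smul fourierWeight_pos, hc]

theorem quartic_real {κ : Kernel} (hκ : κ.IsHerm) {w : Ps s} (hw : IsRealPs w) :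
    (quartic κ (fourierCoords w)).im = 0 := by
  rw [← Complex.conj_eq_iff_im, quartic, Complex.conj_tsum, ← swapEquiv.tsum_eq]
  congr 1; ext q
  have h1 : ∀ m, conj (w.2.coeff m) = w.1.coeff m := fun m => by rw [hw m, Complex.conj_conj]
  have h2 : ∀ m, conj (w.1.coeff m) = w.2.coeff m := fun m => (hw m).symm
  simp only [fourierCoords, legA_swap, legB_swap, legA'_swap, legB'_swap, map_mul, h1, h2, hκ q,
    Complex.conj_conj]
  ring

end

noncomputable section

variable {s : ℝ} [Fact (1 / 2 < s)]

/-! ### Diagonal quadratic Hamiltonians -/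

/-- The diagonal quadratic Hamiltonian `∑ d_n ψ_n ψ̄_n`. -/
def diag (d : Mode → ℂ) (u : FourierPt) : ℂ := ∑' n, d n * (u.psi n * u.psiBar n)

theorem momentum_eq_diag (u : FourierPt) : momentum u = diag (fun n => n.1) u := rfl

theorem P2_eq_diag (u : FourierPt) : P2 u = diag (fun n => (n.1 : ℂ) ^ 2) u := rfl

theorem partialMass_eq_diag (i : Fin 2) (u : FourierPt) :
    partialMass i u = diag (fun n => if n.2 = i then 1 else 0) u := by
  have hinj : Function.Injective fun j : ℤ => ((j, i) : Mode) := fun a b h => by simpa using h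
  have := hinj.tsum_eq (f := fun n : Mode => (if n.2 = i then (1 : ℂ) else 0) *
    (u.psi n * u.psiBar n)) (fun n hn => by
      by_cases h : n.2 = i
      · exact ⟨n.1, by rw [← h]⟩
      · simp [h] at hn)
  rw [diag, ← this, partialMass]
  simp

theorem sqNorm_add_le {ι : Type} (V : ι → ℝ≥0∞) (x y : ι → ℂ) :
    sqNorm V (fun n => ‖x n + y n‖ₑ) ≤
      2 * sqNorm V (fun n => ‖x n‖ₑ) + 2 * sqNorm V (fun n => ‖y n‖ₑ) := by
  simp only [sqNorm]
  rw [← ENNReal.tsum_mul_left, ← ENNReal.tsum_mul_left, ← ENNReal.tsum_add]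
  refine ENNReal.tsum_le_tsum fun n => ?_
  calc (V n * ‖x n + y n‖ₑ) ^ 2 ≤ (V n * ‖x n‖ₑ + V n * ‖y n‖ₑ) ^ 2 := by
        gcongr; rw [← mul_add]; gcongr; exact enorm_add_le _ _
    _ ≤ _ := by
        have e : ∀ a b : ℝ≥0∞, (a + b) ^ 2 ≤ 2 * (a ^ 2 + b ^ 2) := fun a b => by
          by_cases h : a = ∞ ∨ b = ∞
          · have : a ^ 2 + b ^ 2 = ∞ := by rcases h with h | h <;> simp [h]
            rw [this, ENNReal.mul_top (by simp)]; exact le_top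
          · push Not at h
            lift a to NNReal using h.1
            lift b to NNReal using h.2
            have : (a + b) ^ 2 ≤ 2 * (a ^ 2 + b ^ 2) := by
              rw [← NNReal.coe_le_coe]; push_cast; nlinarith [sq_nonneg ((a : ℝ) - b)]
            exact_mod_cast this
        exact (e _ _).trans (le_of_eq (mul_add _ _ _))

theorem sqNorm_const_mul {ι : Type} (V : ι → ℝ≥0∞) (c : ℂ) (x : ι → ℂ) :
    sqNorm V (fun n => ‖c * x n‖ₑ) = ‖c‖ₑ ^ 2 * sqNorm V (fun n => ‖x n‖ₑ) := by
  simp only [sqNorm]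
  rw [← ENNReal.tsum_mul_left]
  congr 1; ext n; rw [enorm_mul]; ring

/-- The squared norm of a point of `P_s` with respect to a weight. -/
def energyV (V : Mode → ℝ≥0∞) (u : Ps s) : ℝ≥0∞ :=
  sqNorm V (fun n => ‖u.1.coeff n‖ₑ) + sqNorm V (fun n => ‖u.2.coeff n‖ₑ)

theorem energyV_add_smul_le (V : Mode → ℝ≥0∞) (c : ℂ) (u v : Ps s) :
    energyV V (u + c • v) ≤ 2 * energyV V u + 2 * ‖c‖ₑ ^ 2 * energyV V v := by
  have h1 := sqNorm_add_le V u.1.coeff fun n => c * v.1.coeff n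
  have h2 := sqNorm_add_le V u.2.coeff fun n => c * v.2.coeff n
  rw [sqNorm_const_mul] at h1 h2
  have e : energyV V (u + c • v) = sqNorm V (fun n => ‖u.1.coeff n + c * v.1.coeff n‖ₑ) +
    sqNorm V (fun n => ‖u.2.coeff n + c * v.2.coeff n‖ₑ) := by simp [energyV]
  rw [e]
  refine (add_le_add h1 h2).trans (le_of_eq ?_)
  simp only [energyV]; ring

theorem summable_diag {V : Mode → ℝ≥0∞} {d : Mode → ℂ} (hd : ∀ n, ‖d n‖ₑ ≤ V n ^ 2)
    {x y : Mode → ℂ} (hx : sqNorm V (fun n => ‖x n‖ₑ) ≠ ∞) (hy : sqNorm V (fun n => ‖y n‖ₑ) ≠ ∞) :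
    Summable fun n => d n * (x n * y n) := by
  apply summable_of_tsum_enorm
  have h1 : ∑' n, ‖d n * (x n * y n)‖ₑ ≤ ∑' n, (V n * ‖x n‖ₑ) * (V n * ‖y n‖ₑ) :=
    ENNReal.tsum_le_tsum fun n => by
      rw [enorm_mul, enorm_mul]
      calc _ ≤ V n ^ 2 * (‖x n‖ₑ * ‖y n‖ₑ) := by gcongr; exact hd n
        _ = _ := by ring
  refine ne_top_of_le_ne_top (fun htop => ?_) h1
  have := tsum_mul_sq_le (fun n => V n * ‖x n‖ₑ) fun n => V n * ‖y n‖ₑ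
  rw [htop, ENNReal.top_pow two_ne_zero] at this
  exact ENNReal.mul_ne_top hx hy (top_le_iff.1 this)

/-- A weight that is tame with respect to all four legs of the quartic monomials. -/
def TameWeight (V : Mode → ℝ≥0∞) (A : ℝ≥0∞) : Prop :=
  ∀ {e f g h : ℤ × ℤ × ℤ → Mode}, IsQuarticLegs e f g h → IsTame V A e f g h

theorem sqNorm_triOp_le {e f g h : ℤ × ℤ × ℤ → Mode} (H : IsQuarticLegs e f g h) (κ : Kernel)
    {V : Mode → ℝ≥0∞} {A : ℝ≥0∞} (hV : TameWeight V A) (x y z : Hs s) :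
    sqNorm V (fun n => ‖(triOp H κ x y z).coeff n‖ₑ) ≤
      3 * A ^ 2 * (∑' m : Mode, (wt fourierWeight s m)⁻¹ ^ 2) ^ 2 *
      (sqNorm V (fun n => ‖x.coeff n‖ₑ) * ‖y‖ₑ ^ 2 * ‖z‖ₑ ^ 2 +
        ‖x‖ₑ ^ 2 * sqNorm V (fun n => ‖y.coeff n‖ₑ) * ‖z‖ₑ ^ 2 +
        ‖x‖ₑ ^ 2 * ‖y‖ₑ ^ 2 * sqNorm V (fun n => ‖z.coeff n‖ₑ)) := by
  simp only [Wl2.enorm_sq_eq fourierWeight_pos]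
  refine le_trans (ENNReal.tsum_le_tsum fun n => ?_)
    (sqNorm_fibSum_le (H.isLegs (half_lt s)) (hV H) _ _ _)
  gcongr
  change ‖(triOp H κ x y z).coeff n‖ₑ ≤ _
  rw [coeff_triOp]
  exact (enorm_tsum_le' _).trans (enorm_fiber_tsum_le κ.bound _ _ _ n)

/-- The constant in the tame estimate for the vector field. -/
def tameConst (s : ℝ) (A : ℝ≥0∞) : ℝ≥0∞ :=
  72 * A ^ 2 * (∑' m : Mode, (wt fourierWeight s m)⁻¹ ^ 2) ^ 2

theorem tameConst_ne_top {A : ℝ≥0∞} (hA : A ≠ ∞) : tameConst s A ≠ ∞ := by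
  have := tsum_wt_fourierWeight_ne_top (half_lt s)
  unfold tameConst; finiteness

theorem energyV_field_le (κ : Kernel) {V : Mode → ℝ≥0∞} {A : ℝ≥0∞} (hV : TameWeight V A)
    (u : Ps s) : energyV V (field symJ (gradOp κ) u) ≤
      tameConst s A * ‖u‖ₑ ^ 4 * energyV V u := by
  have n1 : ‖u.1‖ₑ ≤ ‖u‖ₑ := by
    rw [← ofReal_norm, ← ofReal_norm]; exact ENNReal.ofReal_le_ofReal (norm_fst_le u)
  have n2 : ‖u.2‖ₑ ≤ ‖u‖ₑ := by
    rw [← ofReal_norm, ← ofReal_norm]; exact ENNReal.ofReal_le_ofReal (norm_snd_le u)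
  set S := ∑' m : Mode, (wt fourierWeight s m)⁻¹ ^ 2 with hS
  have key : ∀ {e f g h : ℤ × ℤ × ℤ → Mode} (H : IsQuarticLegs e f g h) (x y z : Hs s),
      ‖x‖ₑ ≤ ‖u‖ₑ → ‖y‖ₑ ≤ ‖u‖ₑ → ‖z‖ₑ ≤ ‖u‖ₑ →
      sqNorm V (fun n => ‖x.coeff n‖ₑ) ≤ energyV V u →
      sqNorm V (fun n => ‖y.coeff n‖ₑ) ≤ energyV V u →
      sqNorm V (fun n => ‖z.coeff n‖ₑ) ≤ energyV V u →
      sqNorm V (fun n => ‖(triOp H κ x y z).coeff n‖ₑ) ≤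
        9 * A ^ 2 * S ^ 2 * ‖u‖ₑ ^ 4 * energyV V u := by
    intro e f g h H x y z hx hy hz hx' hy' hz'
    refine (sqNorm_triOp_le H κ hV x y z).trans ?_
    rw [← hS]
    calc _ ≤ 3 * A ^ 2 * S ^ 2 * (energyV V u * ‖u‖ₑ ^ 2 * ‖u‖ₑ ^ 2 +
          ‖u‖ₑ ^ 2 * energyV V u * ‖u‖ₑ ^ 2 + ‖u‖ₑ ^ 2 * ‖u‖ₑ ^ 2 * energyV V u) := by gcongr
      _ = _ := by ring
  have e1 : sqNorm V (fun n => ‖u.1.coeff n‖ₑ) ≤ energyV V u := le_self_add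
  have e2 : sqNorm V (fun n => ‖u.2.coeff n‖ₑ) ≤ energyV V u := le_add_self
  have b1 := key quarticLegsA u.1 u.2 u.2 n1 n2 n2 e1 e2 e2
  have b2 := key quarticLegsB u.1 u.2 u.2 n1 n2 n2 e1 e2 e2
  have b3 := key quarticLegsA' u.2 u.1 u.1 n2 n1 n1 e2 e1 e1
  have b4 := key quarticLegsB' u.2 u.1 u.1 n2 n1 n1 e2 e1 e1
  have hI : ‖Complex.I‖ₑ = 1 := by rw [← ofReal_norm]; simp
  have hI' : ‖-Complex.I‖ₑ = 1 := by rw [← ofReal_norm]; simp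
  have f1 : sqNorm V (fun n => ‖(field symJ (gradOp κ) u).1.coeff n‖ₑ) =
      sqNorm V (fun n => ‖(gradOp κ u u u).2.coeff n‖ₑ) := by
    simp only [field, symJ_apply, Wl2.coeff_smul]
    rw [sqNorm_const_mul, hI']; simp
  have f2 : sqNorm V (fun n => ‖(field symJ (gradOp κ) u).2.coeff n‖ₑ) =
      sqNorm V (fun n => ‖(gradOp κ u u u).1.coeff n‖ₑ) := by
    simp only [field, symJ_apply, Wl2.coeff_smul]
    rw [sqNorm_const_mul, hI]; simp
  rw [energyV, f1, f2, gradOp_fst, gradOp_snd]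
  simp only [Wl2.coeff_add]
  refine (add_le_add (sqNorm_add_le _ _ _) (sqNorm_add_le _ _ _)).trans ?_
  calc _ ≤ 2 * (9 * A ^ 2 * S ^ 2 * ‖u‖ₑ ^ 4 * energyV V u) +
        2 * (9 * A ^ 2 * S ^ 2 * ‖u‖ₑ ^ 4 * energyV V u) +
        (2 * (9 * A ^ 2 * S ^ 2 * ‖u‖ₑ ^ 4 * energyV V u) +
        2 * (9 * A ^ 2 * S ^ 2 * ‖u‖ₑ ^ 4 * energyV V u)) := by gcongr
    _ = _ := by rw [tameConst]; ring

theorem diag_triOp {e f g h : ℤ × ℤ × ℤ → Mode} (H : IsQuarticLegs e f g h) (κ : Kernel)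
    {d : Mode → ℂ} {u x y z : Hs s} (hs : Summable fun q => d (e q) * (κ.toFun q *
      (u.coeff (e q) * (x.coeff (f q) * y.coeff (g q) * z.coeff (h q))))) :
    (Summable fun n => d n * (u.coeff n * (triOp H κ x y z).coeff n)) ∧
    ∑' n, d n * (u.coeff n * (triOp H κ x y z).coeff n) = ∑' q, d (e q) * (κ.toFun q *
      (u.coeff (e q) * (x.coeff (f q) * y.coeff (g q) * z.coeff (h q)))) := by
  have h1 := summable_quartic_fiber (d := d) (u := u.coeff) (x := x.coeff) (y := y.coeff)
    (z := z.coeff) hs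
  have h2 := tsum_quartic_fiber (d := d) (u := u.coeff) (x := x.coeff) (y := y.coeff)
    (z := z.coeff) hs
  have h3 : ∀ n, d n * (u.coeff n * (triOp H κ x y z).coeff n) = d n * (u.coeff n *
      ∑' q : {q // e q = n}, κ.toFun q * (x.coeff (f q) * y.coeff (g q) * z.coeff (h q))) :=
    fun n => by rw [coeff_triOp]
  exact ⟨h1.congr fun n => (h3 n).symm, (tsum_congr h3).trans h2⟩

/-- The Poisson bracket of a diagonal quadratic Hamiltonian with a quartic one: the kernel is
multiplied by the corresponding divisor. -/
theorem tsum_diag_field (κ : Kernel) {V : Mode → ℝ≥0∞} {A : ℝ≥0∞} (hA : A ≠ ∞)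
    (hV : TameWeight V A) {d : Mode → ℂ} (hd : ∀ n, ‖d n‖ₑ ≤ V n ^ 2) (u : Ps s)
    (hu : energyV V u ≠ ∞) :
    ∑' n, d n * (u.1.coeff n * (field symJ (gradOp κ) u).2.coeff n +
        (field symJ (gradOp κ) u).1.coeff n * u.2.coeff n) =
      Complex.I * ∑' q, (d (legA q) + d (legB q) - d (legA' q) - d (legB' q)) * (κ.toFun q *
        (u.1.coeff (legA q) * (u.1.coeff (legB q) * u.2.coeff (legA' q) * u.2.coeff (legB' q)))) ∧
    Summable fun q => (d (legA q) + d (legB q) - d (legA' q) - d (legB' q)) * (κ.toFun q *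
        (u.1.coeff (legA q) * (u.1.coeff (legB q) * u.2.coeff (legA' q) *
          u.2.coeff (legB' q)))) := by
  have hu1 : sqNorm V (fun n => ‖u.1.coeff n‖ₑ) ≠ ∞ := ne_top_of_le_ne_top hu le_self_add
  have hu2 : sqNorm V (fun n => ‖u.2.coeff n‖ₑ) ≠ ∞ := ne_top_of_le_ne_top hu le_add_self
  have c1 := Wl2.sqNorm_ne_top fourierWeight_pos u.1
  have c2 := Wl2.sqNorm_ne_top fourierWeight_pos u.2
  have L := fun {e f g h : ℤ × ℤ × ℤ → Mode} (H : IsQuarticLegs e f g h) => H.isLegs (half_lt s)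
  have sA := summable_quartic (L quarticLegsA) hA (hV quarticLegsA) κ.bound hd hu1 hu1 hu2 hu2
    c1 c2 c2
  have sB := summable_quartic (L quarticLegsB) hA (hV quarticLegsB) κ.bound hd hu1 hu1 hu2 hu2
    c1 c2 c2
  have sA' := summable_quartic (L quarticLegsA') hA (hV quarticLegsA') κ.bound hd hu2 hu2 hu1 hu1
    c2 c1 c1
  have sB' := summable_quartic (L quarticLegsB') hA (hV quarticLegsB') κ.bound hd hu2 hu2 hu1 hu1
    c2 c1 c1
  have e1 : ∀ n, d n * (u.1.coeff n * (field symJ (gradOp κ) u).2.coeff n +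
        (field symJ (gradOp κ) u).1.coeff n * u.2.coeff n) =
      Complex.I * (d n * (u.1.coeff n * (triOp quarticLegsA κ u.1 u.2 u.2).coeff n) +
        d n * (u.1.coeff n * (triOp quarticLegsB κ u.1 u.2 u.2).coeff n) -
        d n * (u.2.coeff n * (triOp quarticLegsA' κ u.2 u.1 u.1).coeff n) -
        d n * (u.2.coeff n * (triOp quarticLegsB' κ u.2 u.1 u.1).coeff n)) := fun n => by
    simp only [field, symJ_apply, Wl2.coeff_smul, gradOp_fst, gradOp_snd, Wl2.coeff_add]; ring
  simp only [e1, tsum_mul_left]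
  obtain ⟨fA, tA⟩ := diag_triOp quarticLegsA κ sA
  obtain ⟨fB, tB⟩ := diag_triOp quarticLegsB κ sB
  obtain ⟨fA', tA'⟩ := diag_triOp quarticLegsA' κ sA'
  obtain ⟨fB', tB'⟩ := diag_triOp quarticLegsB' κ sB'
  rw [((fA.add fB).sub fA').tsum_sub fB', (fA.add fB).tsum_sub fA', fA.tsum_add fB, tA, tB, tA',
    tB', ← sA.tsum_add sB, ← (sA.add sB).tsum_sub sA', ← ((sA.add sB).sub sA').tsum_sub sB']
  have hterm : ∀ q, d (legA q) * (κ.toFun q * (u.1.coeff (legA q) * (u.1.coeff (legB q) *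
        u.2.coeff (legA' q) * u.2.coeff (legB' q)))) +
      d (legB q) * (κ.toFun q * (u.1.coeff (legB q) * (u.1.coeff (legA q) *
        u.2.coeff (legA' q) * u.2.coeff (legB' q)))) -
      d (legA' q) * (κ.toFun q * (u.2.coeff (legA' q) * (u.2.coeff (legB' q) *
        u.1.coeff (legA q) * u.1.coeff (legB q)))) -
      d (legB' q) * (κ.toFun q * (u.2.coeff (legB' q) * (u.2.coeff (legA' q) *
        u.1.coeff (legA q) * u.1.coeff (legB q)))) =
      (d (legA q) + d (legB q) - d (legA' q) - d (legB' q)) * (κ.toFun q *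
        (u.1.coeff (legA q) * (u.1.coeff (legB q) * u.2.coeff (legA' q) *
          u.2.coeff (legB' q)))) := fun q => by ring
  refine ⟨by rw [tsum_congr hterm], (((sA.add sB).sub sA').sub sB').congr hterm⟩

/-- The increment of a diagonal quadratic Hamiltonian along a full step, in terms of the
midpoint. -/
theorem diag_halfStep_sub (κ : Kernel) {V : Mode → ℝ≥0∞} {A : ℝ≥0∞} (hA : A ≠ ∞)
    (hV : TameWeight V A) {d : Mode → ℂ} (hd : ∀ n, ‖d n‖ₑ ≤ V n ^ 2) (u : Ps s)
    (hu : energyV V u ≠ ∞) :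
    diag d (fourierCoords (halfStep symJ (gradOp κ) (1 / 2) u)) -
      diag d (fourierCoords (halfStep symJ (gradOp κ) (-(1 / 2)) u)) =
      Complex.I * ∑' q, (d (legA q) + d (legB q) - d (legA' q) - d (legB' q)) * (κ.toFun q *
        (u.1.coeff (legA q) * (u.1.coeff (legB q) * u.2.coeff (legA' q) *
          u.2.coeff (legB' q)))) := by
  have hX : energyV V (field symJ (gradOp κ) u) ≠ ∞ := by
    refine ne_top_of_le_ne_top ?_ (energyV_field_le κ hV u)
    have := tameConst_ne_top (s := s) hA
    finiteness
  have hs : ∀ c : ℂ, Summable fun n => d n * ((halfStep symJ (gradOp κ) c u).1.coeff n *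
      (halfStep symJ (gradOp κ) c u).2.coeff n) := fun c => by
    have : energyV V (halfStep symJ (gradOp κ) c u) ≠ ∞ :=
      ne_top_of_le_ne_top (by finiteness)
        (energyV_add_smul_le V c u (field symJ (gradOp κ) u))
    exact summable_diag hd (ne_top_of_le_ne_top this le_self_add)
      (ne_top_of_le_ne_top this le_add_self)
  unfold diag fourierCoords
  rw [← Summable.tsum_sub (hs _) (hs _), ← (tsum_diag_field κ hA hV hd u hu).1]
  refine tsum_congr fun n => ?_
  simp only [halfStep, Prod.fst_add, Prod.snd_add, Prod.smul_fst, Prod.smul_snd, Wl2.coeff_add,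
    Wl2.coeff_smul]
  ring

/-! ### Weights -/

theorem tameWeight_wt : TameWeight (wt fourierWeight s) (ENNReal.ofReal (3 ^ s)) :=
  fun H => H.isTame (s_nonneg s)

theorem energyV_wt_ne_top (u : Ps s) : energyV (wt fourierWeight s) u ≠ ∞ :=
  ENNReal.add_ne_top.2 ⟨Wl2.sqNorm_ne_top fourierWeight_pos _, Wl2.sqNorm_ne_top fourierWeight_pos _⟩

theorem enorm_index_le (n : Mode) : ‖(n.1 : ℂ)‖ₑ ≤ wt fourierWeight s n ^ 2 := by
  have hw := one_le_fourierWeight n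
  rw [wt, ← ofReal_norm, Complex.norm_intCast, ← ENNReal.ofReal_pow (by positivity),
    ← Real.rpow_natCast, ← Real.rpow_mul (by linarith)]
  refine ENNReal.ofReal_le_ofReal ((abs_le_intWeight n.1).trans ?_)
  change fourierWeight n ≤ _
  conv_lhs => rw [← Real.rpow_one (fourierWeight n)]
  exact Real.rpow_le_rpow_of_exponent_le hw (by push_cast; linarith [half_lt s])

theorem enorm_indicator_le (i : Fin 2) (n : Mode) :
    ‖(if n.2 = i then (1 : ℂ) else 0)‖ₑ ≤ wt fourierWeight s n ^ 2 := by
  refine le_trans ?_ (one_le_wt_sq n)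
  split_ifs <;> simp

/-- The weight `|j|`, which measures the energy. -/
def absWeight (n : Mode) : ℝ≥0∞ := ENNReal.ofReal |(n.1 : ℝ)|

theorem tameWeight_abs : TameWeight absWeight 1 := fun H q => by
  rw [one_mul, absWeight, absWeight, absWeight, absWeight, ← ENNReal.ofReal_add (abs_nonneg _)
    (abs_nonneg _), ← ENNReal.ofReal_add (by positivity) (abs_nonneg _)]
  exact ENNReal.ofReal_le_ofReal (by exact_mod_cast H.abs_le q)

theorem tameWeight_min {V : Mode → ℝ≥0∞} (hV : TameWeight V 1) (N : ℝ≥0∞) :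
    TameWeight (fun n => min (V n) N) 1 := fun {e f g h} H q => by
  have h1 := hV H q
  simp only [one_mul] at h1 ⊢
  rcases le_total (V (f q)) N with h2 | h2
  · rcases le_total (V (g q)) N with h3 | h3
    · rcases le_total (V (h q)) N with h4 | h4
      · rw [min_eq_left h2, min_eq_left h3, min_eq_left h4]; exact (min_le_left _ _).trans h1
      · rw [min_eq_right h4]; exact (min_le_right _ _).trans le_add_self
    · rw [min_eq_right h3]
      exact (min_le_right _ _).trans (le_add_self.trans le_self_add)
  · rw [min_eq_right h2]
    exact (min_le_right _ _).trans (le_self_add.trans le_self_add)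

theorem enorm_sq_index_le (n : Mode) : ‖((n.1 : ℂ) ^ 2)‖ₑ ≤ absWeight n ^ 2 := by
  rw [enorm_pow, absWeight, ← ofReal_norm, Complex.norm_intCast]

theorem sqNorm_absWeight_ne_top_iff (x : Mode → ℂ) : sqNorm absWeight (fun n => ‖x n‖ₑ) ≠ ∞ ↔
    Summable fun m : Mode => (m.1 : ℝ) ^ 2 * ‖x m‖ ^ 2 := by
  have e : ∀ m : Mode, (absWeight m * ‖x m‖ₑ) ^ 2 = ENNReal.ofReal ((m.1 : ℝ) ^ 2 * ‖x m‖ ^ 2) :=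
    fun m => by
      rw [absWeight, ← ofReal_norm, ← ENNReal.ofReal_mul (abs_nonneg _),
        ← ENNReal.ofReal_pow (by positivity), mul_pow, sq_abs]
  simp only [sqNorm, e]
  constructor
  · intro h
    refine (ENNReal.summable_toReal h).congr fun m => ?_
    rw [ENNReal.toReal_ofReal (by positivity)]
  · intro h
    rw [← ENNReal.ofReal_tsum_of_nonneg (fun _ => by positivity) h]
    simp

theorem finiteEnergy_iff (u : Ps s) :
    FiniteEnergy (fourierCoords u) ↔ energyV absWeight u ≠ ∞ := by
  rw [energyV, ENNReal.add_ne_top, sqNorm_absWeight_ne_top_iff, sqNorm_absWeight_ne_top_iff]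
  rfl

theorem energyV_min_ne_top (V : Mode → ℝ≥0∞) (N : ℕ) (u : Ps s) :
    energyV (fun n => min (V n) N) u ≠ ∞ := by
  have h : ∀ x : Hs s, sqNorm (fun n => min (V n) (N : ℝ≥0∞)) (fun n => ‖x.coeff n‖ₑ) ≠ ∞ := by
    intro x
    have : sqNorm (fun n => min (V n) (N : ℝ≥0∞)) (fun n => ‖x.coeff n‖ₑ) ≤
        (N : ℝ≥0∞) ^ 2 * ‖x‖ₑ ^ 2 := by
      rw [Wl2.enorm_sq_eq fourierWeight_pos, sqNorm, sqNorm, ← ENNReal.tsum_mul_left]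
      refine ENNReal.tsum_le_tsum fun n => ?_
      have h1 : 1 ≤ wt fourierWeight s n := by
        rw [wt, ← ENNReal.ofReal_one]
        exact ENNReal.ofReal_le_ofReal (Real.one_le_rpow (one_le_fourierWeight n) (s_nonneg s))
      calc (min (V n) N * ‖x.coeff n‖ₑ) ^ 2 ≤ (N * (wt fourierWeight s n * ‖x.coeff n‖ₑ)) ^ 2 := by
            gcongr
            · exact min_le_right _ _
            · exact le_mul_of_one_le_left' h1
        _ = _ := by ring
    exact ne_top_of_le_ne_top (by finiteness) this
  exact ENNReal.add_ne_top.2 ⟨h _, h _⟩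

theorem sqNorm_le_of_min {V : Mode → ℝ≥0∞} (hV : ∀ n, V n ≠ ∞) {x : Mode → ℝ≥0∞} {C : ℝ≥0∞}
    (h : ∀ N : ℕ, sqNorm (fun n => min (V n) N) x ≤ C) : sqNorm V x ≤ C := by
  rw [sqNorm, ENNReal.tsum_eq_iSup_sum]
  refine iSup_le fun t => ?_
  obtain ⟨N, hN⟩ : ∃ N : ℕ, ∀ n ∈ t, V n ≤ N := by
    obtain ⟨N, hN⟩ := ENNReal.exists_nat_gt (r := ∑ n ∈ t, V n)
      (ENNReal.sum_ne_top.2 fun n _ => hV n)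
    exact ⟨N, fun n hn => (Finset.single_le_sum (f := V) (fun _ _ => bot_le) hn).trans hN.le⟩
  refine le_trans (le_of_eq (Finset.sum_congr rfl fun n hn => ?_))
    ((ENNReal.sum_le_tsum t).trans (h N))
  change (V n * x n) ^ 2 = (min (V n) (N : ℝ≥0∞) * x n) ^ 2
  rw [min_eq_left (hN n hn)]

/-- Finiteness of the energy passes to the midpoint. The energy is truncated first, so that it is
known to be finite and can be absorbed. -/
theorem energyV_midpoint_ne_top (κ : Kernel) {δ ε : ℝ} {m : Ps s → Ps s}
    (hm : IsMidpoint symJ (gradOp κ) δ ε m) {w : Ps s} (hw : w ∈ Metric.ball (0 : Ps s) ε)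
    (hsmall : tameConst s 1 * ‖m w‖ₑ ^ 4 ≤ 1) (hE : energyV absWeight w ≠ ∞) :
    energyV absWeight (m w) ≠ ∞ := by
  have key : ∀ N : ℕ, energyV (fun n => min (absWeight n) N) (m w) ≤ 4 * energyV absWeight w := by
    intro N
    set V : Mode → ℝ≥0∞ := fun n => min (absWeight n) N with hV
    have h1 := energyV_field_le κ (tameWeight_min tameWeight_abs N) (m w)
    have h2 := energyV_add_smul_le V (1 / 2) w (field symJ (gradOp κ) (m w))
    have h3 : w + (1 / 2 : ℂ) • field symJ (gradOp κ) (m w) = m w := by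
      have := hm.eq w hw
      rw [halfStep, neg_smul] at this
      calc w + (1 / 2 : ℂ) • field symJ (gradOp κ) (m w)
          = (m w + -((1 / 2 : ℂ) • field symJ (gradOp κ) (m w))) +
            (1 / 2 : ℂ) • field symJ (gradOp κ) (m w) := by rw [this]
        _ = m w := by abel
    rw [h3] at h2
    have h4 : energyV V w ≤ energyV absWeight w := by
      refine add_le_add ?_ ?_ <;>
      · refine ENNReal.tsum_le_tsum fun n => ?_
        gcongr; exact min_le_left _ _
    have h5 : energyV V (field symJ (gradOp κ) (m w)) ≤ energyV V (m w) :=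
      h1.trans (mul_le_of_le_one_left' hsmall)
    have h6 : energyV V (m w) ≠ ∞ := energyV_min_ne_top _ _ _
    have h7 : 2 * ‖(1 / 2 : ℂ)‖ₑ ^ 2 = (2⁻¹ : ℝ≥0∞) := by
      have : ‖(1 / 2 : ℂ)‖ₑ = ENNReal.ofReal (1 / 2) := by rw [← ofReal_norm]; norm_num
      rw [this, ← ENNReal.ofReal_pow (by norm_num)]
      have h8 : (2 : ℝ≥0∞) = ENNReal.ofReal 2 := by simp
      rw [h8, ← ENNReal.ofReal_mul (by norm_num), ← ENNReal.ofReal_inv_of_pos (by norm_num)]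
      norm_num
    rw [h7] at h2
    have h8 : energyV V (m w) ≤ 2 * energyV absWeight w + 2⁻¹ * energyV V (m w) :=
      h2.trans (by gcongr)
    lift energyV V (m w) to NNReal using h6 with a
    lift energyV absWeight w to NNReal using hE with b
    have h9 : a ≤ 2 * b + 2⁻¹ * a := by
      have : ((2 * b + 2⁻¹ * a : NNReal) : ℝ≥0∞) = 2 * (b : ℝ≥0∞) + 2⁻¹ * a := by
        simp [ENNReal.coe_inv]
      rw [← this] at h8; exact_mod_cast h8
    have h10 : a ≤ 4 * b := by
      rw [← NNReal.coe_le_coe] at h9 ⊢; push_cast at h9 ⊢; linarith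
    exact_mod_cast h10
  have hV : ∀ n, absWeight n ≠ ∞ := fun n => ENNReal.ofReal_ne_top
  refine ENNReal.add_ne_top.2 ⟨?_, ?_⟩
  · exact ne_top_of_le_ne_top (by finiteness)
      (sqNorm_le_of_min hV fun N => le_self_add.trans (key N))
  · exact ne_top_of_le_ne_top (by finiteness)
      (sqNorm_le_of_min hV fun N => le_add_self.trans (key N))

end

noncomputable section

open scoped ContDiff

/-! ### The transpose of the midpoint transformation -/

section MidStepT

variable {E : Type} [NormedAddCommGroup E] [NormedSpace ℂ E] [CompleteSpace E]
  {J : E →L[ℂ] E} {T : E →L[ℂ] E →L[ℂ] E →L[ℂ] E} {δ ε : ℝ} {m : E → E}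

/-- The transpose of the derivative of the midpoint transformation. -/
def midStepT (J : E →L[ℂ] E) (T : E →L[ℂ] E →L[ℂ] E →L[ℂ] E) (m : E → E) (w : E) : E →L[ℂ] E :=
  (midT J T m w).comp (halfStepT J T (1 / 2) (m w))

theorem IsMidpoint.contDiffOn_midStepT (h : IsMidpoint J T δ ε m) :
    ContDiffOn ℂ ω (midStepT J T m) (Metric.ball 0 ε) :=
  h.contDiffOn_midT.clm_comp ((contDiff_halfStepT J T (1 / 2)).comp_contDiffOn h.smooth)

theorem IsMidpoint.midStepT_spec (h : IsMidpoint J T δ ε m) {B : E →L[ℂ] E →L[ℂ] ℂ}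
    (hB : IsCayleyData B J T) {w : E} (hw : w ∈ Metric.ball (0 : E) ε) (u k : E) :
    B u (fderiv ℂ (midStep J T m) w k) = B (midStepT J T m w u) k := by
  rw [(h.hasFDerivAt_midStep hw).fderiv, ContinuousLinearMap.comp_apply,
    halfStepT_spec hB, h.midT_spec hB hw]
  rfl

theorem IsMidpoint.norm_midStepT_le (h : IsMidpoint J T δ ε m) {w : E}
    (hw : w ∈ Metric.ball (0 : E) ε) (u : E) : ‖midStepT J T m w u‖ ≤ 4 * ‖u‖ := by
  refine (h.norm_midT_le hw _).trans ?_
  have e : halfStepT J T (1 / 2) (m w) u = u - (1 / 2 : ℂ) • (hessOp T (m w)).comp J u := rfl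
  have h1 : ‖(hessOp T (m w)).comp J u‖ ≤ 1 * ‖u‖ :=
    (ContinuousLinearMap.le_opNorm _ u).trans (by
      gcongr; exact (norm_hessOp_comp_le J T (m w)).trans (h.half_small hw))
  have h2 : ‖halfStepT J T (1 / 2) (m w) u‖ ≤ ‖u‖ + 1 / 2 * ‖(hessOp T (m w)).comp J u‖ := by
    rw [e]
    exact (norm_sub_le _ _).trans (by rw [norm_smul]; norm_num)
  change 2 * ‖halfStepT J T (1 / 2) (m w) u‖ ≤ _
  linarith [norm_nonneg u]

end MidStepT

variable {s : ℝ} [Fact (1 / 2 < s)]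

/-! ### The Birkhoff transformation -/

/-- A Birkhoff map together with the analytic data used later: the transpose `Dt` of its
derivative, the remainder `R6` with its gradient `G6`, and the gauge symmetry. -/
structure IsBirkhoffSystem (ε K : ℝ) (τ : Ps s → Ps s) (Dt : Ps s → Ps s →L[ℂ] Ps s)
    (R6 : Ps s → ℂ) (G6 : Ps s → Ps s) : Prop where
  map : IsBirkhoffMap ε K τ
  smooth : ContDiffOn ℂ ω τ (Metric.ball 0 ε)
  norm_le : ∀ w ∈ Metric.ball (0 : Ps s) ε, ‖τ w‖ ≤ 2 * ‖w‖
  transpose_smooth : ContDiffOn ℂ ω Dt (Metric.ball 0 ε)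
  transpose : ∀ w ∈ Metric.ball (0 : Ps s) ε, ∀ u k,
    bil u (fderiv ℂ τ w k) = bil (Dt w u) k
  transpose_le : ∀ w ∈ Metric.ball (0 : Ps s) ε, ∀ u, ‖Dt w u‖ ≤ 4 * ‖u‖
  gauge_eq : ∀ θ : Fin 2 → ℂ, (∀ i, |(θ i).im| ≤ 1 / 2) → ∀ w ∈ Metric.ball (0 : Ps s) ε,
    gauge θ w ∈ Metric.ball (0 : Ps s) ε → τ (gauge θ w) = gauge θ (τ w)
  rem : HasGradOn bil R6 G6 (Metric.ball 0 ε)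
  rem_zero : R6 0 = 0
  rem_le : ∀ w ∈ Metric.ball (0 : Ps s) ε, ‖G6 w‖ ≤ K * ‖w‖ ^ 5
  rem_gauge : ∀ θ : Fin 2 → ℂ, (∀ i, |(θ i).im| ≤ 1 / 2) → ∀ w ∈ Metric.ball (0 : Ps s) ε,
    gauge θ w ∈ Metric.ball (0 : Ps s) ε → R6 (gauge θ w) = R6 w
  rem_real : ∀ w ∈ Metric.ball (0 : Ps s) ε, IsRealPs w → (R6 w).im = 0
  normalForm : ∀ w ∈ Metric.ball (0 : Ps s) ε, FiniteEnergy (fourierCoords w) →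
    P2 (fourierCoords (τ w)) + P4 (fourierCoords (τ w)) =
      P2 (fourierCoords w) + Z4 (fourierCoords w) + R6 w

theorem IsBirkhoffSystem.mono {ε K ε' K' : ℝ} {τ : Ps s → Ps s} {Dt : Ps s → Ps s →L[ℂ] Ps s}
    {R6 : Ps s → ℂ} {G6 : Ps s → Ps s} (h : IsBirkhoffSystem ε K τ Dt R6 G6) (hε : ε' ≤ ε)
    (hK : K ≤ K') : IsBirkhoffSystem ε' K' τ Dt R6 G6 := by
  have hs := Metric.ball_subset_ball (x := (0 : Ps s)) hε
  have hle : ∀ w ∈ Metric.ball (0 : Ps s) ε', ‖G6 w‖ ≤ K' * ‖w‖ ^ 5 := fun w hw =>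
    (h.rem_le w (hs hw)).trans (by gcongr)
  refine ⟨⟨⟨h.map.biholo.1.mono hs, h.map.biholo.2.1.mono hs,
      fun w hw => h.map.biholo.2.2 w (hs hw)⟩, fun w hw => ?_, fun w hw => h.map.real w (hs hw),
      fun w hw => h.map.symplectic w (hs hw),
      fun w hw => (h.map.close w (hs hw)).trans (by gcongr), fun w hw => h.map.mass_eq w (hs hw),
      fun w hw => h.map.momentum_eq w (hs hw), fun w hw => h.map.energy w (hs hw),
      R6, G6, (h.rem.fn.differentiableOn (by simp)).mono hs,
      (h.rem.grad.differentiableOn (by simp)).mono hs, fun w hw => ⟨fun k => ?_, hle w hw⟩,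
      fun w hw => h.normalForm w (hs hw)⟩,
    h.smooth.mono hs, fun w hw => h.norm_le w (hs hw), h.transpose_smooth.mono hs,
    fun w hw => h.transpose w (hs hw), fun w hw => h.transpose_le w (hs hw),
    fun θ hθ w hw hg => h.gauge_eq θ hθ w (hs hw) (hs hg), h.rem.mono hs, h.rem_zero, hle,
    fun θ hθ w hw hg => h.rem_gauge θ hθ w (hs hw) (hs hg), fun w hw => h.rem_real w (hs hw),
    fun w hw => h.normalForm w (hs hw)⟩
  · have := h.norm_le w (hs hw)
    simp only [Metric.mem_ball, dist_zero_right] at hw ⊢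
    linarith
  · rw [(h.rem.deriv w (hs hw)).fderiv, bil_apply]

/-- Every monomial of the generator conserves the two masses. -/
theorem legs_mass (i : Fin 2) (q : ℤ × ℤ × ℤ) :
    (if (legA q).2 = i then (1 : ℂ) else 0) + (if (legB q).2 = i then (1 : ℂ) else 0) -
      (if (legA' q).2 = i then (1 : ℂ) else 0) - (if (legB' q).2 = i then (1 : ℂ) else 0) = 0 := by
  simp only [legA, legB, legA', legB']
  fin_cases i <;> simp

/-- Every monomial of the generator conserves the momentum. -/
theorem legs_momentum (q : ℤ × ℤ × ℤ) :
    ((legA q).1 : ℂ) + ((legB q).1 : ℂ) - ((legA' q).1 : ℂ) - ((legB' q).1 : ℂ) = 0 := by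
  simp only [legA, legB, legA', legB']; push_cast; ring

/-- The homological equation: the Poisson bracket with the quadratic Hamiltonian multiplies the
kernel of the generator by its divisor, which gives `i (P₄ - Z₄)`. -/
theorem legs_energy (q : ℤ × ℤ × ℤ) :
    (((legA q).1 : ℂ) ^ 2 + ((legB q).1 : ℂ) ^ 2 - ((legA' q).1 : ℂ) ^ 2 - ((legB' q).1 : ℂ) ^ 2) *
      kerChi.toFun q = Complex.I * (kerOne.toFun q - kerRes.toFun q) := by
  have h : ((legA q).1 : ℂ) ^ 2 + ((legB q).1 : ℂ) ^ 2 - ((legA' q).1 : ℂ) ^ 2 -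
      ((legB' q).1 : ℂ) ^ 2 = (divisor q : ℂ) := by
    simp only [legA, legB, legA', legB', divisor]; push_cast; ring
  rw [h]
  simp only [kerChi, kerOne, kerRes]
  split_ifs with hR
  · simp
  · have h0 : (divisor q : ℂ) ≠ 0 := fun h' => hR ((divisor_eq_zero_iff q).1 (by exact_mod_cast h'))
    field_simp; ring

variable {δ ε : ℝ} {m : Ps s → Ps s}

theorem diag_midStep_of_weight (hm : IsMidpoint symJ (gradOp kerChi) δ ε m) {d : Mode → ℂ}
    (hd : ∀ n, ‖d n‖ₑ ≤ wt fourierWeight s n ^ 2)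
    (h0 : ∀ q, d (legA q) + d (legB q) - d (legA' q) - d (legB' q) = 0) {w : Ps s}
    (hw : w ∈ Metric.ball (0 : Ps s) ε) :
    diag d (fourierCoords (midStep symJ (gradOp kerChi) m w)) = diag d (fourierCoords w) := by
  have h := diag_halfStep_sub kerChi ENNReal.ofReal_ne_top tameWeight_wt hd (m w)
    (energyV_wt_ne_top _)
  rw [hm.eq w hw] at h
  simp only [h0, zero_mul, tsum_zero, mul_zero] at h
  exact sub_eq_zero.1 h

/-- The change of the quadratic Hamiltonian is exactly the nonresonant quartic part at the midpoint. -/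
theorem P2_midStep (hm : IsMidpoint symJ (gradOp kerChi) δ ε m) {w : Ps s}
    (hw : w ∈ Metric.ball (0 : Ps s) ε) (hE : energyV absWeight (m w) ≠ ⊤) :
    P2 (fourierCoords (midStep symJ (gradOp kerChi) m w)) - P2 (fourierCoords w) =
      quartic kerRes (fourierCoords (m w)) - quartic kerOne (fourierCoords (m w)) := by
  have h := diag_halfStep_sub kerChi (by simp) tameWeight_abs (d := fun n => (n.1 : ℂ) ^ 2)
    enorm_sq_index_le (m w) hE
  rw [hm.eq w hw] at h
  rw [P2_eq_diag, P2_eq_diag]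
  refine h.trans ?_
  have hs := fun κ => summable_pair_triOp quarticLegsA κ (m w).1 (m w).1 (m w).2 (m w).2
  have e := (hs kerRes).tsum_sub (hs kerOne)
  refine Eq.trans ?_ e
  rw [← tsum_mul_left]
  refine tsum_congr fun q => ?_
  have := legs_energy q
  have hI := Complex.I_mul_I
  linear_combination (Complex.I * ((m w).1.coeff (legA q) * ((m w).1.coeff (legB q) *
    (m w).2.coeff (legA' q) * (m w).2.coeff (legB' q)))) * this +
    ((kerOne.toFun q - kerRes.toFun q) * ((m w).1.coeff (legA q) * ((m w).1.coeff (legB q) *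
    (m w).2.coeff (legA' q) * (m w).2.coeff (legB' q)))) * hI

theorem midStep_equivariant (hm : IsMidpoint symJ (gradOp kerChi) δ ε m) {g : Ps s → Ps s}
    (hg : ∀ x, ‖g x‖ ≤ 2 * ‖x‖) (hcomm : ∀ c : ℂ, conj c = c → ∀ x,
      halfStep symJ (gradOp kerChi) c (g x) = g (halfStep symJ (gradOp kerChi) c x)) {w : Ps s}
    (hw : w ∈ Metric.ball (0 : Ps s) ε) (hgw : g w ∈ Metric.ball (0 : Ps s) ε) :
    m (g w) = g (m w) ∧ midStep symJ (gradOp kerChi) m (g w) =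
      g (midStep symJ (gradOp kerChi) m w) := by
  have h1 := hm.equivariant hg (fun x => hcomm _ (by simp [map_ofNat]) x) hw hgw
  refine ⟨h1, ?_⟩
  rw [midStep, midStep, h1]
  exact hcomm _ (by simp [map_ofNat]) _

/-- Reality is equivariance under the antilinear involution `conjPs`. -/
theorem isRealPs_midpoint (hm : IsMidpoint symJ (gradOp kerChi) δ ε m) {w : Ps s}
    (hw : w ∈ Metric.ball (0 : Ps s) ε) (hr : IsRealPs w) :
    IsRealPs (m w) ∧ IsRealPs (midStep symJ (gradOp kerChi) m w) := by
  rw [isRealPs_iff] at hr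
  have h := midStep_equivariant hm norm_conjPs_le
    (fun c hc x => halfStep_conj kerChi_isHerm hc x) hw (by rwa [hr])
  rw [hr] at h
  rw [isRealPs_iff, isRealPs_iff]
  exact ⟨h.1.symm, h.2.symm⟩

variable (s) in
/-- The midpoint transformation of the generator `χ` removes the nonresonant quartic terms. -/
theorem exists_birkhoffSystem : ∃ (ε K : ℝ) (τ : Ps s → Ps s) (Dt : Ps s → Ps s →L[ℂ] Ps s)
    (R6 : Ps s → ℂ) (G6 : Ps s → Ps s), 0 < ε ∧ 0 < K ∧ IsBirkhoffSystem ε K τ Dt R6 G6 := by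
  obtain ⟨δ, ε₀, m, hδ, hε₀, h4, hs3, hsm, hmm⟩ := exists_midpoint symJ (gradOp (s := s) kerChi)
  have hm₀ : IsMidpoint symJ (gradOp kerChi) δ ε₀ m :=
    ⟨h4, hs3, hsm, fun w hw => (hmm w hw).1, fun w hw => (hmm w hw).2⟩
  -- on a small ball the truncated energy of the step is absorbed by that of the midpoint
  set t : ℝ := (tameConst s 1).toReal with ht
  have ht0 : 0 ≤ t := ENNReal.toReal_nonneg
  obtain ⟨ε, hε, hεε, hε1, htε⟩ : ∃ ε : ℝ, 0 < ε ∧ ε ≤ ε₀ ∧ ε ≤ 1 ∧ t * (2 * ε) ^ 4 ≤ 1 := by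
    refine ⟨min ε₀ (1 / (16 * t + 16)), by positivity, min_le_left _ _, ?_, ?_⟩
    · refine (min_le_right _ _).trans ?_
      rw [div_le_one (by positivity)]; linarith
    · have h1 : min ε₀ (1 / (16 * t + 16)) ≤ 1 / (16 * t + 16) := min_le_right _ _
      have h2 : 1 / (16 * t + 16) ≤ 1 := by rw [div_le_one (by positivity)]; linarith
      set e := min ε₀ (1 / (16 * t + 16))
      have h0 : 0 < e := by positivity
      have h3 : e ^ 3 ≤ 1 := pow_le_one₀ h0.le (h1.trans h2)
      have h4 : e * (16 * t + 16) ≤ 1 := by rwa [le_div_iff₀ (by positivity)] at h1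
      calc t * (2 * e) ^ 4 = (16 * t * e) * e ^ 3 := by ring
        _ ≤ 1 * 1 := by gcongr; nlinarith
        _ = 1 := by ring
  have hm := hm₀.mono hεε
  set T := gradOp (s := s) kerChi with hT
  set C := ‖symJ (s := s)‖ * ‖T‖ with hC
  have hC0 : 0 ≤ C := by positivity
  obtain ⟨G, K₁, hK₁, hG, hGle⟩ := hm.exists_remainder (isCayleyData kerChi)
    (hasGradOn_quartic kerOne) (hasGradOn_quartic kerRes)
  set τ := midStep symJ T m with hτ
  set R6 : Ps s → ℂ := fun w => quartic kerRes (fourierCoords (m w)) -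
    quartic kerOne (fourierCoords (m w)) + quartic kerOne (fourierCoords (τ w)) -
    quartic kerRes (fourierCoords w) with hR6
  have hsmall : ∀ w ∈ Metric.ball (0 : Ps s) ε, tameConst s 1 * ‖m w‖ₑ ^ 4 ≤ 1 := fun w hw => by
    have h1 := hm.norm_le w hw
    have h2 : ‖w‖ < ε := by simpa using hw
    have h3 : ‖m w‖ ≤ 2 * ε := by linarith
    rw [← ENNReal.ofReal_toReal (tameConst_ne_top (s := s) (A := 1) (by simp)), ← ht, ← ofReal_norm,
      ← ENNReal.ofReal_pow (norm_nonneg _), ← ENNReal.ofReal_mul ht0, ← ENNReal.ofReal_one]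
    refine ENNReal.ofReal_le_ofReal (le_trans ?_ htε)
    gcongr
  have hfin : ∀ w ∈ Metric.ball (0 : Ps s) ε, FiniteEnergy (fourierCoords w) →
      energyV absWeight (m w) ≠ ⊤ := fun w hw hE =>
    energyV_midpoint_ne_top kerChi hm hw (hsmall w hw) ((finiteEnergy_iff w).1 hE)
  have hclose : ∀ w ∈ Metric.ball (0 : Ps s) ε, ‖τ w - w‖ ≤ 24 * C * ‖w‖ ^ 3 :=
    fun w hw => hm.norm_midStep_sub_le hw
  have hnorm : ∀ w ∈ Metric.ball (0 : Ps s) ε, ‖τ w‖ ≤ 2 * ‖w‖ := fun w hw => by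
    have h1 : ‖w‖ < ε := by simpa using hw
    have h2 := hclose w hw
    have h3 : 24 * C * ‖w‖ ^ 2 ≤ 1 := by
      have h4 : ‖w‖ ^ 2 ≤ (δ / 4) ^ 2 :=
        pow_le_pow_left₀ (norm_nonneg _) (by linarith [hm.four_le]) 2
      have h5 := mul_le_mul_of_nonneg_left h4 hC0
      have := hm.small
      nlinarith
    have h6 : ‖τ w‖ ≤ ‖τ w - w‖ + ‖w‖ := by simpa using norm_add_le (τ w - w) w
    nlinarith [norm_nonneg w]
  have hgauge : ∀ θ : Fin 2 → ℂ, (∀ i, |(θ i).im| ≤ 1 / 2) → ∀ w ∈ Metric.ball (0 : Ps s) ε,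
      gauge θ w ∈ Metric.ball (0 : Ps s) ε →
      m (gauge θ w) = gauge θ (m w) ∧ τ (gauge θ w) = gauge θ (τ w) := fun θ hθ w hw hg =>
    midStep_equivariant hm (norm_gauge_le hθ) (fun c _ x => halfStep_gauge kerChi c θ x) hw hg
  have hnf : ∀ w ∈ Metric.ball (0 : Ps s) ε, FiniteEnergy (fourierCoords w) →
      P2 (fourierCoords (τ w)) + P4 (fourierCoords (τ w)) =
        P2 (fourierCoords w) + Z4 (fourierCoords w) + R6 w := fun w hw hE => by
    have := P2_midStep hm hw (hfin w hw hE)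
    rw [P4_eq, Z4_eq]
    simp only [hR6]
    linear_combination this
  have hK : 0 < 24 * C + K₁ + 1 := by positivity
  have hrem : ∀ w ∈ Metric.ball (0 : Ps s) ε, ‖G w‖ ≤ (24 * C + K₁ + 1) * ‖w‖ ^ 5 :=
    fun w hw => (hGle w hw).trans (by gcongr; linarith)
  have m0 : m 0 = 0 := by
    have := hm.norm_le 0 (by simpa using hε)
    simpa using this
  have τ0 : τ 0 = 0 := by
    have := hnorm 0 (by simpa using hε)
    simpa using this
  refine ⟨ε, 24 * C + K₁ + 1, τ, midStepT symJ T m, R6, G, hε, hK,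
    ⟨⟨⟨hm.contDiffOn_midStep.differentiableOn (by simp), hm.midStep_injOn,
      fun w hw => IsMidpoint.isInvertible_of_isUnit (hm.isUnit_fderiv_midStep hw)⟩,
      fun w hw => ?_, fun w hw hr => (isRealPs_midpoint hm hw hr).2, fun w hw h k => ?_,
      fun w hw => (hclose w hw).trans (by gcongr; linarith), fun w hw i => ?_, fun w hw => ?_,
      fun w hw hE => ?_, R6, G, hG.fn.differentiableOn (by simp), hG.grad.differentiableOn (by simp),
      fun w hw => ⟨fun k => ?_, hrem w hw⟩, hnf⟩, hm.contDiffOn_midStep, hnorm,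
      hm.contDiffOn_midStepT, fun w hw u k => hm.midStepT_spec (isCayleyData kerChi) hw u k,
      fun w hw u => hm.norm_midStepT_le hw u, fun θ hθ w hw hg => (hgauge θ hθ w hw hg).2, hG, ?_,
      hrem, fun θ hθ w hw hg => ?_, fun w hw hr => ?_, hnf⟩⟩
  · have := hnorm w hw
    simp only [Metric.mem_ball, dist_zero_right] at hw ⊢
    linarith
  · rw [omegaPs_eq, omegaPs_eq]
    exact hm.symplectic (isCayleyData kerChi) hw h k
  · rw [partialMass_eq_diag, partialMass_eq_diag]
    exact diag_midStep_of_weight hm (enorm_indicator_le i) (legs_mass i) hw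
  · rw [momentum_eq_diag, momentum_eq_diag]
    exact diag_midStep_of_weight hm enorm_index_le legs_momentum hw
  · rw [finiteEnergy_iff]
    have h1 := hfin w hw hE
    have h2 := energyV_field_le kerChi tameWeight_abs (m w)
    have h3 := energyV_add_smul_le absWeight (1 / 2) (m w) (field symJ T (m w))
    have h4 := tameConst_ne_top (s := s) (A := 1) (by simp)
    have h5 : energyV absWeight (field symJ T (m w)) ≠ ⊤ :=
      ne_top_of_le_ne_top (by finiteness) h2
    exact ne_top_of_le_ne_top (by finiteness) h3
  · rw [(hG.deriv w hw).fderiv, bil_apply]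
  · simp only [hR6, m0, τ0]; ring
  · obtain ⟨h1, h2⟩ := hgauge θ hθ w hw hg
    simp only [hR6, h1, h2, quartic_gauge]
  · obtain ⟨h1, h2⟩ := isRealPs_midpoint hm hw hr
    simp only [hR6, Complex.add_im, Complex.sub_im]
    rw [quartic_real kerRes_isHerm h1, quartic_real kerOne_isHerm h1, quartic_real kerOne_isHerm h2,
      quartic_real kerRes_isHerm hr]
    simp

end

noncomputable section

/-! ### A functional calculus for analytic functions of two variables -/

/-- The homogeneous parts of an analytic function that is small of order `m` vanish up to
degree `m`. -/
theorem diag_eq_zero_of_isLittleO {E : Type} [NormedAddCommGroup E] [NormedSpace ℂ E] {f : E → ℂ}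
    {p : FormalMultilinearSeries ℂ E ℂ} (hp : HasFPowerSeriesAt f p 0) {m : ℕ}
    (ho : f =o[𝓝 0] fun y => ‖y‖ ^ m) (n : ℕ) (hn : n ≤ m) (y : E) : p n (fun _ => y) = 0 := by
  induction n using Nat.strong_induction_on generalizing y with
  | _ n ih =>
  have h1 := hp.isBigO_sub_partialSum_pow (n + 1)
  have h2 : ∀ y, p.partialSum (n + 1) y = p n fun _ => y := fun y => by
    rw [FormalMultilinearSeries.partialSum, Finset.sum_range_succ, Finset.sum_eq_zero, zero_add]
    intro k hk
    have := Finset.mem_range.1 hk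
    exact ih k this (by omega) y
  simp only [zero_add, h2] at h1
  have h3 : (fun y : E => ‖y‖ ^ (n + 1)) =o[𝓝 0] fun y => ‖y‖ ^ n := by
    have : (fun y : E => ‖y‖) =o[𝓝 0] fun _ => (1 : ℝ) :=
      (isLittleO_one_iff ℝ).2 (by simpa using continuous_norm.tendsto (0 : E))
    simpa [pow_succ] using (isBigO_refl (fun y : E => ‖y‖ ^ n) (𝓝 0)).mul_isLittleO this
  have h4 : f =o[𝓝 0] fun y => ‖y‖ ^ n := by
    refine ho.trans_isBigO (IsBigO.of_bound 1 ?_)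
    filter_upwards [Metric.ball_mem_nhds (0 : E) one_pos] with y hy
    rw [one_mul, norm_pow, norm_pow, norm_norm]
    exact pow_le_pow_of_le_one (norm_nonneg _) (by simpa using (Metric.mem_ball.1 hy).le) hn
  have h5 : (fun y => p n fun _ => y) =o[𝓝 0] fun y => ‖y‖ ^ n := by
    have := h4.sub (h1.trans_isLittleO h3)
    simpa using this
  -- homogeneity along the line through `y`
  have h6 : Tendsto (fun t : ℂ => t • y) (𝓝[≠] 0) (𝓝 0) := by
    have : Tendsto (fun t : ℂ => t • y) (𝓝 0) (𝓝 ((0 : ℂ) • y)) :=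
      (continuous_id.smul continuous_const).tendsto 0
    rw [zero_smul] at this
    exact this.mono_left nhdsWithin_le_nhds
  have h7 := h5.comp_tendsto h6
  have h8 : ∀ c : ℝ, 0 < c → ‖p n fun _ => y‖ ≤ c * ‖y‖ ^ n := fun c hc => by
    obtain ⟨t, ht, ht0⟩ := ((h7.bound hc).and self_mem_nhdsWithin).exists
    have ht0' : t ≠ 0 := ht0
    simp only [Function.comp] at ht
    rw [(p n).map_smul_univ (fun _ => t) (fun _ => y)] at ht
    simp only [Finset.prod_const, Finset.card_univ, Fintype.card_fin, norm_smul, norm_pow,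
      mul_pow] at ht
    rw [Real.norm_of_nonneg (by positivity)] at ht
    have hpos : 0 < ‖t‖ ^ n := pow_pos (norm_pos_iff.2 ht0') n
    refine le_of_mul_le_mul_left ?_ hpos
    linarith
  have h9 : Tendsto (fun c : ℝ => c * ‖y‖ ^ n) (𝓝[>] 0) (𝓝 0) := by
    have : Tendsto (fun c : ℝ => c * ‖y‖ ^ n) (𝓝 0) (𝓝 (0 * ‖y‖ ^ n)) :=
      (continuous_id.mul continuous_const).tendsto 0
    rw [zero_mul] at this
    exact this.mono_left nhdsWithin_le_nhds
  have h10 : ‖p n fun _ => y‖ ≤ 0 := ge_of_tendsto h9 (by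
    filter_upwards [self_mem_nhdsWithin] with c hc using h8 c hc)
  exact norm_le_zero_iff.1 h10

section FunCalc

variable {V R : Type} [NormedAddCommGroup V] [NormedSpace ℂ V] [NormedRing R] [NormedAlgebra ℂ R]

/-- The unit vectors of `ℂ²`. -/
def unitVec (i : Fin 2) : ℂ × ℂ := ![(1, 0), (0, 1)] i

theorem norm_unitVec (i : Fin 2) : ‖unitVec i‖ = 1 := by
  fin_cases i <;> simp [unitVec, Prod.norm_def]

theorem sum_unitVec (ξ : Fin 2 → ℂ) : ∑ i, ξ i • unitVec i = (ξ 0, ξ 1) := by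
  simp [Fin.sum_univ_two, unitVec]

/-- The term of degree `n` of a power series in two commuting scalar variables, evaluated at two
elements of an algebra that depend linearly on a vector: the coefficient of a word in the two
variables multiplies the corresponding product. -/
def wordTerm (M : Fin 2 → V →L[ℂ] R) (p : FormalMultilinearSeries ℂ (ℂ × ℂ) ℂ) (n : ℕ) :
    V [×n]→L[ℂ] R :=
  ∑ S : Fin n → Fin 2, p n (fun i => unitVec (S i)) •
    (ContinuousMultilinearMap.mkPiAlgebraFin ℂ n R).compContinuousLinearMap fun i => M (S i)

theorem norm_wordTerm_le (M : Fin 2 → V →L[ℂ] R) (p : FormalMultilinearSeries ℂ (ℂ × ℂ) ℂ) (n : ℕ)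
    {B : ℝ} (hB : ∀ i, ‖M i‖ ≤ B) :
    ‖wordTerm M p n‖ ≤ max 1 ‖(1 : R)‖ * (‖p n‖ * (2 * B) ^ n) := by
  have hB0 : 0 ≤ B := (norm_nonneg _).trans (hB 0)
  refine (norm_sum_le _ _).trans ?_
  have : ∀ S ∈ (Finset.univ : Finset (Fin n → Fin 2)), ‖p n (fun i => unitVec (S i)) •
      (ContinuousMultilinearMap.mkPiAlgebraFin ℂ n R).compContinuousLinearMap fun i => M (S i)‖ ≤
      ‖p n‖ * (max 1 ‖(1 : R)‖ * B ^ n) := fun S _ => by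
    rw [norm_smul]
    gcongr
    · refine ((p n).le_opNorm _).trans ?_
      simp [norm_unitVec]
    · refine (ContinuousMultilinearMap.norm_compContinuousLinearMap_le _ _).trans ?_
      gcongr
      · exact ContinuousMultilinearMap.norm_mkPiAlgebraFin_le
      · refine (Finset.prod_le_prod (fun _ _ => norm_nonneg _) fun i _ => hB (S i)).trans ?_
        simp
  refine (Finset.sum_le_sum this).trans ?_
  simp only [Finset.sum_const, Finset.card_univ, Fintype.card_fun, Fintype.card_fin, nsmul_eq_mul]
  rw [mul_pow]
  push_cast
  exact le_of_eq (by ring)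

/-- A functional that is multiplicative along the elements `M i W` turns the polynomial of degree `n`
in these elements into its value at the scalars `ξ`. -/
theorem map_wordTerm (M : Fin 2 → V →L[ℂ] R) (p : FormalMultilinearSeries ℂ (ℂ × ℂ) ℂ) (n : ℕ)
    {W : V} {L : R →L[ℂ] ℂ} {ξ : Fin 2 → ℂ} (h1 : L 1 = 1)
    (hL : ∀ i B, L (M i W * B) = ξ i * L B) :
    L (wordTerm M p n fun _ => W) = p n fun _ => (ξ 0, ξ 1) := by
  have hlist : ∀ l : List (Fin 2), L ((l.map fun i => M i W).prod) = (l.map ξ).prod := fun l => by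
    induction l with
    | nil => simpa using h1
    | cons i l ih => rw [List.map_cons, List.prod_cons, hL, ih, List.map_cons, List.prod_cons]
  have e1 : (fun _ : Fin n => (ξ 0, ξ 1)) = fun i => ∑ j : Fin 2, ξ j • unitVec j := by
    funext; rw [sum_unitVec]
  rw [e1, (p n).map_sum]
  simp only [wordTerm, sum_apply, map_sum]
  refine Finset.sum_congr rfl fun S _ => ?_
  rw [(p n).map_smul_univ (fun i => ξ (S i)) (fun i => unitVec (S i))]
  rw [smul_apply, map_smul,
    ContinuousMultilinearMap.compContinuousLinearMap_apply,
    ContinuousMultilinearMap.mkPiAlgebraFin_apply]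
  have e2 : (List.ofFn fun i => M (S i) W) = (List.ofFn S).map fun i => M i W := by
    rw [List.map_ofFn]; rfl
  rw [e2, hlist, List.map_ofFn, List.prod_ofFn, smul_eq_mul, smul_eq_mul, mul_comm]
  rfl

/-- An analytic function of two variables can be evaluated at two elements of a Banach algebra,
compatibly with all functionals that are multiplicative along these elements. -/
theorem exists_funCalc [CompleteSpace R] (M : Fin 2 → V →L[ℂ] R) {f : ℂ × ℂ → ℂ}
    (hf : AnalyticAt ℂ f 0) {m : ℕ} (ho : f =o[𝓝 0] fun y => ‖y‖ ^ m) (C : ℝ) :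
    ∃ fA : V → R, AnalyticAt ℂ fA 0 ∧ (fA =O[𝓝 0] fun W => ‖W‖ ^ (m + 1)) ∧
      ∀ᶠ W in 𝓝 0, ∀ (L : R →L[ℂ] ℂ) (ξ : Fin 2 → ℂ), L 1 = 1 →
        (∀ i B, L (M i W * B) = ξ i * L B) → ‖(ξ 0, ξ 1)‖ ≤ C * ‖W‖ →
        L (fA W) = f (ξ 0, ξ 1) := by
  obtain ⟨p, hp⟩ := hf
  -- the terms of degree at most `m` vanish on the diagonal, but their multilinear versions need not
  set P : FormalMultilinearSeries ℂ V R := fun n => if n ≤ m then 0 else wordTerm M p n with hP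
  have hz := diag_eq_zero_of_isLittleO hp ho
  obtain ⟨r, hpr⟩ := hp
  have hp0 : 0 < p.radius := hpr.r_pos.trans_le hpr.r_le
  obtain ⟨c, a, hc, ha, hca⟩ := p.le_mul_pow_of_radius_pos hp0
  set B : ℝ := ‖M 0‖ + ‖M 1‖ + 1 with hB
  have hB0 : 0 < B := by positivity
  have hMB : ∀ i, ‖M i‖ ≤ B := fun i => by
    have := norm_nonneg (M 0)
    have := norm_nonneg (M 1)
    fin_cases i
    · change ‖M 0‖ ≤ B; linarith
    · change ‖M 1‖ ≤ B; linarith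
  set D : ℝ := max 1 ‖(1 : R)‖ * c with hD
  have hD0 : 0 ≤ D := by positivity
  have hPn : ∀ n, ‖P n‖ ≤ D * (2 * B * a) ^ n := fun n => by
    simp only [hP]
    split_ifs
    · rw [norm_zero]; positivity
    · refine (norm_wordTerm_le M p n hMB).trans ?_
      calc _ ≤ max 1 ‖(1 : R)‖ * (c * a ^ n * (2 * B) ^ n) := by gcongr; exact hca n
        _ = _ := by rw [mul_pow (2 * B) a]; ring
  have hrad : 0 < P.radius := by
    set t : NNReal := ⟨(2 * B * a)⁻¹, by positivity⟩ with ht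
    have ht0 : 0 < t := by
      rw [← NNReal.coe_pos]; change 0 < (2 * B * a)⁻¹; positivity
    refine (ENNReal.coe_pos.2 ht0).trans_le (P.le_radius_of_bound D fun n => ?_)
    calc ‖P n‖ * (t : ℝ) ^ n ≤ D * (2 * B * a) ^ n * ((2 * B * a)⁻¹) ^ n := by
          gcongr
          · exact hPn n
          · exact le_rfl
      _ = D := by
        rw [mul_assoc, ← mul_pow, mul_inv_cancel₀ (by positivity), one_pow, mul_one]
  have hPs := P.hasFPowerSeriesOnBall hrad
  refine ⟨P.sum, hPs.analyticAt, ?_, ?_⟩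
  · -- all terms of degree at most `m` have been dropped
    have h1 := hPs.hasFPowerSeriesAt.isBigO_sub_partialSum_pow (m + 1)
    have h2 : ∀ y, P.partialSum (m + 1) y = 0 := fun y => by
      rw [FormalMultilinearSeries.partialSum, Finset.sum_eq_zero]
      intro k hk
      have := Finset.mem_range.1 hk
      simp only [hP]
      rw [if_pos (by omega)]; rfl
    simpa [h2] using h1
  · have e1 : ∀ᶠ W : V in 𝓝 0, W ∈ Metric.eball (0 : V) P.radius :=
      Metric.eball_mem_nhds _ hrad
    have e2 : ∀ᶠ W : V in 𝓝 0, ENNReal.ofReal (C * ‖W‖) < r := by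
      have : Tendsto (fun W : V => ENNReal.ofReal (C * ‖W‖)) (𝓝 0) (𝓝 (ENNReal.ofReal (C * ‖(0 : V)‖))) :=
        (ENNReal.continuous_ofReal.comp (continuous_const.mul continuous_norm)).tendsto 0
      rw [norm_zero, mul_zero, ENNReal.ofReal_zero] at this
      exact this.eventually_lt_const hpr.r_pos
    filter_upwards [e1, e2] with W h1 h2 L ξ hL1 hL hξ
    have s1 := (hPs.hasSum h1).mapL L
    have hξr : (ξ 0, ξ 1) ∈ Metric.eball (0 : ℂ × ℂ) r := by
      rw [Metric.mem_eball, edist_zero_right, ← ofReal_norm]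
      exact (ENNReal.ofReal_le_ofReal hξ).trans_lt h2
    have s2 := hpr.hasSum hξr
    rw [zero_add] at s1 s2
    have key : ∀ n, L (P n fun _ => W) = p n fun _ => (ξ 0, ξ 1) := fun n => by
      change L ((if n ≤ m then 0 else wordTerm M p n) fun _ => W) = _
      split_ifs with hn
      · rw [hz n hn]; simp
      · exact map_wordTerm M p n hL1 hL
    rw [← funext key] at s2
    exact s1.unique s2

end FunCalc

/-- The derivative of a holomorphic function that is small of order two is small of order one. -/
theorem fderiv_isLittleO {E : Type} [NormedAddCommGroup E] [NormedSpace ℂ E] {f : E → ℂ}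
    (hf : AnalyticAt ℂ f 0) (ho : f =o[𝓝 0] fun y => ‖y‖ ^ 2) {e : E} (he : ‖e‖ ≤ 1) :
    (fun y => fderiv ℂ f y e) =o[𝓝 0] fun y => ‖y‖ ^ 1 := by
  have h0 : HasFDerivAt f (0 : E →L[ℂ] ℂ) 0 := by
    have f0 : f 0 = 0 := by
      have := (ho.bound one_pos).self_of_nhds
      simpa using this
    rw [hasFDerivAt_iff_isLittleO_nhds_zero]
    simp only [zero_add, f0, sub_zero, zero_apply]
    refine ho.trans_isBigO (IsBigO.of_bound 1 ?_)
    filter_upwards [Metric.ball_mem_nhds (0 : E) one_pos] with y hy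
    have hy' : ‖y‖ ≤ 1 := by simpa using (Metric.mem_ball.1 hy).le
    rw [one_mul, norm_pow, norm_norm]
    nlinarith [norm_nonneg y]
  refine isLittleO_iff.2 fun c hc => ?_
  have hc4 : 0 < c / 4 := by positivity
  obtain ⟨δ, hδ, hball⟩ := Metric.eventually_nhds_iff_ball.1
    ((ho.bound hc4).and hf.eventually_analyticAt)
  filter_upwards [Metric.ball_mem_nhds (0 : E) (half_pos hδ)] with y hy
  have hy' : ‖y‖ < δ / 2 := by simpa using hy
  rcases eq_or_ne y 0 with rfl | hy0
  · rw [h0.fderiv]; simp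
  have hpos : 0 < ‖y‖ := norm_pos_iff.2 hy0
  have hline : ∀ t : ℂ, ‖t‖ ≤ ‖y‖ → ‖y + t • e‖ ≤ 2 * ‖y‖ := fun t ht =>
    (norm_add_le _ _).trans (by
      rw [norm_smul]
      have := mul_le_mul ht he (norm_nonneg _) hpos.le
      linarith)
  have hmem : ∀ t : ℂ, ‖t‖ ≤ ‖y‖ → y + t • e ∈ Metric.ball (0 : E) δ := fun t ht => by
    have := hline t ht
    simp only [Metric.mem_ball, dist_zero_right]
    linarith
  have hd : ∀ t : ℂ, ‖t‖ ≤ ‖y‖ → DifferentiableAt ℂ (fun t : ℂ => f (y + t • e)) t := fun t ht =>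
    (hball _ (hmem t ht)).2.differentiableAt.comp t
      ((differentiableAt_const y).add (differentiableAt_id.smul_const e))
  have hder : deriv (fun t : ℂ => f (y + t • e)) 0 = fderiv ℂ f y e := by
    have hy2 : DifferentiableAt ℂ f (y + (0 : ℂ) • e) :=
      (hball _ (hmem 0 (by simp))).2.differentiableAt
    have h2 : HasDerivAt (fun t : ℂ => y + t • e) e 0 := by
      simpa using ((hasDerivAt_id (0 : ℂ)).smul_const e).const_add y
    have := (hy2.hasFDerivAt.comp_hasDerivAt (0 : ℂ) h2).deriv
    rw [zero_smul, add_zero] at this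
    exact this
  have hcauchy := Complex.norm_deriv_le_of_forall_mem_sphere_norm_le (c := 0)
    (f := fun t : ℂ => f (y + t • e)) (C := c / 4 * (2 * ‖y‖) ^ 2) hpos
    (DifferentiableOn.diffContOnCl fun t ht => by
      rw [closure_ball _ hpos.ne'] at ht
      exact (hd t (by simpa using ht)).differentiableWithinAt)
    (fun t ht => by
      have ht' : ‖t‖ ≤ ‖y‖ := by simpa using (Metric.mem_sphere.1 ht).le
      have := (hball _ (hmem t ht')).1
      rw [norm_pow, norm_norm] at this
      refine this.trans ?_
      gcongr
      exact hline t ht')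
  rw [hder] at hcauchy
  refine hcauchy.trans (le_of_eq ?_)
  rw [pow_one, norm_norm]
  field_simp
  ring

end

noncomputable section

/-! ### The convolution algebra -/

variable {s : ℝ} [Fact (1 / 2 < s)]

/-- The space of Fourier coefficients of functions on the circle. -/
abbrev Circ (s : ℝ) : Type := Wl2 ℤ intWeight s

theorem isLegs_conv (hs : 1 / 2 < s) : IsLegs (wt intWeight s)
    (fun q : ℤ × ℤ × ℤ => q.1 + q.2.1 + q.2.2) (fun q => q.1) (fun q => q.2.1) (fun q => q.2.2) := by
  refine ⟨?_, ?_, ?_, ?_, wt_ne_zero intWeight_pos s, wt_ne_top _ _, tsum_wt_intWeight_ne_top hs⟩ <;>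
  · rintro ⟨i, j, k⟩ ⟨i', j', k'⟩ h
    simp only [Prod.mk.injEq] at h ⊢
    omega

theorem isTame_conv (hs : 0 ≤ s) : IsTame (wt intWeight s) (ENNReal.ofReal (3 ^ s))
    (fun q : ℤ × ℤ × ℤ => q.1 + q.2.1 + q.2.2) (fun q => q.1) (fun q => q.2.1) (fun q => q.2.2) :=
  fun q => wt_intWeight_le hs (abs_add_three q.1 q.2.1 q.2.2)

variable (s) in
/-- The triple convolution, from which `conv` is obtained by fixing one factor at the unit. -/
theorem exists_conv3 : ∃ T : Circ s →L[ℂ] Circ s →L[ℂ] Circ s →L[ℂ] Circ s, ∀ x y z n,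
    (T x y z).coeff n = ∑' q : {q : ℤ × ℤ × ℤ // q.1 + q.2.1 + q.2.2 = n},
      1 * (x.coeff q.1.1 * y.coeff q.1.2.1 * z.coeff q.1.2.2) :=
  exists_triOp intWeight_pos (isLegs_conv (half_lt s)) ENNReal.ofReal_ne_top
    (isTame_conv (s_nonneg s)) (κ := fun _ => 1) fun _ => by simp

/-- The unit of the convolution algebra. -/
def convOne : Circ s := Wl2.basis 0

variable (s) in
/-- Convolution, the product of the corresponding functions. -/
def conv : Circ s →L[ℂ] Circ s →L[ℂ] Circ s := (exists_conv3 s).choose convOne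

theorem coeff_conv (u v : Circ s) (n : ℤ) :
    (conv s u v).coeff n = ∑' k, u.coeff (n - k) * v.coeff k := by
  have h := (exists_conv3 s).choose_spec convOne u v n
  have h' : (conv s u v).coeff n = _ := h
  rw [h']
  set i : ℤ → {q : ℤ × ℤ × ℤ // q.1 + q.2.1 + q.2.2 = n} := fun k => ⟨(0, n - k, k), by simp⟩ with hi
  have hinj : Function.Injective i := fun a b hab => by
    have := congrArg (fun q => q.1.2.2) hab
    exact this
  rw [← hinj.tsum_eq]
  · refine tsum_congr fun k => ?_
    have : (convOne : Circ s).coeff 0 = 1 := Wl2.coeff_basis_same intWeight_pos 0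
    simp only [hi, this, one_mul]
  · rintro ⟨⟨x, y, z⟩, hq⟩ hne
    simp only at hq
    have hx : x = 0 := by
      by_contra hx
      refine hne ?_
      have : (convOne : Circ s).coeff x = 0 := Wl2.coeff_basis_ne hx
      simp only [this, zero_mul, mul_zero]
    exact ⟨z, Subtype.ext (Prod.ext hx.symm (Prod.ext (by change n - z = y; omega) rfl))⟩

/-- The norm of evaluation at a point of the circle. -/
def evConst (s : ℝ) : ℝ := Real.sqrt (∑' j : ℤ, (wt intWeight s j)⁻¹ ^ 2).toReal

theorem tsum_enorm_coeff_le (u : Circ s) :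
    ∑' n, ‖u.coeff n‖ₑ ≤ ENNReal.ofReal (evConst s * ‖u‖) := by
  have h := Wl2.tsum_enorm_sq_le intWeight_pos u
  have hS := tsum_wt_intWeight_ne_top (half_lt s)
  refine (ENNReal.pow_le_pow_left_iff two_ne_zero).1 (h.trans (le_of_eq ?_))
  rw [← ENNReal.ofReal_pow (by unfold evConst; positivity), mul_pow, evConst,
    Real.sq_sqrt ENNReal.toReal_nonneg, ENNReal.ofReal_mul ENNReal.toReal_nonneg,
    ENNReal.ofReal_toReal hS, ENNReal.ofReal_pow (norm_nonneg _), ofReal_norm]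

theorem summable_norm_coeff (u : Circ s) : Summable fun n => ‖u.coeff n‖ := by
  have := ENNReal.summable_toReal
    (ne_top_of_le_ne_top ENNReal.ofReal_ne_top (tsum_enorm_coeff_le u))
  simpa using this

theorem tsum_norm_coeff_le (u : Circ s) : ∑' n, ‖u.coeff n‖ ≤ evConst s * ‖u‖ := by
  have h := ENNReal.toReal_mono ENNReal.ofReal_ne_top (tsum_enorm_coeff_le u)
  rw [ENNReal.tsum_toReal_eq (by simp), ENNReal.toReal_ofReal (by unfold evConst; positivity)] at h
  simpa using h

/-- The exponential `e^{inx}`. -/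
def expi (x : ℝ) (n : ℤ) : ℂ := Complex.exp (Complex.I * n * x)

theorem norm_expi (x : ℝ) (n : ℤ) : ‖expi x n‖ = 1 := by
  have : Complex.I * n * x = ((n * x : ℝ) : ℂ) * Complex.I := by push_cast; ring
  rw [expi, this, Complex.norm_exp_ofReal_mul_I]

theorem expi_add (x : ℝ) (m n : ℤ) : expi x (m + n) = expi x m * expi x n := by
  rw [expi, expi, expi, ← Complex.exp_add]; push_cast; ring_nf

theorem summable_ev (u : Circ s) (x : ℝ) : Summable fun n => ‖u.coeff n * expi x n‖ := by
  simpa [norm_expi] using summable_norm_coeff u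

theorem norm_tsum_ev_le (u : Circ s) (x : ℝ) :
    ‖∑' n, u.coeff n * expi x n‖ ≤ evConst s * ‖u‖ := by
  refine (norm_tsum_le_tsum_norm (summable_ev u x)).trans ?_
  refine le_trans (le_of_eq (tsum_congr fun n => ?_)) (tsum_norm_coeff_le u)
  rw [norm_mul, norm_expi, mul_one]

/-- Evaluation at a point of the circle. -/
def ev (x : ℝ) : Circ s →L[ℂ] ℂ :=
  LinearMap.mkContinuous
    { toFun := fun u => ∑' n, u.coeff n * expi x n
      map_add' := fun u v => by
        simp only [Wl2.coeff_add, add_mul]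
        exact (summable_ev u x).of_norm.tsum_add (summable_ev v x).of_norm
      map_smul' := fun c u => by
        simp only [Wl2.coeff_smul, mul_assoc, tsum_mul_left]; rfl } (evConst s)
    fun u => norm_tsum_ev_le u x

theorem ev_apply (x : ℝ) (u : Circ s) : ev x u = ∑' n, u.coeff n * expi x n := rfl

theorem norm_ev_le (x : ℝ) (u : Circ s) : ‖ev x u‖ ≤ evConst s * ‖u‖ := norm_tsum_ev_le u x

theorem ev_convOne (x : ℝ) : ev x (convOne : Circ s) = 1 := by
  rw [ev_apply, tsum_eq_single 0 fun n hn => by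
    rw [convOne, Wl2.coeff_basis_ne hn, zero_mul], convOne, Wl2.coeff_basis_same intWeight_pos]
  simp [expi]

theorem ev_conv (x : ℝ) (u v : Circ s) : ev x (conv s u v) = ev x u * ev x v := by
  set a : ℤ → ℂ := fun n => u.coeff n * expi x n with ha
  set b : ℤ → ℂ := fun n => v.coeff n * expi x n with hb
  have hs : Summable fun q : ℤ × ℤ => a q.1 * b q.2 :=
    summable_mul_of_summable_norm (summable_ev u x) (summable_ev v x)
  have hab : (∑' n, a n) * ∑' n, b n = ∑' q : ℤ × ℤ, a q.1 * b q.2 :=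
    tsum_mul_tsum_of_summable_norm (summable_ev u x) (summable_ev v x)
  set e : ℤ × ℤ ≃ ℤ × ℤ := ⟨fun q => (q.1 - q.2, q.2), fun q => (q.1 + q.2, q.2),
    fun q => by simp, fun q => by simp⟩ with he
  have hshear : ∑' q : ℤ × ℤ, a q.1 * b q.2 = ∑' n, ∑' k, a (n - k) * b k := by
    rw [← e.tsum_eq]
    exact Summable.tsum_prod ((e.summable_iff (f := fun q : ℤ × ℤ => a q.1 * b q.2)).2 hs)
  change _ = (∑' n, a n) * ∑' n, b n
  rw [hab, hshear, ev_apply]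
  refine tsum_congr fun n => ?_
  rw [coeff_conv, ← tsum_mul_right]
  refine tsum_congr fun k => ?_
  have := expi_add x (n - k) k
  rw [sub_add_cancel] at this
  simp only [ha, hb]
  rw [this]; ring

theorem integral_expi (n : ℤ) :
    ∫ x in (0 : ℝ)..(2 * Real.pi), expi x n = if n = 0 then 2 * (Real.pi : ℂ) else 0 := by
  split_ifs with h
  · subst h; simp [expi]
  · have hc : Complex.I * n ≠ 0 := mul_ne_zero Complex.I_ne_zero (by exact_mod_cast h)
    have := integral_exp_mul_complex (a := 0) (b := 2 * Real.pi) hc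
    simp only [expi]
    rw [this]
    have h2 : Complex.I * n * ((2 * Real.pi : ℝ) : ℂ) = n * (2 * Real.pi * Complex.I) := by
      push_cast; ring
    rw [h2, Complex.exp_int_mul_two_pi_mul_I]
    simp

/-- The Fourier coefficients are recovered from the values. -/
theorem coeff_eq_integral (u : Circ s) (n : ℤ) :
    u.coeff n = (1 / (2 * (Real.pi : ℂ))) * ∫ x in (0 : ℝ)..(2 * Real.pi), expi x (-n) * ev x u := by
  have hcont : ∀ k : ℤ, Continuous fun x : ℝ => u.coeff k * expi x (k - n) := fun k => by
    unfold expi; fun_prop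
  have h1 : ∀ x : ℝ, expi x (-n) * ev x u = ∑' k, u.coeff k * expi x (k - n) := fun x => by
    rw [ev_apply, ← tsum_mul_left]
    refine tsum_congr fun k => ?_
    rw [sub_eq_add_neg, expi_add]; ring
  have h2 := intervalIntegral.tsum_intervalIntegral_eq_of_summable_norm (a := 0)
    (b := 2 * Real.pi) (f := fun k : ℤ => (⟨_, hcont k⟩ : C(ℝ, ℂ))) (by
      refine Summable.of_nonneg_of_le (fun _ => norm_nonneg _) (fun k => ?_) (summable_norm_coeff u)
      refine (ContinuousMap.norm_le _ (norm_nonneg _)).2 fun x => ?_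
      simp [norm_expi])
  simp only [ContinuousMap.coe_mk] at h2
  simp only [h1]
  rw [← h2]
  have h3 : ∀ k, ∫ x in (0 : ℝ)..(2 * Real.pi), u.coeff k * expi x (k - n) =
      if k = n then u.coeff n * (2 * (Real.pi : ℂ)) else 0 := fun k => by
    rw [intervalIntegral.integral_const_mul, integral_expi]
    by_cases h : k = n
    · subst h; simp
    · rw [if_neg (sub_ne_zero.2 h), if_neg h, mul_zero]
  simp only [h3, tsum_ite_eq]
  have : (Real.pi : ℂ) ≠ 0 := by exact_mod_cast Real.pi_ne_zero
  field_simp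

theorem ext_ev {u v : Circ s} (h : ∀ x, ev x u = ev x v) : u = v :=
  Wl2.ext_coeff intWeight_pos fun n => by
    rw [coeff_eq_integral, coeff_eq_integral v]; simp only [h]

/-- Evaluation of an analytic function of two variables at two functions on the circle. -/
theorem exists_circ_funCalc {f : ℂ × ℂ → ℂ} (hf : AnalyticAt ℂ f 0) {m : ℕ}
    (ho : f =o[𝓝 0] fun y => ‖y‖ ^ m) :
    ∃ fA : Circ s × Circ s → Circ s, AnalyticAt ℂ fA 0 ∧
      (fA =O[𝓝 0] fun W => ‖W‖ ^ (m + 1)) ∧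
      ∀ᶠ W in 𝓝 0, ∀ x, ev x (fA W) = f (ev x W.1, ev x W.2) := by
  -- the Banach algebra is that of the operators on `Circ s`, in which a function acts by convolution
  set M : Fin 2 → (Circ s × Circ s) →L[ℂ] (Circ s →L[ℂ] Circ s) :=
    ![(conv s).comp (ContinuousLinearMap.fst ℂ _ _), (conv s).comp (ContinuousLinearMap.snd ℂ _ _)]
    with hM
  obtain ⟨fA, h1, h2, h3⟩ := exists_funCalc M hf ho (evConst s)
  set E : (Circ s →L[ℂ] Circ s) →L[ℂ] Circ s := ContinuousLinearMap.apply ℂ (Circ s) convOne with hE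
  refine ⟨fun W => E (fA W), E.analyticAt _ |>.comp h1, ?_, ?_⟩
  · exact (E.isBigO_comp fA (𝓝 0)).trans h2
  · filter_upwards [h3] with W hW x
    have := hW ((ev x).comp E) ![ev x W.1, ev x W.2] (ev_convOne x) (fun i B => ?_) ?_
    · exact this
    · fin_cases i
      · exact ev_conv x W.1 (B convOne)
      · exact ev_conv x W.2 (B convOne)
    · have h0 : 0 ≤ evConst s := Real.sqrt_nonneg _
      refine max_le ((norm_ev_le x W.1).trans ?_) ((norm_ev_le x W.2).trans ?_)
      · gcongr; exact norm_fst_le W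
      · gcongr; exact norm_snd_le W

end

noncomputable section

open scoped ContDiff

variable {s : ℝ} [Fact (1 / 2 < s)]

/-! ### The mean of the nonlinearity -/

theorem exists_slot (i : Fin 2) : ∃ L : Hs s →L[ℂ] Circ s,
    ∀ u j, (L u).coeff j = u.coeff (j, i) := by
  have hinj : Function.Injective fun j : ℤ => ((j, i) : Mode) := fun a b h => by simpa using h
  obtain ⟨L, hL, -⟩ := Wl2.exists_clm (s := s) (t := s) fourierWeight_pos intWeight_pos
    (LinearMap.pi fun j : ℤ => LinearMap.proj ((j, i) : Mode)) (C := 1) zero_le_one fun c => by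
      rw [ENNReal.ofReal_one, one_pow, one_mul]
      exact tsum_comp_le_of_injective hinj fun m => (wt fourierWeight s m * ‖c m‖ₑ) ^ 2
  exact ⟨L, fun u j => hL u j⟩

/-- The Fourier coefficients of one species. -/
def slot (i : Fin 2) : Hs s →L[ℂ] Circ s := (exists_slot i).choose

theorem coeff_slot (i : Fin 2) (u : Hs s) (j : ℤ) : (slot i u).coeff j = u.coeff (j, i) :=
  (exists_slot i).choose_spec u j

theorem exists_unslot (i : Fin 2) : ∃ L : Circ s →L[ℂ] Hs s,
    ∀ u m, (L u).coeff m = if m.2 = i then u.coeff m.1 else 0 := by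
  have hinj : Function.Injective fun j : ℤ => ((j, i) : Mode) := fun a b h => by simpa using h
  obtain ⟨L, hL, -⟩ := Wl2.exists_clm (s := s) (t := s) intWeight_pos fourierWeight_pos
    (LinearMap.pi fun m : Mode => if m.2 = i then LinearMap.proj m.1 else 0) (C := 1)
    zero_le_one fun c => by
      rw [ENNReal.ofReal_one, one_pow, one_mul, sqNorm, ← hinj.tsum_eq]
      · refine le_of_eq (tsum_congr fun j => ?_)
        simp only [LinearMap.pi_apply, if_true]
        rfl
      · intro m hm
        by_cases h : m.2 = i
        · exact ⟨m.1, by rw [← h]⟩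
        · simp [h] at hm
  refine ⟨L, fun u m => ?_⟩
  rw [hL]
  simp only [LinearMap.pi_apply]
  split_ifs <;> simp

/-- The inclusion of one species, the transpose of `slot`. -/
def unslot (i : Fin 2) : Circ s →L[ℂ] Hs s := (exists_unslot i).choose

theorem coeff_unslot (i : Fin 2) (u : Circ s) (m : Mode) :
    (unslot i u).coeff m = if m.2 = i then u.coeff m.1 else 0 :=
  (exists_unslot i).choose_spec u m

theorem intWeight_neg (j : ℤ) : intWeight (-j) = intWeight j := by simp [intWeight]

variable (s) in
theorem exists_reflect : ∃ L : Circ s →L[ℂ] Circ s, ∀ u j, (L u).coeff j = u.coeff (-j) := by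
  obtain ⟨L, hL, -⟩ := Wl2.exists_clm (s := s) (t := s) intWeight_pos intWeight_pos
    (LinearMap.pi fun j : ℤ => LinearMap.proj (-j)) (C := 1) zero_le_one fun c => by
      rw [ENNReal.ofReal_one, one_pow, one_mul, sqNorm, ← (Equiv.neg ℤ).tsum_eq]
      refine le_of_eq (tsum_congr fun j => ?_)
      simp [wt, intWeight_neg]
  exact ⟨L, fun u j => hL u j⟩

/-- Reflection `x ↦ -x` of functions on the circle. -/
def reflect : Circ s →L[ℂ] Circ s := (exists_reflect s).choose

theorem coeff_reflect (u : Circ s) (j : ℤ) : (reflect u).coeff j = u.coeff (-j) :=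
  (exists_reflect s).choose_spec u j

theorem ev_slot (i : Fin 2) (u : Hs s) (x : ℝ) :
    ev x (slot i u) = fourierSeries (fun j => u.coeff (j, i)) x := by
  simp only [ev_apply, coeff_slot]; rfl

theorem ev_reflect_slot (i : Fin 2) (u : Hs s) (x : ℝ) :
    ev x (reflect (slot i u)) = fourierSeriesBar (fun j => u.coeff (j, i)) x := by
  simp only [ev_apply, coeff_reflect, coeff_slot]
  rw [← (Equiv.neg ℤ).tsum_eq]
  refine tsum_congr fun j => ?_
  simp only [Equiv.neg_apply, neg_neg, expi]
  congr 2
  push_cast; ring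

theorem unslot_pair (i : Fin 2) (u : Circ s) (h : Hs s) :
    (unslot i u).pair h = ∑' j, u.coeff j * h.coeff (j, i) := by
  have hinj : Function.Injective fun j : ℤ => ((j, i) : Mode) := fun a b h => by simpa using h
  rw [Wl2.pair, ← hinj.tsum_eq]
  · simp [coeff_unslot]
  · intro m hm
    by_cases h : m.2 = i
    · exact ⟨m.1, by rw [← h]⟩
    · simp [h, coeff_unslot] at hm

theorem coeff_zero_conv_slot (i : Fin 2) (u : Circ s) (h : Hs s) :
    (conv s u (slot i h)).coeff 0 = (unslot i (reflect u)).pair h := by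
  rw [coeff_conv, unslot_pair]
  simp [coeff_slot, coeff_reflect]

theorem coeff_zero_conv_reflect_slot (i : Fin 2) (u : Circ s) (h : Hs s) :
    (conv s u (reflect (slot i h))).coeff 0 = (unslot i u).pair h := by
  rw [coeff_conv, unslot_pair, ← (Equiv.neg ℤ).tsum_eq]
  simp [coeff_slot, coeff_reflect]

/-- The pair of densities `(|u|², |v|²)`. -/
def density (w : Ps s) : Circ s × Circ s :=
  (conv s (slot 0 w.1) (reflect (slot 0 w.2)), conv s (slot 1 w.1) (reflect (slot 1 w.2)))

theorem contDiff_density {n : WithTop ℕ∞} : ContDiff ℂ n (density (s := s)) := by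
  have h : ∀ i : Fin 2, ContDiff ℂ n fun w : Ps s => conv s (slot i w.1) (reflect (slot i w.2)) :=
    fun i => (((conv s).comp (slot i)).contDiff.comp contDiff_fst).clm_apply
      ((reflect.comp (slot i)).contDiff.comp contDiff_snd)
  exact (h 0).prodMk (h 1)

theorem hasFDerivAt_density (w : Ps s) : ∃ D : Ps s →L[ℂ] Circ s × Circ s,
    HasFDerivAt density D w ∧ ∀ h, D h =
      (conv s (slot 0 w.1) (reflect (slot 0 h.2)) + conv s (slot 0 h.1) (reflect (slot 0 w.2)),
        conv s (slot 1 w.1) (reflect (slot 1 h.2)) + conv s (slot 1 h.1) (reflect (slot 1 w.2))) := by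
  have h : ∀ i : Fin 2, ∃ D : Ps s →L[ℂ] Circ s,
      HasFDerivAt (fun w : Ps s => conv s (slot i w.1) (reflect (slot i w.2))) D w ∧
      ∀ h, D h = conv s (slot i w.1) (reflect (slot i h.2)) +
        conv s (slot i h.1) (reflect (slot i w.2)) := fun i => by
    have h1 : HasFDerivAt (fun w : Ps s => conv s (slot i w.1))
        (((conv s).comp (slot i)).comp (ContinuousLinearMap.fst ℂ _ _)) w :=
      (((conv s).comp (slot i)).comp (ContinuousLinearMap.fst ℂ (Hs s) (Hs s))).hasFDerivAt
    have h2 : HasFDerivAt (fun w : Ps s => reflect (slot i w.2))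
        ((reflect.comp (slot i)).comp (ContinuousLinearMap.snd ℂ _ _)) w :=
      ((reflect.comp (slot i)).comp (ContinuousLinearMap.snd ℂ (Hs s) (Hs s))).hasFDerivAt
    exact ⟨_, h1.clm_apply h2, fun h => by simp⟩
  obtain ⟨D0, h0, e0⟩ := h 0
  obtain ⟨D1, h1, e1⟩ := h 1
  exact ⟨D0.prod D1, h0.prodMk h1, fun h => by rw [← e0, ← e1]; rfl⟩

variable (s) in
theorem exists_norm_density_le : ∃ C : ℝ, 0 ≤ C ∧ ∀ w : Ps s, ‖density w‖ ≤ C * ‖w‖ ^ 2 := by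
  have h : ∀ i : Fin 2, ∀ w : Ps s, ‖conv s (slot i w.1) (reflect (slot i w.2))‖ ≤
      ‖conv s‖ * (‖slot (s := s) i‖ * (‖reflect (s := s)‖ * ‖slot (s := s) i‖)) * ‖w‖ ^ 2 :=
    fun i w => by
    refine ((conv s).le_opNorm₂ _ _).trans ?_
    have h1 : ‖slot i w.1‖ ≤ ‖slot (s := s) i‖ * ‖w‖ :=
      ((slot i).le_opNorm _).trans (by gcongr; exact norm_fst_le w)
    have h2 : ‖reflect (slot i w.2)‖ ≤ ‖reflect (s := s)‖ * (‖slot (s := s) i‖ * ‖w‖) :=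
      (reflect.le_opNorm _).trans (by
        gcongr
        exact ((slot i).le_opNorm _).trans (by gcongr; exact norm_snd_le w))
    calc _ ≤ ‖conv s‖ * (‖slot (s := s) i‖ * ‖w‖) *
          (‖reflect (s := s)‖ * (‖slot (s := s) i‖ * ‖w‖)) := by gcongr
      _ = _ := by ring
  refine ⟨‖conv s‖ * (‖slot (s := s) 0‖ * (‖reflect (s := s)‖ * ‖slot (s := s) 0‖)) +
    ‖conv s‖ * (‖slot (s := s) 1‖ * (‖reflect (s := s)‖ * ‖slot (s := s) 1‖)), by positivity,
    fun w => ?_⟩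
  rw [add_mul]
  exact max_le ((h 0 w).trans (le_add_of_nonneg_right (by positivity)))
    ((h 1 w).trans (le_add_of_nonneg_left (by positivity)))

theorem R5_eq (F : ℂ × ℂ → ℂ) (w : Ps s) : R5 F (fourierCoords w) = (1 / (2 * (Real.pi : ℂ))) *
    ∫ x in (0 : ℝ)..(2 * Real.pi), F (ev x (density w).1, ev x (density w).2) := by
  simp only [density, ev_conv, ev_slot, ev_reflect_slot]
  rfl

/-- The nonlinearity only sees products in which the phases cancel. -/
theorem R5_gauge (F : ℂ × ℂ → ℂ) (θ : Fin 2 → ℂ) (w : Ps s) :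
    R5 F (fourierCoords (gauge θ w)) = R5 F (fourierCoords w) := by
  have e1 : ∀ i x, fourierSeries (fun j => (gauge θ w).1.coeff (j, i)) x =
      cis θ i * fourierSeries (fun j => w.1.coeff (j, i)) x := fun i x => by
    simp only [fourierSeries, gauge, coeff_phase, mul_assoc, tsum_mul_left]
  have e2 : ∀ i x, fourierSeriesBar (fun j => (gauge θ w).2.coeff (j, i)) x =
      cis (-θ) i * fourierSeriesBar (fun j => w.2.coeff (j, i)) x := fun i x => by
    simp only [fourierSeriesBar, gauge, coeff_phase, mul_assoc, tsum_mul_left]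
  have e3 : ∀ (i : Fin 2) (a b : ℂ), cis θ i * a * (cis (-θ) i * b) = a * b := fun i a b => by
    linear_combination a * b * cis_mul_neg θ i
  simp only [R5, nonlin, fourierCoords, e1, e2, e3]

theorem conj_fourierSeries (c : ℤ → ℂ) (x : ℝ) :
    conj (fourierSeries c x) = fourierSeriesBar (fun j => conj (c j)) x := by
  rw [fourierSeries, fourierSeriesBar, Complex.conj_tsum]
  refine tsum_congr fun j => ?_
  rw [map_mul, ← Complex.exp_conj]
  congr 2
  simp

/-- Vanishing to order five in the four arguments means order more than two in the densities. -/
theorem isLittleO_of_nonlin {F : ℂ × ℂ → ℂ}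
    (h : (fun z : ℂ × ℂ × ℂ × ℂ => nonlin F z.1 z.2.1 z.2.2.1 z.2.2.2) =O[𝓝 0] fun z => ‖z‖ ^ 5) :
    F =o[𝓝 0] fun ξ => ‖ξ‖ ^ 2 := by
  -- a density is attained at equal arguments, its square roots
  choose q hq using fun ξ : ℂ => IsAlgClosed.exists_pow_nat_eq ξ two_pos
  set Z : ℂ × ℂ → ℂ × ℂ × ℂ × ℂ := fun ξ => (q ξ.1, q ξ.1, q ξ.2, q ξ.2) with hZ
  have hn : ∀ ξ, ‖q ξ‖ = Real.sqrt ‖ξ‖ := fun ξ => by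
    rw [← Real.sqrt_sq (norm_nonneg (q ξ)), ← norm_pow, hq]
  have hZn : ∀ ξ, ‖Z ξ‖ = Real.sqrt ‖ξ‖ := fun ξ => by
    have : Real.sqrt (max ‖ξ.1‖ ‖ξ.2‖) = max (Real.sqrt ‖ξ.1‖) (Real.sqrt ‖ξ.2‖) :=
      Monotone.map_max fun a b h => Real.sqrt_le_sqrt h
    rw [Prod.norm_def ξ, this]
    simp only [hZ, Prod.norm_def, hn]
    simp
  have hZ0 : Tendsto Z (𝓝 0) (𝓝 0) := by
    rw [tendsto_zero_iff_norm_tendsto_zero]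
    simp only [hZn]
    have : Tendsto (fun ξ : ℂ × ℂ => Real.sqrt ‖ξ‖) (𝓝 0) (𝓝 (Real.sqrt ‖(0 : ℂ × ℂ)‖)) :=
      (Real.continuous_sqrt.comp continuous_norm).tendsto 0
    simpa using this
  have h1 := h.comp_tendsto hZ0
  have h2 : ((fun z : ℂ × ℂ × ℂ × ℂ => nonlin F z.1 z.2.1 z.2.2.1 z.2.2.2) ∘ Z) = F := by
    funext ξ
    simp only [Function.comp, nonlin, hZ]
    rw [← sq, ← sq, hq, hq]
  rw [h2] at h1
  have h3 : ((fun z : ℂ × ℂ × ℂ × ℂ => ‖z‖ ^ 5) ∘ Z) = fun ξ => ‖Z ξ‖ * ‖ξ‖ ^ 2 := by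
    funext ξ
    have h4 : ‖Z ξ‖ ^ 2 = ‖ξ‖ := by rw [hZn, Real.sq_sqrt (norm_nonneg _)]
    simp only [Function.comp]
    rw [← h4]; ring
  rw [h3] at h1
  refine h1.trans_isLittleO ?_
  have h4 : (fun ξ => ‖Z ξ‖) =o[𝓝 0] fun _ => (1 : ℝ) :=
    (isLittleO_one_iff ℝ).2 (by simpa using hZ0.norm)
  simpa using h4.mul_isBigO (isBigO_refl (fun ξ : ℂ × ℂ => ‖ξ‖ ^ 2) (𝓝 0))

variable (s) in
/-- Near the origin the mean of the nonlinearity is analytic, with an analytic gradient of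
order five. -/
theorem exists_R5_grad {F : ℂ × ℂ → ℂ} (hF : AnalyticAt ℂ F 0)
    (hFreal : ∀ᶠ w : ℂ × ℂ in 𝓝 0, (nonlin F w.1 (conj w.1) w.2 (conj w.2)).im = 0)
    (hForder : (fun z : ℂ × ℂ × ℂ × ℂ => nonlin F z.1 z.2.1 z.2.2.1 z.2.2.2)
      =O[𝓝 0] fun z => ‖z‖ ^ 5) :
    ∃ (r K : ℝ) (G : Ps s → Ps s), 0 < r ∧ 0 ≤ K ∧
      HasGradOn bil (fun w => R5 F (fourierCoords w)) G (Metric.ball 0 r) ∧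
      (∀ w ∈ Metric.ball (0 : Ps s) r, ‖G w‖ ≤ K * ‖w‖ ^ 5) ∧ R5 F (fourierCoords (0 : Ps s)) = 0 ∧
      ∀ w ∈ Metric.ball (0 : Ps s) r, IsRealPs w → (R5 F (fourierCoords w)).im = 0 := by
  have ho := isLittleO_of_nonlin hForder
  have hFi : ∀ i, AnalyticAt ℂ (fun ξ => fderiv ℂ F ξ (unitVec i)) 0 := fun i =>
    (ContinuousLinearMap.apply ℂ ℂ (unitVec i)).analyticAt _ |>.comp hF.fderiv
  have hoi := fun i => fderiv_isLittleO hF ho (norm_unitVec i).le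
  obtain ⟨FA, hA1, -, hA3⟩ := exists_circ_funCalc (s := s) hF ho
  choose Φ hΦ1 hΦ2 hΦ3 using fun i => exists_circ_funCalc (s := s) (hFi i) (hoi i)
  obtain ⟨C, hC, hdens⟩ := exists_norm_density_le s
  obtain ⟨c0, hc0, hb0⟩ := (hΦ2 0).exists_pos
  obtain ⟨c1, hc1, hb1⟩ := (hΦ2 1).exists_pos
  rw [IsBigOWith] at hb0 hb1
  have hd0 : density (0 : Ps s) = 0 := by
    have := hdens 0
    simpa using this
  have hdt : Tendsto (density (s := s)) (𝓝 0) (𝓝 0) := by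
    have := (contDiff_density (s := s) (n := 0)).continuous.tendsto 0
    rwa [hd0] at this
  -- a neighbourhood of the origin on which all expansions converge
  have hev : ∀ᶠ ξ in 𝓝 (0 : ℂ × ℂ), AnalyticAt ℂ F ξ := hF.eventually_analyticAt
  obtain ⟨δ, hδ, hδball⟩ := Metric.eventually_nhds_iff_ball.1 hev
  obtain ⟨δr, hδr, hδrball⟩ := Metric.eventually_nhds_iff_ball.1 hFreal
  have hsmall : ∀ᶠ W in 𝓝 (0 : Circ s × Circ s), evConst s * ‖W‖ < δ := by
    have : Tendsto (fun W : Circ s × Circ s => evConst s * ‖W‖) (𝓝 0) (𝓝 (evConst s * ‖(0 : Circ s × Circ s)‖)) :=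
      (continuous_const.mul continuous_norm).tendsto 0
    rw [norm_zero, mul_zero] at this
    exact this.eventually_lt_const hδ
  have hall := (hA1.eventually_analyticAt.and (hA3.eventually_nhds.and
    (((hΦ1 0).eventually_analyticAt.and (hΦ3 0)).and
    (((hΦ1 1).eventually_analyticAt.and (hΦ3 1)).and (hb0.and (hb1.and hsmall))))))
  have hreal : ∀ᶠ w in 𝓝 (0 : Ps s), evConst s * (‖slot (s := s) 0‖ + ‖slot (s := s) 1‖) * ‖w‖ < δr := by
    have : Tendsto (fun w : Ps s => evConst s * (‖slot (s := s) 0‖ + ‖slot (s := s) 1‖) * ‖w‖) (𝓝 0)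
        (𝓝 (evConst s * (‖slot (s := s) 0‖ + ‖slot (s := s) 1‖) * ‖(0 : Ps s)‖)) :=
      (continuous_const.mul continuous_norm).tendsto 0
    rw [norm_zero, mul_zero] at this
    exact this.eventually_lt_const hδr
  obtain ⟨r, hr, hball⟩ := Metric.eventually_nhds_iff_ball.1 ((hdt.eventually hall).and hreal)
  set G : Ps s → Ps s := fun w =>
    (unslot 0 (reflect (conv s (Φ 0 (density w)) (reflect (slot 0 w.2)))) +
      unslot 1 (reflect (conv s (Φ 1 (density w)) (reflect (slot 1 w.2)))),
     unslot 0 (conv s (Φ 0 (density w)) (slot 0 w.1)) +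
      unslot 1 (conv s (Φ 1 (density w)) (slot 1 w.1))) with hG
  set D : Fin 2 → ℝ := fun i => ‖unslot (s := s) i‖ * ((‖reflect (s := s)‖ + 1) *
    (‖conv s‖ * ((c0 + c1) * C ^ 2 * ((‖reflect (s := s)‖ + 1) * ‖slot (s := s) i‖)))) with hD
  have hfn : ∀ w ∈ Metric.ball (0 : Ps s) r, R5 F (fourierCoords w) = (FA (density w)).coeff 0 := by
    intro w hw
    obtain ⟨⟨-, h2, -⟩, -⟩ := hball w hw
    rw [R5_eq, coeff_eq_integral]
    have h3 := h2.self_of_nhds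
    simp only [← h3]
    congr 2; ext x
    simp [expi]
  refine ⟨r, D 0 + D 1, G, hr, by positivity, ⟨?_, ?_, ?_⟩, ?_, ?_, ?_⟩
  · have h1 : ContDiffOn ℂ ω (fun w : Ps s => Wl2.coeffL intWeight_pos 0 (FA (density w)))
        (Metric.ball 0 r) := by
      intro w hw
      obtain ⟨⟨h1, -⟩, -⟩ := hball w hw
      exact ((Wl2.coeffL intWeight_pos 0).contDiff.contDiffAt.comp w
        (h1.contDiffAt.comp w contDiff_density.contDiffAt)).contDiffWithinAt
    exact h1.congr hfn
  · intro w hw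
    obtain ⟨⟨-, -, ⟨h1, -⟩, ⟨h2, -⟩, -⟩, -⟩ := hball w hw
    have e : ∀ i, AnalyticAt ℂ (Φ i) (density w) → ContDiffAt ℂ ω (fun w => conv s (Φ i (density w))) w :=
      fun i h => (conv s).contDiff.contDiffAt.comp w (h.contDiffAt.comp w contDiff_density.contDiffAt)
    have e1 : ∀ i, AnalyticAt ℂ (Φ i) (density w) → ContDiffAt ℂ ω
        (fun w : Ps s => unslot i (reflect (conv s (Φ i (density w)) (reflect (slot i w.2))))) w :=
      fun i h => ((unslot i).comp reflect).contDiff.contDiffAt.comp w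
        ((e i h).clm_apply ((reflect.comp (slot i)).contDiff.comp contDiff_snd).contDiffAt)
    have e2 : ∀ i, AnalyticAt ℂ (Φ i) (density w) → ContDiffAt ℂ ω
        (fun w : Ps s => unslot i (conv s (Φ i (density w)) (slot i w.1))) w :=
      fun i h => (unslot i).contDiff.contDiffAt.comp w
        ((e i h).clm_apply ((slot i).contDiff.comp contDiff_fst).contDiffAt)
    exact (((e1 0 h1).add (e1 1 h2)).prodMk ((e2 0 h1).add (e2 1 h2))).contDiffWithinAt
  · intro w hw
    obtain ⟨⟨h1, h2, ⟨-, h3⟩, ⟨-, h4⟩, -, -, h5⟩, -⟩ := hball w hw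
    -- the derivative of the composition with `F`, read off at the points of the circle
    have key : ∀ V, fderiv ℂ FA (density w) V =
        conv s (Φ 0 (density w)) V.1 + conv s (Φ 1 (density w)) V.2 := fun V => by
      refine ext_ev fun x => ?_
      have hx : (ev x (density w).1, ev x (density w).2) ∈ Metric.ball (0 : ℂ × ℂ) δ := by
        rw [mem_ball_zero_iff]
        have h0 : 0 ≤ evConst s := Real.sqrt_nonneg _
        refine lt_of_le_of_lt (max_le ((norm_ev_le x _).trans ?_) ((norm_ev_le x _).trans ?_)) h5
        · gcongr; exact norm_fst_le _
        · gcongr; exact norm_snd_le _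
      have d1 := (ev x).hasFDerivAt.comp (density w) h1.differentiableAt.hasFDerivAt
      have d2 := (hδball _ hx).differentiableAt.hasFDerivAt.comp (density w)
        (f := fun W : Circ s × Circ s => (ev x W.1, ev x W.2))
        (((ev x).prodMap (ev x)).hasFDerivAt (x := density w))
      have d3 : (ev x ∘ FA) =ᶠ[𝓝 (density w)] F ∘ fun W : Circ s × Circ s => (ev x W.1, ev x W.2) := by
        filter_upwards [h2] with W hW using hW x
      have d4 := (d2.congr_of_eventuallyEq d3).unique d1
      have d5 := congrArg (fun A : Circ s × Circ s →L[ℂ] ℂ => A V) d4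
      have d6 : ev x (fderiv ℂ FA (density w) V) =
          fderiv ℂ F (ev x (density w).1, ev x (density w).2) (ev x V.1, ev x V.2) := d5.symm
      have d7 : (ev x V.1, ev x V.2) = ev x V.1 • unitVec 0 + ev x V.2 • unitVec 1 := by
        simp [unitVec]
      rw [d6, d7, map_add, map_smul, map_smul, map_add, ev_conv, ev_conv, h3 x, h4 x]
      simp only [smul_eq_mul]
      ring
    obtain ⟨Dd, hDd, hDd'⟩ := hasFDerivAt_density w
    have hcomp := (Wl2.coeffL (s := s) intWeight_pos 0).hasFDerivAt.comp w
      (h1.differentiableAt.hasFDerivAt.comp w hDd)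
    have heq : (fun w => R5 F (fourierCoords w)) =ᶠ[𝓝 w]
        (Wl2.coeffL (s := s) intWeight_pos 0) ∘ (FA ∘ density) := by
      filter_upwards [Metric.isOpen_ball.mem_nhds hw] with x hx using hfn x hx
    have hfd := hcomp.congr_of_eventuallyEq heq
    have hconv : ∀ a b c : Circ s, conv s a (conv s b c) = conv s (conv s a c) b := fun a b c =>
      ext_ev fun x => by simp only [ev_conv]; ring
    have hconv' : ∀ a b c : Circ s, conv s a (conv s b c) = conv s (conv s a b) c := fun a b c =>
      ext_ev fun x => by simp only [ev_conv]; ring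
    suffices h : bil (G w) = (Wl2.coeffL (s := s) intWeight_pos 0).comp
        ((fderiv ℂ FA (density w)).comp Dd) by rw [h]; exact hfd
    refine ContinuousLinearMap.ext fun h => ?_
    rw [ContinuousLinearMap.comp_apply, ContinuousLinearMap.comp_apply, hDd', key,
      Wl2.coeffL_apply, Wl2.coeff_add, map_add, map_add, Wl2.coeff_add, Wl2.coeff_add,
      hconv' _ _ (reflect (slot 0 h.2)), hconv' _ _ (reflect (slot 1 h.2)), hconv _ (slot 0 h.1),
      hconv _ (slot 1 h.1), coeff_zero_conv_reflect_slot, coeff_zero_conv_reflect_slot,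
      coeff_zero_conv_slot, coeff_zero_conv_slot, bil_apply]
    simp only [hG]
    have padd : ∀ a b c : Hs s, (a + b).pair c = a.pair c + b.pair c := fun a b c => by
      simp only [← Wl2.pairL_apply one_le_fourierWeight (s_nonneg s), map_add, add_apply]
    rw [padd, padd]
    ring
  · intro w hw
    obtain ⟨⟨-, -, -, -, h5, h6, -⟩, -⟩ := hball w hw
    have hΦ : ∀ i, ‖Φ i (density w)‖ ≤ (c0 + c1) * C ^ 2 * ‖w‖ ^ 4 := fun i => by
      have h7 : ‖density w‖ ^ 2 ≤ (C * ‖w‖ ^ 2) ^ 2 :=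
        pow_le_pow_left₀ (norm_nonneg _) (hdens w) 2
      rw [norm_pow, norm_norm] at h5 h6
      have h8 : ‖Φ i (density w)‖ ≤ (c0 + c1) * ‖density w‖ ^ 2 := by
        have := sq_nonneg ‖density w‖
        fin_cases i
        · exact h5.trans (by norm_num; nlinarith)
        · exact h6.trans (by norm_num; nlinarith)
      calc _ ≤ (c0 + c1) * (C * ‖w‖ ^ 2) ^ 2 := h8.trans (by gcongr)
        _ = _ := by ring
    have hs1 : ∀ i, ‖slot i w.1‖ ≤ (‖reflect (s := s)‖ + 1) * ‖slot (s := s) i‖ * ‖w‖ := fun i => by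
      have h7 : ‖slot i w.1‖ ≤ ‖slot (s := s) i‖ * ‖w‖ :=
        ((slot i).le_opNorm _).trans (by gcongr; exact norm_fst_le w)
      have := mul_nonneg (norm_nonneg (reflect (s := s)))
        (mul_nonneg (norm_nonneg (slot (s := s) i)) (norm_nonneg w))
      linarith
    have hs2 : ∀ i, ‖reflect (slot i w.2)‖ ≤ (‖reflect (s := s)‖ + 1) * ‖slot (s := s) i‖ * ‖w‖ :=
      fun i => by
      have h7 : ‖slot i w.2‖ ≤ ‖slot (s := s) i‖ * ‖w‖ :=
        ((slot i).le_opNorm _).trans (by gcongr; exact norm_snd_le w)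
      have h8 := (reflect (s := s)).le_opNorm (slot i w.2)
      have h9 := mul_le_mul_of_nonneg_left h7 (norm_nonneg (reflect (s := s)))
      have := mul_nonneg (norm_nonneg (slot (s := s) i)) (norm_nonneg w)
      linarith
    have hprod : ∀ i (X : Circ s), ‖X‖ ≤ (‖reflect (s := s)‖ + 1) * ‖slot (s := s) i‖ * ‖w‖ →
        ‖conv s (Φ i (density w)) X‖ ≤ ‖conv s‖ * ((c0 + c1) * C ^ 2 *
          ((‖reflect (s := s)‖ + 1) * ‖slot (s := s) i‖)) * ‖w‖ ^ 5 := fun i X hX => by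
      refine ((conv s).le_opNorm₂ _ _).trans ?_
      calc _ ≤ ‖conv s‖ * ((c0 + c1) * C ^ 2 * ‖w‖ ^ 4) *
            ((‖reflect (s := s)‖ + 1) * ‖slot (s := s) i‖ * ‖w‖) := by gcongr; exact hΦ i
        _ = _ := by ring
    have hfin : ∀ i (Y : Circ s), ‖Y‖ ≤ (‖reflect (s := s)‖ + 1) * (‖conv s‖ * ((c0 + c1) * C ^ 2 *
          ((‖reflect (s := s)‖ + 1) * ‖slot (s := s) i‖)) * ‖w‖ ^ 5) →
        ‖unslot i Y‖ ≤ D i * ‖w‖ ^ 5 := fun i Y hY => by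
      refine ((unslot i).le_opNorm _).trans ?_
      calc _ ≤ ‖unslot (s := s) i‖ * ((‖reflect (s := s)‖ + 1) * (‖conv s‖ * ((c0 + c1) * C ^ 2 *
          ((‖reflect (s := s)‖ + 1) * ‖slot (s := s) i‖)) * ‖w‖ ^ 5)) := by gcongr
        _ = _ := by rw [hD]; ring
    have hrefl : ∀ (Y : Circ s) (t : ℝ), ‖Y‖ ≤ t → ‖reflect Y‖ ≤ (‖reflect (s := s)‖ + 1) * t ∧
        ‖Y‖ ≤ (‖reflect (s := s)‖ + 1) * t := fun Y t hY => by
      have h8 := (reflect (s := s)).le_opNorm Y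
      have h9 := mul_le_mul_of_nonneg_left hY (norm_nonneg (reflect (s := s)))
      have h10 := (norm_nonneg Y).trans hY
      have h11 := mul_nonneg (norm_nonneg (reflect (s := s))) h10
      constructor <;> linarith
    rw [add_mul]
    refine max_le ((norm_add_le _ _).trans (add_le_add ?_ ?_))
      ((norm_add_le _ _).trans (add_le_add ?_ ?_))
    · exact hfin 0 _ (hrefl _ _ (hprod 0 _ (hs2 0))).1
    · exact hfin 1 _ (hrefl _ _ (hprod 1 _ (hs2 1))).1
    · exact hfin 0 _ (hrefl _ _ (hprod 0 _ (hs1 0))).2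
    · exact hfin 1 _ (hrefl _ _ (hprod 1 _ (hs1 1))).2
  · have F0 : F 0 = 0 := by
      have := (ho.bound one_pos).self_of_nhds
      simpa using this
    rw [R5_eq, hd0]
    simp only [Prod.fst_zero, Prod.snd_zero, map_zero]
    rw [show ((0 : ℂ), (0 : ℂ)) = 0 from rfl, F0]
    simp
  · intro w hw hr
    obtain ⟨-, h1⟩ := hball w hw
    have h2 : ∀ x : ℝ, (F (ev x (density w).1, ev x (density w).2)).im = 0 := fun x => by
      have hb : ∀ i, ev x (reflect (slot i w.2)) = conj (ev x (slot i w.1)) := fun i => by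
        rw [ev_slot, ev_reflect_slot, conj_fourierSeries]
        simp only [hr _]
      have hmem : (ev x (slot 0 w.1), ev x (slot 1 w.1)) ∈ Metric.ball (0 : ℂ × ℂ) δr := by
        rw [mem_ball_zero_iff]
        have h0 : 0 ≤ evConst s := Real.sqrt_nonneg _
        have h3 : ∀ i, ‖ev x (slot i w.1)‖ ≤ evConst s * (‖slot (s := s) i‖ * ‖w‖) := fun i =>
          (norm_ev_le x _).trans (by
            gcongr
            exact ((slot i).le_opNorm _).trans (by gcongr; exact norm_fst_le w))
        refine lt_of_le_of_lt (max_le ((h3 0).trans ?_) ((h3 1).trans ?_)) h1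
        · rw [mul_assoc]
          gcongr; exact le_add_of_nonneg_right (norm_nonneg _)
        · rw [mul_assoc]
          gcongr; exact le_add_of_nonneg_left (norm_nonneg _)
      have := hδrball _ hmem
      simp only [density, ev_conv, hb]
      exact this
    have h3 : ∀ x : ℝ, F (ev x (density w).1, ev x (density w).2) =
        (((F (ev x (density w).1, ev x (density w).2)).re : ℝ) : ℂ) := fun x =>
      Complex.ext (by simp) (by simp [h2 x])
    rw [R5_eq, intervalIntegral.integral_congr fun x _ => h3 x, intervalIntegral.integral_ofReal]
    have h4 : (1 / (2 * (Real.pi : ℂ))) = ((1 / (2 * Real.pi) : ℝ) : ℂ) := by push_cast; rfl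
    rw [h4, ← Complex.ofReal_mul, Complex.ofReal_im]

end

noncomputable section

/-! ### The principal square root -/

/-- The principal square root. -/
def csqrt (c : ℂ) : ℂ := c ^ (1 / 2 : ℂ)

theorem csqrt_sq (c : ℂ) : csqrt c ^ 2 = c := by
  rw [csqrt, one_div]; exact Complex.cpow_ofNat_inv_pow c 2

theorem csqrt_of_sq {x : ℂ} (hx : 0 < x.re) : csqrt (x ^ 2) = x := by
  rw [csqrt, one_div]; exact Complex.sq_cpow_two_inv hx

theorem norm_csqrt_sq (c : ℂ) : ‖csqrt c‖ ^ 2 = ‖c‖ := by rw [← norm_pow, csqrt_sq]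

theorem csqrt_re_pos {c : ℂ} (hc : 0 < c.re) : 0 < (csqrt c).re := by
  have h0 : c ≠ 0 := fun h => by simp [h] at hc
  rw [csqrt, Complex.cpow_def_of_ne_zero h0, Complex.exp_re]
  refine mul_pos (Real.exp_pos _) (Real.cos_pos_of_mem_Ioo ?_)
  have h1 := Complex.abs_arg_lt_pi_div_two_iff.2 (Or.inl hc)
  have h2 : (Complex.log c * (1 / 2 : ℂ)).im = c.arg / 2 := by
    rw [show (1 / 2 : ℂ) = ((1 / 2 : ℝ) : ℂ) by push_cast; rfl, Complex.im_mul_ofReal,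
      Complex.log_im]; ring
  rw [h2]
  have := abs_lt.1 h1
  constructor <;> linarith [Real.pi_pos]

theorem csqrt_ne_zero {c : ℂ} (hc : 0 < c.re) : csqrt c ≠ 0 := fun h => by
  have := csqrt_re_pos hc; simp [h] at this

/-- The root of a number with positive real part lies in the sector `|Im| < Re`. -/
theorem csqrt_sector {c : ℂ} (hc : 0 < c.re) : |(csqrt c).im| < (csqrt c).re ∧
    c.re ≤ (csqrt c).re ^ 2 := by
  have h1 := congrArg Complex.re (csqrt_sq c)
  rw [sq, Complex.mul_re] at h1
  refine ⟨abs_lt_of_sq_lt_sq (by nlinarith) (csqrt_re_pos hc).le, by nlinarith [sq_nonneg (csqrt c).im]⟩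

/-- Polar coordinates for two numbers `A`, `B` with positive real part: the modulus `√(AB)` and the
phase `√(A/B)`. -/
theorem csqrt_polar {A B : ℂ} (hA : 0 < A.re) (hB : 0 < B.re) :
    csqrt (A * B) * csqrt (A / B) = A ∧ csqrt (A * B) * (csqrt (A / B))⁻¹ = B := by
  obtain ⟨a1, -⟩ := csqrt_sector hA
  obtain ⟨b1, -⟩ := csqrt_sector hB
  have ha := csqrt_ne_zero hA
  have hb := csqrt_ne_zero hB
  set α := csqrt A with hα
  set β := csqrt B with hβ
  have eA : α ^ 2 = A := csqrt_sq A
  have eB : β ^ 2 = B := csqrt_sq B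
  have hprod : |α.im| * |β.im| < α.re * β.re :=
    mul_lt_mul'' a1 b1 (abs_nonneg _) (abs_nonneg _)
  rw [← abs_mul] at hprod
  have hpr := abs_lt.1 hprod
  have e1 : csqrt (A * B) = α * β := by
    rw [← eA, ← eB, ← mul_pow]
    apply csqrt_of_sq
    rw [Complex.mul_re]
    linarith
  have e2 : csqrt (A / B) = α / β := by
    rw [← eA, ← eB, ← div_pow]
    apply csqrt_of_sq
    rw [Complex.div_re, ← add_div]
    have : 0 < Complex.normSq β := Complex.normSq_pos.2 hb
    exact div_pos (by linarith) this
  rw [e1, e2, ← eA, ← eB]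
  constructor <;> field_simp

theorem analyticAt_csqrt {c : ℂ} (hc : 0 < c.re) : AnalyticAt ℂ csqrt c :=
  analyticAt_id.cpow analyticAt_const (Or.inl hc)

theorem hasDerivAt_csqrt {c : ℂ} (hc : 0 < c.re) : HasDerivAt csqrt (1 / (2 * csqrt c)) c := by
  have h1 := (analyticAt_csqrt hc).differentiableAt.hasDerivAt
  have h2 := h1.mul h1
  have h3 : (csqrt * csqrt) = fun c => c := funext fun c => by
    rw [Pi.mul_apply, ← sq, csqrt_sq]
  rw [h3] at h2
  have h4 := h2.unique (hasDerivAt_id c)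
  have h5 : deriv csqrt c = 1 / (2 * csqrt c) := by
    have := csqrt_ne_zero hc
    rw [eq_div_iff (by simpa using this)]
    linear_combination h4
  rw [← h5]; exact h1

theorem csqrt_ofReal {x : ℝ} (hx : 0 ≤ x) : csqrt (x : ℂ) = (Real.sqrt x : ℝ) := by
  rw [csqrt, Real.sqrt_eq_rpow, Complex.ofReal_cpow hx]; norm_num

theorem exp_half_log {c : ℂ} (hc : c ≠ 0) : Complex.exp (Complex.log c / 2) = csqrt c := by
  rw [csqrt, Complex.cpow_def_of_ne_zero hc]; congr 1; ring

/-! ### Internal and external modes -/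

variable {p : ℤ} {s : ℝ} [Fact (1 / 2 < s)]

theorem extWeight_le (α : ExtMode p) : extWeight α ≤ fourierWeight (α.1.1, α.2) := by
  refine max_le (one_le_fourierWeight _) (abs_le_intWeight α.1.1)

theorem fourierWeight_le (α : ExtMode p) : fourierWeight (α.1.1, α.2) ≤ 2 * extWeight α := by
  have h1 := intWeight_le_one_add α.1.1
  have h2 : (1 : ℝ) ≤ extWeight α := le_max_left _ _
  have h3 : |((α.1.1 : ℤ) : ℝ)| ≤ extWeight α := le_max_right _ _
  change intWeight α.1.1 ≤ _
  linarith

theorem extMode_injective : Function.Injective fun α : ExtMode p => ((α.1.1, α.2) : Mode) := by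
  rintro ⟨⟨j, hj⟩, i⟩ ⟨⟨j', hj'⟩, i'⟩ h
  simpa using h

theorem tsum_extMode {R : Type} [AddCommMonoid R] [TopologicalSpace R] {f : Mode → R}
    (h : ∀ i, f (p, i) = 0) : ∑' m, f m = ∑' α : ExtMode p, f (α.1.1, α.2) := by
  rw [← extMode_injective.tsum_eq]
  intro m hm
  by_cases hp : m.1 = p
  · obtain ⟨j, i⟩ := m
    simp only at hp
    subst hp
    exact absurd (h i) hm
  · exact ⟨(⟨m.1, hp⟩, m.2), rfl⟩

/-- A family on the external modes, extended by zero. -/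
def extendZero (c : ExtMode p → ℂ) (m : Mode) : ℂ := if h : m.1 = p then 0 else c (⟨m.1, h⟩, m.2)

theorem extendZero_ext (c : ExtMode p → ℂ) (α : ExtMode p) : extendZero c (α.1.1, α.2) = c α := by
  rw [extendZero, dif_neg α.1.2]

theorem extendZero_int (c : ExtMode p → ℂ) (i : Fin 2) : extendZero c (p, i) = 0 := by
  rw [extendZero, dif_pos rfl]

variable (p s) in
theorem exists_extIn : ∃ L : Zs p s →L[ℂ] Hs s,
    (∀ u m, (L u).coeff m = extendZero u.coeff m) ∧ ∀ u, ‖L u‖ ≤ 2 ^ s * ‖u‖ :=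
  Wl2.exists_clm (s := s) (t := s) extWeight_pos fourierWeight_pos
    { toFun := extendZero
      map_add' := fun a b => funext fun m => by
        simp only [extendZero, Pi.add_apply]; split_ifs <;> simp
      map_smul' := fun c a => funext fun m => by
        simp only [extendZero, Pi.smul_apply, smul_eq_mul, RingHom.id_apply]; split_ifs <;> simp }
    (C := 2 ^ s) (by positivity) fun c => by
      simp only [LinearMap.coe_mk, AddHom.coe_mk, sqNorm]
      rw [tsum_extMode (p := p) fun i => by rw [extendZero_int]; simp, ← ENNReal.tsum_mul_left]
      refine ENNReal.tsum_le_tsum fun α => ?_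
      rw [extendZero_ext, ← mul_pow, ← mul_assoc]
      gcongr
      rw [wt, wt, ← ENNReal.ofReal_mul (by positivity), ← Real.mul_rpow (by norm_num)
        (extWeight_pos α).le]
      exact ENNReal.ofReal_le_ofReal (Real.rpow_le_rpow (fourierWeight_pos _).le
        (fourierWeight_le α) (s_nonneg s))

/-- The inclusion of the external modes. -/
def extIn : Zs p s →L[ℂ] Hs s := (exists_extIn p s).choose

theorem coeff_extIn (u : Zs p s) (m : Mode) : (extIn u).coeff m = extendZero u.coeff m :=
  (exists_extIn p s).choose_spec.1 u m

variable (p s) in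
theorem exists_extOut : ∃ L : Hs s →L[ℂ] Zs p s,
    (∀ u α, (L u).coeff α = u.coeff (α.1.1, α.2)) ∧ ∀ u, ‖L u‖ ≤ 1 * ‖u‖ :=
  Wl2.exists_clm (s := s) (t := s) fourierWeight_pos extWeight_pos
    (LinearMap.pi fun α : ExtMode p => LinearMap.proj ((α.1.1, α.2) : Mode)) (C := 1) (by simp)
    fun c => by
      rw [ENNReal.ofReal_one, one_pow, one_mul]
      refine le_trans (ENNReal.tsum_le_tsum fun α => ?_)
        (tsum_comp_le_of_injective (extMode_injective (p := p))
          fun m => (wt fourierWeight s m * ‖c m‖ₑ) ^ 2)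
      simp only [LinearMap.pi_apply, LinearMap.proj_apply]
      gcongr
      exact ENNReal.ofReal_le_ofReal (Real.rpow_le_rpow (extWeight_pos α).le
        (extWeight_le α) (s_nonneg s))

/-- The restriction to the external modes. -/
def extOut : Hs s →L[ℂ] Zs p s := (exists_extOut p s).choose

theorem coeff_extOut (u : Hs s) (α : ExtMode p) :
    (extOut u : Zs p s).coeff α = u.coeff (α.1.1, α.2) :=
  (exists_extOut p s).choose_spec.1 u α

theorem norm_extOut_le (u : Hs s) : ‖(extOut u : Zs p s)‖ ≤ ‖u‖ := by
  exact ((exists_extOut p s).choose_spec.2 u).trans_eq (one_mul _)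

variable (p) in
/-- The internal modes as a two-dimensional subspace. -/
def intIn : (Fin 2 → ℂ) →L[ℂ] Hs s :=
  ∑ i, (ContinuousLinearMap.proj (R := ℂ) (φ := fun _ : Fin 2 => ℂ) i).smulRight
    (Wl2.basis ((p, i) : Mode) : Hs s)

theorem intIn_apply (v : Fin 2 → ℂ) :
    (intIn p v : Hs s) = v 0 • Wl2.basis (p, 0) + v 1 • Wl2.basis (p, 1) := by
  simp [intIn, Fin.sum_univ_two]

theorem coeff_intIn_int (v : Fin 2 → ℂ) (i : Fin 2) : (intIn p v : Hs s).coeff (p, i) = v i := by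
  have h0 := Wl2.coeff_basis_same (s := s) fourierWeight_pos ((p, 0) : Mode)
  have h1 := Wl2.coeff_basis_same (s := s) fourierWeight_pos ((p, 1) : Mode)
  have h2 : (Wl2.basis (p, 0) : Hs s).coeff (p, 1) = 0 := Wl2.coeff_basis_ne (by simp)
  have h3 : (Wl2.basis (p, 1) : Hs s).coeff (p, 0) = 0 := Wl2.coeff_basis_ne (by simp)
  rw [intIn_apply]
  fin_cases i <;> simp [h0, h1, h2, h3]

theorem coeff_intIn_ext (v : Fin 2 → ℂ) {m : Mode} (hm : m.1 ≠ p) :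
    (intIn p v : Hs s).coeff m = 0 := by
  have h : ∀ i, (Wl2.basis (p, i) : Hs s).coeff m = 0 := fun i =>
    Wl2.coeff_basis_ne fun h => hm (by rw [h])
  rw [intIn_apply]; simp [h]

variable (p) in
/-- The internal entries. -/
def intOut : Hs s →L[ℂ] (Fin 2 → ℂ) :=
  ContinuousLinearMap.pi fun i => Wl2.coeffL fourierWeight_pos (p, i)

@[simp] theorem intOut_apply (u : Hs s) (i : Fin 2) : intOut p u i = u.coeff (p, i) := rfl

theorem coeff_assemble (v : Fin 2 → ℂ) (u : Zs p s) (m : Mode) :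
    (intIn p v + extIn u : Hs s).coeff m = if h : m.1 = p then v m.2 else u.coeff (⟨m.1, h⟩, m.2) := by
  rw [Wl2.coeff_add, coeff_extIn, extendZero]
  obtain ⟨j, i⟩ := m
  by_cases h : j = p
  · subst h; simp [coeff_intIn_int]
  · simp [h, coeff_intIn_ext v (m := (j, i)) h]

theorem intOut_assemble (v : Fin 2 → ℂ) (u : Zs p s) : intOut p (intIn p v + extIn u : Hs s) = v :=
  funext fun i => by rw [intOut_apply, coeff_assemble]; simp

theorem extOut_assemble (v : Fin 2 → ℂ) (u : Zs p s) : extOut (intIn p v + extIn u : Hs s) = u :=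
  Wl2.ext_coeff extWeight_pos fun α => by rw [coeff_extOut, coeff_assemble, dif_neg α.1.2]

theorem assemble_out (u : Hs s) : intIn p (intOut p u) + extIn (extOut u : Zs p s) = u :=
  Wl2.ext_coeff fourierWeight_pos fun m => by
    rw [coeff_assemble]
    obtain ⟨j, i⟩ := m
    split_ifs with h
    · simp only at h; subst h; rfl
    · rw [coeff_extOut]

theorem pair_add_left (a b c : Hs s) : (a + b).pair c = a.pair c + b.pair c := by
  simp only [← Wl2.pairL_apply one_le_fourierWeight (s_nonneg s), map_add, add_apply]

theorem pair_intIn (u : Hs s) (v : Fin 2 → ℂ) :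
    u.pair (intIn p v) = ∑ i, u.coeff (p, i) * v i := by
  rw [intIn_apply, Fin.sum_univ_two, Wl2.pair_comm, pair_add_left, Wl2.pair_comm _ u,
    Wl2.pair_comm _ u, pair_smul_right, pair_smul_right, Wl2.pair_basis fourierWeight_pos,
    Wl2.pair_basis fourierWeight_pos]
  ring

theorem pair_extIn (u : Hs s) (v : Zs p s) : u.pair (extIn v) = (extOut u : Zs p s).pair v := by
  rw [Wl2.pair, tsum_extMode (p := p) fun i => by rw [coeff_extIn, extendZero_int, mul_zero]]
  exact tsum_congr fun α => by rw [coeff_extIn, extendZero_ext, coeff_extOut]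

theorem pair_assemble (v v' : Fin 2 → ℂ) (u u' : Zs p s) :
    (intIn p v + extIn u : Hs s).pair (intIn p v' + extIn u') = ∑ i, v i * v' i + u.pair u' := by
  rw [Wl2.pair_comm, pair_add_left, Wl2.pair_comm, pair_intIn, Wl2.pair_comm, pair_extIn,
    extOut_assemble]
  congr 1
  refine Finset.sum_congr rfl fun i _ => ?_
  rw [coeff_assemble]; simp

/-! ### The symmetrization -/

/-- The symmetrization of plain families. -/
def symFun (c : ExtMode p → ℂ) (α : ExtMode p) : ℂ :=
  ![(c (α.1, 0) + c (α.1, 1)) / (√2 : ℂ),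
    (c (α.1, 0) - c (α.1, 1)) / (√2 : ℂ)] α.2

theorem sqrt_two_sq : (√2 : ℂ) ^ 2 = 2 := by
  rw [← Complex.ofReal_pow, Real.sq_sqrt (by norm_num)]; norm_num

theorem sqrt_two_ne_zero : (√2 : ℂ) ≠ 0 := fun h => by
  have := sqrt_two_sq; rw [h] at this; norm_num at this

theorem enorm_div_sqrt_two_sq (a : ℂ) : ‖a / (√2 : ℂ)‖ₑ ^ 2 = ‖a‖ₑ ^ 2 / 2 := by
  have h : ‖a / (√2 : ℂ)‖ ^ 2 = ‖a‖ ^ 2 / 2 := by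
    rw [norm_div, div_pow, Complex.norm_real, Real.norm_of_nonneg (Real.sqrt_nonneg _),
      Real.sq_sqrt (by norm_num)]
  rw [← ofReal_norm, ← ENNReal.ofReal_pow (norm_nonneg _), h,
    ENNReal.ofReal_div_of_pos (by norm_num), ENNReal.ofReal_pow (norm_nonneg _), ofReal_norm]
  simp

theorem enorm_sym_sq_le (a b : ℂ) : ‖(a + b) / (√2 : ℂ)‖ₑ ^ 2 ≤ ‖a‖ₑ ^ 2 + ‖b‖ₑ ^ 2 := by
  have h := sqNorm_add_le (ι := Unit) (fun _ => 1) (fun _ => a) (fun _ => b)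
  simp only [sqNorm, one_mul, tsum_fintype, Finset.univ_unique, Finset.sum_singleton] at h
  rw [enorm_div_sqrt_two_sq]
  refine ENNReal.div_le_of_le_mul ?_
  rw [add_mul, mul_comm _ (2 : ℝ≥0∞), mul_comm _ (2 : ℝ≥0∞)]
  exact h

theorem exists_sym : ∃ L : Zs p s →L[ℂ] Zs p s, (∀ u α, (L u).coeff α = symFun u.coeff α) ∧
    ∀ u, ‖L u‖ ≤ 3 / 2 * ‖u‖ :=
  Wl2.exists_clm (s := s) (t := s) extWeight_pos extWeight_pos
    { toFun := symFun
      map_add' := fun a b => funext fun ⟨k, i⟩ => by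
        fin_cases i <;> simp [symFun] <;> ring
      map_smul' := fun c a => funext fun ⟨k, i⟩ => by
        fin_cases i <;> simp [symFun] <;> ring }
    (C := 3 / 2) (by norm_num) fun c => by
      simp only [LinearMap.coe_mk, AddHom.coe_mk, sqNorm]
      have e : ∀ f : ExtMode p → ℝ≥0∞, ∑' α, f α = ∑' k, (f (k, 0) + f (k, 1)) := fun f => by
        rw [ENNReal.tsum_prod' (f := f)]
        simp [tsum_fintype, Fin.sum_univ_two]
      rw [e, e, ← ENNReal.tsum_mul_left]
      refine ENNReal.tsum_le_tsum fun k => ?_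
      have hw : wt extWeight s ((k, 1) : ExtMode p) = wt extWeight s ((k, 0) : ExtMode p) := rfl
      have h1 := enorm_sym_sq_le (c (k, 0)) (c (k, 1))
      have h2 := enorm_sym_sq_le (c (k, 0)) (-c (k, 1))
      rw [enorm_neg, ← sub_eq_add_neg] at h2
      have h3 : (2 : ℝ≥0∞) ≤ ENNReal.ofReal (3 / 2) ^ 2 := by
        rw [← ENNReal.ofReal_pow (by norm_num)]
        calc (2 : ℝ≥0∞) = ENNReal.ofReal 2 := by simp
          _ ≤ _ := ENNReal.ofReal_le_ofReal (by norm_num)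
      simp only [symFun, Matrix.cons_val_zero, Matrix.cons_val_one, mul_pow, hw]
      calc _ ≤ wt extWeight s ((k, 0) : ExtMode p) ^ 2 * (‖c (k, 0)‖ₑ ^ 2 + ‖c (k, 1)‖ₑ ^ 2) +
            wt extWeight s ((k, 0) : ExtMode p) ^ 2 * (‖c (k, 0)‖ₑ ^ 2 + ‖c (k, 1)‖ₑ ^ 2) := by
            gcongr
        _ = 2 * (wt extWeight s ((k, 0) : ExtMode p) ^ 2 * ‖c (k, 0)‖ₑ ^ 2 +
            wt extWeight s ((k, 0) : ExtMode p) ^ 2 * ‖c (k, 1)‖ₑ ^ 2) := by ring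
        _ ≤ _ := by gcongr

/-- The symmetrization `(e, f) ↦ ((e + f) / √2, (e - f) / √2)`. -/
def sym : Zs p s →L[ℂ] Zs p s := exists_sym.choose

theorem coeff_sym (u : Zs p s) (α : ExtMode p) : (sym u).coeff α = symFun u.coeff α :=
  exists_sym.choose_spec.1 u α

theorem norm_sym_le (u : Zs p s) : ‖sym u‖ ≤ 3 / 2 * ‖u‖ := exists_sym.choose_spec.2 u

theorem sym_sym (u : Zs p s) : sym (sym u) = u :=
  Wl2.ext_coeff extWeight_pos fun ⟨k, i⟩ => by
    have h := sqrt_two_sq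
    have h0 := sqrt_two_ne_zero
    rw [coeff_sym]
    fin_cases i
    · simp only [symFun, coeff_sym, Matrix.cons_val_zero, Matrix.cons_val_one, Fin.zero_eta]
      field_simp; rw [h]; ring
    · simp only [symFun, coeff_sym, Matrix.cons_val_zero, Matrix.cons_val_one, Fin.mk_one]
      field_simp; rw [h]; ring

theorem summable_pair_ext (u v : Zs p s) : Summable fun α => u.coeff α * v.coeff α :=
  Wl2.summable_pair one_le_extWeight (s_nonneg s) u v

theorem tsum_ext_prod {f : ExtMode p → ℂ} (hf : Summable f) :
    ∑' α, f α = ∑' k, (f (k, 0) + f (k, 1)) := by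
  rw [hf.tsum_prod]
  simp [tsum_fintype, Fin.sum_univ_two]

theorem pair_sym (u v : Zs p s) : (sym u).pair v = u.pair (sym v) := by
  rw [Wl2.pair, Wl2.pair, tsum_ext_prod (summable_pair_ext (sym u) v),
    tsum_ext_prod (summable_pair_ext u (sym v))]
  refine tsum_congr fun k => ?_
  simp only [coeff_sym, symFun, Matrix.cons_val_zero, Matrix.cons_val_one]
  ring

end

noncomputable section

open scoped ContDiff

/-! ### Polar coordinates -/

variable {p : ℤ} {s : ℝ} [Fact (1 / 2 < s)]

/-- The pairs `(ζ, ζ̄)` of external variables. -/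
abbrev ExtPair (p : ℤ) (s : ℝ) : Type := Zs p s × Zs p s

theorem pair_ext_add_left (a b c : Zs p s) : (a + b).pair c = a.pair c + b.pair c := by
  simp only [← Wl2.pairL_apply one_le_extWeight (s_nonneg s), map_add, add_apply]

theorem omegaPs_assemble (a b a' b' : Fin 2 → ℂ) (u v u' v' : Zs p s) :
    omegaPs (intIn p a + extIn u, intIn p b + extIn v) (intIn p a' + extIn u', intIn p b' + extIn v') =
      -Complex.I * (∑ i, (a i * b' i - a' i * b i) + (u.pair v' - u'.pair v)) := by
  rw [omegaPs, pair_assemble, pair_assemble, Finset.sum_sub_distrib]; ring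

/-- The form `-dr ∧ dθ - i dζ ∧ dζ̄` is nondegenerate. -/
theorem eq_zero_of_omega {h : Phase p s} (H : ∀ k, omega h k = 0) : h = 0 := by
  obtain ⟨r, θ, u, v⟩ := h
  have pz : ∀ x : Zs p s, x.pair 0 = 0 := fun x => by
    rw [← Wl2.pairL_apply one_le_extWeight (s_nonneg s), map_zero]
  have zp : ∀ x : Zs p s, (0 : Zs p s).pair x = 0 := fun x => by rw [Wl2.pair_comm, pz]
  have h1 : r = 0 := funext fun i => by
    have := H (0, Pi.single i 1, 0)
    simpa [omega, pz, zp, Pi.single_apply] using this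
  have h2 : θ = 0 := funext fun i => by
    have := H (Pi.single i 1, 0, 0)
    simpa [omega, pz, zp, Pi.single_apply] using this
  have h3 : u = 0 := Wl2.ext_coeff extWeight_pos fun α => by
    have := H (0, 0, 0, Wl2.basis α)
    simpa [omega, pz, zp, Wl2.pair_basis extWeight_pos, Wl2.coeff_zero] using this
  have h4 : v = 0 := Wl2.ext_coeff extWeight_pos fun α => by
    have := H (0, 0, Wl2.basis α, 0)
    simpa [omega, pz, zp, Wl2.pair_comm _ v, Wl2.pair_basis extWeight_pos, Wl2.coeff_zero] using this
  rw [h1, h2, h3, h4]; rfl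

variable (p s) in
/-- The polarization of `occ`. -/
def occL (i : Fin 2) : Zs p s →L[ℂ] Zs p s →L[ℂ] ℂ :=
  (Wl2.pairL one_le_extWeight (s_nonneg s)).bilinearComp ((species extWeight_pos i).comp sym) sym

theorem occL_apply (i : Fin 2) (u v : Zs p s) :
    occL p s i u v = (species extWeight_pos i (sym u)).pair (sym v) := rfl

/-- The mass of the external modes of each species, in symmetrized variables. -/
def occ (z : ExtPair p s) (i : Fin 2) : ℂ := occL p s i z.1 z.2

theorem norm_species_le {ι : Type} {w : ι × Fin 2 → ℝ} (hw : ∀ α, 0 < w α) (i : Fin 2)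
    (u : Wl2 (ι × Fin 2) w s) : ‖species hw i u‖ ≤ ‖u‖ := by
  have h := norm_phase_le hw (c := Pi.single i 1) (C := 1)
    (fun j => by rw [Pi.single_apply]; split_ifs <;> simp) u
  rw [one_mul] at h
  have e : phase hw (Pi.single i 1) u = species hw i u := Wl2.ext_coeff hw fun α => by
    rw [coeff_phase, coeff_species, Pi.single_apply]; split_ifs <;> simp
  rwa [e] at h

theorem norm_occ_le (z : ExtPair p s) (i : Fin 2) : ‖occ z i‖ ≤ 9 / 4 * ‖z‖ ^ 2 := by
  have h1 : ‖species extWeight_pos i (sym z.1)‖ ≤ 3 / 2 * ‖z‖ :=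
    (norm_species_le _ _ _).trans ((norm_sym_le _).trans (by gcongr; exact norm_fst_le z))
  have h2 : ‖sym z.2‖ ≤ 3 / 2 * ‖z‖ := (norm_sym_le _).trans (by gcongr; exact norm_snd_le z)
  calc _ ≤ _ := Wl2.norm_pair_le one_le_extWeight (s_nonneg s) _ _
    _ ≤ (3 / 2 * ‖z‖) * (3 / 2 * ‖z‖) := mul_le_mul h1 h2 (norm_nonneg _) (by positivity)
    _ = _ := by ring

theorem contDiff_occ {n : WithTop ℕ∞} : ContDiff ℂ n (occ (p := p) (s := s)) :=
  contDiff_pi.2 fun i => ((occL p s i).contDiff.comp contDiff_fst).clm_apply contDiff_snd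

theorem hasDerivAt_occ {z : ℂ → ExtPair p s} {z' : ExtPair p s} {t : ℂ}
    (hz : HasDerivAt z z' t) (i : Fin 2) : HasDerivAt (fun t => occ (z t) i)
      (occL p s i z'.1 (z t).2 + occL p s i (z t).1 z'.2) t :=
  ((occL p s i).hasFDerivAt.comp_hasDerivAt t hz.fst).clm_apply hz.snd

/-- The internal amplitudes `√(R - occ z)`: the actions `R` include the masses of the external
modes. -/
def amp (R : Fin 2 → ℂ) (z : ExtPair p s) (i : Fin 2) : ℂ := csqrt (R i - occ z i)

/-- The domain of polar coordinates: the principal square roots stay away from zero. -/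
def polarDom (p : ℤ) (s : ℝ) [Fact (1 / 2 < s)] : Set ((Fin 2 → ℂ) × ExtPair p s) :=
  {y | ∀ i, 1 / 2 < (y.1 i - occ y.2 i).re}

theorem isOpen_polarDom : IsOpen (polarDom p s) := by
  have : polarDom p s = ⋂ i, {y | 1 / 2 < (y.1 i - occ y.2 i).re} := by
    ext; simp [polarDom]
  rw [this]
  refine isOpen_iInter_of_finite fun i => isOpen_lt continuous_const ?_
  have h := (contDiff_pi.1 (contDiff_occ (p := p) (s := s) (n := 0)) i).continuous
  exact Complex.continuous_re.comp (((continuous_apply i).comp continuous_fst).sub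
    (h.comp continuous_snd))

theorem half_le_amp_re {y : (Fin 2 → ℂ) × ExtPair p s} (hy : y ∈ polarDom p s) (i : Fin 2) :
    1 / 2 ≤ (amp y.1 y.2 i).re := by
  have h0 : 0 < (y.1 i - occ y.2 i).re := lt_trans (by norm_num) (hy i)
  have h1 := (csqrt_sector h0).2
  have h2 := csqrt_re_pos h0
  have h3 := hy i
  change _ ≤ (csqrt (y.1 i - occ y.2 i)).re
  nlinarith

theorem amp_ne_zero {y : (Fin 2 → ℂ) × ExtPair p s} (hy : y ∈ polarDom p s) (i : Fin 2) :
    amp y.1 y.2 i ≠ 0 := fun h => by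
  have := half_le_amp_re hy i; rw [h] at this; norm_num at this

theorem amp_sq (R : Fin 2 → ℂ) (z : ExtPair p s) (i : Fin 2) :
    amp R z i ^ 2 = R i - occ z i := csqrt_sq _

theorem contDiffOn_amp : ContDiffOn ℂ ω (fun y => amp y.1 y.2) (polarDom p s) :=
  contDiffOn_pi.2 fun i y hy => by
    have h0 : 0 < (y.1 i - occ y.2 i).re := lt_trans (by norm_num) (hy i)
    exact ((analyticAt_csqrt h0).contDiffAt.comp y (f := fun y => y.1 i - occ y.2 i)
      (((contDiff_apply ℂ ℂ i).comp contDiff_fst).sub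
        ((contDiff_pi.1 contDiff_occ i).comp contDiff_snd)).contDiffAt).contDiffWithinAt

/-- The derivative of the amplitudes. -/
def ampD (R : Fin 2 → ℂ) (z : ExtPair p s) (R' : Fin 2 → ℂ) (z' : ExtPair p s) (i : Fin 2) :
    ℂ := (R' i - (occL p s i z'.1 z.2 + occL p s i z.1 z'.2)) / (2 * amp R z i)

theorem hasDerivAt_amp {R : ℂ → Fin 2 → ℂ} {z : ℂ → ExtPair p s} {R' z'} {t : ℂ}
    (hR : HasDerivAt R R' t) (hz : HasDerivAt z z' t) (h : (R t, z t) ∈ polarDom p s) :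
    HasDerivAt (fun t => amp (R t) (z t)) (ampD (R t) (z t) R' z') t :=
  hasDerivAt_pi.2 fun i => by
    have h0 : 0 < (R t i - occ (z t) i).re := lt_trans (by norm_num) (h i)
    have h1 := (hasDerivAt_csqrt h0).comp t ((hasDerivAt_pi.1 hR i).sub (hasDerivAt_occ hz i))
    refine h1.congr_deriv ?_
    rw [ampD, amp]; ring

/-- The Fourier variables of the point with actions `R`, vanishing angles and symmetrized external
variables `z`. -/
def polar (y : (Fin 2 → ℂ) × ExtPair p s) : Ps s :=
  (intIn p (amp y.1 y.2) + extIn (sym y.2.1), intIn p (amp y.1 y.2) + extIn (sym y.2.2))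

theorem contDiffOn_polar : ContDiffOn ℂ ω (polar (p := p) (s := s)) (polarDom p s) := by
  have h := (intIn (s := s) p).contDiff.comp_contDiffOn (contDiffOn_amp (p := p) (s := s))
  exact (h.add ((extIn (s := s)).contDiff.comp ((sym (p := p) (s := s)).contDiff.comp
      (contDiff_fst.comp contDiff_snd))).contDiffOn).prodMk
    (h.add ((extIn (s := s)).contDiff.comp ((sym (p := p) (s := s)).contDiff.comp
      (contDiff_snd.comp contDiff_snd))).contDiffOn)

theorem norm_amp_le {R : Fin 2 → ℂ} {z : ExtPair p s} (hR : ‖R‖ ≤ 3) (hz : ‖z‖ ≤ 1 / 2) (i : Fin 2) :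
    ‖amp R z i‖ ≤ 2 := by
  have h1 := norm_occ_le z i
  have h2 := norm_csqrt_sq (R i - occ z i)
  have h3 := (norm_sub_le (R i) (occ z i)).trans (add_le_add ((norm_le_pi_norm R i).trans hR) h1)
  have h4 : ‖z‖ ^ 2 ≤ (1 / 2) ^ 2 := by gcongr
  rw [← h2] at h3
  change ‖csqrt _‖ ≤ 2
  exact le_of_sq_le_sq (by linarith) (by norm_num)

variable (p s) in
theorem exists_norm_polar_le : ∃ C : ℝ, 1 ≤ C ∧ ∀ y : (Fin 2 → ℂ) × ExtPair p s, ‖y.1‖ ≤ 3 →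
    ‖y.2‖ ≤ 1 / 2 → ‖polar y‖ ≤ C := by
  refine ⟨1 + (‖intIn (s := s) p‖ * 2 + ‖extIn (p := p) (s := s)‖ * 1), ?_, fun y h1 h2 => ?_⟩
  · have := norm_nonneg (intIn (s := s) p)
    have := norm_nonneg (extIn (p := p) (s := s))
    linarith
  have ha : ‖amp y.1 y.2‖ ≤ 2 := (pi_norm_le_iff_of_nonneg (by norm_num)).2 (norm_amp_le h1 h2)
  have key : ∀ u : Zs p s, ‖u‖ ≤ ‖y.2‖ → ‖intIn p (amp y.1 y.2) + extIn (s := s) (sym u)‖ ≤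
      1 + (‖intIn (s := s) p‖ * 2 + ‖extIn (p := p) (s := s)‖ * 1) := fun u hu => by
    have hsu : ‖sym u‖ ≤ 1 := (norm_sym_le u).trans (by linarith)
    have e1 := (intIn (s := s) p).le_opNorm_of_le ha
    have e2 := (extIn (p := p) (s := s)).le_opNorm_of_le hsu
    have := norm_add_le (intIn (s := s) p (amp y.1 y.2)) (extIn (sym u))
    linarith
  exact max_le (key _ (norm_fst_le _)) (key _ (norm_snd_le _))

theorem phase_assemble (c v : Fin 2 → ℂ) (u : Zs p s) :
    phase fourierWeight_pos c (intIn p v + extIn u) =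
      (intIn p (c * v) + extIn (phase extWeight_pos c u) : Hs s) :=
  Wl2.ext_coeff fourierWeight_pos fun m => by
    rw [coeff_phase, coeff_assemble, coeff_assemble]
    split_ifs with h <;> simp

theorem smul_assemble (c : ℂ) (v : Fin 2 → ℂ) (u : Zs p s) :
    c • (intIn p v + extIn u : Hs s) = intIn p (c • v) + extIn (c • u) := by
  rw [smul_add, map_smul, map_smul]

theorem hasDerivAt_cis {θ : ℂ → Fin 2 → ℂ} {θ' : Fin 2 → ℂ} {t : ℂ} (hθ : HasDerivAt θ θ' t) :
    HasDerivAt (fun t => cis (θ t)) (cis (θ t) * (Complex.I • θ')) t :=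
  hasDerivAt_pi.2 fun i => by
    have := ((hasDerivAt_pi.1 hθ i).const_mul Complex.I).cexp
    exact this

theorem hasDerivAt_phase {c : ℂ → Fin 2 → ℂ} {c' : Fin 2 → ℂ} {u : ℂ → Zs p s} {u' : Zs p s} {t : ℂ}
    (hc : HasDerivAt c c' t) (hu : HasDerivAt u u' t) :
    HasDerivAt (fun t => phase extWeight_pos (c t) (u t))
      (phase extWeight_pos c' (u t) + phase extWeight_pos (c t) u') t := by
  simp only [phase_apply]
  have h := fun i : Fin 2 => (hasDerivAt_pi.1 hc i).smul
    ((species (s := s) extWeight_pos i).hasFDerivAt.comp_hasDerivAt t hu)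
  refine ((h 0).add (h 1)).congr_deriv ?_
  simp only [Function.comp]
  abel

/-- A curve of points with given internal amplitudes and external variables. -/
theorem hasDerivAt_assemble {v : ℂ → Fin 2 → ℂ} {v' : Fin 2 → ℂ} {u : ℂ → Zs p s} {u' : Zs p s} {t : ℂ}
    (hv : HasDerivAt v v' t) (hu : HasDerivAt u u' t) :
    HasDerivAt (fun t => (intIn p (v t) + extIn (u t) : Hs s)) (intIn p v' + extIn u') t :=
  ((intIn p).hasFDerivAt.comp_hasDerivAt t hv).add (extIn.hasFDerivAt.comp_hasDerivAt t hu)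

theorem fderiv_eq_of_curve {E G : Type} [NormedAddCommGroup E] [NormedSpace ℂ E]
    [NormedAddCommGroup G] [NormedSpace ℂ G] {f : E → G} {x h : E} {v : G}
    (hf : DifferentiableAt ℂ f x) (hd : HasDerivAt (fun t : ℂ => f (x + t • h)) v 0) :
    fderiv ℂ f x h = v := by
  rw [← hf.lineDeriv_eq_fderiv]
  exact HasLineDerivAt.lineDeriv hd

theorem hasDerivAt_line {E : Type} [NormedAddCommGroup E] [NormedSpace ℂ E] (x h : E) :
    HasDerivAt (fun t : ℂ => x + t • h) h 0 := by
  simpa using ((hasDerivAt_id (0 : ℂ)).smul_const h).const_add x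

end

noncomputable section

open scoped ContDiff

/-! ### The two charts -/

variable {p : ℤ} {s : ℝ} [Fact (1 / 2 < s)]

/-- The Fourier variables of a point given by actions, angles and external variables. -/
def chart (x : Phase p s) : Ps s :=
  (intIn p (cis x.2.1 * fun i => csqrt (x.1 i)) + extIn x.2.2.1,
    intIn p (cis (-x.2.1) * fun i => csqrt (x.1 i)) + extIn x.2.2.2)

theorem assemble_congr {a a' b b' : Fin 2 → ℂ} {u u' v v' : Zs p s} (ha : a = a') (hu : u = u')
    (hb : b = b') (hv : v = v') : ((intIn p a + extIn u, intIn p b + extIn v) : Ps s) =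
      (intIn p a' + extIn u', intIn p b' + extIn v') := by rw [ha, hu, hb, hv]

theorem fourierCoords_chart (x : Phase p s) : fourierCoords (chart x) = toFourier (coords x) := by
  simp only [fourierCoords, toFourier, coords, FourierPt.mk.injEq]
  constructor
  · funext m
    rw [chart, coeff_assemble]
    simp only [Pi.mul_apply, cis, csqrt, mul_comm]
  · funext m
    rw [chart, coeff_assemble]
    simp only [Pi.mul_apply, cis_neg, csqrt, mul_comm]

/-- The Fourier variables of the point with rescaled actions `l ^ 2 R`, angles `θ` and rescaled
external variables `l z`, after symmetrization and rotation. -/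
def scaledChart (l : ℂ) (x : Phase p s) : Ps s :=
  (intIn p (l • (cis x.2.1 * amp x.1 x.2.2)) +
      extIn (l • phase extWeight_pos (cis x.2.1) (sym x.2.2.1)),
    intIn p (l • (cis (-x.2.1) * amp x.1 x.2.2)) +
      extIn (l • phase extWeight_pos (cis (-x.2.1)) (sym x.2.2.2)))

theorem scaledChart_eq (l : ℂ) (x : Phase p s) :
    scaledChart l x = gauge x.2.1 (l • polar (x.1, x.2.2)) := by
  simp only [scaledChart, gauge, polar, Prod.smul_mk]
  rw [map_smul (phase _ (cis x.2.1)), map_smul (phase _ (cis (-x.2.1))), phase_assemble, phase_assemble,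
    smul_assemble, smul_assemble]

theorem contDiffAt_chart {x : Phase p s} (hx : ∀ i, 0 < (x.1 i).re) : ContDiffAt ℂ ω chart x := by
  have hr : ContDiffAt ℂ ω (fun x : Phase p s => fun i => csqrt (x.1 i)) x :=
    contDiffAt_pi.2 fun i => (analyticAt_csqrt (hx i)).contDiffAt.comp x
      (f := fun x : Phase p s => x.1 i) ((contDiff_apply ℂ ℂ i).comp contDiff_fst).contDiffAt
  have hc : ContDiffAt ℂ ω (fun x : Phase p s => cis x.2.1) x :=
    (contDiff_cis.comp (contDiff_fst.comp contDiff_snd)).contDiffAt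
  have hc' : ContDiffAt ℂ ω (fun x : Phase p s => cis (-x.2.1)) x :=
    (contDiff_cis.comp (contDiff_fst.comp contDiff_snd).neg).contDiffAt
  exact ((((intIn p).contDiff.contDiffAt.comp x (hc.mul hr)).add
      (extIn.contDiff.comp (contDiff_fst.comp (contDiff_snd.comp contDiff_snd))).contDiffAt).prodMk
    (((intIn p).contDiff.contDiffAt.comp x (hc'.mul hr)).add
      (extIn.contDiff.comp (contDiff_snd.comp (contDiff_snd.comp contDiff_snd))).contDiffAt))

theorem contDiffAt_scaledChart (l : ℂ) {x : Phase p s} (hx : (x.1, x.2.2) ∈ polarDom p s) :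
    ContDiffAt ℂ ω (scaledChart l) x := by
  have e : scaledChart (p := p) (s := s) l = fun x => gauge x.2.1 (l • polar (x.1, x.2.2)) :=
    funext (scaledChart_eq l)
  rw [e]
  have hP : ContDiffAt ℂ ω (fun x : Phase p s => polar (x.1, x.2.2)) x :=
    (contDiffOn_polar.contDiffAt (isOpen_polarDom.mem_nhds hx)).comp x
      (f := fun x : Phase p s => (x.1, x.2.2))
      (contDiff_fst.prodMk (contDiff_snd.comp contDiff_snd)).contDiffAt
  have hc : ContDiff ℂ ω fun x : Phase p s => phase (s := s) fourierWeight_pos (cis x.2.1) :=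
    (contDiff_phase _).comp (contDiff_cis.comp (contDiff_fst.comp contDiff_snd))
  have hc' : ContDiff ℂ ω fun x : Phase p s => phase (s := s) fourierWeight_pos (cis (-x.2.1)) :=
    (contDiff_phase _).comp (contDiff_cis.comp (contDiff_fst.comp contDiff_snd).neg)
  have h2 := (contDiff_const (c := l)).contDiffAt.smul hP
  exact (hc.contDiffAt.clm_apply h2.fst).prodMk (hc'.contDiffAt.clm_apply h2.snd)

theorem fderiv_chart {x : Phase p s} (hx : ∀ i, 0 < (x.1 i).re) (h : Phase p s) :
    fderiv ℂ chart x h =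
      (intIn p (cis x.2.1 * fun i => h.1 i / (2 * csqrt (x.1 i)) +
          Complex.I * h.2.1 i * csqrt (x.1 i)) + extIn h.2.2.1,
        intIn p (cis (-x.2.1) * fun i => h.1 i / (2 * csqrt (x.1 i)) -
          Complex.I * h.2.1 i * csqrt (x.1 i)) + extIn h.2.2.2) := by
  refine fderiv_eq_of_curve ((contDiffAt_chart hx).differentiableAt (by simp)) ?_
  have hl := hasDerivAt_line x h
  have hr : HasDerivAt (fun t : ℂ => fun i => csqrt ((x + t • h).1 i))
      (fun i => h.1 i / (2 * csqrt (x.1 i))) 0 := hasDerivAt_pi.2 fun i => by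
    have h1 : HasDerivAt csqrt (1 / (2 * csqrt (x.1 i))) ((x + (0 : ℂ) • h).1 i) := by
      rw [zero_smul, add_zero]; exact hasDerivAt_csqrt (hx i)
    refine (h1.comp (0 : ℂ) (hasDerivAt_pi.1 hl.fst i)).congr_deriv ?_
    ring
  have hθ : HasDerivAt (fun t : ℂ => (x + t • h).2.1) h.2.1 0 := hl.snd.fst
  have hc := hasDerivAt_cis hθ
  have hc' := hasDerivAt_cis hθ.fun_neg
  have key := (hasDerivAt_assemble (hc.mul hr) hl.snd.snd.fst).prodMk
    (hasDerivAt_assemble (hc'.mul hr) hl.snd.snd.snd)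
  refine key.congr_deriv ?_
  simp only [zero_smul, add_zero]
  refine assemble_congr ?_ rfl ?_ rfl <;> · funext i; simp; ring

theorem fderiv_scaledChart (l : ℂ) {x : Phase p s} (hx : (x.1, x.2.2) ∈ polarDom p s) (h : Phase p s) :
    fderiv ℂ (scaledChart l) x h =
      (intIn p (l • (cis x.2.1 * fun i => ampD x.1 x.2.2 h.1 h.2.2 i +
          Complex.I * h.2.1 i * amp x.1 x.2.2 i)) +
        extIn (l • phase extWeight_pos (cis x.2.1)
          (sym h.2.2.1 + phase extWeight_pos (Complex.I • h.2.1) (sym x.2.2.1))),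
      intIn p (l • (cis (-x.2.1) * fun i => ampD x.1 x.2.2 h.1 h.2.2 i -
          Complex.I * h.2.1 i * amp x.1 x.2.2 i)) +
        extIn (l • phase extWeight_pos (cis (-x.2.1))
          (sym h.2.2.2 - phase extWeight_pos (Complex.I • h.2.1) (sym x.2.2.2)))) := by
  refine fderiv_eq_of_curve ((contDiffAt_scaledChart l hx).differentiableAt (by simp)) ?_
  have hl := hasDerivAt_line x h
  have hr := hasDerivAt_amp hl.fst hl.snd.snd (by simpa using hx)
  have hθ : HasDerivAt (fun t : ℂ => (x + t • h).2.1) h.2.1 0 := hl.snd.fst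
  have hc := hasDerivAt_cis hθ
  have hc' := hasDerivAt_cis hθ.fun_neg
  have hz := (sym (p := p) (s := s)).hasFDerivAt.comp_hasDerivAt (0 : ℂ) hl.snd.snd.fst
  have hz' := (sym (p := p) (s := s)).hasFDerivAt.comp_hasDerivAt (0 : ℂ) hl.snd.snd.snd
  have key := (hasDerivAt_assemble ((hc.mul hr).const_smul l)
      ((hasDerivAt_phase hc hz).const_smul l)).prodMk
    (hasDerivAt_assemble ((hc'.mul hr).const_smul l) ((hasDerivAt_phase hc' hz').const_smul l))
  refine key.congr_deriv ?_
  simp only [zero_smul, add_zero, Function.comp]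
  refine assemble_congr ?_ ?_ ?_ ?_
  · refine congrArg _ (funext fun i => ?_); simp; ring
  · refine congrArg _ (Wl2.ext_coeff extWeight_pos fun α => ?_)
    simp only [coeff_phase, Wl2.coeff_add, Pi.mul_apply, Pi.smul_apply, smul_eq_mul]
    ring
  · refine congrArg _ (funext fun i => ?_); simp; ring
  · refine congrArg _ (Wl2.ext_coeff extWeight_pos fun α => ?_)
    simp only [coeff_phase, Wl2.coeff_add, Wl2.coeff_sub, Pi.mul_apply, Pi.smul_apply, smul_eq_mul,
      Pi.neg_apply]
    ring

theorem chart_symplectic {x : Phase p s} (hx : ∀ i, 0 < (x.1 i).re) (h k : Phase p s) :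
    omegaPs (fderiv ℂ chart x h) (fderiv ℂ chart x k) = omega h k := by
  rw [fderiv_chart hx, fderiv_chart hx, omegaPs_assemble, omega, mul_add, Finset.mul_sum]
  refine congrArg₂ (· + ·) ?_ (neg_mul _ _)
  rw [← Finset.sum_neg_distrib]
  refine Finset.sum_congr rfl fun i _ => ?_
  have hc := cis_mul_neg x.2.1 i
  have hq := csqrt_ne_zero (hx i)
  have hI := Complex.I_mul_I
  simp only [Pi.mul_apply]
  set q := csqrt (x.1 i)
  have e1 : h.1 i = 2 * q * (h.1 i / (2 * q)) := by field_simp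
  have e2 : k.1 i = 2 * q * (k.1 i / (2 * q)) := by field_simp
  set u := h.1 i / (2 * q)
  set u' := k.1 i / (2 * q)
  rw [e1, e2]
  linear_combination (-cis x.2.1 i * cis (-x.2.1) i * (2 * q * (h.2.1 i * u' - k.2.1 i * u))) * hI +
    (2 * q * (h.2.1 i * u' - k.2.1 i * u)) * hc

theorem pair_phase_sym (c : Fin 2 → ℂ) (u v : Zs p s) :
    (phase extWeight_pos c (sym u)).pair (sym v) = ∑ i, c i * occL p s i u v := by
  rw [phase_apply, pair_ext_add_left, pair_smul_left, pair_smul_left, Fin.sum_univ_two, occL_apply,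
    occL_apply]

theorem pair_phase_phase_neg (θ : Fin 2 → ℂ) (u v : Zs p s) :
    (phase extWeight_pos (cis θ) u).pair (phase extWeight_pos (cis (-θ)) v) = u.pair v := by
  have : cis θ * cis (-θ) = 1 := funext fun i => cis_mul_neg θ i
  rw [pair_phase, phase_phase, this, phase_one]

theorem pair_ext_sub_right (a b c : Zs p s) : c.pair (a - b) = c.pair a - c.pair b := by
  simp only [← Wl2.pairL_apply one_le_extWeight (s_nonneg s), map_sub]

theorem scaledChart_symplectic (l : ℂ) {x : Phase p s} (hx : (x.1, x.2.2) ∈ polarDom p s)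
    (h k : Phase p s) : omegaPs (fderiv ℂ (scaledChart l) x h) (fderiv ℂ (scaledChart l) x k) =
      l ^ 2 * omega h k := by
  rw [fderiv_scaledChart l hx, fderiv_scaledChart l hx, omegaPs_assemble, omega]
  simp only [pair_smul_left, pair_smul_right, pair_phase_phase_neg, pair_ext_add_left,
    pair_ext_sub_right, Pi.smul_apply, Pi.mul_apply, smul_eq_mul]
  have e1 : ∀ (c : Fin 2 → ℂ) (u v : Zs p s), (sym u).pair (phase extWeight_pos c (sym v)) =
      ∑ i, c i * occL p s i u v := fun c u v => by rw [← pair_phase, pair_phase_sym]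
  have e2 : (phase extWeight_pos (Complex.I • h.2.1) (sym x.2.2.1)).pair
        (phase extWeight_pos (Complex.I • k.2.1) (sym x.2.2.2)) =
      (phase extWeight_pos (Complex.I • k.2.1) (sym x.2.2.1)).pair
        (phase extWeight_pos (Complex.I • h.2.1) (sym x.2.2.2)) := by
    rw [pair_phase, pair_phase, phase_phase, phase_phase, mul_comm]
  have e3 : ∀ u v : Zs p s, (sym u).pair (sym v) = u.pair v := fun u v => by
    rw [pair_sym, sym_sym]
  rw [e2]
  simp only [e1, e3, pair_phase_sym, Fin.sum_univ_two, Pi.smul_apply, smul_eq_mul]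
  have key : ∀ i : Fin 2, l * (cis x.2.1 i * (ampD x.1 x.2.2 h.1 h.2.2 i +
        Complex.I * h.2.1 i * amp x.1 x.2.2 i)) * (l * (cis (-x.2.1) i *
        (ampD x.1 x.2.2 k.1 k.2.2 i - Complex.I * k.2.1 i * amp x.1 x.2.2 i))) -
      l * (cis x.2.1 i * (ampD x.1 x.2.2 k.1 k.2.2 i +
        Complex.I * k.2.1 i * amp x.1 x.2.2 i)) * (l * (cis (-x.2.1) i *
        (ampD x.1 x.2.2 h.1 h.2.2 i - Complex.I * h.2.1 i * amp x.1 x.2.2 i))) =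
      l ^ 2 * (Complex.I * (h.2.1 i * (k.1 i - (occL p s i k.2.2.1 x.2.2.2 + occL p s i x.2.2.1 k.2.2.2)) -
        k.2.1 i * (h.1 i - (occL p s i h.2.2.1 x.2.2.2 + occL p s i x.2.2.1 h.2.2.2)))) := fun i => by
    have hc := cis_mul_neg x.2.1 i
    have hq : amp x.1 x.2.2 i ≠ 0 := amp_ne_zero hx i
    have d1 : h.1 i - (occL p s i h.2.2.1 x.2.2.2 + occL p s i x.2.2.1 h.2.2.2) =
        2 * amp x.1 x.2.2 i * ampD x.1 x.2.2 h.1 h.2.2 i := by rw [ampD]; field_simp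
    have d2 : k.1 i - (occL p s i k.2.2.1 x.2.2.2 + occL p s i x.2.2.1 k.2.2.2) =
        2 * amp x.1 x.2.2 i * ampD x.1 x.2.2 k.1 k.2.2 i := by rw [ampD]; field_simp
    rw [d1, d2]
    linear_combination (2 * l ^ 2 * Complex.I * amp x.1 x.2.2 i *
      (h.2.1 i * ampD x.1 x.2.2 k.1 k.2.2 i - k.2.1 i * ampD x.1 x.2.2 h.1 h.2.2 i)) * hc
  rw [key, key]
  linear_combination (l ^ 2 * (-(h.2.1 0 * k.1 0 - k.2.1 0 * h.1 0) -
    (h.2.1 1 * k.1 1 - k.2.1 1 * h.1 1))) * Complex.I_mul_I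

theorem scaledChart_surjective {l : ℂ} (hl : l ≠ 0) {x : Phase p s}
    (hx : (x.1, x.2.2) ∈ polarDom p s) : Function.Surjective (fderiv ℂ (scaledChart l) x) := by
  rintro ⟨U, V⟩
  -- rotate and rescale the target, and read off first the angles, then `z`, then the actions
  set a : Fin 2 → ℂ := fun i => l⁻¹ * (cis (-x.2.1) i * U.coeff (p, i)) with ha
  set b : Fin 2 → ℂ := fun i => l⁻¹ * (cis x.2.1 i * V.coeff (p, i)) with hb
  set θ' : Fin 2 → ℂ := fun i => (a i - b i) / (2 * Complex.I * amp x.1 x.2.2 i) with hθ'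
  set z' : ExtPair p s :=
    (sym (l⁻¹ • phase extWeight_pos (cis (-x.2.1)) (extOut U) -
      phase extWeight_pos (Complex.I • θ') (sym x.2.2.1)),
     sym (l⁻¹ • phase extWeight_pos (cis x.2.1) (extOut V) +
      phase extWeight_pos (Complex.I • θ') (sym x.2.2.2))) with hz'
  set R' : Fin 2 → ℂ := fun i => amp x.1 x.2.2 i * (a i + b i) +
    (occL p s i z'.1 x.2.2.2 + occL p s i x.2.2.1 z'.2) with hR'
  have hD : ∀ i, ampD x.1 x.2.2 R' z' i = (a i + b i) / 2 := fun i => by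
    have hq : amp x.1 x.2.2 i ≠ 0 := amp_ne_zero hx i
    rw [ampD, hR']; field_simp; ring
  have hc := cis_mul_neg x.2.1
  have hθq : ∀ i, Complex.I * θ' i * amp x.1 x.2.2 i = (a i - b i) / 2 := fun i => by
    have hq : amp x.1 x.2.2 i ≠ 0 := amp_ne_zero hx i
    have := Complex.I_ne_zero
    rw [hθ']; field_simp
  have c1 : cis x.2.1 * cis (-x.2.1) = 1 := funext hc
  have c2 : cis (-x.2.1) * cis x.2.1 = 1 := by rw [mul_comm, c1]
  refine ⟨(R', θ', z'), ?_⟩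
  rw [fderiv_scaledChart l hx]
  simp only [hD, hθq]
  rw [← assemble_out (p := p) U, ← assemble_out (p := p) V]
  refine assemble_congr ?_ ?_ ?_ ?_
  · funext i
    simp only [Pi.smul_apply, Pi.mul_apply, smul_eq_mul, intOut_apply, ha, hb]
    field_simp
    linear_combination (2 * U.coeff (p, i)) * hc i
  · rw [hz', sym_sym, sub_add_cancel, map_smul, smul_smul, mul_inv_cancel₀ hl, one_smul,
      phase_phase, c1, phase_one]
  · funext i
    simp only [Pi.smul_apply, Pi.mul_apply, smul_eq_mul, intOut_apply, ha, hb]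
    field_simp
    linear_combination (2 * V.coeff (p, i)) * hc i
  · rw [hz', sym_sym, add_sub_cancel_right, map_smul, smul_smul, mul_inv_cancel₀ hl, one_smul,
      phase_phase, c2, phase_one]

end

noncomputable section

open scoped ContDiff

/-! ### The Birkhoff map in action-angle variables -/

variable {p : ℤ} {s : ℝ} [Fact (1 / 2 < s)]

/-- Half the argument of the quotient of the internal entries of `ψ` and `ψ̄`: the angle by which
the internal modes of a Fourier point are rotated. -/
def innerAngle (p : ℤ) (w : Ps s) (i : Fin 2) : ℂ :=
  1 / (2 * Complex.I) * Complex.log (w.1.coeff (p, i) / w.2.coeff (p, i))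

/-- Actions, angles and external variables of the Fourier point `w` after rotation by `θ`. -/
def unchart (θ : Fin 2 → ℂ) (w : Ps s) : Phase p s :=
  (fun i => w.1.coeff (p, i) * w.2.coeff (p, i), θ + innerAngle p w,
    (phase extWeight_pos (cis θ) (extOut w.1), phase extWeight_pos (cis (-θ)) (extOut w.2)))

theorem cis_innerAngle {w : Ps s} {i : Fin 2} (h1 : w.1.coeff (p, i) ≠ 0) (h2 : w.2.coeff (p, i) ≠ 0) :
    cis (innerAngle p w) i = csqrt (w.1.coeff (p, i) / w.2.coeff (p, i)) := by
  rw [cis, ← exp_half_log (div_ne_zero h1 h2), innerAngle]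
  congr 1
  field_simp

theorem cis_add (θ δ : Fin 2 → ℂ) : cis (θ + δ) = cis θ * cis δ := funext fun i => by
  simp only [cis, Pi.add_apply, Pi.mul_apply, ← Complex.exp_add]; congr 1; ring

theorem cis_neg_eq_inv (θ : Fin 2 → ℂ) (i : Fin 2) : cis (-θ) i = (cis θ i)⁻¹ :=
  eq_inv_of_mul_eq_one_right (cis_mul_neg θ i)

theorem chart_unchart (θ : Fin 2 → ℂ) {w : Ps s} (h1 : ∀ i, 0 < (w.1.coeff (p, i)).re)
    (h2 : ∀ i, 0 < (w.2.coeff (p, i)).re) : chart (unchart (p := p) θ w) = gauge θ w := by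
  have n1 : ∀ i, w.1.coeff (p, i) ≠ 0 := fun i h => by have := h1 i; rw [h] at this; simp at this
  have n2 : ∀ i, w.2.coeff (p, i) ≠ 0 := fun i h => by have := h2 i; rw [h] at this; simp at this
  have e : gauge θ w =
      (intIn p (cis θ * intOut p w.1) +
        extIn (phase (extWeight_pos (p := p)) (cis θ) (extOut w.1)),
      intIn p (cis (-θ) * intOut p w.2) +
        extIn (phase (extWeight_pos (p := p)) (cis (-θ)) (extOut w.2))) := by
    rw [← phase_assemble, ← phase_assemble, assemble_out, assemble_out]; rfl
  rw [e]
  refine assemble_congr ?_ rfl ?_ rfl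
  · funext i
    simp only [unchart, cis_add, Pi.mul_apply, cis_innerAngle (n1 i) (n2 i), intOut_apply]
    linear_combination cis θ i * (csqrt_polar (h1 i) (h2 i)).1
  · funext i
    simp only [unchart, neg_add, cis_add, Pi.mul_apply, cis_neg_eq_inv (innerAngle p w),
      cis_innerAngle (n1 i) (n2 i), intOut_apply]
    linear_combination cis (-θ) i * (csqrt_polar (h1 i) (h2 i)).2

theorem contDiffAt_unchart {x : Phase p s} {u : Phase p s → Ps s} (hu : ContDiffAt ℂ ω u x)
    (h : ∀ i, (u x).2.coeff (p, i) ≠ 0)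
    (h' : ∀ i, (u x).1.coeff (p, i) / (u x).2.coeff (p, i) ∈ Complex.slitPlane) :
    ContDiffAt ℂ ω (fun x => (unchart x.2.1 (u x) : Phase p s)) x := by
  have hc : ContDiff ℂ ω fun x : Phase p s => phase (s := s) (extWeight_pos (p := p)) (cis x.2.1) :=
    (contDiff_phase _).comp (contDiff_cis.comp (contDiff_fst.comp contDiff_snd))
  have hc' : ContDiff ℂ ω fun x : Phase p s => phase (s := s) (extWeight_pos (p := p)) (cis (-x.2.1)) :=
    (contDiff_phase _).comp (contDiff_cis.comp (contDiff_fst.comp contDiff_snd).neg)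
  have k1 : ∀ i, ContDiffAt ℂ ω (fun x => (u x).1.coeff (p, i)) x := fun i =>
    (Wl2.coeffL (s := s) fourierWeight_pos ((p, i) : Mode)).contDiff.contDiffAt.comp x hu.fst
  have k2 : ∀ i, ContDiffAt ℂ ω (fun x => (u x).2.coeff (p, i)) x := fun i =>
    (Wl2.coeffL (s := s) fourierWeight_pos ((p, i) : Mode)).contDiff.contDiffAt.comp x hu.snd
  refine ContDiffAt.prodMk (contDiffAt_pi.2 fun i => (k1 i).mul (k2 i)) (ContDiffAt.prodMk ?_
    (ContDiffAt.prodMk (hc.contDiffAt.clm_apply (extOut.contDiff.contDiffAt.comp x hu.fst))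
      (hc'.contDiffAt.clm_apply (extOut.contDiff.contDiffAt.comp x hu.snd))))
  refine (contDiff_fst.comp contDiff_snd).contDiffAt.add (contDiffAt_pi.2 fun i =>
    contDiffAt_const.mul ?_)
  exact (analyticAt_clog (h' i)).contDiffAt.comp x ((k1 i).div (k2 i) (h i))

/-- The Birkhoff map with the rescaling, the symmetrization and the rotation built in. -/
def liftMap (l : ℝ) (τ : Ps s → Ps s) (x : Phase p s) : Phase p s :=
  unchart x.2.1 (τ ((l : ℂ) • polar (x.1, x.2.2)))

/-- The domain of `liftMap`. The bound on the imaginary parts of the angles keeps the rotations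
bounded by two. -/
def liftDom (p : ℤ) (s : ℝ) [Fact (1 / 2 < s)] : Set (Phase p s) :=
  {x | (x.1, x.2.2) ∈ polarDom p s ∧ ‖x.1‖ < 3 ∧ (∀ i, |(x.2.1 i).im| < 1 / 2) ∧ ‖x.2.2‖ < 1 / 2}

theorem isOpen_liftDom : IsOpen (liftDom p s) := by
  have h1 : IsOpen {x : Phase p s | (x.1, x.2.2) ∈ polarDom p s} :=
    isOpen_polarDom.preimage (continuous_fst.prodMk (continuous_snd.comp continuous_snd))
  have h2 : IsOpen {x : Phase p s | ‖x.1‖ < 3} := isOpen_lt continuous_fst.norm continuous_const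
  have h3 : IsOpen {x : Phase p s | ∀ i, |(x.2.1 i).im| < 1 / 2} := by
    simp only [Set.ofPred_forall]
    exact isOpen_iInter_of_finite fun i => isOpen_lt (by fun_prop) continuous_const
  have h4 : IsOpen {x : Phase p s | ‖x.2.2‖ < 1 / 2} :=
    isOpen_lt (continuous_snd.comp continuous_snd).norm continuous_const
  exact h1.inter (h2.inter (h3.inter h4))

/-- A scale `l` at which the Birkhoff map is close enough to the identity: `C` bounds the polar
map and `K` is the constant in the cubic estimate. The factor two in `lt` leaves room for the
rotations, and `1 / 100` keeps the internal entries of the image in the right half-plane, since the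
amplitudes have real part at least `1 / 2`. -/
structure IsScale (ε K : ℝ) (p : ℤ) (s : ℝ) [Fact (1 / 2 < s)] (C l : ℝ) : Prop where
  pos : 0 < l
  one_le : 1 ≤ C
  nonneg : 0 ≤ K
  polar_le : ∀ y : (Fin 2 → ℂ) × ExtPair p s, ‖y.1‖ ≤ 3 → ‖y.2‖ ≤ 1 / 2 → ‖polar y‖ ≤ C
  lt : 2 * l * C < ε
  small : K * C ^ 3 * l ^ 2 ≤ 1 / 100

section

variable {ε K C l : ℝ} {τ : Ps s → Ps s} {Dt : Ps s → Ps s →L[ℂ] Ps s} {R6 : Ps s → ℂ}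
  {G6 : Ps s → Ps s}

theorem IsScale.norm_smul_polar_le (hS : IsScale ε K p s C l) {x : Phase p s} (hx : x ∈ liftDom p s) :
    ‖(l : ℂ) • polar (x.1, x.2.2)‖ ≤ l * C := by
  rw [norm_smul, Complex.norm_real, Real.norm_of_nonneg hS.pos.le]
  exact mul_le_mul_of_nonneg_left (hS.polar_le _ hx.2.1.le hx.2.2.2.le) hS.pos.le

theorem IsScale.mem_ball (hS : IsScale ε K p s C l) {x : Phase p s} (hx : x ∈ liftDom p s) :
    (l : ℂ) • polar (x.1, x.2.2) ∈ Metric.ball (0 : Ps s) ε := by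
  rw [mem_ball_zero_iff]
  have h1 := hS.norm_smul_polar_le hx
  have h2 := hS.lt
  have h3 := (norm_nonneg _).trans h1
  linarith

theorem IsScale.scaledChart_mem (hS : IsScale ε K p s C l) {x : Phase p s} (hx : x ∈ liftDom p s) :
    scaledChart l x ∈ Metric.ball (0 : Ps s) ε := by
  rw [mem_ball_zero_iff, scaledChart_eq]
  have h1 := hS.norm_smul_polar_le hx
  have h2 := norm_gauge_le (fun i => (hx.2.2.1 i).le) ((l : ℂ) • polar (x.1, x.2.2))
  have h3 := hS.lt
  linarith

theorem IsScale.dist_le (hS : IsScale ε K p s C l) (hB : IsBirkhoffSystem ε K τ Dt R6 G6)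
    {x : Phase p s} (hx : x ∈ liftDom p s) :
    ‖τ ((l : ℂ) • polar (x.1, x.2.2)) - (l : ℂ) • polar (x.1, x.2.2)‖ ≤ l * (K * C ^ 3 * l ^ 2) := by
  have h1 := hS.norm_smul_polar_le hx
  have hK := hS.nonneg
  calc _ ≤ K * ‖(l : ℂ) • polar (x.1, x.2.2)‖ ^ 3 := hB.map.close _ (hS.mem_ball hx)
    _ ≤ K * (l * C) ^ 3 := by gcongr
    _ = _ := by ring

theorem norm_coeff_le_norm (u : Hs s) (m : Mode) : ‖u.coeff m‖ ≤ ‖u‖ := by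
  refine (Wl2.norm_coeff_le fourierWeight_pos u m).trans ?_
  refine mul_le_of_le_one_left (norm_nonneg _) ?_
  exact Real.rpow_le_one_of_one_le_of_nonpos (one_le_fourierWeight m) (by linarith [s_nonneg s])

/-- The internal entries of the image are `l` times small perturbations of the amplitudes. -/
theorem IsScale.exists_entries (hS : IsScale ε K p s C l) (hB : IsBirkhoffSystem ε K τ Dt R6 G6)
    {x : Phase p s} (hx : x ∈ liftDom p s) (i : Fin 2) : ∃ a b : ℂ,
      (τ ((l : ℂ) • polar (x.1, x.2.2))).1.coeff (p, i) = l * (amp x.1 x.2.2 i + a) ∧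
      (τ ((l : ℂ) • polar (x.1, x.2.2))).2.coeff (p, i) = l * (amp x.1 x.2.2 i + b) ∧
      ‖a‖ ≤ K * C ^ 3 * l ^ 2 ∧ ‖b‖ ≤ K * C ^ 3 * l ^ 2 := by
  have hd := hS.dist_le hB hx
  set w := (l : ℂ) • polar (x.1, x.2.2) with hw
  have hl : (l : ℂ) ≠ 0 := by exact_mod_cast hS.pos.ne'
  have e1 : w.1.coeff (p, i) = l * amp x.1 x.2.2 i := by
    rw [hw, polar, Prod.smul_mk, Wl2.coeff_smul, coeff_assemble]; simp
  have e2 : w.2.coeff (p, i) = l * amp x.1 x.2.2 i := by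
    rw [hw, polar, Prod.smul_mk, Wl2.coeff_smul, coeff_assemble]; simp
  have key : ∀ u : Hs s, ‖u‖ ≤ l * (K * C ^ 3 * l ^ 2) → ‖(l : ℂ)⁻¹ * u.coeff (p, i)‖ ≤ K * C ^ 3 * l ^ 2 :=
    fun u hu => by
      rw [norm_mul, norm_inv, Complex.norm_real, Real.norm_of_nonneg hS.pos.le, inv_mul_le_iff₀ hS.pos]
      exact (norm_coeff_le_norm u _).trans hu
  refine ⟨(l : ℂ)⁻¹ * (τ w - w).1.coeff (p, i), (l : ℂ)⁻¹ * (τ w - w).2.coeff (p, i), ?_, ?_,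
    key _ ((norm_fst_le _).trans hd), key _ ((norm_snd_le _).trans hd)⟩
  · rw [mul_add, mul_inv_cancel_left₀ hl, ← e1, Prod.fst_sub, Wl2.coeff_sub]; ring
  · rw [mul_add, mul_inv_cancel_left₀ hl, ← e2, Prod.snd_sub, Wl2.coeff_sub]; ring

theorem IsScale.entries_re_pos (hS : IsScale ε K p s C l) (hB : IsBirkhoffSystem ε K τ Dt R6 G6)
    {x : Phase p s} (hx : x ∈ liftDom p s) (i : Fin 2) :
    0 < ((τ ((l : ℂ) • polar (x.1, x.2.2))).1.coeff (p, i)).re ∧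
      0 < ((τ ((l : ℂ) • polar (x.1, x.2.2))).2.coeff (p, i)).re := by
  obtain ⟨a, b, e1, e2, ha, hb⟩ := hS.exists_entries hB hx i
  have hq : 1 / 2 ≤ (amp x.1 x.2.2 i).re := half_le_amp_re hx.1 i
  have h1 := (abs_le.1 ((Complex.abs_re_le_norm a).trans (ha.trans hS.small))).1
  have h2 := (abs_le.1 ((Complex.abs_re_le_norm b).trans (hb.trans hS.small))).1
  rw [e1, e2, Complex.re_ofReal_mul, Complex.re_ofReal_mul, Complex.add_re, Complex.add_re]
  exact ⟨mul_pos hS.pos (by linarith), mul_pos hS.pos (by linarith)⟩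

theorem IsScale.norm_ratio_le (hS : IsScale ε K p s C l) (hB : IsBirkhoffSystem ε K τ Dt R6 G6)
    {x : Phase p s} (hx : x ∈ liftDom p s) (i : Fin 2) :
    ‖(τ ((l : ℂ) • polar (x.1, x.2.2))).1.coeff (p, i) /
      (τ ((l : ℂ) • polar (x.1, x.2.2))).2.coeff (p, i) - 1‖ ≤ 5 * (K * C ^ 3 * l ^ 2) := by
  obtain ⟨a, b, e1, e2, ha, hb⟩ := hS.exists_entries hB hx i
  have hq : 1 / 2 ≤ (amp x.1 x.2.2 i).re := half_le_amp_re hx.1 i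
  have hl : (l : ℂ) ≠ 0 := by exact_mod_cast hS.pos.ne'
  have h2 := (abs_le.1 ((Complex.abs_re_le_norm b).trans (hb.trans hS.small))).1
  have hd : 2 / 5 ≤ ‖amp x.1 x.2.2 i + b‖ := by
    refine le_trans ?_ (Complex.re_le_norm _)
    rw [Complex.add_re]; linarith
  have h0 : amp x.1 x.2.2 i + b ≠ 0 := fun h => by rw [h] at hd; norm_num at hd
  have e : (l * (amp x.1 x.2.2 i + a)) / (l * (amp x.1 x.2.2 i + b)) - 1 =
      (a - b) / (amp x.1 x.2.2 i + b) := by field_simp; ring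
  rw [e1, e2, e, norm_div, div_le_iff₀ (by linarith)]
  have := norm_sub_le a b
  nlinarith [norm_nonneg a]

theorem IsScale.norm_act_le (hS : IsScale ε K p s C l) (hB : IsBirkhoffSystem ε K τ Dt R6 G6)
    {x : Phase p s} (hx : x ∈ liftDom p s) (i : Fin 2) :
    ‖(liftMap l τ x).1 i - l ^ 2 * (x.1 i - occ x.2.2 i)‖ ≤ l ^ 2 * (5 * (K * C ^ 3 * l ^ 2)) := by
  obtain ⟨a, b, e1, e2, ha, hb⟩ := hS.exists_entries hB hx i
  have e : (liftMap l τ x).1 i - l ^ 2 * (x.1 i - occ x.2.2 i) =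
      l ^ 2 * (amp x.1 x.2.2 i * (a + b) + a * b) := by
    change (τ _).1.coeff (p, i) * (τ _).2.coeff (p, i) - _ = _
    rw [e1, e2, ← amp_sq]; ring
  have hq : ‖amp x.1 x.2.2 i‖ ≤ 2 := norm_amp_le hx.2.1.le hx.2.2.2.le i
  have hs := hS.small
  set κ := K * C ^ 3 * l ^ 2
  rw [e, norm_mul, norm_pow, Complex.norm_real, Real.norm_of_nonneg hS.pos.le]
  refine mul_le_mul_of_nonneg_left ?_ (sq_nonneg _)
  have hκ : 0 ≤ κ := (norm_nonneg _).trans ha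
  calc _ ≤ ‖amp x.1 x.2.2 i * (a + b)‖ + ‖a * b‖ := norm_add_le _ _
    _ ≤ 2 * (κ + κ) + κ * κ := by
      rw [norm_mul, norm_mul]
      gcongr
      exact (norm_add_le _ _).trans (add_le_add ha hb)
    _ ≤ _ := by nlinarith

theorem IsScale.norm_innerAngle_le (hS : IsScale ε K p s C l) (hB : IsBirkhoffSystem ε K τ Dt R6 G6)
    {x : Phase p s} (hx : x ∈ liftDom p s) (i : Fin 2) :
    ‖innerAngle p (τ ((l : ℂ) • polar (x.1, x.2.2))) i‖ ≤ 4 * (K * C ^ 3 * l ^ 2) := by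
  have h1 := hS.norm_ratio_le hB hx i
  have hs := hS.small
  set c := (τ ((l : ℂ) • polar (x.1, x.2.2))).1.coeff (p, i) /
    (τ ((l : ℂ) • polar (x.1, x.2.2))).2.coeff (p, i) with hc
  have h2 := Complex.norm_log_one_add_half_le_self (z := c - 1) (by linarith)
  rw [add_sub_cancel] at h2
  have h0 := norm_nonneg (c - 1)
  rw [innerAngle, ← hc, norm_mul, norm_div, norm_mul, Complex.norm_I, norm_one, Complex.norm_ofNat]
  linarith

theorem IsScale.norm_ext_le (hS : IsScale ε K p s C l) (hB : IsBirkhoffSystem ε K τ Dt R6 G6)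
    {x : Phase p s} (hx : x ∈ liftDom p s) :
    ‖(liftMap l τ x).2.2 - ((l : ℂ) • phase extWeight_pos (cis x.2.1) (sym x.2.2.1),
      (l : ℂ) • phase extWeight_pos (cis (-x.2.1)) (sym x.2.2.2))‖ ≤ l * (2 * (K * C ^ 3 * l ^ 2)) := by
  have hd := hS.dist_le hB hx
  have he : Real.exp (1 / 2) ≤ 2 := by
    have h := Real.exp_one_lt_d9
    have h1 : Real.exp (1 / 2) ^ 2 = Real.exp 1 := by rw [← Real.exp_nat_mul]; norm_num
    nlinarith [Real.exp_pos (1 / 2)]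
  set w := (l : ℂ) • polar (x.1, x.2.2) with hw
  have key : ∀ {θ : Fin 2 → ℂ} (_ : ∀ i, |(θ i).im| ≤ 1 / 2) {u v : Hs s} {z : Zs p s}
      (_ : (extOut v : Zs p s) = (l : ℂ) • z) (_ : ‖u - v‖ ≤ l * (K * C ^ 3 * l ^ 2)),
      ‖phase extWeight_pos (cis θ) (extOut u) - (l : ℂ) • phase extWeight_pos (cis θ) z‖ ≤
        l * (2 * (K * C ^ 3 * l ^ 2)) := fun {θ} hθ {u v z} hz hu => by
    rw [← map_smul, ← hz, ← map_sub, ← map_sub]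
    refine (norm_phase_le extWeight_pos (fun i => (norm_cis_le hθ i).trans he) _).trans ?_
    have := (norm_extOut_le (p := p) (u - v)).trans hu
    linarith
  have hθ : ∀ i, |(x.2.1 i).im| ≤ 1 / 2 := fun i => (hx.2.2.1 i).le
  refine max_le (key hθ (v := w.1) ?_ ((norm_fst_le _).trans hd))
    (key (by simpa using hθ) (v := w.2) ?_ ((norm_snd_le _).trans hd))
  · rw [hw, polar, Prod.smul_mk, map_smul, extOut_assemble]
  · rw [hw, polar, Prod.smul_mk, map_smul, extOut_assemble]

/-- In Fourier variables `liftMap` is the Birkhoff map: rotating by `θ` commutes with `τ`, so `τ` may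
be applied before the rotation, where logarithms and roots stay on the principal branch. -/
theorem IsScale.chart_liftMap (hS : IsScale ε K p s C l) (hB : IsBirkhoffSystem ε K τ Dt R6 G6)
    {x : Phase p s} (hx : x ∈ liftDom p s) : chart (liftMap l τ x) = τ (scaledChart l x) := by
  rw [liftMap, chart_unchart _ (fun i => (hS.entries_re_pos hB hx i).1)
    (fun i => (hS.entries_re_pos hB hx i).2), scaledChart_eq,
    hB.gauge_eq _ (fun i => (hx.2.2.1 i).le) _ (hS.mem_ball hx)]
  rw [← scaledChart_eq]; exact hS.scaledChart_mem hx

theorem IsScale.contDiffAt_liftMap (hS : IsScale ε K p s C l) (hB : IsBirkhoffSystem ε K τ Dt R6 G6)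
    {x : Phase p s} (hx : x ∈ liftDom p s) : ContDiffAt ℂ ω (liftMap l τ) x := by
  have hτ := hB.smooth.contDiffAt (Metric.isOpen_ball.mem_nhds (hS.mem_ball hx))
  have hP : ContDiffAt ℂ ω (fun x : Phase p s => (l : ℂ) • polar (x.1, x.2.2)) x :=
    (contDiff_const (c := (l : ℂ))).contDiffAt.smul
      ((contDiffOn_polar.contDiffAt (isOpen_polarDom.mem_nhds hx.1)).comp x
      (f := fun x : Phase p s => (x.1, x.2.2))
      (contDiff_fst.prodMk (contDiff_snd.comp contDiff_snd)).contDiffAt)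
  refine contDiffAt_unchart (hτ.comp x hP) (fun i h => ?_) fun i => Or.inl ?_
  · have := (hS.entries_re_pos hB hx i).2
    rw [show (τ ((l : ℂ) • polar (x.1, x.2.2))).2.coeff (p, i) = 0 from h] at this; simp at this
  · have h1 := (Complex.abs_re_le_norm _).trans (hS.norm_ratio_le hB hx i)
    have h2 := hS.small
    rw [Complex.sub_re, Complex.one_re] at h1
    have h3 := (abs_le.1 h1).1
    have h4 : 0 < ((τ ((l : ℂ) • polar (x.1, x.2.2))).1.coeff (p, i) /
        (τ ((l : ℂ) • polar (x.1, x.2.2))).2.coeff (p, i)).re := by linarith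
    exact h4

theorem IsScale.act_re_pos (hS : IsScale ε K p s C l) (hB : IsBirkhoffSystem ε K τ Dt R6 G6)
    {x : Phase p s} (hx : x ∈ liftDom p s) (i : Fin 2) : 0 < ((liftMap l τ x).1 i).re := by
  have h1 := (abs_le.1 ((Complex.abs_re_le_norm _).trans (hS.norm_act_le hB hx i))).1
  have h2 : 1 / 2 < (x.1 i - occ x.2.2 i).re := hx.1 i
  have hs := hS.small
  have hl : 0 < l ^ 2 := pow_pos hS.pos 2
  rw [Complex.sub_re, ← Complex.ofReal_pow, Complex.re_ofReal_mul] at h1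
  nlinarith

theorem IsScale.fderiv_chart_liftMap (hS : IsScale ε K p s C l) (hB : IsBirkhoffSystem ε K τ Dt R6 G6)
    {x : Phase p s} (hx : x ∈ liftDom p s) (h : Phase p s) :
    fderiv ℂ chart (liftMap l τ x) (fderiv ℂ (liftMap l τ) x h) =
      fderiv ℂ τ (scaledChart l x) (fderiv ℂ (scaledChart l) x h) := by
  have e : (fun x => chart (liftMap (p := p) l τ x)) =ᶠ[𝓝 x] fun x => τ (scaledChart l x) :=
    Filter.eventuallyEq_of_mem (isOpen_liftDom.mem_nhds hx) fun y hy => hS.chart_liftMap hB hy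
  have h1 := ((contDiffAt_chart (hS.act_re_pos hB hx)).differentiableAt (by simp)).hasFDerivAt.comp x
    ((hS.contDiffAt_liftMap hB hx).differentiableAt (by simp)).hasFDerivAt
  have hτ := hB.smooth.contDiffAt (Metric.isOpen_ball.mem_nhds (hS.scaledChart_mem hx))
  have h2 := (hτ.differentiableAt (by simp)).hasFDerivAt.comp x
    ((contDiffAt_scaledChart l hx.1).differentiableAt (by simp)).hasFDerivAt
  exact congrArg (fun L : Phase p s →L[ℂ] Ps s => L h) ((h1.congr_of_eventuallyEq e.symm).unique h2)

/-- The charts are symplectic up to the factor `l ^ 2`, and so is `liftMap`, which intertwines them. -/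
theorem IsScale.symplectic (hS : IsScale ε K p s C l) (hB : IsBirkhoffSystem ε K τ Dt R6 G6)
    {x : Phase p s} (hx : x ∈ liftDom p s) (h k : Phase p s) :
    omega (fderiv ℂ (liftMap l τ) x h) (fderiv ℂ (liftMap l τ) x k) = l ^ 2 * omega h k := by
  rw [← chart_symplectic (hS.act_re_pos hB hx), hS.fderiv_chart_liftMap hB hx,
    hS.fderiv_chart_liftMap hB hx, hB.map.symplectic _ (hS.scaledChart_mem hx),
    scaledChart_symplectic l hx.1]

theorem isInvertible_of_bijective {E : Type} [NormedAddCommGroup E] [NormedSpace ℂ E]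
    [CompleteSpace E] {L : E →L[ℂ] E} (h : Function.Bijective L) : L.IsInvertible :=
  ⟨ContinuousLinearEquiv.ofBijective L (LinearMap.ker_eq_bot.2 h.1) (LinearMap.range_eq_top.2 h.2),
    ContinuousLinearEquiv.coe_ofBijective _ _ _⟩

/-- A symplectic derivative is injective; surjectivity is that of `scaledChart` followed by `τ`. -/
theorem IsScale.isInvertible (hS : IsScale ε K p s C l) (hB : IsBirkhoffSystem ε K τ Dt R6 G6)
    {x : Phase p s} (hx : x ∈ liftDom p s) : (fderiv ℂ (liftMap l τ) x).IsInvertible := by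
  have hl : (l : ℂ) ≠ 0 := by exact_mod_cast hS.pos.ne'
  have inj : ∀ h, fderiv ℂ (liftMap l τ) x h = 0 → h = 0 := fun h h0 => by
    refine eq_zero_of_omega fun k => ?_
    have h1 := hS.symplectic hB hx h k
    rw [h0] at h1
    have h2 : ∀ v : Phase p s, omega 0 v = 0 := fun v => by
      have e : ∀ u : Zs p s, (0 : Zs p s).pair u = 0 := fun u => by
        rw [← Wl2.pairL_apply one_le_extWeight (s_nonneg s), map_zero, zero_apply]
      simp [omega, e, Wl2.pair_comm _ (0 : Zs p s)]
    rw [h2] at h1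
    exact (mul_eq_zero.1 h1.symm).resolve_left (pow_ne_zero _ hl)
  have chart_inj : Function.Injective (fderiv ℂ (chart (p := p) (s := s)) (liftMap l τ x)) := by
    refine (injective_iff_map_eq_zero _).2 fun h h0 => eq_zero_of_omega fun k => ?_
    rw [← chart_symplectic (hS.act_re_pos hB hx), h0, omegaPs_eq, map_zero, zero_apply]
  refine isInvertible_of_bijective ⟨(injective_iff_map_eq_zero _).2 inj, fun y => ?_⟩
  obtain ⟨e, he⟩ := hB.map.biholo.2.2 _ (hS.scaledChart_mem hx)
  obtain ⟨h, hh⟩ := scaledChart_surjective hl hx.1 (e.symm (fderiv ℂ chart (liftMap l τ x) y))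
  refine ⟨h, chart_inj ?_⟩
  rw [hS.fderiv_chart_liftMap hB hx, hh, ← he]
  exact e.apply_symm_apply _

theorem cis_ne_zero (θ : Fin 2 → ℂ) (i : Fin 2) : cis θ i ≠ 0 := Complex.exp_ne_zero _

/-- The intertwining recovers everything but the integer multiples of `2π` in the angles; these are
fixed because the angle component is `θ` plus a function of the remaining variables. -/
theorem IsScale.injOn (hS : IsScale ε K p s C l) (hB : IsBirkhoffSystem ε K τ Dt R6 G6) :
    Set.InjOn (liftMap l τ) (liftDom p s) := by
  rintro ⟨R, θ, z⟩ hx ⟨R', θ', z'⟩ hx' h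
  have hl : (l : ℂ) ≠ 0 := by exact_mod_cast hS.pos.ne'
  have h1 := hB.map.biholo.2.1 (hS.scaledChart_mem hx) (hS.scaledChart_mem hx')
    (by rw [← hS.chart_liftMap hB hx, h, hS.chart_liftMap hB hx'])
  have a1 : ∀ i, cis θ i * amp R z i = cis θ' i * amp R' z' i := fun i => by
    have := congrArg (fun w : Ps s => intOut p w.1 i) h1
    simp only [scaledChart, intOut_assemble, Pi.smul_apply, smul_eq_mul, Pi.mul_apply] at this
    exact mul_left_cancel₀ hl this
  have a2 : ∀ i, cis (-θ) i * amp R z i = cis (-θ') i * amp R' z' i := fun i => by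
    have := congrArg (fun w : Ps s => intOut p w.2 i) h1
    simp only [scaledChart, intOut_assemble, Pi.smul_apply, smul_eq_mul, Pi.mul_apply] at this
    exact mul_left_cancel₀ hl this
  have hR : ∀ i, R i - occ z i = R' i - occ z' i := fun i => by
    rw [← amp_sq, ← amp_sq]
    have e1 := cis_mul_neg θ i
    have e2 := cis_mul_neg θ' i
    calc amp R z i ^ 2 = (cis θ i * amp R z i) * (cis (-θ) i * amp R z i) := by
          linear_combination -(amp R z i ^ 2) * e1
      _ = (cis θ' i * amp R' z' i) * (cis (-θ') i * amp R' z' i) := by rw [a1, a2]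
      _ = _ := by linear_combination (amp R' z' i ^ 2) * e2
  have hq : amp R z = amp R' z' := funext fun i => by rw [amp, amp, hR]
  have hc : cis θ = cis θ' := funext fun i => by
    have := a1 i
    rw [hq] at this
    exact mul_right_cancel₀ (amp_ne_zero hx'.1 i) this
  have hc' : cis (-θ) = cis (-θ') := funext fun i => by rw [cis_neg_eq_inv, cis_neg_eq_inv, hc]
  have ph : ∀ {α : Fin 2 → ℂ} {u v : Zs p s}, phase extWeight_pos (cis α) u = phase extWeight_pos (cis α) v →
      u = v := fun {α u v} e => Wl2.ext_coeff extWeight_pos fun β => by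
    have := congrArg (fun x : Zs p s => x.coeff β) e
    simp only [coeff_phase] at this
    exact mul_left_cancel₀ (cis_ne_zero _ _) this
  have sj : ∀ {u v : Zs p s}, sym u = sym v → u = v := fun {u v} e => by
    rw [← sym_sym u, e, sym_sym]
  have z1 : z.1 = z'.1 := by
    have := congrArg (fun w : Ps s => (extOut w.1 : Zs p s)) h1
    simp only [scaledChart, extOut_assemble, hc] at this
    exact sj (ph (smul_right_injective _ hl this))
  have z2 : z.2 = z'.2 := by
    have := congrArg (fun w : Ps s => (extOut w.2 : Zs p s)) h1
    simp only [scaledChart, extOut_assemble, hc'] at this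
    exact sj (ph (smul_right_injective _ hl this))
  have hz : z = z' := Prod.ext z1 z2
  have hRR : R = R' := funext fun i => by
    have := hR i; rw [hz] at this; exact sub_left_injective this
  subst hz hRR
  -- the angles are equal and not only congruent, as the correction to them is the same
  have ht : θ = θ' := by
    have := congrArg (fun x : Phase p s => x.2.1) h
    exact add_right_cancel this
  rw [ht]

theorem liftMap_shift (l : ℝ) (τ : Ps s → Ps s) (x : Phase p s) (k : Fin 2 → ℤ) :
    liftMap l τ (x + shift k) = liftMap l τ x + shift k := by
  have e : ∀ (n : ℤ) (t : ℂ), Complex.exp (Complex.I * (t + 2 * (Real.pi : ℂ) * n)) =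
      Complex.exp (Complex.I * t) := fun n t => by
    rw [mul_add, show Complex.I * (2 * (Real.pi : ℂ) * n) = n * (2 * Real.pi * Complex.I) by ring]
    exact Complex.exp_periodic.int_mul n _
  have c1 : cis (x + shift k).2.1 = cis x.2.1 := funext fun i => e (k i) (x.2.1 i)
  have c2 : cis (-(x + shift k).2.1) = cis (-x.2.1) := funext fun i => by
    rw [cis_neg_eq_inv, cis_neg_eq_inv, c1]
  have s1 : (x + shift k).1 = x.1 := add_zero _
  have s2 : (x + shift k).2.2 = x.2.2 := add_zero _
  rw [liftMap, liftMap, s1, s2, unchart, unchart, c1, c2]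
  refine Prod.ext (add_zero _).symm (Prod.ext ?_ (add_zero _).symm)
  exact add_right_comm _ _ _

end

end

noncomputable section

open scoped ContDiff

/-! ### Real points, the explicit part and the torus neighbourhoods -/

variable {p : ℤ} {s : ℝ} [Fact (1 / 2 < s)]

theorem occ_eq_tsum (z : ExtPair p s) (i : Fin 2) :
    occ z i = ∑' k : {j : ℤ // j ≠ p}, (sym z.1).coeff (k, i) * (sym z.2).coeff (k, i) := by
  have hinj : Function.Injective fun k : {j : ℤ // j ≠ p} => ((k, i) : ExtMode p) :=
    fun k k' h => congrArg Prod.fst h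
  rw [occ, occL_apply, Wl2.pair, ← hinj.tsum_eq]
  · exact tsum_congr fun k => by rw [coeff_species, if_pos rfl]
  · rintro ⟨k, j⟩ hk
    by_cases h : j = i
    · exact ⟨k, by rw [h]⟩
    · refine absurd ?_ hk
      simp only [coeff_species]
      rw [if_neg h, zero_mul]

/-- External variables are real when `ζ̄` is the conjugate of `ζ`. -/
def IsRealExt (z : ExtPair p s) : Prop := ∀ α, z.2.coeff α = conj (z.1.coeff α)

theorem IsRealExt.sym {z : ExtPair p s} (hz : IsRealExt z) :
    IsRealExt (sym z.1, sym z.2) := fun ⟨k, i⟩ => by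
  simp only [coeff_sym, symFun, hz _]
  fin_cases i <;> simp [Complex.conj_ofReal]

theorem occ_real {z : ExtPair p s} (hz : IsRealExt z) (i : Fin 2) : (occ z i).im = 0 := by
  rw [occ_eq_tsum]
  have e : ∀ k : {j : ℤ // j ≠ p}, (sym z.1).coeff (k, i) * (sym z.2).coeff (k, i) =
      ((Complex.normSq ((sym z.1).coeff (k, i)) : ℝ) : ℂ) := fun k => by
    rw [← Complex.mul_conj]; exact congrArg _ (hz.sym _)
  rw [tsum_congr e, ← Complex.ofReal_tsum, Complex.ofReal_im]

theorem amp_real {R : Fin 2 → ℂ} {z : ExtPair p s} (hR : ∀ i, (R i).im = 0) (hz : IsRealExt z)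
    (h : (R, z) ∈ polarDom p s) (i : Fin 2) : conj (amp R z i) = amp R z i := by
  have e : R i - occ z i = (((R i - occ z i).re : ℝ) : ℂ) := Complex.ext rfl (by
    rw [Complex.sub_im, hR, occ_real hz, Complex.ofReal_im, sub_zero])
  have h0 : 0 ≤ (R i - occ z i).re := le_trans (by norm_num) (h i).le
  rw [amp, e, csqrt_ofReal h0, Complex.conj_ofReal]

theorem polar_real {R : Fin 2 → ℂ} {z : ExtPair p s} (hR : ∀ i, (R i).im = 0) (hz : IsRealExt z)
    (h : (R, z) ∈ polarDom p s) (l : ℝ) : IsRealPs ((l : ℂ) • polar (R, z)) := fun m => by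
  rw [polar, Prod.smul_mk]
  simp only [Wl2.coeff_smul, coeff_assemble]
  split_ifs with hm
  · rw [map_mul, amp_real hR hz h, Complex.conj_ofReal]
  · rw [map_mul, Complex.conj_ofReal, ← hz.sym]

theorem unchart_real {θ : Fin 2 → ℂ} {w : Ps s} (hθ : ∀ i, (θ i).im = 0) (hw : IsRealPs w)
    (h0 : ∀ i, w.1.coeff (p, i) ≠ 0) : IsRealPhase (unchart θ w : Phase p s) := by
  refine ⟨fun i => ?_, fun i => ?_, fun α => ?_⟩
  · simp only [unchart]
    rw [hw, Complex.mul_conj, Complex.ofReal_im]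
  · have hn : ‖w.1.coeff (p, i) / w.2.coeff (p, i)‖ = 1 := by
      rw [hw, norm_div, Complex.norm_conj, div_self (norm_ne_zero_iff.2 (h0 i))]
    have hre : (Complex.log (w.1.coeff (p, i) / w.2.coeff (p, i))).re = 0 := by
      rw [Complex.log_re, hn, Real.log_one]
    simp only [unchart, Pi.add_apply, innerAngle]
    rw [Complex.add_im, hθ, zero_add,
      show (1 : ℂ) / (2 * Complex.I) = ((-(1 / 2) : ℝ) : ℂ) * Complex.I by
        have := Complex.I_sq; field_simp; push_cast; linear_combination (-(1 : ℂ)) * this * (-1)]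
    rw [mul_assoc, Complex.im_ofReal_mul, Complex.I_mul_im, hre, mul_zero]
  · simp only [unchart, coeff_phase, coeff_extOut]
    rw [map_mul, ← hw, cis_neg, cis, ← Complex.exp_conj, map_mul, Complex.conj_I,
      Complex.conj_eq_iff_im.2 (hθ _), neg_mul]

/-- The translation in the actions by a real vector. -/
def base (ρ : Fin 2 → ℝ) : Phase p s := (fun i => (ρ i : ℂ), 0, 0)

/-- The explicit part of the change of variables. -/
def explicitPart (l : ℂ) (x : Phase p s) : Phase p s :=
  (fun i => l ^ 2 * (x.1 i - occ x.2.2 i), x.2.1,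
    (l • phase extWeight_pos (cis x.2.1) (sym x.2.2.1),
      l • phase extWeight_pos (cis (-x.2.1)) (sym x.2.2.2)))

theorem coords_explicitPart {ν : ℝ} (hν : 0 ≤ ν) (ρ : Fin 2 → ℝ) (x : Phase p s) :
    coords (explicitPart (√ν : ℝ) (x + base ρ)) = psiAng (psiSym (chi ν ρ (coords x))) := by
  have hl : ((√ν : ℝ) : ℂ) ^ 2 = ν := by
    rw [← Complex.ofReal_pow, Real.sq_sqrt hν]
  have b1 : (x + base ρ).2 = x.2 := add_zero _
  have b2 : ∀ i, (x + base ρ).1 i = x.1 i + ρ i := fun i => rfl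
  have hs : ∀ (c : ℂ) (u : Zs p s) (α : ExtMode p), symFun (fun β => c * u.coeff β) α =
      c * (sym u).coeff α := fun c u ⟨k, i⟩ => by
    rw [coeff_sym]; fin_cases i <;> simp [symFun] <;> ring
  simp only [coords, explicitPart, psiAng, psiSym, chi, Pt.mk.injEq, b1, b2]
  refine ⟨funext fun i => ?_, trivial, funext fun α => ?_, funext fun α => ?_⟩
  · have e : ∀ k : {j : ℤ // j ≠ p},
        symFun (fun β => ((√ν : ℝ) : ℂ) * x.2.2.1.coeff β) (k, i) *
        symFun (fun β => ((√ν : ℝ) : ℂ) * x.2.2.2.coeff β) (k, i) =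
        ν * ((sym x.2.2.1).coeff (k, i) * (sym x.2.2.2).coeff (k, i)) := fun k => by
      rw [hs, hs, ← hl]; ring
    refine Eq.trans ?_ (congrArg (fun t => (ν : ℂ) * ρ i + ν * x.1 i - t) (tsum_congr e).symm)
    rw [tsum_mul_left, ← occ_eq_tsum, hl]; ring
  · refine Eq.trans ?_ (congrArg (· * Complex.exp (Complex.I * x.2.1 α.2)) (hs _ _ α)).symm
    rw [Wl2.coeff_smul, coeff_phase, cis]; ring
  · refine Eq.trans ?_ (congrArg (· * Complex.exp (-(Complex.I * x.2.1 α.2))) (hs _ _ α)).symm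
    rw [Wl2.coeff_smul, coeff_phase, cis_neg]; ring

theorem chart_explicitPart {l : ℝ} (hl : 0 < l) {x : Phase p s} (hx : x ∈ liftDom p s) :
    chart (explicitPart (l : ℂ) x) = scaledChart l x := by
  have e : ∀ i, csqrt ((l : ℂ) ^ 2 * (x.1 i - occ x.2.2 i)) = l * amp x.1 x.2.2 i := fun i => by
    rw [← amp_sq, ← mul_pow]
    apply csqrt_of_sq
    rw [Complex.re_ofReal_mul]
    have : 1 / 2 ≤ (amp x.1 x.2.2 i).re := half_le_amp_re hx.1 i
    exact mul_pos hl (by linarith)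
  refine assemble_congr ?_ rfl ?_ rfl <;>
  · funext i
    simp only [explicitPart, Pi.mul_apply, Pi.smul_apply, smul_eq_mul, e]
    ring

theorem exp_half_bound : Real.exp (-(1 / 2)) / 2 < 31 / 100 := by
  have h := Real.exp_neg_one_lt_d9
  have h1 : Real.exp (-(1 / 2)) ^ 2 = Real.exp (-1) := by rw [← Real.exp_nat_mul]; norm_num
  nlinarith [Real.exp_pos (-(1 / 2))]

/-- The points at which the change of variables is evaluated. -/
theorem add_base_mem_liftDom {ρ : Fin 2 → ℝ} (hρ : ρ ∈ paramSet) {x : Phase p s}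
    (hx : x ∈ dom (p := p) (s := s) (1 / 2) (Real.exp (-(1 / 2)) / 2)) : x + base ρ ∈ liftDom p s := by
  have he := exp_half_bound
  have he0 := Real.exp_pos (-(1 / 2))
  obtain ⟨h1, h2, h3⟩ := hx
  have hr : ‖x.1‖ < 1 / 10 := h1.trans_le (by nlinarith)
  have hz : ‖x.2.2‖ < 31 / 100 := h3.trans he
  have b1 : (x + base ρ).2 = x.2 := add_zero _
  have b2 : ∀ i, (x + base ρ).1 i = x.1 i + ρ i := fun i => rfl
  have hρ' : ∀ i, 1 ≤ ρ i ∧ ρ i ≤ 2 := fun i => ⟨hρ.1 i, hρ.2 i⟩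
  have hi : ∀ i, ‖x.1 i‖ < 1 / 10 := fun i => (norm_le_pi_norm _ i).trans_lt hr
  refine ⟨fun i => ?_, ?_, by rw [b1]; exact h2, by rw [b1]; linarith⟩
  · have ho := norm_occ_le x.2.2 i
    have h4 := (abs_le.1 (Complex.abs_re_le_norm (x.1 i))).1
    have h5 := (abs_le.1 (Complex.abs_re_le_norm (occ x.2.2 i))).2
    simp only [b1, b2]
    rw [Complex.sub_re, Complex.add_re, Complex.ofReal_re]
    nlinarith [hi i, (hρ' i).1, norm_nonneg x.2.2]
  · refine lt_of_le_of_lt ((pi_norm_le_iff_of_nonneg (r := 5 / 2) (by norm_num)).2 fun i => ?_)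
      (by norm_num)
    rw [b2]
    have h6 : ‖((ρ i : ℝ) : ℂ)‖ ≤ 2 := by
      rw [Complex.norm_real, Real.norm_of_nonneg (by linarith [(hρ' i).1])]; exact (hρ' i).2
    linarith [norm_add_le (x.1 i) ((ρ i : ℝ) : ℂ), hi i]

variable {ε K C ν : ℝ} {τ : Ps s → Ps s} {Dt : Ps s → Ps s →L[ℂ] Ps s} {R6 : Ps s → ℂ}
  {G6 : Ps s → Ps s}

theorem IsScale.real {l : ℝ} (hS : IsScale ε K p s C l) (hB : IsBirkhoffSystem ε K τ Dt R6 G6)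
    {x : Phase p s} (hx : x ∈ liftDom p s) (hr : IsRealPhase x) : IsRealPhase (liftMap l τ x) := by
  refine unchart_real hr.2.1 (hB.map.real _ (hS.mem_ball hx) (polar_real hr.1 hr.2.2 hx.1 l))
    fun i h => ?_
  have := (hS.entries_re_pos hB hx i).1
  rw [h] at this
  simp at this

theorem IsScale.mapsTo (hν : 0 < ν) (hS : IsScale ε K p s C (√ν))
    (hB : IsBirkhoffSystem ε K τ Dt R6 G6) {ρ : Fin 2 → ℝ} (hρ : ρ ∈ paramSet) {x : Phase p s}
    (hx : x ∈ dom (p := p) (s := s) (1 / 2) (Real.exp (-(1 / 2)) / 2)) :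
    liftMap (√ν) τ (x + base ρ) ∈ torusNhd (p := p) (s := s) ν ρ 1 1 := by
  have hx' := add_base_mem_liftDom hρ hx
  have he := exp_half_bound
  have he0 := Real.exp_pos (-(1 / 2))
  obtain ⟨h1, h2, h3⟩ := hx
  have hr : ‖x.1‖ < 1 / 10 := h1.trans_le (by nlinarith)
  have hz : ‖x.2.2‖ < 31 / 100 := h3.trans he
  have b1 : (x + base ρ).2 = x.2 := add_zero _
  have b2 : ∀ i, (x + base ρ).1 i = x.1 i + ρ i := fun i => rfl
  have hi : ∀ i, ‖x.1 i‖ < 1 / 10 := fun i => (norm_le_pi_norm _ i).trans_lt hr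
  have hl : √ν ^ 2 = ν := Real.sq_sqrt hν.le
  have hlp := hS.pos
  have hsm := hS.small
  refine ⟨?_, fun i => ?_, ?_⟩
  · rw [one_pow, mul_one]
    refine lt_of_le_of_lt ((pi_norm_le_iff_of_nonneg (r := ν * (4 / 5)) (by positivity)).2 fun i => ?_)
      (by linarith)
    have ha := hS.norm_act_le hB hx' i
    have ho := norm_occ_le x.2.2 i
    rw [b2, b1, hl, ← Complex.ofReal_pow, hl] at ha
    rw [hl] at hsm
    set A := (liftMap (√ν) τ (x + base ρ)).1 i
    have e : A - ((ν * ρ i : ℝ) : ℂ) = (A - ν * (x.1 i + ρ i - occ x.2.2 i)) + ν * (x.1 i - occ x.2.2 i) := by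
      push_cast; ring
    rw [e]
    refine (norm_add_le _ _).trans ?_
    rw [norm_mul, Complex.norm_real, Real.norm_of_nonneg hν.le]
    have h7 := norm_sub_le (x.1 i) (occ x.2.2 i)
    have h8 : ‖x.1 i - occ x.2.2 i‖ ≤ 1 / 10 + 9 / 40 := by
      nlinarith [hi i, norm_nonneg x.2.2]
    have h9 : ν * (5 * (K * C ^ 3 * ν)) ≤ ν * (1 / 20) :=
      mul_le_mul_of_nonneg_left (by linarith) hν.le
    have h10 : ν * ‖x.1 i - occ x.2.2 i‖ ≤ ν * (1 / 10 + 9 / 40) :=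
      mul_le_mul_of_nonneg_left h8 hν.le
    linarith
  · have h4 := (Complex.abs_im_le_norm _).trans (hS.norm_innerAngle_le hB hx' i)
    have h5 := h2 i
    change |((x + base ρ).2.1 i + innerAngle p (τ _) i).im| < 1
    rw [b1] at h4
    rw [Complex.add_im, b1]
    refine (abs_add_le _ _).trans_lt ?_
    linarith
  · have h4 := hS.norm_ext_le hB hx'
    rw [b1] at h4
    have he2 : Real.exp (1 / 2) ≤ 2 := by
      have h := Real.exp_one_lt_d9
      have h1 : Real.exp (1 / 2) ^ 2 = Real.exp 1 := by rw [← Real.exp_nat_mul]; norm_num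
      nlinarith [Real.exp_pos (1 / 2)]
    have key : ∀ {θ : Fin 2 → ℂ} (_ : ∀ i, |(θ i).im| ≤ 1 / 2) {z : Zs p s} (_ : ‖z‖ ≤ ‖x.2.2‖),
        ‖((√ν : ℝ) : ℂ) • phase extWeight_pos (cis θ) (sym z)‖ ≤ √ν * (93 / 100) :=
      fun {θ} hθ {z} hz' => by
        rw [norm_smul, Complex.norm_real, Real.norm_of_nonneg hlp.le]
        refine mul_le_mul_of_nonneg_left ?_ hlp.le
        have a1 := norm_phase_le extWeight_pos (fun i => (norm_cis_le hθ i).trans he2) (sym z)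
        have a2 := norm_sym_le z
        linarith
    have hθ : ∀ i, |(x.2.1 i).im| ≤ 1 / 2 := fun i => (h2 i).le
    have h5 : ‖(((√ν : ℝ) : ℂ) • phase (extWeight_pos (p := p)) (cis x.2.1) (sym x.2.2.1),
        ((√ν : ℝ) : ℂ) • phase (extWeight_pos (p := p)) (cis (-x.2.1)) (sym x.2.2.2))‖ ≤
        √ν * (93 / 100) :=
      max_le (key hθ (norm_fst_le _)) (key (by simpa using hθ) (norm_snd_le _))
    have h6 : √ν * (2 * (K * C ^ 3 * √ν ^ 2)) ≤ √ν * (2 / 100) :=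
      mul_le_mul_of_nonneg_left (by linarith) hlp.le
    rw [mul_one]
    have h7 := norm_le_norm_add_norm_sub' (liftMap (√ν) τ (x + base ρ)).2.2
      (((√ν : ℝ) : ℂ) • phase (extWeight_pos (p := p)) (cis x.2.1) (sym x.2.2.1),
        ((√ν : ℝ) : ℂ) • phase (extWeight_pos (p := p)) (cis (-x.2.1)) (sym x.2.2.2))
    linarith

theorem analyticOnNhd_liftMap {l : ℝ} (hS : IsScale ε K p s C l) (hB : IsBirkhoffSystem ε K τ Dt R6 G6) :
    AnalyticOnNhd ℝ (fun q : (Fin 2 → ℝ) × Phase p s => liftMap l τ (q.2 + base q.1))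
      (paramSet ×ˢ dom (1 / 2) (Real.exp (-(1 / 2)) / 2)) := by
  rintro ⟨ρ, x⟩ ⟨hρ, hx⟩
  have h1 := ((hS.contDiffAt_liftMap hB (add_base_mem_liftDom hρ hx)).analyticAt).restrictScalars (𝕜 := ℝ)
  have h2 : AnalyticAt ℝ (fun q : (Fin 2 → ℝ) × Phase p s => q.2 + (base q.1 : Phase p s)) (ρ, x) := by
    refine analyticAt_snd.add ?_
    let L : (Fin 2 → ℝ) →L[ℝ] (Fin 2 → ℂ) := ContinuousLinearMap.pi fun i =>
      Complex.ofRealCLM.comp (ContinuousLinearMap.proj i)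
    exact ((L.analyticAt _).comp analyticAt_fst).prod (analyticAt_const.prod analyticAt_const)
  exact h1.comp_of_eq h2 rfl

end

noncomputable section

open scoped ContDiff

/-! ### The quadratic part in polar coordinates -/

variable {p : ℤ} {s : ℝ} [Fact (1 / 2 < s)]

theorem finite_internal (p : ℤ) : {m : Mode | m.1 = p}.Finite :=
  ((Set.finite_singleton p).prod Set.finite_univ).subset fun _ hm => ⟨hm, trivial⟩

theorem summable_mode_iff {R : Type} [NormedAddCommGroup R] {f : Mode → R} :
    Summable f ↔ Summable fun α : ExtMode p => f (α.1.1, α.2) := by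
  have h1 : f =ᶠ[cofinite] fun m => if m.1 = p then 0 else f m := by
    refine (finite_internal p).subset fun m hm => ?_
    by_contra hne
    exact hm (if_neg hne).symm
  rw [summable_congr_cofinite h1, ← (extMode_injective (p := p)).summable_iff fun m hm => ?_]
  · refine summable_congr fun α => ?_
    exact if_neg α.1.2
  · by_cases h : m.1 = p
    · exact if_pos h
    · exact absurd ⟨(⟨m.1, h⟩, m.2), rfl⟩ hm

theorem tsum_mode_split {f : Mode → ℂ} (hf : Summable f) :
    ∑' m, f m = ∑ i, f (p, i) + ∑' α : ExtMode p, f (α.1.1, α.2) := by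
  have hfin : Summable fun m : Mode => if m.1 = p then f m else 0 :=
    summable_of_hasFiniteSupport ((finite_internal p).subset fun m hm => by
      by_contra hne
      exact hm (if_neg hne))
  have e : ∀ m : Mode, f m - (if m.1 = p then f m else 0) = if m.1 = p then 0 else f m := fun m => by
    split_ifs <;> simp
  have h1 := hf.tsum_sub hfin
  simp only [e] at h1
  have h2 : ∑' m : Mode, (if m.1 = p then 0 else f m) = ∑' α : ExtMode p, f (α.1.1, α.2) := by
    rw [tsum_extMode (p := p) (f := fun m : Mode => if m.1 = p then 0 else f m) fun i => if_pos rfl]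
    exact tsum_congr fun α => if_neg α.1.2
  have h3 : ∑' m : Mode, (if m.1 = p then f m else 0) = ∑ i, f (p, i) := by
    rw [tsum_eq_sum (s := Finset.univ.image fun i : Fin 2 => ((p, i) : Mode)) fun m hm => if_neg fun h => ?_]
    · rw [Finset.sum_image fun i _ j _ h => congrArg Prod.snd h]
      simp
    · exact hm (Finset.mem_image.2 ⟨m.2, Finset.mem_univ _, by rw [← h]⟩)
  rw [h2, h3] at h1
  rw [h1]; ring

/-- Finiteness of the energy of external variables. -/
def ExtEnergy (u : Zs p s) : Prop := Summable fun α : ExtMode p => ((α.1 : ℤ) : ℝ) ^ 2 * ‖u.coeff α‖ ^ 2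

theorem finiteEnergy_assemble (a b : Fin 2 → ℂ) (u v : Zs p s) :
    FiniteEnergy (fourierCoords (intIn p a + extIn u, intIn p b + extIn v)) ↔
      ExtEnergy u ∧ ExtEnergy v := by
  have key : ∀ (a : Fin 2 → ℂ) (u : Zs p s), (Summable fun m : Mode => (m.1 : ℝ) ^ 2 *
      ‖(intIn p a + extIn u : Hs s).coeff m‖ ^ 2) ↔ ExtEnergy u := fun a u => by
    rw [summable_mode_iff (p := p)]
    refine summable_congr fun α => ?_
    rw [coeff_assemble, dif_neg α.1.2]
  exact and_congr (key a u) (key b v)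

theorem ExtEnergy.of_le {u v : Zs p s} (hu : ExtEnergy u) {C : ℝ}
    (h : ∀ α, ‖v.coeff α‖ ≤ C * ‖u.coeff α‖) : ExtEnergy v := by
  refine Summable.of_nonneg_of_le (fun α => by positivity) (fun α => ?_) (hu.mul_left (C ^ 2))
  calc _ ≤ ((α.1 : ℤ) : ℝ) ^ 2 * (C * ‖u.coeff α‖) ^ 2 := by gcongr; exact h α
    _ = _ := by ring

theorem ExtEnergy.sym {u : Zs p s} (hu : ExtEnergy u) : ExtEnergy (sym u) := by
  have hinj : Function.Injective fun α : ExtMode p => ((α.1, α.2 + 1) : ExtMode p) := by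
    rintro ⟨k, i⟩ ⟨k', i'⟩ h
    simpa using h
  refine Summable.of_nonneg_of_le (fun α => by positivity) (fun α => ?_)
    (hu.add (hu.comp_injective hinj))
  obtain ⟨k, i⟩ := α
  simp only [Function.comp]
  rw [← mul_add]
  gcongr
  have key : ∀ a b : ℂ, ‖(a + b) / (√2 : ℂ)‖ ^ 2 ≤ ‖a‖ ^ 2 + ‖b‖ ^ 2 := fun a b => by
    rw [norm_div, div_pow, Complex.norm_real, Real.norm_of_nonneg (Real.sqrt_nonneg _),
      Real.sq_sqrt (by norm_num), div_le_iff₀ (by norm_num)]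
    have h1 := norm_add_le a b
    nlinarith [norm_nonneg (a + b), sq_nonneg (‖a‖ - ‖b‖)]
  rw [coeff_sym]
  fin_cases i
  · exact key _ _
  · have := key (u.coeff (k, 0)) (-u.coeff (k, 1))
    rw [norm_neg, ← sub_eq_add_neg, add_comm] at this
    exact this

theorem finiteEnergy_coords (x : Phase p s) : FiniteEnergy (toFourier (coords x)) ↔
    ExtEnergy x.2.2.1 ∧ ExtEnergy x.2.2.2 := by
  rw [← fourierCoords_chart, chart, finiteEnergy_assemble]

theorem finiteEnergy_scaledChart (l : ℂ) {x : Phase p s} (h1 : ExtEnergy x.2.2.1)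
    (h2 : ExtEnergy x.2.2.2) : FiniteEnergy (fourierCoords (scaledChart l x)) := by
  have key : ∀ (θ : Fin 2 → ℂ) {u : Zs p s}, ExtEnergy u →
      ExtEnergy (l • phase extWeight_pos (cis θ) (sym u)) := fun θ {u} hu => by
    refine hu.sym.of_le (C := ‖l‖ * ‖cis θ‖) fun α => ?_
    rw [Wl2.coeff_smul, coeff_phase, norm_mul, norm_mul, ← mul_assoc]
    gcongr
    exact norm_le_pi_norm _ _
  exact (finiteEnergy_assemble _ _ _ _).2 ⟨key _ h1, key _ h2⟩

theorem ExtEnergy.summable {u v : Zs p s} (hu : ExtEnergy u) (hv : ExtEnergy v) :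
    Summable fun α : ExtMode p => ((α.1 : ℤ) : ℂ) ^ 2 * (u.coeff α * v.coeff α) := by
  refine Summable.of_norm_bounded (hu.add hv) fun α => ?_
  rw [norm_mul, norm_mul, norm_pow, Complex.norm_intCast, sq_abs, ← mul_add]
  gcongr
  nlinarith [sq_nonneg (‖u.coeff α‖ - ‖v.coeff α‖), sq_nonneg (‖u.coeff α‖ + ‖v.coeff α‖)]

theorem tsum_sq_sym {u v : Zs p s} (hu : ExtEnergy u) (hv : ExtEnergy v) :
    ∑' α : ExtMode p, ((α.1 : ℤ) : ℂ) ^ 2 * ((sym u).coeff α * (sym v).coeff α) =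
      ∑' α : ExtMode p, ((α.1 : ℤ) : ℂ) ^ 2 * (u.coeff α * v.coeff α) := by
  rw [tsum_ext_prod (hu.sym.summable hv.sym), tsum_ext_prod (hu.summable hv)]
  refine tsum_congr fun k => ?_
  have h := sqrt_two_sq
  have h0 := sqrt_two_ne_zero
  simp only [coeff_sym, symFun, Matrix.cons_val_zero, Matrix.cons_val_one]
  field_simp
  rw [h]; ring

theorem sum_occ (z : ExtPair p s) : ∑ i, occ z i = z.1.pair z.2 := by
  have h := pair_phase_sym 1 z.1 z.2
  rw [phase_one, pair_sym, sym_sym] at h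
  rw [h]; simp [occ]

/-- The quadratic Hamiltonian in the new variables. -/
theorem P2_scaledChart (l : ℂ) {x : Phase p s} (h1 : ExtEnergy x.2.2.1) (h2 : ExtEnergy x.2.2.2) :
    P2 (fourierCoords (scaledChart l x)) = l ^ 2 * ((p : ℂ) ^ 2 * ∑ i, x.1 i +
      ∑' α : ExtMode p, (((α.1 : ℤ) : ℂ) ^ 2 - (p : ℂ) ^ 2) *
        (x.2.2.1.coeff α * x.2.2.2.coeff α)) := by
  have hfe := (finiteEnergy_iff _).1 (finiteEnergy_scaledChart l h1 h2)
  rw [energyV, ENNReal.add_ne_top] at hfe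
  have hsum := summable_diag enorm_sq_index_le hfe.1 hfe.2
  have i1 : ∀ i : Fin 2, (((p, i) : Mode).1 : ℂ) ^ 2 * ((scaledChart l x).1.coeff (p, i) *
      (scaledChart l x).2.coeff (p, i)) = l ^ 2 * ((p : ℂ) ^ 2 * (x.1 i - occ x.2.2 i)) := by
    intro i
    simp only [scaledChart, coeff_assemble, dif_pos, Pi.smul_apply, Pi.mul_apply,
      smul_eq_mul]
    rw [← amp_sq]
    linear_combination (p ^ 2 * l ^ 2 * amp x.1 x.2.2 i ^ 2) * cis_mul_neg x.2.1 i
  have i2 : ∀ α : ExtMode p, ((((α.1.1, α.2) : Mode).1 : ℤ) : ℂ) ^ 2 *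
      ((scaledChart l x).1.coeff (α.1.1, α.2) *
      (scaledChart l x).2.coeff (α.1.1, α.2)) =
      l ^ 2 * (((α.1 : ℤ) : ℂ) ^ 2 * ((sym x.2.2.1).coeff α * (sym x.2.2.2).coeff α)) := by
    intro α
    simp only [scaledChart, coeff_assemble]
    rw [dif_neg α.1.2, dif_neg α.1.2]
    simp only [Wl2.coeff_smul, coeff_phase]
    linear_combination (((α.1 : ℤ) : ℂ) ^ 2 * l ^ 2 * (sym x.2.2.1).coeff α * (sym x.2.2.2).coeff α) *
      cis_mul_neg x.2.1 α.2
  have s1 := h1.summable h2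
  have s2 := (summable_pair_ext x.2.2.1 x.2.2.2).mul_left ((p : ℂ) ^ 2)
  have e3 : ∀ α : ExtMode p, (((α.1 : ℤ) : ℂ) ^ 2 - (p : ℂ) ^ 2) * (x.2.2.1.coeff α * x.2.2.2.coeff α) =
      ((α.1 : ℤ) : ℂ) ^ 2 * (x.2.2.1.coeff α * x.2.2.2.coeff α) -
        (p : ℂ) ^ 2 * (x.2.2.1.coeff α * x.2.2.2.coeff α) := fun α => sub_mul _ _ _
  refine (tsum_mode_split (p := p) hsum).trans ?_
  rw [Finset.sum_congr rfl fun i _ => i1 i, tsum_congr i2, tsum_mul_left, tsum_sq_sym h1 h2,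
    ← Finset.mul_sum, ← Finset.mul_sum, Finset.sum_sub_distrib, sum_occ, tsum_congr e3,
    s1.tsum_sub s2, tsum_mul_left, Wl2.pair]
  ring

/-! ### The resonant quartic part in polar coordinates -/

/-- On the resonant set the difference of the quadratic energies factors as `2 (i - k) (k - j)`. -/
theorem resonant_iff (q : ℤ × ℤ × ℤ) : Resonant q ↔ q.1 = q.2.2 ∨ q.2.1 = q.2.2 := by
  have h : q.1 ^ 2 + q.2.1 ^ 2 - (q.2.2 ^ 2 + (q.1 + q.2.1 - q.2.2) ^ 2) =
      2 * ((q.1 - q.2.2) * (q.2.2 - q.2.1)) := by ring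
  rw [Resonant, ← sub_eq_zero, h, mul_eq_zero, or_iff_right two_ne_zero, mul_eq_zero, sub_eq_zero,
    sub_eq_zero, eq_comm (a := q.2.2)]

/-- Resonant monomials are products of two quadratic ones. -/
theorem quartic_kerRes (w : Ps s) : quartic kerRes (fourierCoords w) =
    (∑' j : ℤ, w.1.coeff (j, 0) * w.2.coeff (j, 0)) * (∑' j : ℤ, w.1.coeff (j, 1) * w.2.coeff (j, 1)) +
    (∑' j : ℤ, w.1.coeff (j, 0) * w.2.coeff (j, 1)) * (∑' j : ℤ, w.1.coeff (j, 1) * w.2.coeff (j, 0)) -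
    ∑' j : ℤ, w.1.coeff (j, 0) * w.1.coeff (j, 1) * w.2.coeff (j, 0) * w.2.coeff (j, 1) := by
  have sm : ∀ a b : Fin 2, Summable fun j : ℤ => w.1.coeff (j, a) * w.2.coeff (j, b) := fun a b => by
    have := Wl2.summable_pair one_le_intWeight (s_nonneg s) (slot a w.1) (slot b w.2)
    simpa only [coeff_slot] using this
  set T : ℤ × ℤ × ℤ → ℂ := fun q => w.1.coeff (legA q) * (w.1.coeff (legB q) * w.2.coeff (legA' q) *
    w.2.coeff (legB' q)) with hT
  have hs : Summable T := by
    have := summable_pair_triOp quarticLegsA kerOne w.1 w.1 w.2 w.2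
    simpa only [kerOne, one_mul] using this
  have hI : ∀ P : ℤ × ℤ × ℤ → Prop, ∀ [DecidablePred P], Summable fun q => if P q then T q else 0 :=
    fun P _ => Summable.of_norm_bounded hs.norm fun q => by split_ifs <;> simp
  have s1 : ∑' q : ℤ × ℤ × ℤ, (if q.1 = q.2.2 then T q else 0) =
      (∑' j : ℤ, w.1.coeff (j, 0) * w.2.coeff (j, 0)) * (∑' j : ℤ, w.1.coeff (j, 1) * w.2.coeff (j, 1)) := by
    rw [tsum_mul_tsum_of_summable_norm (sm 0 0).norm (sm 1 1).norm]
    have hinj : Function.Injective fun x : ℤ × ℤ => ((x.1, x.2, x.1) : ℤ × ℤ × ℤ) := by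
      rintro ⟨a, b⟩ ⟨c, d⟩ h; simp at h ⊢; tauto
    rw [← hinj.tsum_eq]
    · refine tsum_congr fun x => ?_
      simp only [hT, legA, legB, legA', legB', if_true, add_sub_cancel_left]
      ring
    · rintro ⟨i, j, k⟩ hq
      by_cases h : i = k
      · exact ⟨(i, j), by rw [h]⟩
      · exact absurd (if_neg h) hq
  have s2 : ∑' q : ℤ × ℤ × ℤ, (if q.2.1 = q.2.2 then T q else 0) =
      (∑' j : ℤ, w.1.coeff (j, 0) * w.2.coeff (j, 1)) * (∑' j : ℤ, w.1.coeff (j, 1) * w.2.coeff (j, 0)) := by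
    rw [tsum_mul_tsum_of_summable_norm (sm 0 1).norm (sm 1 0).norm]
    have hinj : Function.Injective fun x : ℤ × ℤ => ((x.2, x.1, x.1) : ℤ × ℤ × ℤ) := by
      rintro ⟨a, b⟩ ⟨c, d⟩ h; simp at h ⊢; tauto
    rw [← hinj.tsum_eq]
    · refine tsum_congr fun x => ?_
      simp only [hT, legA, legB, legA', legB', if_true, add_sub_cancel_right]
      ring
    · rintro ⟨i, j, k⟩ hq
      by_cases h : j = k
      · exact ⟨(j, i), by rw [h]⟩
      · exact absurd (if_neg h) hq
  have s3 : ∑' q : ℤ × ℤ × ℤ, (if q.1 = q.2.2 ∧ q.2.1 = q.2.2 then T q else 0) =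
      ∑' j : ℤ, w.1.coeff (j, 0) * w.1.coeff (j, 1) * w.2.coeff (j, 0) * w.2.coeff (j, 1) := by
    have hinj : Function.Injective fun x : ℤ => ((x, x, x) : ℤ × ℤ × ℤ) := fun a b h =>
      congrArg Prod.fst h
    rw [← hinj.tsum_eq]
    · refine tsum_congr fun x => ?_
      simp only [hT, legA, legB, legA', legB', and_self, if_true, add_sub_cancel_right]
      ring
    · rintro ⟨i, j, k⟩ hq
      by_cases h : i = k ∧ j = k
      · exact ⟨k, by rw [h.1, h.2]⟩
      · exact absurd (if_neg h) hq
  rw [← s1, ← s2, ← s3, ← (hI _).tsum_add (hI _), ← ((hI _).add (hI _)).tsum_sub (hI _)]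
  refine tsum_congr fun q => ?_
  change (if Resonant q then (1 : ℂ) else 0) * T q = _
  simp only [resonant_iff]
  by_cases h1 : q.1 = q.2.2 <;> by_cases h2 : q.2.1 = q.2.2 <;> simp [h1, h2]

theorem tsum_int_split (p : ℤ) {f : ℤ → ℂ} (hf : Summable f) :
    ∑' j, f j = f p + ∑' k : {j : ℤ // j ≠ p}, f k := by
  rw [hf.tsum_eq_add_tsum_ite p]
  congr 1
  have hinj : Function.Injective fun k : {j : ℤ // j ≠ p} => (k : ℤ) := Subtype.val_injective
  rw [← hinj.tsum_eq (f := fun j => if j = p then 0 else f j)]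
  · exact tsum_congr fun k => if_neg k.2
  · intro j hj
    by_cases h : j = p
    · exact absurd (if_pos h) hj
    · exact ⟨⟨j, h⟩, rfl⟩

/-- The exchange terms of the resonant quartic part. -/
def exch (a b : Fin 2) (z : ExtPair p s) : ℂ :=
  ∑' k : {j : ℤ // j ≠ p}, (sym z.1).coeff (k, a) * (sym z.2).coeff (k, b)

/-- The diagonal terms of the resonant quartic part. -/
def quarticDiag (z : ExtPair p s) : ℂ := ∑' k : {j : ℤ // j ≠ p},
  (sym z.1).coeff (k, 0) * (sym z.1).coeff (k, 1) * (sym z.2).coeff (k, 0) * (sym z.2).coeff (k, 1)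

/-- The difference of the masses of the symmetrized species. -/
def massDiff (z : ExtPair p s) : ℂ := (phase extWeight_pos ![1, -1] z.1).pair z.2

theorem summable_fiber_ext (a b : Fin 2) (u v : Zs p s) :
    Summable fun k : {j : ℤ // j ≠ p} => u.coeff (k, a) * v.coeff (k, b) := by
  have := Wl2.summable_pair one_le_intWeight (s_nonneg s) (slot a (extIn u)) (slot b (extIn v))
  have := this.comp_injective (Subtype.val_injective (p := (· ≠ p)))
  refine this.congr fun k => ?_
  simp only [Function.comp, coeff_slot, coeff_extIn]
  rw [extendZero_ext _ (k, a), extendZero_ext _ (k, b)]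

/-- After symmetrization the two exchange terms add up to the difference of the masses, which is what
splits the frequencies `Λ` of the two species. -/
theorem exch_add (z : ExtPair p s) : exch 0 1 z + exch 1 0 z = massDiff z := by
  have e : massDiff z = ∑' k : {j : ℤ // j ≠ p}, (z.1.coeff (k, 0) * z.2.coeff (k, 0) -
      z.1.coeff (k, 1) * z.2.coeff (k, 1)) := by
    rw [massDiff, Wl2.pair, tsum_ext_prod (summable_pair_ext _ _)]
    refine tsum_congr fun k => ?_
    simp only [coeff_phase, Matrix.cons_val_zero, Matrix.cons_val_one]
    ring
  rw [exch, exch, e, ← (summable_fiber_ext _ _ _ _).tsum_add (summable_fiber_ext _ _ _ _)]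
  refine tsum_congr fun k => ?_
  have h := sqrt_two_sq
  have h0 := sqrt_two_ne_zero
  simp only [coeff_sym, symFun, Matrix.cons_val_zero, Matrix.cons_val_one]
  field_simp
  rw [h]; ring

/-- The resonant quartic Hamiltonian in polar coordinates. -/
theorem quartic_polar (R : Fin 2 → ℂ) (z : ExtPair p s) :
    quartic kerRes (fourierCoords (polar (R, z))) =
      R 0 * R 1 + amp R z 0 * amp R z 1 * massDiff z + (exch 0 1 z * exch 1 0 z - quarticDiag z) := by
  have cp : ∀ (u : Zs p s) (i : Fin 2), (intIn p (amp R z) + extIn u : Hs s).coeff (p, i) = amp R z i :=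
    fun u i => by rw [coeff_assemble, dif_pos rfl]
  have ce : ∀ (u : Zs p s) (k : {j : ℤ // j ≠ p}) (i : Fin 2),
      (intIn p (amp R z) + extIn u : Hs s).coeff ((k : ℤ), i) = u.coeff (k, i) :=
    fun u k i => by rw [coeff_assemble, dif_neg k.2]
  have sm : ∀ a b : Fin 2, Summable fun j : ℤ =>
      (polar (R, z)).1.coeff (j, a) * (polar (R, z)).2.coeff (j, b) := fun a b => by
    have := Wl2.summable_pair one_le_intWeight (s_nonneg s) (slot a (polar (R, z)).1)
      (slot b (polar (R, z)).2)
    simpa only [coeff_slot] using this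
  have key : ∀ a b : Fin 2, ∑' j : ℤ, (polar (R, z)).1.coeff (j, a) * (polar (R, z)).2.coeff (j, b) =
      amp R z a * amp R z b + exch a b z := fun a b => by
    rw [tsum_int_split p (sm a b), exch]
    simp only [polar, cp, ce]
  have hm : ∀ i, amp R z i * amp R z i + exch i i z = R i := fun i => by
    have h1 := amp_sq R z i
    have h2 : exch i i z = occ z i := (occ_eq_tsum z i).symm
    rw [h2]; linear_combination h1
  have h4 : ∑' j : ℤ, (polar (R, z)).1.coeff (j, 0) * (polar (R, z)).1.coeff (j, 1) *
      (polar (R, z)).2.coeff (j, 0) * (polar (R, z)).2.coeff (j, 1) =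
      amp R z 0 * amp R z 1 * amp R z 0 * amp R z 1 + quarticDiag z := by
    rw [tsum_int_split p, quarticDiag]
    · simp only [polar, cp, ce]
    · have hinj : Function.Injective fun x : ℤ => ((x, x, x) : ℤ × ℤ × ℤ) := fun a b h =>
        congrArg Prod.fst h
      refine ((summable_pair_triOp quarticLegsA kerOne (polar (R, z)).1 (polar (R, z)).1
        (polar (R, z)).2 (polar (R, z)).2).comp_injective hinj).congr fun j => ?_
      simp only [Function.comp, kerOne, legA, legB, legA', legB', one_mul, add_sub_cancel_right]
      ring
  rw [quartic_kerRes, key, key, key, key, h4, hm, hm, ← exch_add]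
  ring

end

noncomputable section

open scoped ContDiff

/-! ### Cauchy estimates and classes of perturbations -/

/-- The Cauchy estimate for the derivative at the centre of a ball, from one complex variable on the
half ball. -/
theorem norm_fderiv_le_of_ball {E W : Type} [NormedAddCommGroup E] [NormedSpace ℂ E]
    [NormedAddCommGroup W] [NormedSpace ℂ W] {Ψ : E → W} {q : E} {R M : ℝ} (hR : 0 < R)
    (hd : DifferentiableOn ℂ Ψ (Metric.ball q R)) (hM : ∀ y ∈ Metric.ball q R, ‖Ψ y‖ ≤ M) :
    ‖fderiv ℂ Ψ q‖ ≤ 2 * M / R := by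
  have hM0 : 0 ≤ M := (norm_nonneg _).trans (hM q (Metric.mem_ball_self hR))
  refine ContinuousLinearMap.opNorm_le_bound _ (by positivity) fun h => ?_
  rcases eq_or_ne h 0 with rfl | hh
  · simp
  have hn : 0 < ‖h‖ := norm_pos_iff.2 hh
  set r := R / (2 * ‖h‖) with hr
  have hr0 : 0 < r := by positivity
  have hmem : ∀ t ∈ Metric.closedBall (0 : ℂ) r, q + t • h ∈ Metric.ball q R := fun t ht => by
    rw [mem_closedBall_zero_iff] at ht
    rw [Metric.mem_ball, dist_self_add_left, norm_smul]
    calc ‖t‖ * ‖h‖ ≤ r * ‖h‖ := by gcongr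
      _ = R / 2 := by rw [hr]; field_simp
      _ < R := by linarith
  have hline : Differentiable ℂ fun t : ℂ => q + t • h := by fun_prop
  have h1 : DifferentiableOn ℂ (fun t : ℂ => Ψ (q + t • h)) (Metric.closedBall 0 r) :=
    hd.comp hline.differentiableOn hmem
  have h2 := Complex.norm_deriv_le_of_forall_mem_sphere_norm_le (f := fun t : ℂ => Ψ (q + t • h)) hr0
    (h1.diffContOnCl_ball subset_rfl) fun t ht => hM _ (hmem t (Metric.sphere_subset_closedBall ht))
  have hq := hd.differentiableAt (Metric.isOpen_ball.mem_nhds (Metric.mem_ball_self hR))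
  have h3 : HasDerivAt (fun t : ℂ => Ψ (q + t • h)) (fderiv ℂ Ψ q h) 0 :=
    hq.hasFDerivAt.hasLineDerivAt h
  rw [h3.deriv] at h2
  refine h2.trans_eq ?_
  rw [hr]; field_simp

variable {p : ℤ} {s : ℝ} [Fact (1 / 2 < s)]

variable (p s) in
/-- The pairing `∑ u v + ∑ ū v̄` on the external variables. -/
def zdot : ExtPair p s →L[ℂ] ExtPair p s →L[ℂ] ℂ :=
  (Wl2.pairL one_le_extWeight (s_nonneg s)).bilinearComp
      (ContinuousLinearMap.fst ℂ _ _) (ContinuousLinearMap.fst ℂ _ _) +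
    (Wl2.pairL one_le_extWeight (s_nonneg s)).bilinearComp
      (ContinuousLinearMap.snd ℂ _ _) (ContinuousLinearMap.snd ℂ _ _)

theorem zdot_apply (u v : ExtPair p s) : zdot p s u v = u.1.pair v.1 + u.2.pair v.2 := rfl

theorem norm_zdot_le (u v : ExtPair p s) : ‖zdot p s u v‖ ≤ 2 * ‖u‖ * ‖v‖ := by
  have h1 := Wl2.norm_pair_le one_le_extWeight (s_nonneg s) u.1 v.1
  have h2 := Wl2.norm_pair_le one_le_extWeight (s_nonneg s) u.2 v.2
  have h3 : ‖u.1‖ * ‖v.1‖ ≤ ‖u‖ * ‖v‖ := by gcongr; exacts [norm_fst_le u, norm_fst_le v]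
  have h4 : ‖u.2‖ * ‖v.2‖ ≤ ‖u‖ * ‖v‖ := by gcongr; exacts [norm_snd_le u, norm_snd_le v]
  rw [zdot_apply]
  linarith [norm_add_le (u.1.pair v.1) (u.2.pair v.2)]

theorem zdot_injective {u v : ExtPair p s} (h : ∀ x, zdot p s u x = zdot p s v x) : u = v := by
  have pz : ∀ x : Zs p s, x.pair 0 = 0 := fun x => by
    rw [← Wl2.pairL_apply one_le_extWeight (s_nonneg s), map_zero]
  refine Prod.ext (Wl2.ext_pair extWeight_pos fun x => ?_) (Wl2.ext_pair extWeight_pos fun x => ?_)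
  · simpa [zdot_apply, pz] using h (x, 0)
  · simpa [zdot_apply, pz] using h (0, x)

/-- Complex parameters together with points of the phase space. -/
abbrev ParamPhase (p : ℤ) (s : ℝ) : Type := (Fin 2 → ℂ) × Phase p s

variable (p s) in
/-- Directions in the external variables. -/
def zDir : ExtPair p s →L[ℂ] ParamPhase p s :=
  (ContinuousLinearMap.inr ℂ _ _).comp ((ContinuousLinearMap.inr ℂ _ _).comp
    (ContinuousLinearMap.inr ℂ _ _))

variable (p s) in
/-- Directions in the actions. -/
def rDir : (Fin 2 → ℂ) →L[ℂ] ParamPhase p s :=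
  (ContinuousLinearMap.inr ℂ _ _).comp (ContinuousLinearMap.inl ℂ _ _)

theorem zDir_apply (h : ExtPair p s) : zDir p s h = (0, 0, 0, h) := rfl

theorem rDir_apply (r : Fin 2 → ℂ) : rDir p s r = (0, r, 0, 0) := rfl

theorem norm_zDir (h : ExtPair p s) : ‖zDir p s h‖ = ‖h‖ := by
  simp [zDir_apply, Prod.norm_def]

theorem norm_rDir (r : Fin 2 → ℂ) : ‖rDir p s r‖ = ‖r‖ := by
  simp [rDir_apply, Prod.norm_def]

/-- The domain on which perturbations extend holomorphically in parameters and phase variables. It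
contains a neighbourhood of width `1 / 16` of the real parameters and of `‖r‖ ≤ 1 / 16`,
`‖z‖ ≤ 1 / 4`, and does not restrict the angles, on which perturbations do not depend. -/
def cylinder (p : ℤ) (s : ℝ) (δ : ℝ) : Set (ParamPhase p s) :=
  {q | (∀ i, 1 - δ < (q.1 i).re) ∧ ‖q.1‖ < 2 + δ ∧ ‖q.2.1‖ < 1 / 8 ∧ ‖q.2.2.2‖ < 5 / 16}

theorem isOpen_cylinder (δ : ℝ) : IsOpen (cylinder p s δ) := by
  have h1 : IsOpen {q : ParamPhase p s | ∀ i, 1 - δ < (q.1 i).re} := by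
    simp only [Set.ofPred_forall]
    exact isOpen_iInter_of_finite fun i => isOpen_lt continuous_const (by fun_prop)
  have h2 : IsOpen {q : ParamPhase p s | ‖q.1‖ < 2 + δ} := isOpen_lt (by fun_prop) continuous_const
  have h3 : IsOpen {q : ParamPhase p s | ‖q.2.1‖ < 1 / 8} := isOpen_lt (by fun_prop) continuous_const
  have h4 : IsOpen {q : ParamPhase p s | ‖q.2.2.2‖ < 5 / 16} :=
    isOpen_lt (by fun_prop) continuous_const
  exact h1.inter (h2.inter (h3.inter h4))

theorem cylinder_mono {δ δ' : ℝ} (h : δ ≤ δ') : cylinder p s δ ⊆ cylinder p s δ' := fun q hq =>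
  ⟨fun i => by linarith [hq.1 i], by linarith [hq.2.1], hq.2.2⟩

/-- Moving by `1 / 16` inside the cylinder. -/
theorem ball_subset_cylinder {δ δ' : ℝ} (hδ : δ' + 1 / 16 ≤ δ) {q : ParamPhase p s}
    (h1 : ∀ i, 1 - δ' ≤ (q.1 i).re) (h2 : ‖q.1‖ ≤ 2 + δ') (h3 : ‖q.2.1‖ ≤ 1 / 16)
    (h4 : ‖q.2.2.2‖ ≤ 1 / 4) : Metric.ball q (1 / 16) ⊆ cylinder p s δ := fun y hy => by
  rw [mem_ball_iff_norm] at hy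
  have e1 : ‖y.1 - q.1‖ < 1 / 16 := (norm_fst_le (y - q)).trans_lt hy
  have e2 : ‖y.2 - q.2‖ < 1 / 16 := (norm_snd_le (y - q)).trans_lt hy
  have e3 : ‖y.2.1 - q.2.1‖ < 1 / 16 := (norm_fst_le (y.2 - q.2)).trans_lt e2
  have e4 : ‖y.2.2.2 - q.2.2.2‖ < 1 / 16 :=
    (norm_snd_le (y.2.2 - q.2.2)).trans_lt ((norm_snd_le (y.2 - q.2)).trans_lt e2)
  refine ⟨fun i => ?_, ?_, ?_, ?_⟩
  · have e5 := (Complex.abs_re_le_norm _).trans_lt ((norm_le_pi_norm (y.1 - q.1) i).trans_lt e1)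
    rw [Pi.sub_apply, Complex.sub_re] at e5
    have := (abs_lt.1 e5).1
    linarith [h1 i]
  · linarith [norm_le_norm_add_norm_sub' y.1 q.1]
  · linarith [norm_le_norm_add_norm_sub' y.2.1 q.2.1]
  · linarith [norm_le_norm_add_norm_sub' y.2.2.2 q.2.2.2]

/-- `F` is holomorphic with holomorphic gradient `G` in the external variables, both of them bounded
by `M`. -/
structure IsZClass (M : ℝ) (F : ParamPhase p s → ℂ) (G : ParamPhase p s → ExtPair p s)
    (U : Set (ParamPhase p s)) : Prop where
  fn : ContDiffOn ℂ ω F U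
  grad : ContDiffOn ℂ ω G U
  deriv : ∀ q ∈ U, ∀ h, fderiv ℂ F q (zDir p s h) = zdot p s (G q) h
  fn_le : ∀ q ∈ U, ‖F q‖ ≤ M
  grad_le : ∀ q ∈ U, ‖G q‖ ≤ M

variable {M M' δ : ℝ} {F F' : ParamPhase p s → ℂ} {G G' : ParamPhase p s → ExtPair p s}
  {U : Set (ParamPhase p s)}

theorem IsZClass.add (hU : IsOpen U) (h : IsZClass M F G U) (h' : IsZClass M' F' G' U) :
    IsZClass (M + M') (fun q => F q + F' q) (fun q => G q + G' q) U where
  fn := h.fn.add h'.fn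
  grad := h.grad.add h'.grad
  deriv q hq k := by
    have d1 := (h.fn.contDiffAt (hU.mem_nhds hq)).differentiableAt (by simp)
    have d2 := (h'.fn.contDiffAt (hU.mem_nhds hq)).differentiableAt (by simp)
    rw [fderiv_fun_add d1 d2, add_apply, h.deriv q hq, h'.deriv q hq, map_add, add_apply]
  fn_le q hq := (norm_add_le _ _).trans (add_le_add (h.fn_le q hq) (h'.fn_le q hq))
  grad_le q hq := (norm_add_le _ _).trans (add_le_add (h.grad_le q hq) (h'.grad_le q hq))

theorem IsZClass.const_mul (hU : IsOpen U) (h : IsZClass M F G U) (c : ℂ) :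
    IsZClass (‖c‖ * M) (fun q => c * F q) (fun q => c • G q) U where
  fn := contDiffOn_const.mul h.fn
  grad := h.grad.const_smul c
  deriv q hq k := by
    have d1 := (h.fn.contDiffAt (hU.mem_nhds hq)).differentiableAt (by simp)
    rw [fderiv_const_mul d1, smul_apply, h.deriv q hq, map_smul, smul_apply]
  fn_le q hq := by rw [norm_mul]; exact mul_le_mul_of_nonneg_left (h.fn_le q hq) (norm_nonneg _)
  grad_le q hq := by rw [norm_smul]; exact mul_le_mul_of_nonneg_left (h.grad_le q hq) (norm_nonneg _)

/-- Second derivatives in which one direction is external. -/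
theorem IsZClass.snd (hU : IsOpen U) (h : IsZClass M F G U) {q : ParamPhase p s} (hq : q ∈ U)
    (v : ParamPhase p s) (k : ExtPair p s) :
    fderiv ℂ (fderiv ℂ F) q v (zDir p s k) = zdot p s (fderiv ℂ G q v) k := by
  have d1 := ((h.fn.contDiffAt (hU.mem_nhds hq)).fderiv_right (m := ω) (by simp)).differentiableAt (by simp)
  have d2 := (h.grad.contDiffAt (hU.mem_nhds hq)).differentiableAt (by simp)
  have e1 : HasFDerivAt (fun y => fderiv ℂ F y (zDir p s k))
      ((ContinuousLinearMap.apply ℂ ℂ (zDir p s k)).comp (fderiv ℂ (fderiv ℂ F) q)) q :=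
    (ContinuousLinearMap.apply ℂ ℂ (zDir p s k)).hasFDerivAt.comp q d1.hasFDerivAt
  have e2 : HasFDerivAt (fun y => zdot p s (G y) k)
      (((zdot p s).flip k).comp (fderiv ℂ G q)) q := ((zdot p s).flip k).hasFDerivAt.comp q d2.hasFDerivAt
  have e3 : (fun y => fderiv ℂ F y (zDir p s k)) =ᶠ[𝓝 q] fun y => zdot p s (G y) k :=
    Filter.eventuallyEq_of_mem (hU.mem_nhds hq) fun y hy => h.deriv y hy k
  exact congrArg (fun L : ParamPhase p s →L[ℂ] ℂ => L v) ((e1.congr_of_eventuallyEq e3.symm).unique e2)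

theorem IsZClass.symm (hU : IsOpen U) (h : IsZClass M F G U) {q : ParamPhase p s} (hq : q ∈ U)
    (k l : ExtPair p s) :
    zdot p s (fderiv ℂ G q (zDir p s k)) l = zdot p s (fderiv ℂ G q (zDir p s l)) k := by
  rw [← h.snd hU hq, ← h.snd hU hq]
  exact ((h.fn.contDiffAt (hU.mem_nhds hq)).isSymmSndFDerivAt (by simp)) _ _

/-- The mixed second derivative in `(ζ, ζ̄)` as an operator. -/
def mixedHess (G : ParamPhase p s → ExtPair p s) (q : ParamPhase p s) : Zs p s →L[ℂ] Zs p s :=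
  (ContinuousLinearMap.fst ℂ _ _).comp ((fderiv ℂ G q).comp
    ((zDir p s).comp (ContinuousLinearMap.inr ℂ _ _)))

theorem norm_mixedHess_le (G : ParamPhase p s → ExtPair p s) (q : ParamPhase p s) :
    ‖mixedHess G q‖ ≤ ‖fderiv ℂ G q‖ := by
  refine ContinuousLinearMap.opNorm_le_bound _ (norm_nonneg _) fun k => ?_
  change ‖(fderiv ℂ G q (zDir p s (0, k))).1‖ ≤ _
  refine (norm_fst_le _).trans (((fderiv ℂ G q).le_opNorm _).trans_eq ?_)
  rw [norm_zDir, Prod.norm_mk, norm_zero, max_eq_right (norm_nonneg _)]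

theorem contDiffOn_mixedHess (hU : IsOpen U) (h : ContDiffOn ℂ ω G U) : ContDiffOn ℂ ω (mixedHess G) U :=
  contDiffOn_const.clm_comp ((h.fderiv_of_isOpen hU (by simp)).clm_comp contDiffOn_const)

/-! ### Restriction to real parameters -/

/-- Real parameters as complex ones. -/
def cplx (ρ : Fin 2 → ℝ) (i : Fin 2) : ℂ := (ρ i : ℂ)

/-- The complexification of real parameters as a linear map. -/
def cplxL : (Fin 2 → ℝ) →L[ℝ] (Fin 2 → ℂ) := ContinuousLinearMap.pi fun i =>
  Complex.ofRealCLM.comp (ContinuousLinearMap.proj i)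

theorem norm_cplx (ρ : Fin 2 → ℝ) : ‖cplx ρ‖ = ‖ρ‖ := by
  simp only [Pi.norm_def, cplx]
  congr 2; ext i
  simp

theorem isOpen_dom (σ μ : ℝ) : IsOpen (dom (p := p) (s := s) σ μ) := by
  have h1 : IsOpen {x : Phase p s | ∀ i, |(x.2.1 i).im| < σ} := by
    simp only [Set.ofPred_forall]
    exact isOpen_iInter_of_finite fun i => isOpen_lt (by fun_prop) continuous_const
  have h2 : IsOpen {x : Phase p s | ‖x.1‖ < μ ^ 2} := isOpen_lt (by fun_prop) continuous_const
  have h3 : IsOpen {x : Phase p s | ‖x.2.2‖ < μ} := isOpen_lt (by fun_prop) continuous_const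
  exact h2.inter (h1.inter h3)

theorem dom_mono {σ μ σ' μ' : ℝ} (hσ : σ ≤ σ') (hμ0 : 0 ≤ μ) (hμ : μ ≤ μ') :
    dom (p := p) (s := s) σ μ ⊆ dom σ' μ' := fun _ hx =>
  ⟨hx.1.trans_le (by gcongr), fun i => (hx.2.1 i).trans_le hσ, hx.2.2.trans_le hμ⟩

theorem ball_subset_cylinder_of_dom {ρ : Fin 2 → ℝ} (hρ : ρ ∈ paramSet) {x : Phase p s}
    (hx : x ∈ dom (p := p) (s := s) (1 / 2) (1 / 4)) (hδ : 1 / 16 ≤ δ) :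
    Metric.ball (cplx ρ, x) (1 / 16) ⊆ cylinder p s δ := by
  have h1 : ∀ i, 1 ≤ ρ i ∧ ρ i ≤ 2 := fun i => ⟨hρ.1 i, hρ.2 i⟩
  refine ball_subset_cylinder (δ' := 0) (by linarith) (fun i => ?_) ?_ ?_ hx.2.2.le
  · rw [sub_zero]; exact (h1 i).1
  · rw [add_zero, norm_cplx]
    exact (pi_norm_le_iff_of_nonneg (by norm_num)).2 fun i => by
      rw [Real.norm_of_nonneg (by linarith [h1 i])]; exact (h1 i).2
  · exact hx.1.le.trans (by norm_num)

section RealParam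

variable {W : Type} [NormedAddCommGroup W] [NormedSpace ℂ W] [NormedSpace ℝ W] [IsScalarTower ℝ ℂ W]
  {Ψ : ParamPhase p s → W}

theorem uniqueDiffOn_paramSet : UniqueDiffOn ℝ paramSet := by
  have h : paramSet = Set.pi Set.univ fun _ : Fin 2 => Set.Icc (1 : ℝ) 2 := by
    rw [Set.pi_univ_Icc]; rfl
  rw [h]
  exact UniqueDiffOn.univ_pi fun _ => uniqueDiffOn_Icc (by norm_num)

/-- Derivatives in the real parameters are bounded by those of the holomorphic extension. -/
theorem norm_fderivWithin_param_le {ρ : Fin 2 → ℝ} (hρ : ρ ∈ paramSet) {x : Phase p s}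
    (hΨ : DifferentiableAt ℂ Ψ (cplx ρ, x)) {g : (Fin 2 → ℝ) → W}
    (hg : ∀ ρ' ∈ paramSet, g ρ' = Ψ (cplx ρ', x)) :
    ‖fderivWithin ℝ g paramSet ρ‖ ≤ ‖fderiv ℂ Ψ (cplx ρ, x)‖ := by
  have h1 : HasFDerivAt (fun ρ' : Fin 2 → ℝ => ((cplx ρ', x) : ParamPhase p s))
      (cplxL.prod 0) ρ := (cplxL.hasFDerivAt (x := ρ)).prodMk (hasFDerivAt_const x ρ)
  have h2 := ((hΨ.hasFDerivAt.restrictScalars ℝ).comp ρ h1).hasFDerivWithinAt (s := paramSet)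
  have h3 := (h2.congr hg (hg ρ hρ)).fderivWithin (uniqueDiffOn_paramSet ρ hρ)
  rw [h3]
  refine ContinuousLinearMap.opNorm_le_bound _ (norm_nonneg _) fun v => ?_
  refine ((fderiv ℂ Ψ (cplx ρ, x)).le_opNorm _).trans_eq ?_
  change _ * ‖((cplx v, 0) : ParamPhase p s)‖ = _
  rw [Prod.norm_mk, norm_zero, max_eq_left (norm_nonneg _), norm_cplx]

theorem contDiffOn_param {V : Set (Phase p s)} (hU : ContDiffOn ℂ ω Ψ U)
    (hV : ∀ ρ ∈ paramSet, ∀ x ∈ V, (cplx ρ, x) ∈ U) {g : (Fin 2 → ℝ) → Phase p s → W}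
    (hg : ∀ ρ ∈ paramSet, ∀ x ∈ V, g ρ x = Ψ (cplx ρ, x)) :
    ContDiffOn ℝ 1 (fun q : (Fin 2 → ℝ) × Phase p s => g q.1 q.2) (paramSet ×ˢ V) := by
  have h1 : ContDiff ℝ 1 fun q : (Fin 2 → ℝ) × Phase p s => ((cplx q.1, q.2) : ParamPhase p s) :=
    (cplxL.contDiff.comp contDiff_fst).prodMk contDiff_snd
  exact (((hU.of_le (by simp)).restrict_scalars ℝ).comp h1.contDiffOn fun q hq => hV _ hq.1 _ hq.2).congr
    fun q hq => hg _ hq.1 _ hq.2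

end RealParam

section

variable {f : (Fin 2 → ℝ) → Phase p s → ℂ} {ρ : Fin 2 → ℝ} {x : Phase p s}

/-- `f` is the restriction of `F` to real parameters. -/
def IsRestriction (f : (Fin 2 → ℝ) → Phase p s → ℂ) (F : ParamPhase p s → ℂ) : Prop :=
  ∀ ρ ∈ paramSet, ∀ x ∈ dom (p := p) (s := s) (1 / 2) (1 / 4), f ρ x = F (cplx ρ, x)

theorem mem_cylinder_of_dom (hρ : ρ ∈ paramSet) (hx : x ∈ dom (p := p) (s := s) (1 / 2) (1 / 4))
    (hδ : 1 / 16 ≤ δ) : (cplx ρ, x) ∈ cylinder p s δ :=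
  ball_subset_cylinder_of_dom hρ hx hδ (Metric.mem_ball_self (by norm_num))

theorem IsZClass.fderiv_eq (h : IsZClass M F G (cylinder p s δ)) (hδ : 1 / 16 ≤ δ)
    (hf : IsRestriction f F) (hρ : ρ ∈ paramSet) (hx : x ∈ dom (p := p) (s := s) (1 / 2) (1 / 4)) :
    fderiv ℂ (f ρ) x = (fderiv ℂ F (cplx ρ, x)).comp (ContinuousLinearMap.inr ℂ _ _) := by
  have hd := (h.fn.contDiffAt ((isOpen_cylinder δ).mem_nhds (mem_cylinder_of_dom hρ hx hδ))).differentiableAt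
    (by simp)
  have e1 : f ρ =ᶠ[𝓝 x] fun y => F (cplx ρ, y) :=
    Filter.eventuallyEq_of_mem ((isOpen_dom _ _).mem_nhds hx) fun y hy => hf ρ hρ y hy
  rw [e1.fderiv_eq]
  exact (hd.hasFDerivAt.comp x (hasFDerivAt_prodMk_right (cplx ρ) x)).fderiv

theorem IsZClass.hess_eq (h : IsZClass M F G (cylinder p s δ)) (hδ : 1 / 16 ≤ δ)
    (hf : IsRestriction f F) (hρ : ρ ∈ paramSet) (hx : x ∈ dom (p := p) (s := s) (1 / 2) (1 / 4))
    (u : Phase p s) (k : ExtPair p s) :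
    hess (f ρ) x u (0, 0, k) = zdot p s (fderiv ℂ G (cplx ρ, x) (0, u)) k := by
  have hq := mem_cylinder_of_dom hρ hx hδ
  have hd := ((h.fn.contDiffAt ((isOpen_cylinder δ).mem_nhds hq)).fderiv_right (m := ω)
    (by simp)).differentiableAt (by simp)
  have e1 : fderiv ℂ (f ρ) =ᶠ[𝓝 x] fun y => (fderiv ℂ F (cplx ρ, y)).comp (ContinuousLinearMap.inr ℂ _ _) :=
    Filter.eventuallyEq_of_mem ((isOpen_dom _ _).mem_nhds hx) fun y hy => h.fderiv_eq hδ hf hρ hy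
  have e2 := hd.hasFDerivAt.comp x (hasFDerivAt_prodMk_right (𝕜 := ℂ) (cplx ρ) x)
  have e3 : HasFDerivAt (fun y => (fderiv ℂ F (cplx ρ, y)).comp
      (ContinuousLinearMap.inr ℂ (Fin 2 → ℂ) (Phase p s))) _ x :=
    e2.clm_comp (hasFDerivAt_const (ContinuousLinearMap.inr ℂ (Fin 2 → ℂ) (Phase p s)) x)
  rw [hess, e1.fderiv_eq, e3.fderiv, ← h.snd (isOpen_cylinder δ) hq]
  simp [zDir_apply]

theorem IsZClass.zGrad_eq (h : IsZClass M F G (cylinder p s δ)) (hδ : 1 / 16 ≤ δ)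
    (hf : IsRestriction f F) (hρ : ρ ∈ paramSet) (hx : x ∈ dom (p := p) (s := s) (1 / 2) (1 / 4)) :
    IsZGrad (f ρ) x (G (cplx ρ, x)) ∧ zGrad (f ρ) x = G (cplx ρ, x) := by
  have h1 : IsZGrad (f ρ) x (G (cplx ρ, x)) := fun k => by
    rw [h.fderiv_eq hδ hf hρ hx]
    exact h.deriv _ (mem_cylinder_of_dom hρ hx hδ) k
  have h2 : ∃ G, IsZGrad (f ρ) x G := ⟨_, h1⟩
  refine ⟨h1, ?_⟩
  rw [zGrad, dif_pos h2]
  exact zdot_injective fun k => (h2.choose_spec k).symm.trans (h1 k)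

theorem IsZClass.zHess_eq (h : IsZClass M F G (cylinder p s δ)) (hδ : 1 / 16 ≤ δ)
    (hf : IsRestriction f F) (hρ : ρ ∈ paramSet) (hx : x ∈ dom (p := p) (s := s) (1 / 2) (1 / 4)) :
    IsZHess (f ρ) x (mixedHess G (cplx ρ, x)) ∧ zHess (f ρ) x = mixedHess G (cplx ρ, x) := by
  have hq := mem_cylinder_of_dom hρ hx hδ
  have pz : ∀ u : Zs p s, u.pair 0 = 0 := fun u => by
    rw [← Wl2.pairL_apply one_le_extWeight (s_nonneg s), map_zero]
  have h1 : IsZHess (f ρ) x (mixedHess G (cplx ρ, x)) := fun k l => by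
    rw [h.hess_eq hδ hf hρ hx]
    refine (h.symm (isOpen_cylinder δ) hq (k, 0) (0, l)).trans ?_
    rw [zdot_apply, pz, add_zero, Wl2.pair_comm]
    rfl
  have h2 : ∃ A, IsZHess (f ρ) x A := ⟨_, h1⟩
  refine ⟨h1, ?_⟩
  rw [zHess, dif_pos h2]
  refine ContinuousLinearMap.ext fun l => Wl2.ext_pair extWeight_pos fun k => ?_
  rw [Wl2.pair_comm _ k, Wl2.pair_comm _ k, ← h2.choose_spec k l, h1 k l]

/-- Membership in the class of perturbations. -/
theorem IsZClass.inT (h : IsZClass M F G (cylinder p s δ)) (hδ : 1 / 16 ≤ δ)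
    (hf : IsRestriction f F) {σ μ : ℝ} (hσ : σ ≤ 1 / 2) (hμ0 : 0 < μ) (hμ : μ ≤ 1 / 4)
    (hper : ∀ ρ ∈ paramSet, ∀ x ∈ dom (p := p) (s := s) σ μ, ∀ k : Fin 2 → ℤ, f ρ (x + shift k) = f ρ x)
    (hreal : ∀ ρ ∈ paramSet, ∀ x ∈ dom (p := p) (s := s) σ μ, IsRealPhase x → (f ρ x).im = 0) :
    InT σ μ paramSet f := by
  have hD := dom_mono (p := p) (s := s) hσ hμ0.le hμ
  have hmem : ∀ ρ ∈ paramSet, ∀ x ∈ dom (p := p) (s := s) σ μ, (cplx ρ, x) ∈ cylinder p s δ :=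
    fun ρ hρ x hx => mem_cylinder_of_dom hρ (hD hx) hδ
  have hH := contDiffOn_mixedHess (isOpen_cylinder δ) h.grad
  have slice : ∀ {W : Type} [NormedAddCommGroup W] [NormedSpace ℂ W] {Ψ : ParamPhase p s → W}
      {g : Phase p s → W} (_ : ContDiffOn ℂ ω Ψ (cylinder p s δ)) {ρ : Fin 2 → ℝ} (_ : ρ ∈ paramSet)
      (_ : ∀ x ∈ dom (p := p) (s := s) σ μ, g x = Ψ (cplx ρ, x)),
      DifferentiableOn ℂ g (dom (p := p) (s := s) σ μ) := fun {W} _ _ {Ψ g} hΨ {ρ} hρ hg => by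
    have h1 : Differentiable ℂ fun x : Phase p s => ((cplx ρ, x) : ParamPhase p s) := by fun_prop
    exact ((hΨ.differentiableOn (by simp)).comp h1.differentiableOn fun x hx => hmem ρ hρ x hx).congr hg
  exact
  { periodic := hper
    real := hreal
    holo := fun ρ hρ => slice h.fn hρ fun x hx => hf ρ hρ x (hD hx)
    smooth := contDiffOn_param h.fn hmem fun ρ hρ x hx => hf ρ hρ x (hD hx)
    grad_exists := fun ρ hρ x hx => ⟨_, (h.zGrad_eq hδ hf hρ (hD hx)).1⟩
    grad_holo := fun ρ hρ => slice h.grad hρ fun x hx => (h.zGrad_eq hδ hf hρ (hD hx)).2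
    grad_smooth := contDiffOn_param h.grad hmem fun ρ hρ x hx => (h.zGrad_eq hδ hf hρ (hD hx)).2
    hess_exists := fun ρ hρ x hx => ⟨_, (h.zHess_eq hδ hf hρ (hD hx)).1⟩
    hess_holo := fun ρ hρ => slice hH hρ fun x hx => (h.zHess_eq hδ hf hρ (hD hx)).2
    hess_smooth := contDiffOn_param hH hmem fun ρ hρ x hx => (h.zHess_eq hδ hf hρ (hD hx)).2 }

/-- The norm of a perturbation that extends holomorphically. All derivatives come from Cauchy
estimates; the worst one is the parameter derivative of the mixed Hessian, which costs `64 * 64`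
and gains `μ ^ 2 ≤ 1 / 16`. -/
theorem IsZClass.tNorm_le (h : IsZClass M F G (cylinder p s δ)) (hδ : 1 / 16 ≤ δ)
    (hf : IsRestriction f F) {σ μ : ℝ} (hσ : σ ≤ 1 / 2) (hμ0 : 0 < μ) (hμ : μ ≤ 1 / 4) :
    tNorm σ μ paramSet f ≤ ENNReal.ofReal (256 * M) := by
  have hD := dom_mono (p := p) (s := s) hσ hμ0.le hμ
  have key : ∀ {W : Type} [NormedAddCommGroup W] {c b : ℝ} {v : W}, 0 ≤ c → ‖v‖ ≤ b → c * b ≤ 256 * M →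
      ENNReal.ofReal c * ‖v‖ₑ ≤ ENNReal.ofReal (256 * M) := fun {W} _ {c b v} hc hv hcb => by
    rw [← ofReal_norm, ← ENNReal.ofReal_mul hc]
    exact ENNReal.ofReal_le_ofReal ((mul_le_mul_of_nonneg_left hv hc).trans hcb)
  have key1 : ∀ {W : Type} [NormedAddCommGroup W] {b : ℝ} {v : W}, ‖v‖ ≤ b → b ≤ 256 * M →
      ‖v‖ₑ ≤ ENNReal.ofReal (256 * M) := fun {W} _ {b v} hv hb => by
    rw [← ofReal_norm]
    exact ENNReal.ofReal_le_ofReal (hv.trans hb)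
  refine iSup₂_le fun ρ hρ => iSup₂_le fun x hx => ?_
  have hx' := hD hx
  have hball := ball_subset_cylinder_of_dom hρ hx' hδ
  have hq := mem_cylinder_of_dom hρ hx' hδ
  have hM : 0 ≤ M := (norm_nonneg _).trans (h.fn_le _ hq)
  have dat : ∀ {W : Type} [NormedAddCommGroup W] [NormedSpace ℂ W] {Ψ : ParamPhase p s → W},
      ContDiffOn ℂ ω Ψ (cylinder p s δ) → DifferentiableAt ℂ Ψ (cplx ρ, x) := fun hΨ =>
    (hΨ.contDiffAt ((isOpen_cylinder δ).mem_nhds hq)).differentiableAt (by simp)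
  have hH := contDiffOn_mixedHess (isOpen_cylinder δ) h.grad
  have hsub : ∀ y ∈ Metric.ball ((cplx ρ, x) : ParamPhase p s) (1 / 32),
      Metric.ball y (1 / 32) ⊆ Metric.ball ((cplx ρ, x) : ParamPhase p s) (1 / 16) := fun y hy =>
    Metric.ball_subset_ball' (by rw [Metric.mem_ball] at hy; linarith)
  -- the mixed Hessian is bounded on half of the ball, so that a second Cauchy estimate applies
  have bH : ∀ y ∈ Metric.ball ((cplx ρ, x) : ParamPhase p s) (1 / 32), ‖mixedHess G y‖ ≤ 64 * M :=
    fun y hy => by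
      have := norm_fderiv_le_of_ball (q := y) (M := M) (R := 1 / 32) (by norm_num)
        ((h.grad.differentiableOn (by simp)).mono ((hsub y hy).trans hball))
        fun z hz => h.grad_le z (hball (hsub y hy hz))
      exact (norm_mixedHess_le G y).trans (this.trans_eq (by ring))
  have bF := norm_fderiv_le_of_ball (M := M) (by norm_num)
    ((h.fn.differentiableOn (by simp)).mono hball) fun z hz => h.fn_le z (hball hz)
  have bG := norm_fderiv_le_of_ball (M := M) (by norm_num)
    ((h.grad.differentiableOn (by simp)).mono hball) fun z hz => h.grad_le z (hball hz)
  have bH' := norm_fderiv_le_of_ball (M := 64 * M) (R := 1 / 32) (by norm_num)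
    ((hH.differentiableOn (by simp)).mono (((Metric.ball_subset_ball (by norm_num)).trans hball))) bH
  have hμ2 : μ ^ 2 ≤ 1 / 16 := by nlinarith
  have hμ2' := sq_nonneg μ
  refine max_le (max_le ?_ (max_le ?_ ?_)) (max_le ?_ (max_le ?_ ?_))
  · rw [hf ρ hρ x hx']
    exact key1 (h.fn_le _ hq) (by linarith)
  · rw [(h.zGrad_eq hδ hf hρ hx').2]
    exact key hμ0.le (h.grad_le _ hq) (by nlinarith)
  · rw [(h.zHess_eq hδ hf hρ hx').2]
    exact key hμ2' (bH _ (Metric.mem_ball_self (by norm_num))) (by nlinarith)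
  · exact key1 ((norm_fderivWithin_param_le hρ (dat h.fn) fun ρ' hρ' => hf ρ' hρ' x hx').trans bF)
      (by linarith)
  · exact key hμ0.le ((norm_fderivWithin_param_le hρ (dat h.grad) fun ρ' hρ' =>
      (h.zGrad_eq hδ hf hρ' hx').2).trans bG) (by nlinarith)
  · exact key hμ2' ((norm_fderivWithin_param_le hρ (dat hH) fun ρ' hρ' =>
      (h.zHess_eq hδ hf hρ' hx').2).trans bH') (by nlinarith)

end

end

noncomputable section

open scoped ContDiff

/-! ### Jets -/

variable {p : ℤ} {s : ℝ} [Fact (1 / 2 < s)]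

variable (p s) in
/-- The projection to the torus `r = 0`, `z = 0`. -/
def core : ParamPhase p s →L[ℂ] ParamPhase p s :=
  (ContinuousLinearMap.fst ℂ _ _).prod ((0 : ParamPhase p s →L[ℂ] (Fin 2 → ℂ)).prod
    (((ContinuousLinearMap.fst ℂ _ _).comp ((ContinuousLinearMap.snd ℂ _ _).comp
      (ContinuousLinearMap.snd ℂ _ _))).prod 0))

theorem core_apply (q : ParamPhase p s) : core p s q = (q.1, 0, q.2.2.1, 0) := rfl

/-- The jet of `F`, expressed by first derivatives of `F` and of its gradient `G`. -/
def jetFn (F : ParamPhase p s → ℂ) (G : ParamPhase p s → ExtPair p s) (q : ParamPhase p s) : ℂ :=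
  F (core p s q) + fderiv ℂ F (core p s q) (rDir p s q.2.1) + zdot p s (G (core p s q)) q.2.2.2 +
    1 / 2 * zdot p s (fderiv ℂ G (core p s q) (zDir p s q.2.2.2)) q.2.2.2

/-- The gradient of the jet. -/
def jetGrad (G : ParamPhase p s → ExtPair p s) (q : ParamPhase p s) : ExtPair p s :=
  G (core p s q) + fderiv ℂ G (core p s q) (zDir p s q.2.2.2)

variable {M δ : ℝ} {F : ParamPhase p s → ℂ} {G : ParamPhase p s → ExtPair p s}

theorem core_mem {δ : ℝ} {q : ParamPhase p s} (hq : q ∈ cylinder p s δ) : core p s q ∈ cylinder p s δ :=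
  ⟨hq.1, hq.2.1, by rw [core_apply]; norm_num, by rw [core_apply]; norm_num⟩

theorem ball_core_subset {q : ParamPhase p s} (hq : q ∈ cylinder p s (1 / 16)) :
    Metric.ball (core p s q) (1 / 16) ⊆ cylinder p s (1 / 8) :=
  ball_subset_cylinder (δ' := 1 / 16) (by norm_num) (fun i => (hq.1 i).le) hq.2.1.le
    (by rw [core_apply]; norm_num) (by rw [core_apply]; norm_num)

/-- The jet of a perturbation belongs to the same class on a smaller cylinder. -/
theorem IsZClass.jet (h : IsZClass M F G (cylinder p s (1 / 8))) :
    IsZClass (16 * M) (jetFn F G) (jetGrad G) (cylinder p s (1 / 16)) := by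
  have hU := isOpen_cylinder (p := p) (s := s) (1 / 8)
  have hV := isOpen_cylinder (p := p) (s := s) (1 / 16)
  have hmaps : Set.MapsTo (core p s) (cylinder p s (1 / 16)) (cylinder p s (1 / 8)) := fun q hq =>
    cylinder_mono (by norm_num) (core_mem hq)
  have hr : ContDiff ℂ ω fun q : ParamPhase p s => q.2.1 := contDiff_fst.comp contDiff_snd
  have hz : ContDiff ℂ ω fun q : ParamPhase p s => q.2.2.2 :=
    contDiff_snd.comp (contDiff_snd.comp contDiff_snd)
  have cF := h.fn.comp (core p s).contDiff.contDiffOn hmaps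
  have cG := h.grad.comp (core p s).contDiff.contDiffOn hmaps
  have cDF := (h.fn.fderiv_of_isOpen hU (m := ω) (by simp)).comp (core p s).contDiff.contDiffOn hmaps
  have cDG := (h.grad.fderiv_of_isOpen hU (m := ω) (by simp)).comp (core p s).contDiff.contDiffOn hmaps
  have cDGz := cDG.clm_apply ((zDir p s).contDiff.comp hz).contDiffOn
  have smooth : ContDiffOn ℂ ω (jetFn F G) (cylinder p s (1 / 16)) :=
    (((cF.add (cDF.clm_apply ((rDir p s).contDiff.comp hr).contDiffOn)).add
      (((zdot p s).contDiff.comp_contDiffOn cG).clm_apply hz.contDiffOn)).add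
      (contDiffOn_const.mul (((zdot p s).contDiff.comp_contDiffOn cDGz).clm_apply hz.contDiffOn)))
  refine ⟨smooth, cG.add cDGz, fun q hq k => ?_, fun q hq => ?_, fun q hq => ?_⟩
  · -- along an external direction the jet is a quadratic polynomial
    refine fderiv_eq_of_curve ((smooth.contDiffAt (hV.mem_nhds hq)).differentiableAt (by simp)) ?_
    have hc : ∀ t : ℂ, core p s (q + t • zDir p s k) = core p s q := fun t => by
      rw [map_add, map_smul, show core p s (zDir p s k) = 0 from rfl, smul_zero, add_zero]
    have hl := hasDerivAt_line q.2.2.2 k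
    have e1 := (zdot p s (G (core p s q))).hasFDerivAt.comp_hasDerivAt (0 : ℂ) hl
    have e2 := (((zdot p s).comp ((fderiv ℂ G (core p s q)).comp (zDir p s))).hasFDerivAt.comp_hasDerivAt
      (0 : ℂ) hl).clm_apply hl
    have e3 := ((e1.const_add (F (core p s q) + fderiv ℂ F (core p s q) (rDir p s q.2.1)))).add
      (e2.const_mul (1 / 2 : ℂ))
    have e4 : (fun t : ℂ => jetFn F G (q + t • zDir p s k)) = fun t : ℂ =>
        F (core p s q) + fderiv ℂ F (core p s q) (rDir p s q.2.1) +
          zdot p s (G (core p s q)) (q.2.2.2 + t • k) + 1 / 2 *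
          zdot p s (fderiv ℂ G (core p s q) (zDir p s (q.2.2.2 + t • k))) (q.2.2.2 + t • k) :=
      funext fun t => by
        have r1 : (q + t • zDir p s k).2.1 = q.2.1 := by simp [zDir_apply]
        rw [jetFn, hc, r1]; rfl
    rw [e4]
    refine e3.congr_deriv ?_
    have e5 := h.symm hU (hmaps hq) k q.2.2.2
    simp only [zero_smul, add_zero, ContinuousLinearMap.comp_apply, Function.comp]
    rw [e5, jetGrad, map_add, add_apply]
    ring
  all_goals
    have hb := ball_core_subset hq
    have hm := hmaps hq
    have b1 := h.fn_le _ hm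
    have b2 := h.grad_le _ hm
    have hM : 0 ≤ M := (norm_nonneg _).trans b1
    have bF := norm_fderiv_le_of_ball (M := M) (by norm_num)
      ((h.fn.differentiableOn (by simp)).mono hb) fun z hz => h.fn_le z (hb hz)
    have bG := norm_fderiv_le_of_ball (M := M) (by norm_num)
      ((h.grad.differentiableOn (by simp)).mono hb) fun z hz => h.grad_le z (hb hz)
    have hr : ‖q.2.1‖ ≤ 1 / 8 := hq.2.2.1.le
    have hz : ‖q.2.2.2‖ ≤ 5 / 16 := hq.2.2.2.le
    have c2 : ‖fderiv ℂ G (core p s q) (zDir p s q.2.2.2)‖ ≤ 10 * M := by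
      refine ((fderiv ℂ G (core p s q)).le_of_opNorm_le_of_le bG ((norm_zDir _).trans_le hz)).trans_eq ?_
      ring
  · have c1 : ‖fderiv ℂ F (core p s q) (rDir p s q.2.1)‖ ≤ 4 * M := by
      refine ((fderiv ℂ F (core p s q)).le_of_opNorm_le_of_le bF ((norm_rDir _).trans_le hr)).trans_eq ?_
      ring
    have c3 : ‖zdot p s (G (core p s q)) q.2.2.2‖ ≤ M := by
      refine (norm_zdot_le _ _).trans ?_
      calc _ ≤ 2 * M * (5 / 16) := by gcongr
        _ ≤ _ := by linarith
    have c4 : ‖1 / 2 * zdot p s (fderiv ℂ G (core p s q) (zDir p s q.2.2.2)) q.2.2.2‖ ≤ 4 * M := by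
      rw [norm_mul, norm_div, norm_one, Complex.norm_ofNat]
      have : 2 * ‖fderiv ℂ G (core p s q) (zDir p s q.2.2.2)‖ * ‖q.2.2.2‖ ≤ 2 * (10 * M) * (5 / 16) := by
        gcongr
      linarith [norm_zdot_le (fderiv ℂ G (core p s q) (zDir p s q.2.2.2)) q.2.2.2]
    refine (norm_add_le _ _).trans ?_
    linarith [norm_add₃_le (a := F (core p s q)) (b := fderiv ℂ F (core p s q) (rDir p s q.2.1))
      (c := zdot p s (G (core p s q)) q.2.2.2)]
  · refine (norm_add_le _ _).trans ?_
    linarith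

/-- The jet of a restriction is the restriction of the jet. -/
theorem IsZClass.jet_eq (h : IsZClass M F G (cylinder p s δ)) (hδ : 1 / 16 ≤ δ)
    {f : (Fin 2 → ℝ) → Phase p s → ℂ} (hf : IsRestriction f F) :
    IsRestriction (fun ρ => CoupledNLS.jet (f ρ)) (jetFn F G) := fun ρ hρ x hx => by
  have hx0 : ((0, x.2.1, 0) : Phase p s) ∈ dom (p := p) (s := s) (1 / 2) (1 / 4) :=
    ⟨by norm_num, hx.2.1, by norm_num⟩
  have e0 : core p s (cplx ρ, x) = (cplx ρ, 0, x.2.1, 0) := rfl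
  have hq := mem_cylinder_of_dom hρ hx0 hδ
  simp only [CoupledNLS.jet, jetFn]
  rw [h.hess_eq hδ hf hρ hx0, h.fderiv_eq hδ hf hρ hx0, hf ρ hρ _ hx0, e0, ← h.deriv _ hq]
  rfl

theorem jetFn_add {U : Set (ParamPhase p s)} (hU : IsOpen U) {M' : ℝ} {F' : ParamPhase p s → ℂ}
    {G' : ParamPhase p s → ExtPair p s} (h : IsZClass M F G U) (h' : IsZClass M' F' G' U) (c : ℂ)
    {q : ParamPhase p s} (hq : core p s q ∈ U) :
    jetFn (fun q => c * F q + F' q) (fun q => c • G q + G' q) q = c * jetFn F G q + jetFn F' G' q := by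
  have d1 := (h.fn.contDiffAt (hU.mem_nhds hq)).differentiableAt (by simp)
  have d2 := (h'.fn.contDiffAt (hU.mem_nhds hq)).differentiableAt (by simp)
  have d3 := (h.grad.contDiffAt (hU.mem_nhds hq)).differentiableAt (by simp)
  have d4 := (h'.grad.contDiffAt (hU.mem_nhds hq)).differentiableAt (by simp)
  have e1 : fderiv ℂ (fun q => c * F q + F' q) (core p s q) =
      c • fderiv ℂ F (core p s q) + fderiv ℂ F' (core p s q) :=
    ((d1.hasFDerivAt.const_mul c).add d2.hasFDerivAt).fderiv
  have e2 : fderiv ℂ (fun q => c • G q + G' q) (core p s q) =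
      c • fderiv ℂ G (core p s q) + fderiv ℂ G' (core p s q) :=
    ((d3.hasFDerivAt.const_smul c).add d4.hasFDerivAt).fderiv
  simp only [jetFn, e1, e2, map_add, map_smul, add_apply, smul_apply, smul_eq_mul]
  ring

theorem hasDerivAt_mul_self_zero {u : ℂ → ℂ} (hu : ContinuousAt u 0) :
    HasDerivAt (fun t => t * u t) (u 0) 0 := by
  rw [hasDerivAt_iff_tendsto_slope]
  refine (hu.tendsto.mono_left nhdsWithin_le_nhds).congr' ?_
  filter_upwards [self_mem_nhdsWithin] with t ht
  have ht' : t ≠ 0 := ht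
  rw [slope_def_field, zero_mul, sub_zero, sub_zero]
  field_simp

/-- The jet vanishes when `F` vanishes to third order along the quasi-homogeneous curve
`t ↦ (t² r, θ, t z)`. -/
theorem IsZClass.jetFn_eq_zero {U : Set (ParamPhase p s)} (hU : IsOpen U) (h : IsZClass M F G U)
    {q : ParamPhase p s} (hq : core p s q ∈ U) {e : ℂ → ℂ} (he : ContDiffAt ℂ ω e 0) (h0 : e 0 = 0)
    (hF : ∀ᶠ t : ℂ in 𝓝 0,
      F (core p s q + t ^ 2 • rDir p s q.2.1 + t • zDir p s q.2.2.2) = t ^ 2 * e t) :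
    jetFn F G q = 0 := by
  set c : ℂ → ParamPhase p s := fun t => core p s q + t ^ 2 • rDir p s q.2.1 + t • zDir p s q.2.2.2 with hc
  have c0 : c 0 = core p s q := by simp [hc]
  have dc : ∀ t, HasDerivAt c ((2 * t) • rDir p s q.2.1 + zDir p s q.2.2.2) t := fun t => by
    have h1 := (((hasDerivAt_pow 2 t).smul_const (rDir p s q.2.1)).const_add (core p s q)).add
      ((hasDerivAt_id t).smul_const (zDir p s q.2.2.2))
    refine h1.congr_deriv ?_
    simp
  have hcU : ∀ᶠ t in 𝓝 0, c t ∈ U :=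
    (dc 0).continuousAt.eventually (by rw [c0]; exact hU.mem_nhds hq)
  set ψ : ℂ → ℂ := fun t => t * (2 * fderiv ℂ F (c t) (rDir p s q.2.1)) + zdot p s (G (c t)) q.2.2.2
    with hψ
  -- the derivative along the curve, computed in two ways
  have w1 : ∀ᶠ t in 𝓝 0, HasDerivAt (fun t => F (c t)) (ψ t) t := hcU.mono fun t ht => by
    have dF := ((h.fn.contDiffAt (hU.mem_nhds ht)).differentiableAt (by simp)).hasFDerivAt
    refine (dF.comp_hasDerivAt t (dc t)).congr_deriv ?_
    rw [map_add, map_smul, h.deriv _ ht, hψ, smul_eq_mul]; ring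
  have w2 : ∀ᶠ t in 𝓝 0, HasDerivAt (fun t => F (c t)) (t * (2 * e t + t * _root_.deriv e t)) t := by
    have he2 : ∀ᶠ t in 𝓝 0, ContDiffAt ℂ 1 e t := (he.of_le (by simp)).eventually (by simp)
    filter_upwards [hF.eventually_nhds, he2] with t ht het
    have de := (het.differentiableAt (by simp)).hasDerivAt
    refine (((hasDerivAt_pow 2 t).mul de).congr_of_eventuallyEq ht).congr_deriv ?_
    simp; ring
  have hψ2 : ψ =ᶠ[𝓝 0] fun t => t * (2 * e t + t * _root_.deriv e t) := by
    filter_upwards [w1, w2] with t h1 h2 using h1.unique h2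
  have ce' : ContinuousAt (_root_.deriv e) 0 := by
    have h1 := (he.fderiv_right (m := 0) (by simp)).continuousAt
    exact (ContinuousLinearMap.apply ℂ ℂ (1 : ℂ)).continuous.continuousAt.comp h1
  have d1 : HasDerivAt ψ 0 0 := by
    have hu : ContinuousAt (fun t => 2 * e t + t * _root_.deriv e t) 0 :=
      (continuousAt_const.mul he.continuousAt).add (continuousAt_id.mul ce')
    refine ((hasDerivAt_mul_self_zero hu).congr_of_eventuallyEq hψ2).congr_deriv ?_
    simp [h0]
  have d2 : HasDerivAt ψ (2 * fderiv ℂ F (core p s q) (rDir p s q.2.1) +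
      zdot p s (fderiv ℂ G (core p s q) (zDir p s q.2.2.2)) q.2.2.2) 0 := by
    have hDF := (h.fn.contDiffAt (hU.mem_nhds hq)).fderiv_right (m := ω) (by simp)
    have k1 : ContinuousAt (fun t => 2 * fderiv ℂ F (c t) (rDir p s q.2.1)) 0 := by
      have : ContinuousAt (fun t => fderiv ℂ F (c t)) 0 :=
        ContinuousAt.comp (g := fderiv ℂ F) (by rw [c0]; exact hDF.continuousAt) (dc 0).continuousAt
      exact continuousAt_const.mul (this.clm_apply continuousAt_const)
    have dG := ((h.grad.contDiffAt (hU.mem_nhds hq)).differentiableAt (by simp)).hasFDerivAt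
    rw [← c0] at dG
    have k2 := (((zdot p s).flip q.2.2.2).hasFDerivAt.comp_hasDerivAt (0 : ℂ)
      (dG.comp_hasDerivAt (0 : ℂ) (dc 0)))
    refine ((hasDerivAt_mul_self_zero k1).add k2).congr_deriv ?_
    rw [c0, mul_zero, zero_smul, zero_add]
    rfl
  have e1 := d1.unique d2
  have e2 : ψ 0 = 0 := by rw [hψ2.self_of_nhds]; simp
  have e3 : F (core p s q) = 0 := by
    have := hF.self_of_nhds
    change F (c 0) = _ at this
    rw [c0] at this
    rw [this]; simp
  have e4 : zdot p s (G (core p s q)) q.2.2.2 = 0 := by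
    rw [← e2, hψ]
    simp [c0]
  rw [jetFn, e3, e4]
  linear_combination -(1 / 2 : ℂ) * e1

end

noncomputable section

open scoped ContDiff

/-! ### The perturbation in polar coordinates -/

variable {p : ℤ} {s : ℝ} [Fact (1 / 2 < s)]

variable (p s) in
/-- The argument `(ρ + r, z)` of the polar coordinates. -/
def polarArg : ParamPhase p s →L[ℂ] (Fin 2 → ℂ) × ExtPair p s :=
  ContinuousLinearMap.prod (ContinuousLinearMap.fst ℂ _ _ + (ContinuousLinearMap.fst ℂ _ _).comp
    (ContinuousLinearMap.snd ℂ _ _)) ((ContinuousLinearMap.snd ℂ _ _).comp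
      ((ContinuousLinearMap.snd ℂ _ _).comp (ContinuousLinearMap.snd ℂ _ _)))

theorem polarArg_apply (q : ParamPhase p s) : polarArg p s q = (q.1 + q.2.1, q.2.2.2) := rfl

/-- The cylinder lies in the domain of polar coordinates, with room for the occupation of the external
modes: `7/8 - 1/8 - 9/4 * (5/16)^2 > 1/2`. -/
theorem polarArg_mem {q : ParamPhase p s} (hq : q ∈ cylinder p s (1 / 8)) :
    polarArg p s q ∈ polarDom p s ∧ ‖(polarArg p s q).1‖ ≤ 3 ∧ ‖(polarArg p s q).2‖ ≤ 1 / 2 := by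
  obtain ⟨h1, h2, h3, h4⟩ := hq
  refine ⟨fun i => ?_, ?_, h4.le.trans (by norm_num)⟩
  · have e1 := (abs_le.1 ((Complex.abs_re_le_norm _).trans (norm_le_pi_norm q.2.1 i))).1
    have e2 := (abs_le.1 ((Complex.abs_re_le_norm _).trans (norm_occ_le q.2.2.2 i))).2
    have e3 : ‖q.2.2.2‖ ^ 2 ≤ (5 / 16) ^ 2 := by gcongr
    have e4 := h1 i
    change 1 / 2 < (q.1 i + q.2.1 i - occ q.2.2.2 i).re
    rw [Complex.sub_re, Complex.add_re]
    linarith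
  · exact (norm_add_le q.1 q.2.1).trans (by linarith)

/-- The quotients through which the amplitudes enter the gradient in the external variables. -/
def ampGrad (y : (Fin 2 → ℂ) × ExtPair p s) (g : Ps s) (i : Fin 2) : ℂ :=
  (intOut p g.1 i + intOut p g.2 i) / (2 * amp y.1 y.2 i)

/-- The gradient in the external variables of a function with gradient `g` at `polar y`. -/
def polarGrad (y : (Fin 2 → ℂ) × ExtPair p s) (g : Ps s) : ExtPair p s :=
  (sym (extOut g.1 - phase extWeight_pos (ampGrad y g) (sym y.2.2)),
    sym (extOut g.2 - phase extWeight_pos (ampGrad y g) (sym y.2.1)))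

theorem norm_polarGrad_le {y : (Fin 2 → ℂ) × ExtPair p s} (hy : y ∈ polarDom p s)
    (hz : ‖y.2‖ ≤ 1 / 2) (g : Ps s) : ‖polarGrad y g‖ ≤ 4 * ‖g‖ := by
  have hγ : ∀ i, ‖ampGrad y g i‖ ≤ 2 * ‖g‖ := fun i => by
    have h1 : 1 / 2 ≤ ‖amp y.1 y.2 i‖ := (half_le_amp_re hy i).trans (Complex.re_le_norm _)
    have h2 := (norm_coeff_le_norm g.1 (p, i)).trans (norm_fst_le g)
    have h3 := (norm_coeff_le_norm g.2 (p, i)).trans (norm_snd_le g)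
    rw [ampGrad, norm_div, norm_mul, Complex.norm_ofNat, div_le_iff₀ (by linarith)]
    refine (norm_add_le _ _).trans ((add_le_add h2 h3).trans ?_)
    nlinarith [norm_nonneg g]
  have key : ∀ (u : Hs s) (v : Zs p s), ‖u‖ ≤ ‖g‖ → ‖v‖ ≤ ‖y.2‖ →
      ‖sym (extOut u - phase extWeight_pos (ampGrad y g) (sym v))‖ ≤ 4 * ‖g‖ := fun u v hu hv => by
    have h1 : ‖sym v‖ ≤ 3 / 4 := (norm_sym_le v).trans (by linarith)
    have h2 := norm_phase_le extWeight_pos hγ (sym v)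
    have h3 := norm_extOut_le (p := p) u
    have h4 := norm_sub_le (extOut u : Zs p s) (phase extWeight_pos (ampGrad y g) (sym v))
    have h5 : 2 * ‖g‖ * ‖sym v‖ ≤ 2 * ‖g‖ * (3 / 4) := by gcongr
    refine (norm_sym_le _).trans ?_
    linarith [norm_nonneg g]
  exact max_le (key _ _ (norm_fst_le _) (norm_snd_le _)) (key _ _ (norm_snd_le _) (norm_fst_le _))

theorem contDiffOn_polarGrad {U : Set (ParamPhase p s)} {g : ParamPhase p s → Ps s}
    (hU : ∀ q ∈ U, polarArg p s q ∈ polarDom p s) (hg : ContDiffOn ℂ ω g U) :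
    ContDiffOn ℂ ω (fun q => polarGrad (polarArg p s q) (g q)) U := by
  have hA : ContDiffOn ℂ ω (fun q => polarArg p s q) U := (polarArg p s).contDiff.contDiffOn
  have ha := contDiffOn_pi.1 (contDiffOn_amp.comp hA hU)
  have hγ : ContDiffOn ℂ ω (fun q => ampGrad (polarArg p s q) (g q)) U := contDiffOn_pi.2 fun i =>
    ((contDiffOn_pi.1 ((intOut p).contDiff.comp_contDiffOn hg.fst) i).add
      (contDiffOn_pi.1 ((intOut p).contDiff.comp_contDiffOn hg.snd) i)).div
      (contDiffOn_const.mul (ha i)) fun q hq => mul_ne_zero two_ne_zero (amp_ne_zero (hU q hq) i)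
  have hph := (contDiff_phase (s := s) (extWeight_pos (p := p))).comp_contDiffOn hγ
  exact (sym.contDiff.comp_contDiffOn ((extOut.contDiff.comp_contDiffOn hg.fst).sub
      (hph.clm_apply (sym.contDiff.comp_contDiffOn hA.snd.snd)))).prodMk
    (sym.contDiff.comp_contDiffOn ((extOut.contDiff.comp_contDiffOn hg.snd).sub
      (hph.clm_apply (sym.contDiff.comp_contDiffOn hA.snd.fst))))

/-- The transpose of the derivative of `polar` in the external variables maps `g` to `polarGrad y g`. -/
theorem bil_polarD (y : (Fin 2 → ℂ) × ExtPair p s) (g : Ps s) (h : ExtPair p s) :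
    bil g (intIn p (ampD y.1 y.2 0 h) + extIn (sym h.1), intIn p (ampD y.1 y.2 0 h) + extIn (sym h.2)) =
      zdot p s (polarGrad y g) h := by
  have sub_l : ∀ a b c : Zs p s, (a - b).pair c = a.pair c - b.pair c := fun a b c => by
    rw [Wl2.pair_comm, pair_ext_sub_right, Wl2.pair_comm c, Wl2.pair_comm c]
  have add_r : ∀ a b c : Hs s, c.pair (a + b) = c.pair a + c.pair b := fun a b c => by
    rw [Wl2.pair_comm, pair_add_left, Wl2.pair_comm a, Wl2.pair_comm b]
  rw [bil_apply, zdot_apply, polarGrad, pair_sym, pair_sym, sub_l, sub_l, add_r, add_r, pair_intIn,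
    pair_intIn, pair_extIn, pair_extIn, pair_phase _ _ (sym y.2.2), Wl2.pair_comm (sym y.2.2),
    pair_phase_sym, pair_phase_sym]
  simp only [Fin.sum_univ_two, ampD, ampGrad, intOut_apply, Pi.zero_apply]
  ring

/-- Composition with the rescaled polar coordinates turns a function with gradient into one of the
class of perturbations. -/
theorem isZClass_pullback {Q : Ps s → ℂ} {g : Ps s → Ps s} {V : Set (Ps s)}
    (hQ : HasGradOn bil Q g V) (c l : ℂ) {M : ℝ}
    (hm : ∀ q ∈ cylinder p s (1 / 8), l • polar (polarArg p s q) ∈ V)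
    (hb : ∀ q ∈ cylinder p s (1 / 8), ‖c * Q (l • polar (polarArg p s q))‖ ≤ M ∧
      4 * ‖c * l‖ * ‖g (l • polar (polarArg p s q))‖ ≤ M) :
    IsZClass M (fun q => c * Q (l • polar (polarArg p s q)))
      (fun q => (c * l) • polarGrad (polarArg p s q) (g (l • polar (polarArg p s q))))
      (cylinder p s (1 / 8)) := by
  have hw : ContDiffOn ℂ ω (fun q => l • polar (polarArg p s q)) (cylinder p s (1 / 8)) :=
    (contDiffOn_polar.comp (polarArg p s).contDiff.contDiffOn
      fun q hq => (polarArg_mem hq).1).const_smul l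
  have hfn := (contDiffOn_const (c := c)).mul (hQ.fn.comp hw hm)
  refine ⟨hfn, (contDiffOn_polarGrad (fun q hq => (polarArg_mem hq).1)
    (hQ.grad.comp hw hm)).const_smul (c * l), fun q hq h => ?_, fun q hq => (hb q hq).1, fun q hq => ?_⟩
  · refine fderiv_eq_of_curve ((hfn.contDiffAt ((isOpen_cylinder _).mem_nhds hq)).differentiableAt
      (by simp)) ?_
    have e0 : ∀ t : ℂ, polarArg p s (q + t • zDir p s h) =
        (q.1 + q.2.1, q.2.2.2 + t • h) := fun t => by
      rw [polarArg_apply, zDir_apply]; simp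
    have hz := hasDerivAt_line q.2.2.2 h
    have ha := hasDerivAt_amp (R := fun _ : ℂ => q.1 + q.2.1) (z := fun t => q.2.2.2 + t • h)
      (hasDerivAt_const (0 : ℂ) _) hz (by rw [zero_smul, add_zero]; exact (polarArg_mem hq).1)
    have h1 := hasDerivAt_assemble ha (sym.hasFDerivAt.comp_hasDerivAt (0 : ℂ) hz.fst)
    have h2 := hasDerivAt_assemble ha (sym.hasFDerivAt.comp_hasDerivAt (0 : ℂ) hz.snd)
    have hp := (h1.prodMk h2).const_smul l
    have hp' := hp.congr_of_eventuallyEq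
      (f₁ := fun t : ℂ => l • polar (polarArg p s (q + t • zDir p s h)))
      (Eventually.of_forall fun t => by simp only [e0]; rfl)
    have hd := hQ.deriv _ (hm q hq)
    have e1 : q = q + (0 : ℂ) • zDir p s h := by simp
    rw [e1] at hd
    refine ((hd.comp_hasDerivAt (0 : ℂ) hp').const_mul c).congr_deriv ?_
    rw [← e1, map_smul, map_smul, smul_apply, ← bil_polarD, polarArg_apply]
    simp only [zero_smul, add_zero, smul_eq_mul]
    rw [mul_assoc]
  · rw [norm_smul]
    refine le_trans ?_ (hb q hq).2
    have := norm_polarGrad_le (polarArg_mem hq).1 (polarArg_mem hq).2.2 (g (l • polar (polarArg p s q)))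
    calc _ ≤ ‖c * l‖ * (4 * ‖g (l • polar (polarArg p s q))‖) := by gcongr
      _ = _ := by ring

/-- The part of the resonant quartic Hamiltonian that enters the integrable Hamiltonian. -/
def quarticMain (q : ParamPhase p s) : ℂ :=
  q.1 0 * q.1 1 + q.1 1 * q.2.1 0 + q.1 0 * q.2.1 1 + csqrt (q.1 0) * csqrt (q.1 1) * massDiff q.2.2.2

/-- The gradient of `quarticMain` in the external variables. -/
def quarticMainGrad (q : ParamPhase p s) : ExtPair p s :=
  (csqrt (q.1 0) * csqrt (q.1 1)) • (phase extWeight_pos ![1, -1] q.2.2.2.2,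
    phase extWeight_pos ![1, -1] q.2.2.2.1)

/-- The remainder of the resonant quartic Hamiltonian. -/
def quarticRem (q : ParamPhase p s) : ℂ :=
  quartic kerRes (fourierCoords (polar (polarArg p s q))) - quarticMain q

theorem hasDerivAt_massDiff (z h : ExtPair p s) : HasDerivAt (fun t : ℂ => massDiff (z + t • h))
    (zdot p s (phase extWeight_pos ![1, -1] z.2, phase extWeight_pos ![1, -1] z.1) h) 0 := by
  have hz := hasDerivAt_line z h
  have h1 := ((Wl2.pairL one_le_extWeight (s_nonneg s)).hasFDerivAt.comp_hasDerivAt (0 : ℂ)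
    ((phase (extWeight_pos (p := p)) ![1, -1]).hasFDerivAt.comp_hasDerivAt (0 : ℂ) hz.fst)).clm_apply hz.snd
  refine h1.congr_deriv ?_
  simp only [zero_smul, add_zero, Function.comp, Wl2.pairL_apply]
  rw [zdot_apply, pair_phase, Wl2.pair_comm h.1]

theorem contDiff_massDiff : ContDiff ℂ ω (massDiff (p := p) (s := s)) :=
  ((Wl2.pairL one_le_extWeight (s_nonneg s)).contDiff.comp
    ((phase (extWeight_pos (p := p)) ![1, -1]).contDiff.comp contDiff_fst)).clm_apply contDiff_snd

theorem norm_phase_alt_le (u : Zs p s) : ‖phase extWeight_pos ![1, -1] u‖ ≤ ‖u‖ := by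
  have h := norm_phase_le (extWeight_pos (p := p)) (c := ![1, -1]) (C := 1)
    (fun i => by fin_cases i <;> simp) u
  rwa [one_mul] at h

theorem isZClass_quarticMain : IsZClass 19 quarticMain quarticMainGrad (cylinder p s (1 / 8)) := by
  have hre : ∀ q ∈ cylinder p s (1 / 8), ∀ i, 0 < (q.1 i).re := fun q hq i => by
    linarith [hq.1 i]
  have hc1 : ∀ i : Fin 2, ContDiff ℂ ω fun q : ParamPhase p s => q.1 i := fun i =>
    (contDiff_apply ℂ ℂ i).comp contDiff_fst
  have hc2 : ∀ i : Fin 2, ContDiff ℂ ω fun q : ParamPhase p s => q.2.1 i := fun i =>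
    (contDiff_apply ℂ ℂ i).comp (contDiff_fst.comp contDiff_snd)
  have hz : ContDiff ℂ ω fun q : ParamPhase p s => q.2.2.2 :=
    contDiff_snd.comp (contDiff_snd.comp contDiff_snd)
  have hs : ∀ i : Fin 2, ContDiffOn ℂ ω (fun q : ParamPhase p s => csqrt (q.1 i))
      (cylinder p s (1 / 8)) := fun i q hq =>
    ((analyticAt_csqrt (hre q hq i)).contDiffAt.comp q (f := fun q : ParamPhase p s => q.1 i)
      (hc1 i).contDiffAt).contDiffWithinAt
  have hfn : ContDiffOn ℂ ω (quarticMain (p := p) (s := s)) (cylinder p s (1 / 8)) :=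
    ((((hc1 0).mul (hc1 1)).add ((hc1 1).mul (hc2 0))).add ((hc1 0).mul (hc2 1))).contDiffOn.add
      (((hs 0).mul (hs 1)).mul (contDiff_massDiff.comp hz).contDiffOn)
  have b1 : ∀ q ∈ cylinder p s (1 / 8), ∀ i, ‖q.1 i‖ ≤ 17 / 8 := fun q hq i =>
    (norm_le_pi_norm q.1 i).trans (by linarith [hq.2.1])
  have b2 : ∀ q ∈ cylinder p s (1 / 8), ∀ i, ‖q.2.1 i‖ ≤ 1 / 8 := fun q hq i =>
    (norm_le_pi_norm q.2.1 i).trans hq.2.2.1.le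
  have b3 : ∀ q ∈ cylinder p s (1 / 8), ∀ i, ‖csqrt (q.1 i)‖ ≤ 2 := fun q hq i => by
    have h1 := norm_csqrt_sq (q.1 i)
    have h2 := b1 q hq i
    exact le_of_sq_le_sq (by linarith) (by norm_num)
  have b4 : ∀ q ∈ cylinder p s (1 / 8), ‖csqrt (q.1 0) * csqrt (q.1 1)‖ ≤ 4 := fun q hq => by
    rw [norm_mul]
    nlinarith [b3 q hq 0, b3 q hq 1, norm_nonneg (csqrt (q.1 0)), norm_nonneg (csqrt (q.1 1))]
  refine ⟨hfn, ?_, fun q hq h => ?_, fun q hq => ?_, fun q hq => ?_⟩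
  · exact ((hs 0).mul (hs 1)).smul (((phase (extWeight_pos (p := p)) ![1, -1]).contDiff.comp
      (contDiff_snd.comp hz)).prodMk ((phase (extWeight_pos (p := p)) ![1, -1]).contDiff.comp
      (contDiff_fst.comp hz))).contDiffOn
  · refine fderiv_eq_of_curve ((hfn.contDiffAt ((isOpen_cylinder _).mem_nhds hq)).differentiableAt
      (by simp)) ?_
    have h1 := ((hasDerivAt_massDiff q.2.2.2 h).const_mul (csqrt (q.1 0) * csqrt (q.1 1))).const_add
      (q.1 0 * q.1 1 + q.1 1 * q.2.1 0 + q.1 0 * q.2.1 1)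
    have e : (fun t : ℂ => quarticMain (q + t • zDir p s h)) = fun t : ℂ =>
        q.1 0 * q.1 1 + q.1 1 * q.2.1 0 + q.1 0 * q.2.1 1 +
          csqrt (q.1 0) * csqrt (q.1 1) * massDiff (q.2.2.2 + t • h) := funext fun t => by
      simp [quarticMain, zDir_apply]
    rw [e, quarticMainGrad, map_smul, smul_apply, smul_eq_mul]
    exact h1
  · have hd : ‖massDiff q.2.2.2‖ ≤ 1 / 4 := by
      refine (Wl2.norm_pair_le one_le_extWeight (s_nonneg s) _ _).trans ?_
      have h1 := (norm_phase_alt_le q.2.2.2.1).trans (norm_fst_le q.2.2.2)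
      have h2 := norm_snd_le q.2.2.2
      have h3 : ‖q.2.2.2‖ ≤ 5 / 16 := hq.2.2.2.le
      nlinarith [norm_nonneg (phase extWeight_pos ![1, -1] q.2.2.2.1), norm_nonneg q.2.2.2.2]
    have m1 : ‖q.1 0 * q.1 1‖ ≤ 17 / 8 * (17 / 8) := by
      rw [norm_mul]; gcongr; exacts [b1 q hq 0, b1 q hq 1]
    have m2 : ‖q.1 1 * q.2.1 0‖ ≤ 17 / 8 * (1 / 8) := by
      rw [norm_mul]; gcongr; exacts [b1 q hq 1, b2 q hq 0]
    have m3 : ‖q.1 0 * q.2.1 1‖ ≤ 17 / 8 * (1 / 8) := by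
      rw [norm_mul]; gcongr; exacts [b1 q hq 0, b2 q hq 1]
    have m4 : ‖csqrt (q.1 0) * csqrt (q.1 1) * massDiff q.2.2.2‖ ≤ 4 * (1 / 4) := by
      rw [norm_mul]; gcongr; exact b4 q hq
    refine (norm_add_le _ _).trans ?_
    linarith [norm_add₃_le (a := q.1 0 * q.1 1) (b := q.1 1 * q.2.1 0) (c := q.1 0 * q.2.1 1)]
  · rw [quarticMainGrad, norm_smul]
    have h1 : ‖((phase extWeight_pos ![1, -1] q.2.2.2.2, phase extWeight_pos ![1, -1] q.2.2.2.1) :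
        ExtPair p s)‖ ≤ 1 := max_le
      ((norm_phase_alt_le _).trans ((norm_snd_le _).trans (hq.2.2.2.le.trans (by norm_num))))
      ((norm_phase_alt_le _).trans ((norm_fst_le _).trans (hq.2.2.2.le.trans (by norm_num))))
    calc _ ≤ 4 * (1 : ℝ) := by gcongr; exact b4 q hq
      _ ≤ 19 := by norm_num

variable (p s) in
/-- The remainder of the resonant quartic Hamiltonian belongs to the class of perturbations. -/
theorem exists_isZClass_quarticRem : ∃ M G, IsZClass M quarticRem G (cylinder p s (1 / 8)) := by
  obtain ⟨C, hC1, hC⟩ := exists_norm_polar_le p s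
  set κ := gradOp (s := s) kerRes
  have hgr : ∀ w : Ps s, ‖κ w w w‖ ≤ ‖κ‖ * ‖w‖ ^ 3 := fun w => by
    refine ((κ w w).le_of_opNorm_le_of_le ((κ w).le_of_opNorm_le_of_le (κ.le_opNorm w) le_rfl)
      le_rfl).trans_eq (by ring)
  have hQ := hasGradOn_quartic (s := s) kerRes
  have h0 : quartic kerRes (fourierCoords (0 : Ps s)) = 0 := by
    rw [quartic_eq, ← Wl2.pairL_apply one_le_fourierWeight (s_nonneg s)]
    simp
  have hw : ∀ q ∈ cylinder p s (1 / 8), ‖(1 : ℂ) • polar (polarArg p s q)‖ ≤ C := fun q hq => by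
    rw [one_smul]; exact hC _ (polarArg_mem hq).2.1 (polarArg_mem hq).2.2
  have h1 := isZClass_pullback (p := p) hQ 1 1
    (M := ‖bil (s := s)‖ * ‖κ‖ * C ^ 4 + 4 * (‖κ‖ * C ^ 3)) (fun _ _ => trivial) fun q hq => by
    have hwq := hw q hq
    have hn := (hQ.mono (Set.subset_univ (Metric.ball 0 (C + 1)))).norm_le h0 (norm_nonneg κ) (n := 3)
      (fun w _ => hgr w) (w := (1 : ℂ) • polar (polarArg p s q))
      (by rw [mem_ball_zero_iff]; linarith)
    have hp1 : 0 ≤ ‖bil (s := s)‖ * ‖κ‖ * C ^ 4 := by positivity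
    have hp2 : 0 ≤ 4 * (‖κ‖ * C ^ 3) := by positivity
    constructor
    · rw [one_mul]
      refine hn.trans (le_trans ?_ (le_add_of_nonneg_right hp2))
      gcongr
    · refine le_trans ?_ (le_add_of_nonneg_left hp1)
      rw [mul_one, norm_one, mul_one]
      gcongr
      exact (hgr _).trans (by gcongr)
  have h2 := h1.add (isOpen_cylinder _) (isZClass_quarticMain.const_mul (isOpen_cylinder _) (-1))
  have e : (quarticRem (p := p) (s := s)) = fun q =>
      1 * quartic kerRes (fourierCoords ((1 : ℂ) • polar (polarArg p s q))) + -1 * quarticMain q :=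
    funext fun q => by rw [quarticRem, one_smul]; ring
  rw [e]
  exact ⟨_, _, h2⟩

/-- The remainder of the resonant quartic Hamiltonian has a vanishing jet: along `(t² r, θ, t z)` all
its terms are of order three at least, because `quarticMain` takes the constant, the linear part in
`r` and the quadratic part in `z`. -/
theorem jetFn_quarticRem {M : ℝ} {G : ParamPhase p s → ExtPair p s}
    (h : IsZClass M quarticRem G (cylinder p s (1 / 8))) {q : ParamPhase p s}
    (hq : core p s q ∈ cylinder p s (1 / 8)) : jetFn quarticRem G q = 0 := by
  set R : ℂ → Fin 2 → ℂ := fun t => q.1 + t ^ 2 • q.2.1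
  set z := q.2.2.2
  set D := exch 0 1 z * exch 1 0 z - quarticDiag z
  have hex : ∀ (a b : Fin 2) (t : ℂ), exch a b (t • z) = t ^ 2 * exch a b z := fun a b t => by
    rw [exch, exch, ← tsum_mul_left]
    refine tsum_congr fun k => ?_
    simp only [Prod.smul_fst, Prod.smul_snd, map_smul, Wl2.coeff_smul]; ring
  have hdg : ∀ t : ℂ, quarticDiag (t • z) = t ^ 4 * quarticDiag z := fun t => by
    rw [quarticDiag, quarticDiag, ← tsum_mul_left]
    refine tsum_congr fun k => ?_
    simp only [Prod.smul_fst, Prod.smul_snd, map_smul, Wl2.coeff_smul]; ring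
  have hms : ∀ t : ℂ, massDiff (t • z) = t ^ 2 * massDiff z := fun t => by
    rw [massDiff, massDiff, Prod.smul_fst, Prod.smul_snd, map_smul, pair_smul_left, pair_smul_right]
    ring
  set a : ℂ → Fin 2 → ℂ := fun t => amp (R t) (t • z) with ha
  have hcurve : ContDiff ℂ ω fun t : ℂ => (R t, t • z) := by fun_prop
  have h00 : ((R 0, (0 : ℂ) • z) : (Fin 2 → ℂ) × ExtPair p s) = polarArg p s (core p s q) := by
    rw [polarArg_apply, core_apply]; simp [R]
  have hac : ContDiffAt ℂ ω a 0 :=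
    ContDiffAt.comp (0 : ℂ) (g := fun y : (Fin 2 → ℂ) × ExtPair p s => amp y.1 y.2)
      (contDiffOn_amp.contDiffAt (isOpen_polarDom.mem_nhds (by rw [h00]; exact (polarArg_mem hq).1)))
      hcurve.contDiffAt
  have a0 : ∀ i, a 0 i = csqrt (q.1 i) := fun i => by
    simp [ha, amp, occ, R]
  refine h.jetFn_eq_zero (isOpen_cylinder _) hq (e := fun t => t ^ 2 * (q.2.1 0 * q.2.1 1 + D) +
    (a t 0 * a t 1 - csqrt (q.1 0) * csqrt (q.1 1)) * massDiff z) ?_ ?_ (Eventually.of_forall fun t => ?_)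
  · have h0 := contDiffAt_pi.1 hac 0
    have h1 := contDiffAt_pi.1 hac 1
    exact ((contDiff_id.pow 2).contDiffAt.mul contDiffAt_const).add
      (((h0.mul h1).sub contDiffAt_const).mul contDiffAt_const)
  · rw [a0, a0]; ring
  · have e1 : core p s q + t ^ 2 • rDir p s q.2.1 + t • zDir p s q.2.2.2 =
        (q.1, t ^ 2 • q.2.1, q.2.2.1, t • z) := by
      rw [core_apply, rDir_apply, zDir_apply]; simp [z]
    rw [e1, quarticRem, polarArg_apply, quartic_polar]
    simp only [quarticMain, hex, hdg, hms, ha, R, Pi.add_apply, Pi.smul_apply, smul_eq_mul, D]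
    ring

end

noncomputable section

open scoped ContDiff

/-! ### The Hamiltonian in the new variables -/

variable {p : ℤ} {s : ℝ} [Fact (1 / 2 < s)]

/-- The perturbation: the remainder of the resonant quartic part and a function `Q` of higher order,
in polar coordinates and after rescaling. It does not depend on the angles. -/
def perturbation (Q : Ps s → ℂ) (ν : ℝ) (q : ParamPhase p s) : ℂ :=
  ν * quarticRem q + (ν : ℂ)⁻¹ * Q (((√ν : ℝ) : ℂ) • polar (polarArg p s q))

section

variable {ε K K' C ν : ℝ} {Q : Ps s → ℂ} {g : Ps s → Ps s}

theorem IsScale.norm_smul_polarArg_le (hS : IsScale ε K p s C (√ν)) {q : ParamPhase p s}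
    (hq : q ∈ cylinder p s (1 / 8)) :
    ‖((√ν : ℝ) : ℂ) • polar (polarArg p s q)‖ ≤ √ν * C := by
  rw [norm_smul, Complex.norm_real, Real.norm_of_nonneg hS.pos.le]
  exact mul_le_mul_of_nonneg_left (hS.polar_le _ (polarArg_mem hq).2.1 (polarArg_mem hq).2.2) hS.pos.le

theorem IsScale.smul_polarArg_mem (hS : IsScale ε K p s C (√ν)) {q : ParamPhase p s}
    (hq : q ∈ cylinder p s (1 / 8)) :
    ((√ν : ℝ) : ℂ) • polar (polarArg p s q) ∈ Metric.ball (0 : Ps s) ε := by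
  rw [mem_ball_zero_iff]
  have h1 := hS.norm_smul_polarArg_le hq
  have h2 := hS.lt
  have h3 := (norm_nonneg _).trans h1
  linarith

/-- The part of higher order is small of second order in `ν`: it is of order six in `√ν`, divided
by `ν`. -/
theorem IsScale.isZClass_highOrder (hν : 0 < ν) (hS : IsScale ε K p s C (√ν))
    (hQ : HasGradOn bil Q g (Metric.ball 0 ε)) (h0 : Q 0 = 0) (hK' : 0 ≤ K')
    (hg : ∀ w ∈ Metric.ball (0 : Ps s) ε, ‖g w‖ ≤ K' * ‖w‖ ^ 5) :
    ∃ G, IsZClass ((‖bil (s := s)‖ + 4) * K' * C ^ 6 * ν ^ 2)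
      (fun q : ParamPhase p s => (ν : ℂ)⁻¹ * Q (((√ν : ℝ) : ℂ) • polar (polarArg p s q))) G
      (cylinder p s (1 / 8)) := by
  have hν2 : √ν ^ 2 = ν := Real.sq_sqrt hν.le
  have hC := hS.one_le
  refine ⟨_, isZClass_pullback hQ (ν : ℂ)⁻¹ ((√ν : ℝ) : ℂ)
    (fun q hq => hS.smul_polarArg_mem hq) fun q hq => ?_⟩
  have hw := hS.smul_polarArg_mem hq
  have hn := hS.norm_smul_polarArg_le hq
  have nν : ‖(ν : ℂ)⁻¹‖ = ν⁻¹ := by rw [norm_inv, Complex.norm_real, Real.norm_of_nonneg hν.le]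
  have nl : ‖((√ν : ℝ) : ℂ)‖ = √ν := by
    rw [Complex.norm_real, Real.norm_of_nonneg hS.pos.le]
  have hp1 : 0 ≤ ‖bil (s := s)‖ * K' * C ^ 6 * ν ^ 2 := by positivity
  have hp2 : 0 ≤ 4 * K' * C ^ 6 * ν ^ 2 := by positivity
  constructor
  · rw [norm_mul, nν]
    calc _ ≤ ν⁻¹ * (‖bil (s := s)‖ * K' * (√ν * C) ^ 6) := by
          gcongr; exact (hQ.norm_le h0 hK' hg hw).trans (by gcongr)
      _ = ‖bil (s := s)‖ * K' * C ^ 6 * ν ^ 2 := by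
          rw [mul_pow, show √ν ^ 6 = (√ν ^ 2) ^ 3 by ring, hν2]
          field_simp
      _ ≤ _ := by linarith
  · rw [norm_mul, nν, nl]
    calc _ ≤ 4 * (ν⁻¹ * √ν) * (K' * (√ν * C) ^ 5) := by
          gcongr; exact (hg _ hw).trans (by gcongr)
      _ = 4 * K' * C ^ 5 * ν ^ 2 := by
          rw [mul_pow, show 4 * (ν⁻¹ * √ν) * (K' * (√ν ^ 5 * C ^ 5)) =
            4 * K' * C ^ 5 * (ν⁻¹ * (√ν ^ 2) ^ 3) by ring, hν2]
          field_simp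
      _ ≤ 4 * K' * C ^ 6 * ν ^ 2 := by gcongr; norm_num
      _ ≤ _ := by linarith

end

theorem massDiff_real {z : ExtPair p s} (hz : IsRealExt z) : (massDiff z).im = 0 := by
  rw [← Complex.conj_eq_iff_im, massDiff, Wl2.pair, Complex.conj_tsum]
  refine tsum_congr fun ⟨k, i⟩ => ?_
  rw [coeff_phase, map_mul, map_mul, hz, Complex.conj_conj]
  fin_cases i <;> simp <;> ring

theorem quarticRem_real {ρ : Fin 2 → ℝ} (hρ : ρ ∈ paramSet) {x : Phase p s}
    (hx : x ∈ dom (p := p) (s := s) (1 / 2) (1 / 4)) (hr : IsRealPhase x) :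
    (quarticRem (cplx ρ, x)).im = 0 := by
  have hq := mem_cylinder_of_dom hρ hx (δ := 1 / 8) (by norm_num)
  have h1 : (quartic kerRes (fourierCoords (polar (polarArg p s (cplx ρ, x))))).im = 0 := by
    have h := polar_real (l := 1) (R := (polarArg p s (cplx ρ, x)).1) (fun i => by
      change ((ρ i : ℂ) + x.1 i).im = 0
      rw [Complex.add_im, Complex.ofReal_im, hr.1, add_zero]) hr.2.2 (polarArg_mem hq).1
    rw [Complex.ofReal_one, one_smul] at h
    exact quartic_real kerRes_isHerm h
  have hs : ∀ i, (csqrt (cplx ρ i)).im = 0 := fun i => by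
    have : 0 ≤ ρ i := zero_le_one.trans (hρ.1 i)
    rw [cplx, csqrt_ofReal this, Complex.ofReal_im]
  have hc : ∀ i, (cplx ρ i).im = 0 := fun i => Complex.ofReal_im _
  rw [quarticRem, Complex.sub_im, h1, quarticMain]
  simp [Complex.add_im, Complex.mul_im, hs, hc, hr.1, massDiff_real hr.2.2]

/-- The resonance condition is void for functions that do not depend on the angles. -/
theorem jetCoeff_eq_zero {f : Phase p s → ℂ} (hf : ∀ x (θ : Fin 2 → ℂ), f (x + (0, θ, 0)) = f x)
    {k : Fin 2 → ℤ} (hk : k ≠ 0) (α β : ExtMode p) : jetCoeff f k α β = 0 := by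
  have h1 : ∀ x (θ : Fin 2 → ℂ), fderiv ℂ f (x + (0, θ, 0)) = fderiv ℂ f x := fun x θ => by
    rw [← fderiv_comp_add_right]; simp only [hf]
  have h2 : ∀ θ : Fin 2 → ℂ, hess f (0, θ, 0) = hess f 0 := fun θ => by
    funext u v
    have e : ((0, θ, 0) : Phase p s) = 0 + (0, θ, 0) := (zero_add _).symm
    rw [hess, hess, e, ← fderiv_comp_add_right]
    simp only [h1]
  have h3 : ∀ t₀ t₁ : ℝ, Complex.exp (-(Complex.I * (k 0 * t₀ + k 1 * t₁))) =
      expi t₀ (-k 0) * expi t₁ (-k 1) := fun t₀ t₁ => by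
    rw [expi, expi, ← Complex.exp_add]; congr 1; push_cast; ring
  rw [jetCoeff]
  simp only [h2, h3, intervalIntegral.integral_mul_const, intervalIntegral.integral_const_mul,
    integral_expi, neg_eq_zero]
  have : k 0 ≠ 0 ∨ k 1 ≠ 0 := by
    by_contra! h
    exact hk (funext fun i => by fin_cases i <;> simp [h])
  rcases this with h | h <;> simp [h]

section

variable {ε K C ν : ℝ} {τ : Ps s → Ps s} {Dt : Ps s → Ps s →L[ℂ] Ps s} {R6 : Ps s → ℂ}
  {G6 : Ps s → Ps s}

theorem quartic_smul (κ : Kernel) (l : ℂ) (w : Ps s) :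
    quartic κ (fourierCoords (l • w)) = l ^ 4 * quartic κ (fourierCoords w) := by
  rw [quartic_eq, quartic_eq]
  simp only [Prod.smul_fst, Prod.smul_snd, map_smul, smul_apply, pair_smul_left, pair_smul_right]
  ring

/-- The external frequencies collect the quadratic energy relative to the mode `p` and the quadratic
part of the resonant Hamiltonian. -/
theorem tsum_freqExt (ν : ℝ) {ρ : Fin 2 → ℝ} (hρ : ρ ∈ paramSet) {z : ExtPair p s}
    (h1 : ExtEnergy z.1) (h2 : ExtEnergy z.2) :
    ∑' α : ExtMode p, (freqExt ν ρ α : ℂ) * (z.1.coeff α * z.2.coeff α) =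
      ∑' α : ExtMode p, (((α.1 : ℤ) : ℂ) ^ 2 - (p : ℂ) ^ 2) * (z.1.coeff α * z.2.coeff α) +
        ν * (csqrt (cplx ρ 0) * csqrt (cplx ρ 1) * massDiff z) := by
  have hρ0 : 0 ≤ ρ 0 := zero_le_one.trans (hρ.1 0)
  have hρ1 : 0 ≤ ρ 1 := zero_le_one.trans (hρ.1 1)
  have s1 : Summable fun α : ExtMode p => (((α.1 : ℤ) : ℂ) ^ 2 - (p : ℂ) ^ 2) *
      (z.1.coeff α * z.2.coeff α) := by
    simp only [sub_mul]
    exact (h1.summable h2).sub ((summable_pair_ext z.1 z.2).mul_left _)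
  have s2 := (summable_pair_ext (phase extWeight_pos ![1, -1] z.1) z.2).mul_left
    ((ν : ℂ) * (csqrt (cplx ρ 0) * csqrt (cplx ρ 1)))
  rw [massDiff, Wl2.pair, ← mul_assoc, ← tsum_mul_left, ← s1.tsum_add s2]
  refine tsum_congr fun α => ?_
  rw [coeff_phase, cplx, cplx, csqrt_ofReal hρ0, csqrt_ofReal hρ1, freqExt, Real.sqrt_mul hρ0]
  obtain ⟨k, i⟩ := α
  fin_cases i <;> simp <;> ring

/-- The Hamiltonian in the new variables: the Birkhoff normal form, read in polar coordinates. -/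
theorem IsScale.hamiltonian_liftMap (hν : 0 < ν) (hS : IsScale ε K p s C (√ν))
    (hB : IsBirkhoffSystem ε K τ Dt R6 G6) (F : ℂ × ℂ → ℂ) {ρ : Fin 2 → ℝ} (hρ : ρ ∈ paramSet)
    {x : Phase p s} (hx : x ∈ dom (p := p) (s := s) (1 / 2) (Real.exp (-(1 / 2)) / 2))
    (he : FiniteEnergy (toFourier (coords x))) :
    FiniteEnergy (toFourier (coords (liftMap (√ν) τ (x + base ρ)))) ∧
      (hamiltonian F (toFourier (coords (liftMap (√ν) τ (x + base ρ))))
        - ((ν ^ 2 * ρ 0 * ρ 1 + ν * (p : ℝ) ^ 2 * (ρ 0 + ρ 1) : ℝ) : ℂ)) / (ν : ℂ) =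
      h0 ν ρ (coords x) +
        perturbation (fun w => R6 w + R5 F (fourierCoords (τ w))) ν (cplx ρ, x) := by
  have hl := add_base_mem_liftDom hρ hx
  obtain ⟨h1, h2⟩ := (finiteEnergy_coords x).1 he
  have b2 : (x + base ρ).2 = x.2 := add_zero _
  have b1 : (x + base ρ).1 = (polarArg p s (cplx ρ, x)).1 := add_comm _ _
  have k1 : ExtEnergy (x + base ρ).2.2.1 := by rw [b2]; exact h1
  have k2 : ExtEnergy (x + base ρ).2.2.2 := by rw [b2]; exact h2
  have hW := hS.scaledChart_mem hl
  have hfe := finiteEnergy_scaledChart ((√ν : ℝ) : ℂ) k1 k2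
  rw [← fourierCoords_chart, hS.chart_liftMap hB hl]
  refine ⟨hB.map.energy _ hW hfe, ?_⟩
  have hν0 : (ν : ℂ) ≠ 0 := by exact_mod_cast hν.ne'
  have hν2 : ((√ν : ℝ) : ℂ) ^ 2 = ν := by rw [← Complex.ofReal_pow, Real.sq_sqrt hν.le]
  have hν4 : ((√ν : ℝ) : ℂ) ^ 4 = ν ^ 2 := by rw [← hν2]; ring
  have hP2 := P2_scaledChart ((√ν : ℝ) : ℂ) k1 k2
  have hθ : ∀ i, |((x + base ρ).2.1 i).im| ≤ 1 / 2 := fun i => (hl.2.2.1 i).le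
  set w := ((√ν : ℝ) : ℂ) • polar ((x + base ρ).1, (x + base ρ).2.2) with hw
  have hwb : w ∈ Metric.ball (0 : Ps s) ε := hS.mem_ball hl
  have hgauge : scaledChart ((√ν : ℝ) : ℂ) (x + base ρ) = gauge (x + base ρ).2.1 w :=
    scaledChart_eq _ _
  have hw' : w = ((√ν : ℝ) : ℂ) • polar (polarArg p s (cplx ρ, x)) := by
    rw [hw, b1, b2]; rfl
  rw [hamiltonian, hB.normalForm _ hW hfe, Z4_eq, hP2, hν2]
  rw [hgauge] at hW ⊢
  rw [quartic_gauge, hB.rem_gauge _ hθ w hwb hW, hB.gauge_eq _ hθ w hwb hW, R5_gauge]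
  simp only [perturbation, ← hw', quarticRem, quarticMain]
  have hq4 : quartic kerRes (fourierCoords w) =
      ν ^ 2 * quartic kerRes (fourierCoords (polar (polarArg p s (cplx ρ, x)))) := by
    rw [hw', quartic_smul, hν4]
  rw [hq4, h0, coords, tsum_freqExt ν hρ h1 h2, b1, b2, polarArg_apply]
  simp only [Fin.sum_univ_two, freqInt, Pi.add_apply, cplx, Matrix.cons_val_zero, Matrix.cons_val_one]
  push_cast
  field_simp
  ring

end

end

end CoupledNLS

open CoupledNLS

theorem mainTheorem6 (p : ℤ) (F : ℂ × ℂ → ℂ) (hF : AnalyticAt ℂ F 0)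
    (hFreal : ∀ᶠ w : ℂ × ℂ in 𝓝 0,
      (CoupledNLS.nonlin F w.1 (conj w.1) w.2 (conj w.2)).im = 0)
    (hForder : (fun z : ℂ × ℂ × ℂ × ℂ => CoupledNLS.nonlin F z.1 z.2.1 z.2.2.1 z.2.2.2)
      =O[𝓝 0] fun z => ‖z‖ ^ 5)
    (s : ℝ) (hs : 1 / 2 < s) :
    ∃ (ε K : ℝ) (τ : CoupledNLS.Ps s → CoupledNLS.Ps s),
      0 < ε ∧ 0 < K ∧ CoupledNLS.IsBirkhoffMap ε K τ ∧
    ∃ ν₀ σ₀ μ₀ : ℝ, 0 < ν₀ ∧ 0 < σ₀ ∧ 0 < μ₀ ∧ σ₀ ≤ 1 / 2 ∧ μ₀ ≤ Real.exp (-(1 / 2)) / 2 ∧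
    ∀ ν : ℝ, 0 < ν → ν ≤ ν₀ →
    ∃ (Φ : (Fin 2 → ℝ) → CoupledNLS.Phase p s → CoupledNLS.Phase p s)
      (f : (Fin 2 → ℝ) → CoupledNLS.Phase p s → ℂ),
      -- the changes of variables
      AnalyticOnNhd ℝ (fun q : (Fin 2 → ℝ) × CoupledNLS.Phase p s => Φ q.1 q.2)
        (CoupledNLS.paramSet ×ˢ CoupledNLS.dom (1 / 2) (Real.exp (-(1 / 2)) / 2)) ∧
      (∀ ρ ∈ CoupledNLS.paramSet,
        CoupledNLS.IsBiholoOn (Φ ρ) (CoupledNLS.dom (1 / 2) (Real.exp (-(1 / 2)) / 2)) ∧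
        Set.MapsTo (Φ ρ) (CoupledNLS.dom (1 / 2) (Real.exp (-(1 / 2)) / 2))
          (CoupledNLS.torusNhd ν ρ 1 1) ∧
        ∀ x ∈ CoupledNLS.dom (p := p) (s := s) (1 / 2) (Real.exp (-(1 / 2)) / 2),
          (∀ k : Fin 2 → ℤ, Φ ρ (x + CoupledNLS.shift k) = Φ ρ x + CoupledNLS.shift k) ∧
          (CoupledNLS.IsRealPhase x → CoupledNLS.IsRealPhase (Φ ρ x)) ∧
          (∀ h k, CoupledNLS.omega (fderiv ℂ (Φ ρ) x h) (fderiv ℂ (Φ ρ) x k) =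
            ν * CoupledNLS.omega h k) ∧
          -- factorization through the Birkhoff map, and closeness to the explicit part
          (∃ (y : CoupledNLS.Phase p s) (w : CoupledNLS.Ps s),
            CoupledNLS.coords y =
              CoupledNLS.psiAng (CoupledNLS.psiSym (CoupledNLS.chi ν ρ (CoupledNLS.coords x))) ∧
            w ∈ Metric.ball 0 ε ∧
            CoupledNLS.fourierCoords w = CoupledNLS.toFourier (CoupledNLS.coords y) ∧
            CoupledNLS.toFourier (CoupledNLS.coords (Φ ρ x)) = CoupledNLS.fourierCoords (τ w) ∧
            ‖(Φ ρ x).1 - y.1‖ ≤ K * ν ^ 2 ∧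
            ‖(Φ ρ x).2.1 - y.2.1‖ ≤ K * ν ∧
            ‖(Φ ρ x).2.2 - y.2.2‖ ≤ K * ν ^ (3 / 2 : ℝ)) ∧
          -- the normal form
          (CoupledNLS.FiniteEnergy (CoupledNLS.toFourier (CoupledNLS.coords x)) →
            CoupledNLS.FiniteEnergy (CoupledNLS.toFourier (CoupledNLS.coords (Φ ρ x))) ∧
            (CoupledNLS.hamiltonian F (CoupledNLS.toFourier (CoupledNLS.coords (Φ ρ x)))
                - ((ν ^ 2 * ρ 0 * ρ 1 + ν * (p : ℝ) ^ 2 * (ρ 0 + ρ 1) : ℝ) : ℂ)) / (ν : ℂ) =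
              CoupledNLS.h0 ν ρ (CoupledNLS.coords x) + f ρ x)) ∧
      -- the remainder
      ∀ σ μ : ℝ, 0 < σ → σ ≤ σ₀ → 0 < μ → μ ≤ μ₀ →
        CoupledNLS.InTres σ μ CoupledNLS.paramSet f ∧
        CoupledNLS.tNorm σ μ CoupledNLS.paramSet f ≤ ENNReal.ofReal (K * ν) ∧
        CoupledNLS.tNorm σ μ CoupledNLS.paramSet (fun ρ => CoupledNLS.jet (f ρ)) ≤
          ENNReal.ofReal (K * ν ^ (3 / 2 : ℝ)) := by
  have : Fact (1 / 2 < s) := ⟨hs⟩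
  obtain ⟨ε₁, K₁, τ, Dt, R6, G6, hε₁, hK₁, hB₁⟩ := exists_birkhoffSystem (s := s)
  obtain ⟨r, K₂, G5, hr, hK₂, hG5, hG5le, hR0, hR5real⟩ :=
    exists_R5_grad (s := s) hF hFreal hForder
  obtain ⟨C, hC1, hC⟩ := exists_norm_polar_le p s
  obtain ⟨M₁, G₁, hrem⟩ := exists_isZClass_quarticRem p s
  -- the Birkhoff map at most doubles the norm, so that half the radius suffices for `R5 ∘ τ`
  set ε := min ε₁ (r / 2) with hεdef
  have hε : 0 < ε := lt_min hε₁ (by linarith)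
  have hB := hB₁.mono (min_le_left _ _ : ε ≤ ε₁) le_rfl
  -- the part of higher order is `R6 + R5 ∘ τ`
  have hτr : Set.MapsTo τ (Metric.ball 0 ε) (Metric.ball 0 r) := fun w hw => by
    have h1 := hB.norm_le w hw
    rw [mem_ball_zero_iff] at hw ⊢
    linarith [hw.trans_le (min_le_right ε₁ (r / 2))]
  have hQ := hB.rem.add (hG5.comp hB.smooth hτr hB.transpose_smooth fun w hw =>
    ⟨_, ((hB.smooth.contDiffAt (Metric.isOpen_ball.mem_nhds hw)).differentiableAt
      (by simp)).hasFDerivAt, hB.transpose w hw⟩)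
  have hτ0 : τ 0 = 0 := by
    have := hB.norm_le 0 (Metric.mem_ball_self hε)
    rwa [norm_zero, mul_zero, norm_le_zero_iff] at this
  set Q : Ps s → ℂ := fun w => R6 w + R5 F (fourierCoords (τ w))
    with hQdef
  have hQ0 : Q 0 = 0 := by rw [hQdef]; simp only [hτ0, hB.rem_zero, hR0, add_zero]
  have hQle : ∀ w ∈ Metric.ball (0 : Ps s) ε,
      ‖G6 w + Dt w (G5 (τ w))‖ ≤ (K₁ + 128 * K₂) * ‖w‖ ^ 5 := fun w hw => by
    have h1 := hB.transpose_le w hw (G5 (τ w))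
    have h2 : K₂ * ‖τ w‖ ^ 5 ≤ K₂ * (2 * ‖w‖) ^ 5 := by gcongr; exact hB.norm_le w hw
    linarith [norm_add_le (G6 w) (Dt w (G5 (τ w))), hB.rem_le w hw, hG5le _ (hτr hw)]
  set A := (‖bil (s := s)‖ + 4) * (K₁ + 128 * K₂) * C ^ 6 with hA
  have hA0 : 0 ≤ A := by positivity
  have hKC : 0 < K₁ * C ^ 3 := by positivity
  set K := K₁ + 5 * (K₁ * C ^ 3) + 4096 * (|M₁| + A) with hK
  have hM := abs_nonneg M₁
  -- the three bounds on `ν` give `ν ^ 2 ≤ ν ^ (3 / 2) ≤ ν` and the two conditions in `IsScale`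
  refine ⟨ε, K, τ, hε, by positivity, (hB.mono le_rfl (by linarith)).map,
    min 1 (min ((ε / (4 * C)) ^ 2) (1 / (100 * (K₁ * C ^ 3)))), 1 / 2, 1 / 4, by positivity,
    by norm_num, by norm_num, le_rfl, ?_, fun ν hν hν₀ => ?_⟩
  · linarith [Real.add_one_le_exp (-(1 / 2 : ℝ))]
  have hν1 : ν ≤ 1 := hν₀.trans (min_le_left _ _)
  have hνε : √ν ≤ ε / (4 * C) :=
    Real.sqrt_le_iff.2 ⟨by positivity, hν₀.trans ((min_le_right _ _).trans (min_le_left _ _))⟩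
  have hνK : K₁ * C ^ 3 * ν ≤ 1 / 100 := by
    have := hν₀.trans ((min_le_right _ _).trans (min_le_right _ _))
    rw [le_div_iff₀ (by positivity)] at this
    linarith
  have hνsq : √ν ^ 2 = ν := Real.sq_sqrt hν.le
  have hν32 : ν ^ (3 / 2 : ℝ) = √ν * ν := by
    rw [show (3 / 2 : ℝ) = 1 / 2 + 1 by norm_num, Real.rpow_add hν, Real.rpow_one, Real.sqrt_eq_rpow]
  have hν2 : ν ^ 2 ≤ ν ^ (3 / 2 : ℝ) := by
    have h : ν ≤ √ν := Real.le_sqrt_of_sq_le (by nlinarith)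
    rw [hν32, sq]; gcongr
  have hS : IsScale ε K₁ p s C (√ν) := by
    refine ⟨Real.sqrt_pos.2 hν, hC1, hK₁.le, hC, ?_, by rwa [hνsq]⟩
    rw [le_div_iff₀ (by positivity)] at hνε
    linarith
  obtain ⟨G₂, hhigh⟩ := hS.isZClass_highOrder hν hQ hQ0 (by positivity) hQle
  rw [← hA] at hhigh
  have hopen := isOpen_cylinder (p := p) (s := s) (1 / 8)
  have hclass := (hrem.const_mul hopen (ν : ℂ)).add hopen hhigh
  set f : (Fin 2 → ℝ) → Phase p s → ℂ := fun ρ x =>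
    perturbation Q ν (cplx ρ, x) with hf
  have hfθ : ∀ ρ x (θ : Fin 2 → ℂ), f ρ (x + (0, θ, 0)) = f ρ x := fun ρ x θ => by
    simp only [hf, perturbation, quarticRem, quarticMain,
      polarArg_apply, Prod.fst_add, Prod.snd_add, add_zero]
  refine ⟨fun ρ x => liftMap (√ν) τ (x + base ρ), f,
    analyticOnNhd_liftMap hS hB, fun ρ hρ => ?_, fun σ μ hσ hσ₀ hμ hμ₀ => ?_⟩
  · have hmem := fun x hx => add_base_mem_liftDom (p := p) (s := s) hρ (x := x) hx
    have hfd : ∀ x, fderiv ℂ (fun x => liftMap (√ν) τ (x + base ρ)) x =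
        fderiv ℂ (liftMap (p := p) (√ν) τ) (x + base ρ) := fun x =>
      fderiv_comp_add_right _
    refine ⟨⟨fun x hx => ?_, fun x hx y hy h => ?_, fun x hx => ?_⟩,
      fun x hx => hS.mapsTo hν hB hρ hx, fun x hx => ?_⟩
    · have h1 := (hS.contDiffAt_liftMap hB (hmem x hx)).differentiableAt (by simp)
      exact (h1.comp x (f := fun x => x + base ρ)
        (by fun_prop)).differentiableWithinAt
    · exact add_right_cancel (hS.injOn hB (hmem x hx) (hmem y hy) h)
    · rw [hfd]; exact hS.isInvertible hB (hmem x hx)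
    have b2 : (x + base ρ).2 = x.2 := add_zero _
    refine ⟨fun k => ?_, fun hreal => ?_, fun h k => ?_,
      ⟨explicitPart ((√ν : ℝ) : ℂ) (x + base ρ),
        scaledChart ((√ν : ℝ) : ℂ) (x + base ρ),
        coords_explicitPart hν.le ρ x, hS.scaledChart_mem (hmem x hx), ?_, ?_, ?_, ?_, ?_⟩,
      hS.hamiltonian_liftMap hν hB F hρ hx⟩
    · beta_reduce
      rw [add_right_comm]; exact liftMap_shift _ _ _ _
    · refine hS.real hB (hmem x hx) ⟨fun i => ?_, ?_⟩
      · change (x.1 i + (ρ i : ℂ)).im = 0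
        rw [Complex.add_im, Complex.ofReal_im, hreal.1, add_zero]
      · rw [b2]; exact hreal.2
    · rw [hfd, hS.symplectic hB (hmem x hx), ← Complex.ofReal_pow, hνsq]
    · rw [← chart_explicitPart hS.pos (hmem x hx), fourierCoords_chart]
    · rw [← fourierCoords_chart, hS.chart_liftMap hB (hmem x hx)]
    · refine (pi_norm_le_iff_of_nonneg (by positivity)).2 fun i => ?_
      have := hS.norm_act_le hB (hmem x hx) i
      rw [hνsq] at this
      refine this.trans ?_
      rw [show ν * (5 * (K₁ * C ^ 3 * ν)) = 5 * (K₁ * C ^ 3) * ν ^ 2 by ring]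
      gcongr
      linarith
    · refine (pi_norm_le_iff_of_nonneg (by positivity)).2 fun i => ?_
      have := hS.norm_innerAngle_le hB (hmem x hx) i
      rw [hνsq] at this
      refine le_trans (le_of_eq (congrArg norm (add_sub_cancel_left _ _))) (this.trans ?_)
      rw [show 4 * (K₁ * C ^ 3 * ν) = 4 * (K₁ * C ^ 3) * ν by ring]
      gcongr
      linarith
    · have := hS.norm_ext_le hB (hmem x hx)
      rw [hνsq] at this
      refine this.trans ?_
      rw [show √ν * (2 * (K₁ * C ^ 3 * ν)) = 2 * (K₁ * C ^ 3) * (√ν * ν) by ring,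
        ← hν32]
      gcongr
      linarith
  have hrest : IsRestriction f
      (perturbation (p := p) Q ν) := fun ρ _ x _ => rfl
  have hreal : ∀ ρ ∈ paramSet, ∀ x ∈ dom (p := p) (s := s) σ μ,
      IsRealPhase x → (f ρ x).im = 0 := fun ρ hρ x hx hxr => by
    have hx' := dom_mono hσ₀ hμ.le hμ₀ hx
    have hq := mem_cylinder_of_dom hρ hx' (δ := 1 / 8) (by norm_num)
    have hw := hS.smul_polarArg_mem hq
    have hwr := polar_real (l := √ν)
      (R := (polarArg p s (cplx ρ, x)).1) (fun i => by
        change ((ρ i : ℂ) + x.1 i).im = 0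
        rw [Complex.add_im, Complex.ofReal_im, hxr.1, add_zero]) hxr.2.2
      (polarArg_mem hq).1
    have h1 := hB.rem_real _ hw hwr
    have h2 := hR5real _ (hτr hw) (hB.map.real _ hw hwr)
    have h3 : (Q (((√ν : ℝ) : ℂ) •
        polar (polarArg p s (cplx ρ, x)))).im = 0 := by
      rw [hQdef, Complex.add_im, h1, h2, add_zero]
    simp only [hf, perturbation]
    rw [← Complex.ofReal_inv, Complex.add_im, Complex.im_ofReal_mul, Complex.im_ofReal_mul, h3,
      quarticRem_real hρ hx' hxr]
    simp
  refine ⟨⟨hclass.inT (by norm_num) hrest hσ₀ hμ hμ₀ (fun ρ _ x _ k => hfθ ρ x _) hreal, 0,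
    fun ρ _ k hk α β _ h => absurd (jetCoeff_eq_zero (hfθ ρ) hk α β) h⟩, ?_, ?_⟩
  · refine (hclass.tNorm_le (by norm_num) hrest hσ₀ hμ hμ₀).trans (ENNReal.ofReal_le_ofReal ?_)
    rw [Complex.norm_real, Real.norm_of_nonneg hν.le]
    have h1 : ν * M₁ ≤ ν * |M₁| := by gcongr; exact le_abs_self _
    have h2 : A * ν ^ 2 ≤ A * ν := by gcongr; nlinarith
    have h3 : 0 ≤ ν * |M₁| := by positivity
    have h4 : 0 ≤ A * ν := by positivity
    have h5 : 0 ≤ (K₁ + 5 * (K₁ * C ^ 3)) * ν := by positivity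
    rw [hK]
    linarith
  · -- only the part of higher order contributes to the jet
    have hjet : IsRestriction (fun ρ => jet (f ρ)) (jetFn
        (fun q : ParamPhase p s => (ν : ℂ)⁻¹ * Q (((√ν : ℝ) : ℂ) •
          polar (polarArg p s q))) G₂) := fun ρ hρ x hx => by
      have hc := core_mem (mem_cylinder_of_dom hρ hx (δ := 1 / 8) (by norm_num))
      refine (hclass.jet_eq (by norm_num) hrest ρ hρ x hx).trans ?_
      refine (jetFn_add hopen hrem hhigh (ν : ℂ) hc).trans ?_
      rw [jetFn_quarticRem hrem hc, mul_zero, zero_add]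
    refine (hhigh.jet.tNorm_le le_rfl hjet hσ₀ hμ hμ₀).trans (ENNReal.ofReal_le_ofReal ?_)
    have h1 : A * ν ^ 2 ≤ A * ν ^ (3 / 2 : ℝ) := by gcongr
    have h2 : 0 ≤ (K₁ + 5 * (K₁ * C ^ 3) + 4096 * |M₁|) * ν ^ (3 / 2 : ℝ) := by positivity
    rw [hK]
    linarith
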